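/- Let $\kappa$ be a field of characteristic $0$, and let $(\operatorname{Spec}\kappa,\mathbb N)$ be the standard log point, with log structure associated with $\mathbb N\to\kappa$, $0\mapsto 1$, $n\mapsto 0$ for $n>0$. Let $\pi:(C,\mathcal M_C)\to(\operatorname{Spec}\kappa,\mathbb N)$ be a pre-stable marked log curve: $C$ is proper over $\kappa$, geometrically connected and geometrically reduced, with all irreducible components of dimension one; $\mathcal M_C$ is a fine saturated log structure on the étale site of $C$, log smooth over the standard log point; there are pairwise distinct marked points, given by sections of $C\to\operatorname{Spec}\kappa$ in its smooth locus; and on the smooth locus the ghost sheaf $\overline{\mathcal M}_C$ is the direct sum of the constant sheaf $\mathbb N$ pulled back from the base and one copy of $\mathbb N$ at each marked point. Call a point of $C$ a node if $C\to\operatorname{Spec}\kappa$ is not smooth there, and special if it is a node or marked. At a geometric point $\bar q$ over a node one has $\overline{\mathcal M}_{C,\bar q}\cong\{(a,b)\in\mathbb N^2: a\equiv b \bmod e_q\}$ for some $e_q>0$, where $\mathbb N$ maps diagonally. Let $\mathcal M$ be a fine saturated log structure on the Zariski site of $C$, with a morphism of log schemes $(C,\mathcal M_C)\to(C,\mathcal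 M)$ over $\mathrm{id}_C$, and let $\varphi$ be the induced map on stalks of ghost sheaves. (For a stable log map $f:(C,\mathcal M_C)\to(X,\mathcal M_X)$ over the standard log point take $\mathcal M=\underline f^*\mathcal M_X$.) Write $P_c=\overline{\mathcal M}_c$ and $P^*=\operatorname{Hom}(P,\mathbb Z)$. Let $D\subset C$ be an irreducible component with generic point $\eta$, let $g:\tilde D\to C$ be the normalization of $D$, and let $\Sigma\subset\tilde D$ be the preimage of the set of special points. For $x\in\Sigma$ the contact order $u_x\in P_{g(x)}^*$ is defined as follows. * If $p=g(x)$ is a marked point, $u_x$ is the composition of $\varphi_p:P_p\to\overline{\mathcal M}_{C,\bar p}=\mathbb N\oplus\mathbb N$ with the second projection, where the first summand comes from the base. * If $q=g(x)$ is a node, then $e_q u_x=V_{\eta'}\circ\chi'-V_\eta\circ\chi$, where $\eta'$ is the generic point of the component of the other branch at $q$ (so $\eta'=\eta$ if $q$ lies on no other component), $\chi:P_q\to P_\eta$ and $\chi':P_q\to P_{\eta'}$ are the generization maps, and $V_\zeta=\varphi_\zeta:P_\zeta\to\overline{\mathcal M}_{C,\bar\zeta}=\mathbb N$ for $\zeta=\eta,\eta'$.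 Let $\tau_\eta^X:\Gamma(\tilde D,g^*\overline{\mathcal M})\to\mathbb Z$ map $m$ to the degree over $\kappa$ of the $\mathcal O_{\tilde D}^\times$-torsor of sections of $g^*\mathcal M$ with image $m$. Put $N_D=\Gamma(\tilde D,g^*\overline{\mathcal M}^{\mathrm{gp}})^*$. A tuple $(a_x)_{x\in\Sigma}$ with $a_x\in P_{g(x)}^*$ represents the element $m\mapsto\sum_{x\in\Sigma}a_x(m_x)$ of $N_D$. Then $\Sigma$ is finite, the contact orders $u_x$ exist and are unique, and the modified balancing condition holds: $\tau_\eta^X$ extends to an element $T$ of $N_D$ with $$\big([\kappa(x):\kappa]\,u_x\big)_{x\in\Sigma}+T=0 ,$$ and for every tuple $(\tau_x)_{x\in\Sigma}$, $\tau_x\in P_{g(x)}^*$, whose class in $N_D$ restricts to $\tau_\eta^X$ on $\Gamma(\tilde D,g^*\overline{\mathcal M})$, $$\big([\kappa(x):\kappa]\,u_x\big)_{x\in\Sigma}+(\tau_x)_{x\in\Sigma}=0\quad\text{in } N_D .$$ If $\kappa$ is algebraically closed, or more generally if the points of $\Sigma$ are $\kappa$-rational, this reads $(u_x)_{x\in\Sigma}+(\tau_x)_{x\in\Sigma}=0$.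 -/

import Mathlib

open CategoryTheory Limits Opposite TopologicalSpace AlgebraicGeometry

universe u

noncomputable section

namespace LogGeom

/-! ### Colimits of commutative monoids

The category of commutative monoids is reflective in the category of monoids, hence cocomplete.
This is needed in order to speak of stalks of sheaves of commutative monoids. -/

/-- The congruence generated by `a * b ~ b * a`. -/
def commCon (M : Type u) [Monoid M] : Con M :=
  conGen fun x y => ∃ a b, x = a * b ∧ y = b * a

instance (M : Type u) [Monoid M] : CommMonoid (commCon M).Quotient :=
  { (inferInstance : Monoid (commCon M).Quotient) with
    mul_comm := by
      rintro ⟨a⟩ ⟨b⟩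
      exact (Con.eq _).2 (ConGen.Rel.of _ _ ⟨a, b, rfl, rfl⟩) }

/-- A homomorphism to a commutative monoid factors through the commutative quotient. -/
def commConLift {M : Type u} [Monoid M] {N : Type u} [CommMonoid N] (f : M →* N) :
    (commCon M).Quotient →* N :=
  (commCon M).lift f (Con.conGen_le.2 (by
    rintro _ _ ⟨a, b, rfl, rfl⟩
    simp [Con.ker_rel, mul_comm]))

instance : Reflective (forget₂ CommMonCat.{u} MonCat.{u}) where
  L := Adjunction.leftAdjointOfEquiv
    (F_obj := fun M => CommMonCat.of (commCon M).Quotient)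
    (e := fun M N =>
      { toFun := fun f => MonCat.ofHom (f.hom.comp (commCon M).mk')
        invFun := fun f => CommMonCat.ofHom (commConLift f.hom)
        left_inv := fun f => by ext x; rfl
        right_inv := fun f => by ext x; rfl })
    (fun _ _ _ _ _ => rfl)
  adj := Adjunction.adjunctionOfEquivLeft _ _

instance : HasColimitsOfSize.{u, u} CommMonCat.{u} :=
  hasColimits_of_reflective (forget₂ CommMonCat.{u} MonCat.{u})

/-! ### Log structures on a ringed site -/

/-- A log structure on a site with (multiplicative) structure presheaf `𝒪`: a sheaf of commutative
monoids `M` with a homomorphism `α : M → 𝒪` inducing an isomorphism `α⁻¹(𝒪ˣ) ≅ 𝒪ˣ`. -/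
structure LogStructure {E : Type*} [Category E] (J : GrothendieckTopology E)
    (𝒪 : Eᵒᵖ ⥤ CommMonCat.{u}) where
  M : Sheaf J CommMonCat.{u}
  α : M.obj ⟶ 𝒪
  existsUnique_unit : ∀ (U : E) (a : (𝒪.obj (op U))ˣ),
    ∃! m : M.obj.obj (op U), α.app (op U) m = a

/-- Fine (finitely generated and integral) and saturated monoids. -/
structure IsFineSaturated (P : Type*) [CommMonoid P] : Prop where
  fg : Monoid.FG P
  integral : ∀ a b c : P, a * c = b * c → a = b
  saturated : ∀ (n : ℕ) (a b c : P), n ≠ 0 → a ^ n = b ^ n * c → ∃ d, a = b * d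

namespace LogStructure

variable {E : Type*} [Category E] {J : GrothendieckTopology E} {𝒪 : Eᵒᵖ ⥤ CommMonCat.{u}}

/-- The sections of the sheaf of monoids. -/
abbrev sections (L : LogStructure J 𝒪) (U : E) : Type u := L.M.obj.obj (op U)

/-- Restriction of sections. -/
def res (L : LogStructure J 𝒪) {U V : E} (f : V ⟶ U) : L.sections U →* L.sections V :=
  (L.M.obj.map f.op).hom

/-- `β : P → Γ(U, M)` is a chart: the log structure associated with `P → Γ(U, 𝒪)`, that is, the
sheaf pushout of `P` and `𝒪ˣ` over the preimage of `𝒪ˣ` in `P`, maps isomorphically to `M|_U`. -/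
structure IsChart (L : LogStructure J 𝒪) {U : E} {P : Type*} [CommMonoid P]
    (β : P →* L.sections U) : Prop where
  surj : ∀ {V : E} (f : V ⟶ U) (m : L.sections V), ∃ S ∈ J V, ∀ {W : E} (g : W ⟶ V), S g →
    ∃ (p : P) (a : (L.sections W)ˣ), L.res g m = L.res (g ≫ f) (β p) * a
  inj : ∀ {V : E} (f : V ⟶ U) (p p' : P) (a : (L.sections V)ˣ),
    L.res f (β p) = L.res f (β p') * a → ∃ S ∈ J V, ∀ {W : E} (g : W ⟶ V), S g →
      ∃ b b' : P, IsUnit (L.res (g ≫ f) (β b)) ∧ IsUnit (L.res (g ≫ f) (β b')) ∧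
        p * b = p' * b' ∧ L.res (g ≫ f) (β b') = L.res (g ≫ f) (β b) * L.res g a

/-- Fine saturated log structures: locally there are charts by fine saturated monoids. -/
def IsFS (L : LogStructure J 𝒪) : Prop :=
  ∀ U : E, ∃ S ∈ J U, ∀ {V : E} (f : V ⟶ U), S f →
    ∃ (P : Type u) (_ : CommMonoid P) (β : P →* L.sections V), IsFineSaturated P ∧ L.IsChart β

end LogStructure

/-! ### Log structures on the étale site and on the Zariski site of a scheme -/

/-- The structure sheaf on the small étale site, as a presheaf of multiplicative monoids. -/
def etaleO (X : Scheme.{u}) : X.Etaleᵒᵖ ⥤ CommMonCat.{u} :=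
  (Scheme.Etale.forget X ⋙ Over.forget X).op ⋙ Scheme.Γ ⋙ forget₂ CommRingCat CommMonCat

/-- The structure sheaf on the Zariski site, as a presheaf of multiplicative monoids. -/
def zariskiO (X : Scheme.{u}) : X.Opensᵒᵖ ⥤ CommMonCat.{u} :=
  X.presheaf ⋙ forget₂ CommRingCat CommMonCat

abbrev EtaleLogStructure (X : Scheme.{u}) := LogStructure X.smallEtaleTopology (etaleO X)

abbrev ZariskiLogStructure (X : Scheme.{u}) :=
  LogStructure (Opens.grothendieckTopology X) (zariskiO X)

/-- The map `α` of an étale log structure with values in the ring of functions. -/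
def etaleAlpha {X : Scheme.{u}} (N : EtaleLogStructure X) (V : X.Etale) :
    N.sections V →* Γ(V.left, ⊤) :=
  (N.α.app (op V)).hom

/-- The map `α` of a Zariski log structure with values in the ring of functions. -/
def zariskiAlpha {X : Scheme.{u}} (M : ZariskiLogStructure X) (U : X.Opens) :
    M.sections U →* Γ(X, U) :=
  (M.α.app (op U)).hom

/-- The inclusion of the Zariski site into the étale site. -/
def openToEtale (X : Scheme.{u}) : X.Opens ⥤ X.Etale where
  obj U := Scheme.Etale.mk U.ι
  map f := MorphismProperty.Over.homMk (X.homOfLE f.le) (X.homOfLE_ι f.le)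
  map_id U := MorphismProperty.Over.Hom.ext (X.homOfLE_rfl U)
  map_comp f g := MorphismProperty.Over.Hom.ext (X.homOfLE_homOfLE f.le g.le).symm

/-- A morphism of log schemes `(X, N) → (X, M)` over the identity of `X`, where `N` is an étale log
structure and `M` is a Zariski log structure: a homomorphism `M → N`, compatible with the maps to
the structure sheaf. By adjunction such homomorphisms on Zariski opens are the same as
homomorphisms to `N` from the étale log structure defined by `M`. -/
structure ZariskiToEtaleHom {X : Scheme.{u}} (M : ZariskiLogStructure X)
    (N : EtaleLogStructure X) where
  hom : M.M.obj ⟶ (openToEtale X).op ⋙ N.M.obj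
  comm : ∀ (U : X.Opens) (m : M.sections U),
    etaleAlpha N ((openToEtale X).obj U) (hom.app (op U) m) = U.topIso.inv (zariskiAlpha M U m)

/-! ### Stalks -/

/-- The geometric point of `X` over `x` with values in an algebraic closure of `κ(x)`. -/
def geomPoint {X : Scheme.{u}} (x : X) :
    Spec (.of (AlgebraicClosure (X.residueField x))) ⟶ X :=
  Spec.map (CommRingCat.ofHom (algebraMap (X.residueField x) _)) ≫ X.fromSpecResidueField x

lemma geomPoint_apply {X : Scheme.{u}} (x : X) (y) : geomPoint x y = x := by
  simp only [geomPoint, Scheme.Hom.comp_apply]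
  exact Scheme.fromSpecResidueField_apply _ _

lemma geomPoint_range_subset {X : Scheme.{u}} {x : X} {U : X.Opens} (hx : x ∈ U) :
    Set.range (geomPoint x) ⊆ Set.range U.ι := by
  rintro _ ⟨y, rfl⟩
  rw [geomPoint_apply]
  simpa using hx

/-- The geometric point over `x`, as a point of an open neighbourhood of `x`. -/
def geomPointLift {X : Scheme.{u}} {x : X} {U : X.Opens} (hx : x ∈ U) :
    Spec (.of (AlgebraicClosure (X.residueField x))) ⟶ U.toScheme :=
  IsOpenImmersion.lift U.ι (geomPoint x) (geomPoint_range_subset hx)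

lemma geomPointLift_ι {X : Scheme.{u}} {x : X} {U : X.Opens} (hx : x ∈ U) :
    geomPointLift hx ≫ U.ι = geomPoint x :=
  IsOpenImmersion.lift_fac _ _ _

/-- An open neighbourhood of `x` is an étale neighbourhood of the geometric point over `x`. -/
def openPoint {X : Scheme.{u}} {x : X} {U : X.Opens} (hx : x ∈ U) :
    (Scheme.pointSmallEtale (geomPoint x)).fiber.obj ((openToEtale X).obj U) :=
  Over.homMk (geomPointLift hx) (geomPointLift_ι hx)

/-- The stalk of an étale log structure at the geometric point over `x`. -/
def etaleStalk {X : Scheme.{u}} (N : EtaleLogStructure X) (x : X) : CommMonCat.{u} :=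
  (Scheme.pointSmallEtale (geomPoint x)).sheafFiber.obj N.M

/-- The stalk of a Zariski log structure. -/
abbrev zariskiStalk {X : Scheme.{u}} (M : ZariskiLogStructure X) (x : X) : CommMonCat.{u} :=
  TopCat.Presheaf.stalk (C := CommMonCat.{u}) (X := X.toTopCat) M.M.obj x

/-- The germ at `x` of a section. -/
def zGerm {X : Scheme.{u}} (M : ZariskiLogStructure X) (U : X.Opens) (x : X) (hx : x ∈ U) :
    M.sections U →* zariskiStalk M x :=
  (TopCat.Presheaf.germ (C := CommMonCat.{u}) (X := X.toTopCat) M.M.obj U x hx).hom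

/-- Homomorphisms out of a stalk are given by compatible homomorphisms on the neighbourhoods. -/
def stalkDesc {X : TopCat.{u}} (F : TopCat.Presheaf CommMonCat.{u} X) (x : X)
    (T : CommMonCat.{u}) (f : ∀ U : Opens X, x ∈ U → (F.obj (op U) ⟶ T))
    (hf : ∀ (U V : Opens X) (i : U ⟶ V) (hU : x ∈ U), F.map i.op ≫ f U hU = f V (i.le hU)) :
    F.stalk x ⟶ T :=
  colimit.desc ((OpenNhds.inclusion x).op ⋙ F)
    { pt := T
      ι :=
        { app U := f U.unop.1 U.unop.2
          naturality U V i := by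
            refine (hf _ _ ((OpenNhds.inclusion x).map i.unop) V.unop.2).trans ?_
            exact (Category.comp_id _).symm } }

lemma fiber_map_openPoint {X : Scheme.{u}} {x : X} {U V : X.Opens} (i : U ⟶ V) (hU : x ∈ U) :
    (Scheme.pointSmallEtale (geomPoint x)).fiber.map ((openToEtale X).map i) (openPoint hU) =
      openPoint (i.le hU) := by
  have h : (geomPointLift hU ≫ X.homOfLE i.le) = geomPointLift (i.le hU) := by
    rw [← cancel_mono V.ι, Category.assoc, X.homOfLE_ι, geomPointLift_ι, geomPointLift_ι]
  exact Over.OverMorphism.ext h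

/-- The germ at the geometric point over `x` of a section of `N` over a Zariski open `U ∋ x`. -/
def openToEtaleStalk {X : Scheme.{u}} (N : EtaleLogStructure X) {x : X} {U : X.Opens}
    (hU : x ∈ U) : ((openToEtale X).op ⋙ N.M.obj).obj (op U) ⟶ etaleStalk N x :=
  (Scheme.pointSmallEtale (geomPoint x)).toPresheafFiber _ (openPoint hU) N.M.obj

lemma map_openToEtaleStalk {X : Scheme.{u}} (N : EtaleLogStructure X) {x : X} {U V : X.Opens}
    (i : U ⟶ V) (hU : x ∈ U) :
    ((openToEtale X).op ⋙ N.M.obj).map i.op ≫ openToEtaleStalk N hU =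
      openToEtaleStalk N (i.le hU) := by
  refine ((Scheme.pointSmallEtale (geomPoint x)).toPresheafFiber_w
    ((openToEtale X).map i) (openPoint hU) N.M.obj).trans ?_
  rw [fiber_map_openPoint]
  rfl

/-- The map on stalks `M_x → N_x̄` induced by a morphism `(X, N) → (X, M)`. -/
def ZariskiToEtaleHom.stalkMap {X : Scheme.{u}} {M : ZariskiLogStructure X}
    {N : EtaleLogStructure X} (φ : ZariskiToEtaleHom M N) (x : X) :
    zariskiStalk M x →* etaleStalk N x :=
  (stalkDesc (X := X.toTopCat) M.M.obj x (etaleStalk N x)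
    (fun U hU => φ.hom.app (op U) ≫ openToEtaleStalk N hU)
    (fun U V i hU => by
      rw [← map_openToEtaleStalk N i hU]
      exact φ.hom.naturality_assoc i.op _)).hom

/-- The germ of a function, on multiplicative monoids. -/
def germO (X : Scheme.{u}) {x : X} {U : X.Opens} (hU : x ∈ U) :
    (zariskiO X).obj (op U) ⟶ CommMonCat.of (X.presheaf.stalk x) :=
  (forget₂ CommRingCat CommMonCat).map (X.presheaf.germ U x hU)

lemma map_germO (X : Scheme.{u}) {x : X} {U V : X.Opens} (i : U ⟶ V) (hU : x ∈ U) :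
    (zariskiO X).map i.op ≫ germO X hU = germO X (i.le hU) := by
  refine ((forget₂ CommRingCat CommMonCat).map_comp _ _).symm.trans ?_
  rw [X.presheaf.germ_res i x hU]
  rfl

/-- The stalk `M_x → 𝒪_{X,x}` of `α`. -/
def alphaStalk {X : Scheme.{u}} (M : ZariskiLogStructure X) (x : X) :
    zariskiStalk M x →* X.presheaf.stalk x :=
  (stalkDesc (X := X.toTopCat) M.M.obj x (CommMonCat.of (X.presheaf.stalk x))
    (fun U hU => M.α.app (op U) ≫ germO X hU)
    (fun U V i hU => by
      rw [← map_germO X i hU]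
      exact M.α.naturality_assoc i.op _)).hom

/-! ### Stalks of ghost sheaves, written additively -/

/-- The stalk `M̄_x = M_x / 𝒪ˣ_{X,x}` of the ghost sheaf; the units of `M_x` are `𝒪ˣ_{X,x}`. -/
abbrev Ghost {X : Scheme.{u}} (M : ZariskiLogStructure X) (x : X) : Type u :=
  Additive (Associates (zariskiStalk M x))

/-- The group `M̄_xᵍᵖ`. -/
abbrev GhostGp {X : Scheme.{u}} (M : ZariskiLogStructure X) (x : X) : Type u :=
  Algebra.GrothendieckAddGroup (Ghost M x)

/-- The stalk of the ghost sheaf of an étale log structure at the geometric point over `x`. -/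
abbrev EtaleGhost {X : Scheme.{u}} (N : EtaleLogStructure X) (x : X) : Type u :=
  Additive (Associates (etaleStalk N x))

/-- The homomorphism induced on quotients by the groups of units. -/
def associatesMap {A B : Type*} [CommMonoid A] [CommMonoid B] (f : A →* B) :
    Associates A →* Associates B where
  toFun := Quotient.map f fun _ _ h => h.map f
  map_one' := congrArg Associates.mk f.map_one
  map_mul' := by
    rintro ⟨a⟩ ⟨b⟩
    exact congrArg Associates.mk (f.map_mul a b)

/-- The germ in `M̄_x` of a section of `M`. -/
def ghostGerm {X : Scheme.{u}} (M : ZariskiLogStructure X) {U : X.Opens} {x : X} (hx : x ∈ U)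
    (m : M.sections U) : Ghost M x :=
  Additive.ofMul (Associates.mk (zGerm M U x hx m))

/-- The generization map `M̄_x → M̄_y` for `x` in the closure of `y`. -/
def generization {X : Scheme.{u}} (M : ZariskiLogStructure X) {y x : X} (h : y ⤳ x) :
    Ghost M x →+ Ghost M y :=
  (associatesMap (TopCat.Presheaf.stalkSpecializes (C := CommMonCat.{u}) (X := X.toTopCat)
    M.M.obj h).hom).toAdditive

/-- The map `M̄_x → N̄_x̄` induced by a morphism `(X, N) → (X, M)`. -/
def ZariskiToEtaleHom.ghostMap {X : Scheme.{u}} {M : ZariskiLogStructure X}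
    {N : EtaleLogStructure X} (φ : ZariskiToEtaleHom M N) (x : X) :
    Ghost M x →+ EtaleGhost N x :=
  (associatesMap (φ.stalkMap x)).toAdditive

/-- `X` as an object of its étale site. -/
def etaleTop (X : Scheme.{u}) : X.Etale := Scheme.Etale.mk (𝟙 X)

def toEtaleTop {X : Scheme.{u}} (V : X.Etale) : V ⟶ etaleTop X :=
  MorphismProperty.Over.homMk V.hom (Category.comp_id V.hom)

def topPoint {X : Scheme.{u}} (x : X) :
    (Scheme.pointSmallEtale (geomPoint x)).fiber.obj (etaleTop X) :=
  Over.homMk (geomPoint x) (Category.comp_id (geomPoint x))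

/-- The germ of a global section at the geometric point over `x`. -/
def globalGerm {X : Scheme.{u}} (N : EtaleLogStructure X) (x : X) :
    N.sections (etaleTop X) →* etaleStalk N x :=
  ((Scheme.pointSmallEtale (geomPoint x)).toPresheafFiber _ (topPoint x) N.M.obj).hom

/-- The map `ℕ → N̄_x̄` induced by a homomorphism from `ℕ` to the global sections of `N`. -/
def baseGhost {X : Scheme.{u}} {N : EtaleLogStructure X}
    (q : Multiplicative ℕ →* N.sections (etaleTop X)) (x : X) : ℕ →+ EtaleGhost N x :=
  MonoidHom.toAdditiveRight
    (Associates.mkMonoidHom.comp ((globalGerm N x).comp q))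

/-! ### Log smooth curves over the standard log point -/

/-- `f` is smooth at `x`. -/
def IsSmoothAt {X Y : Scheme.{u}} (f : X ⟶ Y) (x : X) : Prop :=
  ∃ U : X.Opens, x ∈ U ∧ Smooth (U.ι ≫ f)

/-- The ring `κ[P] / (z ^ h(1))` for `h : ℕ → P`, which is the coordinate ring of the product of
`Spec κ` and `Spec ℤ[P]` over `Spec ℤ[ℕ]`, where the chart `ℕ → κ` of the standard log point maps
`1` to `0`. -/
abbrev ChartRing (κ : Type u) [Field κ] {P : Type u} [CommMonoid P]
    (h : Multiplicative ℕ →* P) : Type u :=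
  MonoidAlgebra κ P ⧸ Ideal.span {MonoidAlgebra.of κ P (h (Multiplicative.ofAdd 1))}

/-- Log smoothness of a morphism `(C, N) → (Spec κ, ℕ)` of fine log schemes, by means of charts:
étale locally on `C` the chart `ℕ` of the base extends to a chart `h : ℕ → P` of the morphism such
that `hᵍᵖ` is injective, the torsion of its cokernel has order invertible in `κ`, and the induced
morphism to `Spec κ ×_{Spec ℤ[ℕ]} Spec ℤ[P]` is smooth. -/
def IsLogSmoothOverLogPoint {κ : Type u} [Field κ] {C : Scheme.{u}} (π : C ⟶ Spec (.of κ))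
    (N : EtaleLogStructure C) (q : Multiplicative ℕ →* N.sections (etaleTop C)) : Prop :=
  ∀ c : C, ∃ (V : C.Etale) (P : Type u) (_ : CommMonoid P) (h : Multiplicative ℕ →* P)
    (β : P →* N.sections V),
    c ∈ Set.range V.hom ∧ IsFineSaturated P ∧ N.IsChart β ∧
    (∀ n, β (h n) = N.res (toEtaleTop V) (q n)) ∧
    Function.Injective (Algebra.GrothendieckGroup.lift (Algebra.GrothendieckGroup.of.comp h)) ∧
    (∀ y : Algebra.GrothendieckGroup P ⧸
        (Algebra.GrothendieckGroup.lift (Algebra.GrothendieckGroup.of.comp h)).range,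
      IsOfFinOrder y → (orderOf y : κ) ≠ 0) ∧
    ∃ r : V.left ⟶ Spec (.of (ChartRing κ h)), Smooth r ∧
      r ≫ Spec.map (CommRingCat.ofHom (algebraMap κ (ChartRing κ h))) = V.hom ≫ π ∧
      ∀ p : P, etaleAlpha N V (β p) =
        r.appTop ((Scheme.ΓSpecIso (.of (ChartRing κ h))).inv
          (Ideal.Quotient.mk _ (MonoidAlgebra.of κ P p)))

/-- Pre-stable marked log curves over the standard log point `(Spec κ, ℕ)`, whose log structure is
the one associated with `ℕ → κ`, `0 ↦ 1`, `n ↦ 0` for `n > 0`.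
A morphism `(C, N) → (Spec κ, ℕ)` over `π : C → Spec κ` is therefore the same as a homomorphism
`q : ℕ → Γ(C, N)` lifting the composition of `ℕ → κ` with `κ → Γ(C, 𝒪)`. -/
structure PrestableLogCurve (κ : Type u) [Field κ] where
  C : Scheme.{u}
  π : C ⟶ Spec (.of κ)
  N : EtaleLogStructure C
  q : Multiplicative ℕ →* N.sections (etaleTop C)
  /-- the number of marked points -/
  l : ℕ
  /-- the sections of `π` which define the marked points -/
  sec : Fin l → (Spec (.of κ) ⟶ C)
  isProper : IsProper π
  geometricallyReduced : GeometricallyReduced π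
  geometricallyConnected : GeometricallyConnected π
  dim_eq_one : ∀ Z ∈ irreducibleComponents C, topologicalKrullDim Z = 1
  isFS : N.IsFS
  α_q : ∀ n, n ≠ 1 → etaleAlpha N (etaleTop C) (q n) = 0
  logSmooth : IsLogSmoothOverLogPoint π N q
  sec_π : ∀ i, sec i ≫ π = 𝟙 _
  sec_smooth : ∀ i, IsSmoothAt π (sec i default)
  sec_injective : Function.Injective fun i => sec i default
  /-- On the smooth locus of `π` the ghost sheaf is the direct sum of the constant sheaf `ℕ` coming
  from the base and of one copy of `ℕ` at each marked point. -/
  ghost : ∀ c, IsSmoothAt π c →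
    ∃ θ : EtaleGhost N c ≃+ ℕ × ({i // sec i default = c} → ℕ), ∀ n, θ (baseGhost q c n) = (n, 0)

/-! ### Pull-back of a Zariski log structure and the torsors of ghost sections -/

section Pullback

variable {X Y : Scheme.{u}} (g : Y ⟶ X) (M : ZariskiLogStructure X)

lemma zGerm_res {U V : X.Opens} (i : U ⟶ V) {x : X} (hx : x ∈ U) (m : M.sections V) :
    zGerm M U x hx (M.res i m) = zGerm M V x (i.le hx) m :=
  TopCat.Presheaf.germ_res_apply (X := X.toTopCat) M.M.obj i x hx m

lemma ghostGerm_res {U V : X.Opens} (i : U ⟶ V) {x : X} (hx : x ∈ U) (m : M.sections V) :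
    ghostGerm M hx (M.res i m) = ghostGerm M (i.le hx) m := by
  rw [ghostGerm, zGerm_res, ghostGerm]

lemma ghostGerm_one {U : X.Opens} {x : X} (hx : x ∈ U) :
    ghostGerm M hx (1 : M.sections U) = 0 := by
  rw [ghostGerm, map_one, Associates.mk_one, ofMul_one]

lemma ghostGerm_mul {U : X.Opens} {x : X} (hx : x ∈ U) (m m' : M.sections U) :
    ghostGerm M hx (m * m') = ghostGerm M hx m + ghostGerm M hx m' := by
  rw [ghostGerm, map_mul, ← Associates.mk_mul_mk, ofMul_mul, ghostGerm, ghostGerm]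

/-- The germ of an invertible function. -/
def unitGerm {U : Y.Opens} {y : Y} (hy : y ∈ U) : Γ(Y, U)ˣ →* (Y.presheaf.stalk y)ˣ :=
  Units.map ((Y.presheaf.germ U y hy).hom : Γ(Y, U) →* Y.presheaf.stalk y)

/-- Restriction of invertible functions. -/
def unitRes {U V : Y.Opens} (h : V ≤ U) : Γ(Y, U)ˣ →* Γ(Y, V)ˣ :=
  Units.map ((Y.presheaf.map (homOfLE h).op).hom : Γ(Y, U) →* Γ(Y, V))

lemma unitGerm_unitRes {U V : Y.Opens} (h : V ≤ U) {y : Y} (hy : y ∈ V) (a : Γ(Y, U)ˣ) :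
    unitGerm hy (unitRes h a) = unitGerm (h hy) a :=
  Units.ext (Y.presheaf.germ_res_apply (homOfLE h) y hy (a : Γ(Y, U)))

/-- The homomorphism `𝒪ˣ_{X,g(y)} → 𝒪ˣ_{Y,y}`, where `𝒪ˣ_{X,g(y)}` is the group of units of the
stalk of `M`. -/
def pullbackUnits (y : Y) : (zariskiStalk M (g y))ˣ →* (Y.presheaf.stalk y)ˣ :=
  Units.map ((g.stalkMap y).hom.toMonoidHom.comp (alphaStalk M (g y)))

/-- The congruence `(m h, a) ~ (m, h a)` for `h ∈ 𝒪ˣ_{X,g(y)}`. -/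
def pullbackCon (y : Y) : Con (zariskiStalk M (g y) × (Y.presheaf.stalk y)ˣ) where
  r a b := ∃ h : (zariskiStalk M (g y))ˣ, b.1 = a.1 * h ∧ a.2 = b.2 * pullbackUnits g M y h
  iseqv :=
    { refl := fun a => ⟨1, by simp⟩
      symm := by
        rintro a b ⟨h, h1, h2⟩
        exact ⟨h⁻¹, by simp [h1], by simp [h2]⟩
      trans := by
        rintro a b c ⟨h, h1, h2⟩ ⟨k, k1, k2⟩
        exact ⟨h * k, by simp [k1, h1, mul_assoc], by
          rw [h2, k2, map_mul, mul_assoc, mul_comm (pullbackUnits g M y h)]⟩ }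
  mul' := by
    rintro a b c d ⟨h, h1, h2⟩ ⟨k, k1, k2⟩
    refine ⟨h * k, ?_, ?_⟩
    · simp only [Prod.fst_mul, h1, k1, Units.val_mul]
      exact mul_mul_mul_comm _ _ _ _
    · simp only [Prod.snd_mul, h2, k2, map_mul]
      exact mul_mul_mul_comm _ _ _ _

/-- The stalk at `y` of the pull-back log structure `g^* M`: the pushout of `M_{g(y)}` and
`𝒪ˣ_{Y,y}` over `𝒪ˣ_{X,g(y)}`. -/
abbrev PullbackStalk (y : Y) : Type u := (pullbackCon g M y).Quotient

def PullbackStalk.mk (y : Y) (m : zariskiStalk M (g y)) (a : (Y.presheaf.stalk y)ˣ) :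
    PullbackStalk g M y := (pullbackCon g M y).mk' (m, a)

lemma PullbackStalk.mk_one_one (y : Y) : PullbackStalk.mk g M y 1 1 = 1 := rfl

lemma PullbackStalk.mk_mul_mk (y : Y) (m m' : zariskiStalk M (g y))
    (a a' : (Y.presheaf.stalk y)ˣ) :
    PullbackStalk.mk g M y m a * PullbackStalk.mk g M y m' a' =
      PullbackStalk.mk g M y (m * m') (a * a') := rfl

/-- The quotient map from the stalk of `g^* M` to the stalk of its ghost sheaf `g⁻¹ M̄`. -/
def PullbackStalk.toGhost (y : Y) : PullbackStalk g M y →* Associates (zariskiStalk M (g y)) :=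
  (pullbackCon g M y).lift (Associates.mkMonoidHom.comp (MonoidHom.fst _ _)) (by
    rintro a b ⟨h, h1, -⟩
    exact Associates.mk_eq_mk_iff_associated.2 ⟨h, h1.symm⟩)

lemma PullbackStalk.toGhost_mk (y : Y) (m : zariskiStalk M (g y)) (a : (Y.presheaf.stalk y)ˣ) :
    PullbackStalk.toGhost g M y (PullbackStalk.mk g M y m a) = Associates.mk m := rfl

/-- The monoid `Γ(Y, g⁻¹ M̄)`: families of germs which locally come from sections of `M`. -/
def ghostSections : AddSubmonoid (∀ y : Y, Ghost M (g y)) where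
  carrier := {s | ∀ y : Y, ∃ (V : X.Opens) (W : Y.Opens) (hW : ∀ z ∈ W, g z ∈ V)
    (m : M.sections V), y ∈ W ∧ ∀ (z : Y) (hz : z ∈ W), s z = ghostGerm M (hW z hz) m}
  zero_mem' y := ⟨⊤, ⊤, fun _ _ => trivial, 1, trivial, fun z hz => (ghostGerm_one M _).symm⟩
  add_mem' {s t} hs ht y := by
    obtain ⟨V, W, hW, m, hy, h⟩ := hs y
    obtain ⟨V', W', hW', m', hy', h'⟩ := ht y
    have hW₂ : ∀ z ∈ W ⊓ W', g z ∈ V ⊓ V' := by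
      rintro z ⟨h₁, h₂⟩
      exact ⟨hW z h₁, hW' z h₂⟩
    refine ⟨V ⊓ V', W ⊓ W', hW₂,
      M.res (homOfLE inf_le_left) m * M.res (homOfLE inf_le_right) m', ⟨hy, hy'⟩, fun z hz => ?_⟩
    rw [ghostGerm_mul, ghostGerm_res, ghostGerm_res, Pi.add_apply, h z hz.1, h' z hz.2]

/-- The group `Γ(Y, g⁻¹ M̄ᵍᵖ)`. -/
def ghostGpSections : AddSubgroup (∀ y : Y, GhostGp M (g y)) where
  carrier := {s | ∀ y : Y, ∃ (V : X.Opens) (W : Y.Opens) (hW : ∀ z ∈ W, g z ∈ V)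
    (m m' : M.sections V), y ∈ W ∧ ∀ (z : Y) (hz : z ∈ W),
      s z = Algebra.GrothendieckAddGroup.of (ghostGerm M (hW z hz) m) -
        Algebra.GrothendieckAddGroup.of (ghostGerm M (hW z hz) m')}
  zero_mem' y := ⟨⊤, ⊤, fun _ _ => trivial, 1, 1, trivial, fun z hz => (sub_self _).symm⟩
  add_mem' {s t} hs ht y := by
    obtain ⟨V, W, hW, m, n, hy, h⟩ := hs y
    obtain ⟨V', W', hW', m', n', hy', h'⟩ := ht y
    have hW₂ : ∀ z ∈ W ⊓ W', g z ∈ V ⊓ V' := by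
      rintro z ⟨h₁, h₂⟩
      exact ⟨hW z h₁, hW' z h₂⟩
    refine ⟨V ⊓ V', W ⊓ W', hW₂,
      M.res (homOfLE inf_le_left) m * M.res (homOfLE inf_le_right) m',
      M.res (homOfLE inf_le_left) n * M.res (homOfLE inf_le_right) n', ⟨hy, hy'⟩, fun z hz => ?_⟩
    simp only [ghostGerm_mul, ghostGerm_res, Pi.add_apply, h z hz.1, h' z hz.2, map_add]
    abel
  neg_mem' {s} hs y := by
    obtain ⟨V, W, hW, m, n, hy, h⟩ := hs y
    exact ⟨V, W, hW, n, m, hy, fun z hz => by rw [Pi.neg_apply, h z hz, neg_sub]⟩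

variable {g M} in
/-- The natural map `Γ(Y, g⁻¹ M̄) → Γ(Y, g⁻¹ M̄ᵍᵖ)`. -/
def ghostSections.toGp (s : ghostSections g M) : ghostGpSections g M :=
  ⟨fun y => Algebra.GrothendieckAddGroup.of (s.1 y), fun y => by
    obtain ⟨V, W, hW, m, hy, h⟩ := s.2 y
    refine ⟨V, W, hW, m, 1, hy, fun z hz => ?_⟩
    dsimp only
    rw [h z hz, ghostGerm_one, map_zero, sub_zero]⟩

/-- A presheaf of sets on `Y` with an action of `𝒪ˣ`. -/
structure UnitsPresheaf (Y : Scheme.{u}) where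
  sec : Y.Opens → Type u
  res : ∀ {U V : Y.Opens}, V ≤ U → sec U → sec V
  act : ∀ {U : Y.Opens}, Γ(Y, U)ˣ → sec U → sec U
  res_refl : ∀ {U : Y.Opens} (s : sec U), res le_rfl s = s
  res_trans : ∀ {U V W : Y.Opens} (h : V ≤ U) (k : W ≤ V) (s : sec U),
    res k (res h s) = res (k.trans h) s
  one_act : ∀ {U : Y.Opens} (s : sec U), act 1 s = s
  mul_act : ∀ {U : Y.Opens} (a b : Γ(Y, U)ˣ) (s : sec U), act (a * b) s = act a (act b s)
  res_act : ∀ {U V : Y.Opens} (h : V ≤ U) (a : Γ(Y, U)ˣ) (s : sec U),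
    res h (act a s) = act (unitRes h a) (res h s)

/-- `t` is a section over `U` of `g^* M` (that is, locally the product of a section of `M` and of an
invertible function) which maps to `s` in the ghost sheaf. -/
def IsTorsorSection (s : ghostSections g M) (U : Y.Opens)
    (t : ∀ y : Y, y ∈ U → PullbackStalk g M y) : Prop :=
  ∀ (y : Y) (hy : y ∈ U), Additive.ofMul (PullbackStalk.toGhost g M y (t y hy)) = s.1 y ∧
    ∃ (V : X.Opens) (W : Y.Opens) (hWU : W ≤ U) (hW : ∀ z ∈ W, g z ∈ V)
      (m : M.sections V) (a : Γ(Y, W)ˣ), y ∈ W ∧ ∀ (z : Y) (hz : z ∈ W),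
        t z (hWU hz) = PullbackStalk.mk g M z (zGerm M V (g z) (hW z hz) m) (unitGerm hz a)

lemma IsTorsorSection.res {s : ghostSections g M} {U V : Y.Opens} (h : V ≤ U)
    {t : ∀ y : Y, y ∈ U → PullbackStalk g M y} (ht : IsTorsorSection g M s U t) :
    IsTorsorSection g M s V fun y hy => t y (h hy) := by
  intro y hy
  obtain ⟨h1, V', W, hWU, hW, m, a, hyW, h2⟩ := ht y (h hy)
  refine ⟨h1, V', W ⊓ V, inf_le_right, fun z hz => hW z hz.1, m, unitRes inf_le_left a,
    ⟨hyW, hy⟩, fun z hz => ?_⟩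
  rw [unitGerm_unitRes]
  exact h2 z hz.1

lemma IsTorsorSection.act {s : ghostSections g M} {U : Y.Opens}
    {t : ∀ y : Y, y ∈ U → PullbackStalk g M y} (b : Γ(Y, U)ˣ) (ht : IsTorsorSection g M s U t) :
    IsTorsorSection g M s U fun y hy => PullbackStalk.mk g M y 1 (unitGerm hy b) * t y hy := by
  intro y hy
  obtain ⟨h1, V', W, hWU, hW, m, a, hyW, h2⟩ := ht y hy
  refine ⟨?_, V', W, hWU, hW, m, unitRes hWU b * a, hyW, fun z hz => ?_⟩
  · rw [map_mul, PullbackStalk.toGhost_mk, Associates.mk_one, one_mul, h1]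
  · dsimp only
    rw [h2 z hz, PullbackStalk.mk_mul_mk, one_mul, map_mul, unitGerm_unitRes]

/-- The torsor of a section `s` of the ghost sheaf of `g^* M`: the preimage of `s` in `g^* M`, with
the action of `𝒪ˣ` by multiplication. -/
def torsor (s : ghostSections g M) : UnitsPresheaf Y where
  sec U := {t : ∀ y : Y, y ∈ U → PullbackStalk g M y // IsTorsorSection g M s U t}
  res h t := ⟨fun y hy => t.1 y (h hy), t.2.res g M h⟩
  act a t := ⟨fun y hy => PullbackStalk.mk g M y 1 (unitGerm hy a) * t.1 y hy, t.2.act g M a⟩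
  res_refl _ := rfl
  res_trans _ _ _ := rfl
  one_act t := by
    ext y hy
    simp only [map_one, PullbackStalk.mk_one_one, one_mul]
  mul_act a b t := by
    ext y hy
    simp only [map_mul, ← mul_assoc, PullbackStalk.mk_mul_mk, one_mul]
  res_act h a t := by
    ext y hy
    simp only [unitGerm_unitRes]

/-- The group `Γ(Y, g⁻¹ M̄ᵍᵖ)^*`. -/
abbrev DualGhostGp : Type u := ghostGpSections g M →+ ℤ

/-- The map `Hom(M̄_{g(y)}, ℤ) → Γ(Y, g⁻¹ M̄ᵍᵖ)^*` dual to taking the germ at `y`. -/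
def dualOfStalk (y : Y) (a : Ghost M (g y) →+ ℤ) : DualGhostGp g M :=
  (Algebra.GrothendieckAddGroup.lift a).comp
    ((Pi.evalAddMonoidHom (fun y : Y => GhostGp M (g y)) y).comp (ghostGpSections g M).subtype)

end Pullback

/-! ### The degree of an `𝒪ˣ`-torsor on an integral curve -/

section Degree

variable {κ : Type u} [Field κ] {Y : Scheme.{u}} [IsIntegral Y]

open Classical in
/-- The order of vanishing of a rational function at a point of codimension one of a locally
Noetherian integral scheme. -/
def orderAt (f : Y.functionField) (y : Y) : ℤ :=
  if _h : IsLocallyNoetherian Y then Y.ord f y else 0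

/-- The rational section `σ` has order `n` at `y`: there are a local generator `t` of the torsor
near `y` and a function `f` with `σ = f t` and with order `n` at `y`. -/
def UnitsPresheaf.HasOrderAt (T : UnitsPresheaf Y) {U : Y.Opens} (σ : T.sec U) (y : Y)
    (n : ℤ) : Prop :=
  ∃ (W : Y.Opens) (_ : Nonempty (U ⊓ W : Y.Opens)) (t : T.sec W) (f : Γ(Y, U ⊓ W)ˣ),
    y ∈ W ∧ T.res inf_le_left σ = T.act f (T.res inf_le_right t) ∧
    n = orderAt (Y.germToFunctionField (U ⊓ W) f) y

open Classical in
/-- The order at `y` of a rational section of an `𝒪ˣ`-torsor. -/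
def UnitsPresheaf.orderAt (T : UnitsPresheaf Y) {U : Y.Opens} (σ : T.sec U) (y : Y) : ℤ :=
  if h : ∃ n, T.HasOrderAt σ y n then h.choose else 0

open Classical in
/-- The degree over `κ` of an `𝒪ˣ`-torsor, or of the corresponding line bundle, on a proper normal
curve `p : Y → Spec κ`: the degree of the divisor of a rational section. -/
def UnitsPresheaf.degree (p : Y ⟶ Spec (.of κ)) (T : UnitsPresheaf Y) : ℤ :=
  if h : ∃ (U : Y.Opens) (_ : Nonempty U), Nonempty (T.sec U) then
    ∑ᶠ y : Y, (p.residueDegree y : ℤ) * T.orderAt h.choose_spec.choose_spec.some y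
  else 0

end Degree

/-! ### Components, special points and contact orders -/

/-- The monoid `ℕ ⊕_ℕ ℕ²`, where `1 ∈ ℕ` maps to `e ∈ ℕ` and to `(1, 1) ∈ ℕ²`, as the submonoid of
`ℕ²` of all `(a, b)` with `a ≡ b` modulo `e`. The inclusion of the first summand is the diagonal. -/
def nodeMonoid (e : ℕ) : AddSubmonoid (ℕ × ℕ) where
  carrier := {p | p.1 ≡ p.2 [MOD e]}
  zero_mem' := rfl
  add_mem' h k := Nat.ModEq.add h k

namespace PrestableLogCurve

variable {κ : Type u} [Field κ] (X : PrestableLogCurve κ)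

/-- The marked points. -/
def IsMarked (c : X.C) : Prop := ∃ i, X.sec i default = c

/-- The nodes are the points where `π` is not smooth. -/
def IsNode (c : X.C) : Prop := ¬ IsSmoothAt X.π c

/-- The normalization of the irreducible component with generic point `η`. -/
def normalizedComponent (η : X.C) : Scheme.{u} := (X.C.fromSpecResidueField η).normalization

/-- The morphism from the normalization of a component to the curve. -/
def toCurve (η : X.C) : X.normalizedComponent η ⟶ X.C :=
  (X.C.fromSpecResidueField η).fromNormalization

instance (η : X.C) : IsIntegral (X.normalizedComponent η) :=
  inferInstanceAs (IsIntegral (X.C.fromSpecResidueField η).normalization)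

/-- The points of the normalized component which lie over special points of the curve. -/
def specialPoints (η : X.C) : Set (X.normalizedComponent η) :=
  {x | X.IsMarked (X.toCurve η x) ∨ X.IsNode (X.toCurve η x)}

/-- The degree `[κ(x) : κ]` of a point of the normalized component. -/
def pointDegree (η : X.C) (x : X.normalizedComponent η) : ℕ :=
  (X.toCurve η ≫ X.π).residueDegree x

variable {X} {M : ZariskiLogStructure X.C} (φ : ZariskiToEtaleHom M X.N)

/-- The degree of the torsor of a section of the pulled back ghost sheaf. -/
def torsorDegree (η : X.C) (m : ghostSections (X.toCurve η) M) : ℤ :=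
  (torsor (X.toCurve η) M m).degree (X.toCurve η ≫ X.π)

/-- For a node `c` on the component of `η`, the point `η'` is the generic point of the other branch
at `c`: it is different from `η` if `c` lies on a second component, and equal to `η` otherwise. -/
def IsOtherBranch (η c η' : X.C) : Prop :=
  η' ∈ genericPoints X.C ∧ (η' ≠ η ∨ ∀ ζ ∈ genericPoints X.C, ζ ⤳ c → ζ = η)

/-- `V` is the map on ghost stalks at the generic point `η`, with values in `ℕ`. -/
def IsVertexPosition (η : X.C) (V : Ghost M η →+ ℕ) : Prop :=
  ∀ m, φ.ghostMap η m = baseGhost X.q η (V m)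

/-- `u` is the map on ghost stalks at the marked point `p`, with values in `ℕ ⊕ ℕ`, followed by the
second projection. -/
def IsMarkedContactOrder (p : X.C) (u : Ghost M p →+ ℤ) : Prop :=
  ∃ θ : EtaleGhost X.N p ≃+ ℕ × ℕ, (∀ n, θ (baseGhost X.q p n) = (n, 0)) ∧
    ∀ m, u m = (θ (φ.ghostMap p m)).2

/-- `u` is the contact order at the node `c`, with respect to the branch on the component of `η`:
`V_{η'} ∘ χ' - V_η ∘ χ = e u`, where `η'` belongs to the other branch, `χ` and `χ'` are the
generization maps, and `e > 0` is the number with ghost stalk `ℕ ⊕_ℕ ℕ²` at `c` over `1 ↦ e`. -/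
def IsNodalContactOrder (η c : X.C) (u : Ghost M c →+ ℤ) : Prop :=
  ∃ (e : ℕ) (θ : EtaleGhost X.N c ≃+ nodeMonoid e) (η' : X.C) (h : η ⤳ c) (h' : η' ⤳ c)
    (V : Ghost M η →+ ℕ) (V' : Ghost M η' →+ ℕ),
    0 < e ∧ (∀ n, (θ (baseGhost X.q c n) : ℕ × ℕ) = (n, n)) ∧ IsOtherBranch η c η' ∧
    IsVertexPosition φ η V ∧ IsVertexPosition φ η' V' ∧
    ∀ m, (V' (generization M h' m) : ℤ) - V (generization M h m) = e * u m

/-- `u` is the family of contact orders at the special points of the component of `η`. -/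
def IsContactData (η : X.C)
    (u : ∀ x : X.specialPoints η, Ghost M (X.toCurve η x.1) →+ ℤ) : Prop :=
  ∀ x : X.specialPoints η,
    (X.IsMarked (X.toCurve η x.1) → IsMarkedContactOrder φ (X.toCurve η x.1) (u x)) ∧
    (X.IsNode (X.toCurve η x.1) → IsNodalContactOrder φ η (X.toCurve η x.1) (u x))

/-- The element of `Γ(D̃, M̄ᵍᵖ)^*` represented by a tuple of elements of `Hom(M̄_x, ℤ)`, where `x`
runs over the (finitely many) points over special points. -/
def tupleClass {η : X.C} (a : ∀ x : X.specialPoints η, Ghost M (X.toCurve η x.1) →+ ℤ) :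
    DualGhostGp (X.toCurve η) M :=
  ∑ᶠ x : X.specialPoints η, dualOfStalk (X.toCurve η) M x.1 (a x)

/-- The element `T` of `Γ(D̃, M̄ᵍᵖ)^*` restricts to the degree map of torsors on `Γ(D̃, M̄)`. -/
def IsDegreeClass {η : X.C} (T : DualGhostGp (X.toCurve η) M) : Prop :=
  ∀ m : ghostSections (X.toCurve η) M, T (ghostSections.toGp m) = torsorDegree η m

end PrestableLogCurve

end LogGeom

end

open LogGeom PrestableLogCurve

/-!
# The modified balancing condition

Let `ε` be the generic point of the normalization `D̃` of the component with generic point `η`, let `g`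
be the map from `D̃` to the curve, and let `K` be the function field of `D̃`. At the generic point of a
component the ghost stalk of `X.N` is `ℕ`, generated by the base, so the image of a germ `m` of `M` at
`g ε` is, locally, `q n * b` for one number `n` and one invertible section `b`. The invertible function
of `b` is a *value* of `m` in `Kˣ` (`rationalValue`), which is multiplicative in `m` and is `α m` if `m`
is a unit. Sending a germ of `M` at `g y` to the order at `y` of the value of its generization
therefore defines a homomorphism from the ghost stalk to `ℤ`, `vanishingOrder`. The theorem follows from
three facts.

*Contact orders are orders of vanishing* (`isContactData_iff`; `vanishingOrder_eq_zero` at points which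
are not special). Étale locally the curve is smooth over the spectrum of `κ[P] / (z ^ ρ)`, and flatness
shows that the faces of `P` without `ρ` which contain the face `F` of a point are the faces of its
generizations. Proper generizations are generic points, with quotient `ℕ ρ`, so `P / F` is `ℕ ρ` or has
rank two, with coordinates given by the order of vanishing along the branch, up to a factor, and the
position of its vertex (`classify_face_quotient`). The factor is one because on the branch functions
are, up to units, powers of one monomial, while quotients of functions on the curve include uniformizers
of `D̃` (`BranchInvariants.classify`). If `P / F` is `ℕ ρ` or `ℕ²` with `ρ` as a generator, then the curve is
smooth at the point: in characteristic zero formal smoothness over `κ` follows from the divisibility of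
`1 + I` for ideals of square zero (`formallySmooth_of_monoidAlgebra`), and it descends along étale
morphisms (`mem_smoothLocus_of_etale`). So nodes have ghost stalk `ℕ ⊕_ℕ ℕ²`, whose two facets without `ρ`
belong to the two branches, and both descriptions of the contact order reduce to the order of vanishing
(`BranchInvariants.snd_eq`, `BranchInvariants.node`).

*The torsor of a ghost section `s` has degree minus the sum of the orders of vanishing of `s`*
(`torsorDegree_eq`). Taking values maps a rational section `σ` of the torsor to a rational function
whose order at `y` is the order of `σ` plus the order of vanishing of `s` (`hasOrderAt_iff`), and the
divisor of a rational function on the complete regular curve `D̃` has degree zero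
(`finsum_residueDegree_orderAt`). The latter is proved by counting the zeros and the poles of a
transcendental function `f`: both numbers are the degree of `K` over `κ(f)`, by the formula
`∑ e f = n` for the integral closures of `κ[f]` and of `κ[f⁻¹]`, whose primes over zero are points of
`D̃` by the valuative criterion.

*Sections of the ghost sheaf generate its group of sections* (`exists_toGp_sub_toGp`). Generization of
ghost stalks of `M` to `ε` is surjective, and it is injective outside of finitely many points, so a
ghost section is the same as compatible lifts of a generic element at these points. Hence an element of
`DualGhostGp` which restricts to the degree is unique, and it is minus the class of the contact orders.
-/

noncomputable section

namespace LogGeom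

set_option linter.unusedSectionVars false

/-! ### Rank-two toric monoids -/

/-- `G` is a face of the monoid `Q`. -/
structure IsFaceOf {L : Type*} [AddCommGroup L] (G Q : AddSubmonoid L) : Prop where
  le : G ≤ Q
  mem_of_add_mem : ∀ x ∈ Q, ∀ y ∈ Q, x + y ∈ G → x ∈ G

/-- The face of `Q` on which a functional vanishes. -/
def zeroFace {L : Type*} [AddCommGroup L] (Q : AddSubmonoid L) (ψ : L →+ ℤ) : AddSubmonoid L where
  carrier := {x | x ∈ Q ∧ ψ x = 0}
  zero_mem' := ⟨Q.zero_mem, map_zero ψ⟩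
  add_mem' := by
    rintro a b ⟨ha, ha'⟩ ⟨hb, hb'⟩
    exact ⟨Q.add_mem ha hb, by rw [map_add, ha', hb', add_zero]⟩

lemma isFaceOf_zeroFace {L : Type*} [AddCommGroup L] (Q : AddSubmonoid L) (ψ : L →+ ℤ)
    (h : ∀ x ∈ Q, 0 ≤ ψ x) : IsFaceOf (zeroFace Q ψ) Q where
  le _ hx := hx.1
  mem_of_add_mem x hx y hy hxy := by
    have := hxy.2
    rw [map_add] at this
    exact ⟨hx, by have := h x hx; have := h y hy; omega⟩

lemma nonneg_of_generators {L : Type*} [AddCommGroup L] {Q : AddSubmonoid L} {s : Finset L}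
    (hs : AddSubmonoid.closure (s : Set L) = Q) {ψ : L →+ ℤ} (h : ∀ x ∈ s, 0 ≤ ψ x) :
    ∀ x ∈ Q, 0 ≤ ψ x := by
  intro x hx
  rw [← hs] at hx
  induction hx using AddSubmonoid.closure_induction with
  | mem x hx => exact h x hx
  | zero => rw [map_zero]
  | add x y _ _ hx hy => rw [map_add]; exact add_nonneg hx hy

/-- `Q` becomes `ℕ ρ` after inverting the face `G`. -/
def HasVertex {L : Type*} [AddCommGroup L] (Q G : AddSubmonoid L) (ρ : L) : Prop :=
  ∀ q ∈ Q, ∃ n : ℕ, ∃ g ∈ G, ∃ g' ∈ G, q + g = n • ρ + g'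

/-- In a finite set on which `w > 0`, the ratio `l / w` attains its minimum. -/
lemma exists_min_ratio {α : Type*} (s : Finset α) (hs : s.Nonempty) (l w : α → ℤ)
    (hw : ∀ x ∈ s, 0 < w x) : ∃ y ∈ s, ∀ x ∈ s, l y * w x ≤ l x * w y := by
  obtain ⟨y, hy, h⟩ := s.exists_min_image (fun x => (l x : ℚ) / w x) hs
  refine ⟨y, hy, fun x hx => ?_⟩
  have h1 := h x hx
  have hwy : (0 : ℚ) < w y := by exact_mod_cast hw y hy
  have hwx : (0 : ℚ) < w x := by exact_mod_cast hw x hx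
  rw [div_le_div_iff₀ hwy hwx] at h1
  exact_mod_cast h1

/-- The values of `w` on `ker V` are the multiples of one positive value. -/
lemma exists_generator_on_ker {L : Type*} [AddCommGroup L] (V w : L →+ ℤ)
    (h : ∃ x, V x = 0 ∧ w x ≠ 0) :
    ∃ x, V x = 0 ∧ 0 < w x ∧ ∀ y, V y = 0 → w x ∣ w y := by
  obtain ⟨d, hd⟩ := Int.subgroup_cyclic (V.ker.map w)
  have hmem : ∀ y, V y = 0 → d ∣ w y := by
    intro y hy
    have : w y ∈ V.ker.map w := ⟨y, hy, rfl⟩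
    rw [hd, AddSubgroup.mem_closure_singleton] at this
    obtain ⟨k, hk⟩ := this
    exact ⟨k, by rw [← hk, smul_eq_mul, mul_comm]⟩
  have hd0 : d ∈ V.ker.map w := hd ▸ AddSubgroup.mem_closure_singleton_self d
  obtain ⟨x, hx, hxd⟩ := hd0
  obtain ⟨z, hz, hz'⟩ := h
  have hdne : d ≠ 0 := by
    rintro rfl
    exact hz' (zero_dvd_iff.1 (hmem z hz))
  rcases lt_or_gt_of_ne hdne with h0 | h0
  · refine ⟨-x, by rw [map_neg, show V x = 0 from hx, neg_zero], by rw [map_neg, hxd]; omega,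
      fun y hy => ?_⟩
    rw [map_neg, hxd, neg_dvd]; exact hmem y hy
  · exact ⟨x, hx, by rw [hxd]; omega, fun y hy => by rw [hxd]; exact hmem y hy⟩

section Combinatorics

variable {L : Type*} [AddCommGroup L] {Q : AddSubmonoid L} {s : Finset L} {V w : L →+ ℤ} {ρ : L}

/-- If every nonzero face of `Q` which does not contain `ρ` has a vertex, then two functionals
separate the points of `L`. -/
lemma injective_of_faces [Module.Finite ℤ L] [Module.IsTorsionFree ℤ L]
    (hs : AddSubmonoid.closure (s : Set L) = Q)
    (hgen : ∀ x, ∃ q ∈ Q, ∃ q' ∈ Q, x = q - q')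
    (hV : ∀ q ∈ Q, 0 ≤ V q) (hVρ : V ρ = 1)
    (hN : ∀ q ∈ Q, ∃ g ∈ Q, ∃ g' ∈ Q, V g = 0 ∧ V g' = 0 ∧ q + g = V q • ρ + g')
    (hw : ∀ q ∈ Q, V q = 0 → q ≠ 0 → 0 < w q)
    (H : ∀ G, IsFaceOf G Q → G ≠ ⊥ → ρ ∉ G → HasVertex Q G ρ) :
    ∀ x, V x = 0 → w x = 0 → x = 0 := by
  classical
  intro x hVx hwx
  by_contra hx
  obtain ⟨l, hl⟩ : ∃ l : Module.Dual ℤ L, l x ≠ 0 := by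
    by_contra! h
    exact hx ((Module.forall_dual_apply_eq_zero_iff ℤ x).1 h)
  -- elements of `ker V` are differences of elements of the face `V = 0`
  have hker : ∀ x, V x = 0 → ∃ g ∈ Q, ∃ g' ∈ Q, V g = 0 ∧ V g' = 0 ∧ x = g - g' := by
    intro x hx
    obtain ⟨q, hq, q', hq', rfl⟩ := hgen x
    obtain ⟨g, hg, g', hg', e1, e2, e3⟩ := hN q hq
    obtain ⟨k, hk, k', hk', f1, f2, f3⟩ := hN q' hq'
    have : V q = V q' := by rw [map_sub] at hx; omega
    refine ⟨g' + k, Q.add_mem hg' hk, g + k', Q.add_mem hg hk', by simp [e2, f1],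
      by simp [e1, f2], ?_⟩
    rw [this] at e3
    have e4 : q = V q' • ρ + g' - g := by rw [← e3]; abel
    have f4 : q' = V q' • ρ + k' - k := by rw [← f3]; abel
    nth_rw 1 [e4]
    nth_rw 2 [f4]
    abel
  let t : Finset L := s.filter fun y => V y = 0 ∧ y ≠ 0
  have hsQ : ∀ y ∈ s, y ∈ Q := fun y hy => hs ▸ AddSubmonoid.subset_closure hy
  have ht : t.Nonempty := by
    by_contra h
    rw [Finset.not_nonempty_iff_eq_empty] at h
    -- otherwise the face `V = 0` is trivial
    have hz : ∀ q ∈ Q, V q = 0 → q = 0 := by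
      intro q hq
      rw [← hs] at hq
      induction hq using AddSubmonoid.closure_induction with
      | mem y hy =>
        intro h0
        by_contra h1
        have : y ∈ t := Finset.mem_filter.2 ⟨hy, h0, h1⟩
        rw [h] at this
        simp at this
      | zero => intro; rfl
      | add a b ha hb iha ihb =>
        intro h0
        rw [hs] at ha hb
        rw [map_add] at h0
        have h1 := hV a ha
        have h2 := hV b hb
        rw [iha (by omega), ihb (by omega), add_zero]
    obtain ⟨g, hg, g', hg', e1, e2, e3⟩ := hker x hVx
    rw [hz g hg e1, hz g' hg' e2, sub_zero] at e3
    exact hx e3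
  obtain ⟨y, hy, hmin⟩ := exists_min_ratio t ht l w (fun z hz => by
    rw [Finset.mem_filter] at hz
    exact hw z (hsQ z hz.1) hz.2.1 hz.2.2)
  have hy' := (Finset.mem_filter.1 hy).2
  have hyQ := hsQ y (Finset.mem_filter.1 hy).1
  have hwy : 0 < w y := hw y hyQ hy'.1 hy'.2
  -- `ψ` is nonnegative on the generators in the face `V = 0`; adding a multiple of `V` makes it
  -- nonnegative everywhere
  let ψ₀ : L →+ ℤ := (w y) • l.toAddMonoidHom - (l y) • w
  have hψ₀ : ∀ z, ψ₀ z = w y * l z - l y * w z := fun z => by simp [ψ₀]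
  let B : ℤ := ∑ z ∈ s, |ψ₀ z| + 1
  let ψ : L →+ ℤ := ψ₀ + B • V
  have hψ : ∀ z, ψ z = ψ₀ z + B * V z := fun z => by simp [ψ]
  have hB : ∀ z ∈ s, |ψ₀ z| < B := fun z hz => by
    have := Finset.single_le_sum (f := fun z => |ψ₀ z|) (fun i _ => abs_nonneg _) hz
    simp only [B]; omega
  have hpos : ∀ z ∈ s, 0 ≤ ψ z ∧ (V z ≠ 0 → 0 < ψ z) := by
    intro z hz
    rw [hψ]
    have h1 := hB z hz
    have h2 := abs_lt.1 h1
    have h3 := hV z (hsQ z hz)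
    by_cases h0 : V z = 0
    · refine ⟨?_, fun h => (h h0).elim⟩
      rw [h0, mul_zero, add_zero]
      by_cases hz0 : z = 0
      · rw [hz0, map_zero]
      · have := hmin z (Finset.mem_filter.2 ⟨hz, h0, hz0⟩)
        rw [hψ₀]
        nlinarith
    · have : 0 < ψ₀ z + B * V z := by
        have : 1 ≤ V z := by omega
        have : B * 1 ≤ B * V z := mul_le_mul_of_nonneg_left this (by omega)
        omega
      exact ⟨this.le, fun _ => this⟩
  have hposQ : ∀ z ∈ Q, 0 ≤ ψ z := nonneg_of_generators hs fun z hz => (hpos z hz).1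
  have hyface : y ∈ zeroFace Q ψ := ⟨hyQ, by rw [hψ, hψ₀, hy'.1]; ring⟩
  -- on `zeroFace Q ψ` the functional `V` vanishes
  have hVface : ∀ z ∈ Q, V z ≠ 0 → 0 < ψ z := by
    intro z hz
    rw [← hs] at hz
    induction hz using AddSubmonoid.closure_induction with
    | mem z hz => exact (hpos z hz).2
    | zero => simp
    | add a b ha hb iha ihb =>
      intro h0
      rw [hs] at ha hb
      rw [map_add] at h0 ⊢
      have := hposQ a ha
      have := hposQ b hb
      by_cases h1 : V a = 0
      · have := ihb (by omega); omega
      · have := iha h1; omega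
  have hvert := H (zeroFace Q ψ) (isFaceOf_zeroFace Q ψ hposQ)
    (fun h => hy'.2 (by rw [h] at hyface; exact hyface))
    (fun h => by
      have := hVface ρ h.1 (by omega)
      rw [h.2] at this; omega)
  have hV0 : ∀ z ∈ zeroFace Q ψ, V z = 0 := by
    intro z hz
    by_contra h
    have := hVface z hz.1 h
    rw [hz.2] at this; omega
  have key : ∀ q ∈ Q, V q = 0 → ψ₀ q = 0 := by
    intro q hq h0
    obtain ⟨n, g, hg, g', hg', e⟩ := hvert q hq
    have e1 := congrArg V e
    rw [map_add, map_add, map_nsmul, hV0 g hg, hV0 g' hg', h0, hVρ] at e1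
    have hn : n = 0 := by simpa using e1.symm
    subst hn
    have e2 := congrArg ψ e
    rw [map_add, map_add, hg.2, hg'.2, zero_smul, map_zero, hψ, h0] at e2
    simpa using e2
  obtain ⟨g, hg, g', hg', e1, e2, rfl⟩ := hker x hVx
  have h1 : ψ₀ (g - g') = 0 := by rw [map_sub, key g hg e1, key g' hg' e2, sub_zero]
  rw [hψ₀, hwx, mul_zero, sub_zero] at h1
  rcases mul_eq_zero.1 h1 with h | h
  · omega
  · exact hl h

/-- A sharp saturated toric monoid `Q` with a face whose quotient is `ℕ ρ`, such that every
nonzero face which does not contain `ρ` has this property, is `ℕ ρ`, or `ℕ²` with `ρ = (0, 1)`,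
or the monoid of all `(a, b)` with `b ≥ 0` and `e a + b ≥ 0`. -/
theorem classify_rank_two [Module.Finite ℤ L] [Module.IsTorsionFree ℤ L]
    (hs : AddSubmonoid.closure (s : Set L) = Q)
    (hgen : ∀ x, ∃ q ∈ Q, ∃ q' ∈ Q, x = q - q')
    (hsat : ∀ (n : ℕ) (x : L), n ≠ 0 → n • x ∈ Q → x ∈ Q)
    (hV : ∀ q ∈ Q, 0 ≤ V q) (hρ : ρ ∈ Q) (hVρ : V ρ = 1) (hwρ : w ρ = 0)
    (hN : ∀ q ∈ Q, ∃ g ∈ Q, ∃ g' ∈ Q, V g = 0 ∧ V g' = 0 ∧ q + g = V q • ρ + g')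
    (hw : ∀ q ∈ Q, V q = 0 → q ≠ 0 → 0 < w q)
    (H : ∀ G, IsFaceOf G Q → G ≠ ⊥ → ρ ∉ G → HasVertex Q G ρ) :
    (∀ q ∈ Q, V q = 0 → q = 0) ∨
    ∃ (a : L →+ ℤ) (d : ℤ), 0 < d ∧ (∀ x, w x = d * a x) ∧ (∀ x, V x = 0 → a x = 0 → x = 0) ∧
      a ρ = 0 ∧ (∃ g ∈ Q, a g = 1 ∧ V g = 0) ∧
      ((∀ x, x ∈ Q ↔ 0 ≤ a x ∧ 0 ≤ V x) ∨
        ∃ e : ℕ, 0 < e ∧ ∀ x, x ∈ Q ↔ 0 ≤ e * a x + V x ∧ 0 ≤ V x) := by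
  classical
  by_cases htriv : ∀ q ∈ Q, V q = 0 → q = 0
  · exact Or.inl htriv
  right
  push Not at htriv
  obtain ⟨q₀, hq₀, hVq₀, hq₀'⟩ := htriv
  have hinj := injective_of_faces hs hgen hV hVρ hN hw H
  obtain ⟨g, hVg, hwg, hdvd⟩ := exists_generator_on_ker V w
    ⟨q₀, hVq₀, (hw q₀ hq₀ hVq₀ hq₀').ne'⟩
  have hdvd' : ∀ x, w g ∣ w x := by
    intro x
    have := hdvd (x - V x • ρ) (by rw [map_sub, map_zsmul, hVρ]; simp)
    rwa [map_sub, map_zsmul, hwρ, smul_zero, sub_zero] at this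
  -- the coordinate dual to `g`; together with `V` it identifies `L` with `ℤ²`
  let a : L →+ ℤ :=
    { toFun := fun x => w x / w g
      map_zero' := by simp
      map_add' := fun x y => by rw [map_add, Int.add_ediv_of_dvd_left (hdvd' x)] }
  have ha : ∀ x, w x = w g * a x := fun x => (Int.mul_ediv_cancel' (hdvd' x)).symm
  have hag : a g = 1 := Int.ediv_self hwg.ne'
  have haρ : a ρ = 0 := by simp [a, hwρ]
  have hinj' : ∀ x, V x = 0 → a x = 0 → x = 0 := fun x h1 h2 =>
    hinj x h1 (by rw [ha, h2, mul_zero])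
  have hcoord : ∀ x, x = a x • g + V x • ρ := fun x => by
    refine sub_eq_zero.1 (hinj' _ ?_ ?_) <;> simp [hVg, hVρ, hag, haρ]
  -- `a q₀ • g = q₀` lies in the saturated monoid `Q`
  have hgQ : g ∈ Q := by
    have hk : 0 < a q₀ := by
      have := hw q₀ hq₀ hVq₀ hq₀'
      rw [ha] at this
      exact (mul_pos_iff_of_pos_left hwg).1 this
    refine hsat (a q₀).toNat g (by omega) ?_
    have : ((a q₀).toNat : ℤ) • g = q₀ := by
      rw [Int.toNat_of_nonneg hk.le]
      conv_rhs => rw [hcoord q₀, hVq₀, zero_smul, add_zero]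
    rw [← natCast_zsmul, this]
    exact hq₀
  have hpos : ∀ x, 0 ≤ a x → 0 ≤ V x → x ∈ Q := by
    intro x h1 h2
    rw [hcoord x]
    obtain ⟨m, hm⟩ := Int.eq_ofNat_of_zero_le h1
    obtain ⟨n, hn⟩ := Int.eq_ofNat_of_zero_le h2
    rw [hm, hn, natCast_zsmul, natCast_zsmul]
    exact Q.add_mem (Q.nsmul_mem hgQ _) (Q.nsmul_mem hρ _)
  refine ⟨a, w g, hwg, ha, hinj', haρ, ⟨g, hgQ, hag, hVg⟩, ?_⟩
  have hsQ : ∀ y ∈ s, y ∈ Q := fun y hy => hs ▸ AddSubmonoid.subset_closure hy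
  have hV0 : ∀ y ∈ Q, V y = 0 → 0 ≤ a y := by
    intro y hy h0
    by_cases hy0 : y = 0
    · simp [hy0]
    · have := hw y hy h0 hy0
      rw [ha] at this
      exact ((mul_pos_iff_of_pos_left hwg).1 this).le
  by_cases hall : ∀ y ∈ s, 0 ≤ a y
  · exact Or.inl fun x => ⟨fun hx => ⟨nonneg_of_generators hs hall x hx, hV x hx⟩,
      fun hx => hpos x hx.1 hx.2⟩
  right
  push Not at hall
  obtain ⟨y₀, hy₀, hay₀⟩ := hall
  have hVy₀ : V y₀ ≠ 0 := fun h => by have := hV0 y₀ (hsQ y₀ hy₀) h; omega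
  -- the generator of smallest slope spans the second extremal ray of `Q`
  obtain ⟨y, hy, hmin⟩ := exists_min_ratio (s.filter fun y => V y ≠ 0)
    ⟨y₀, Finset.mem_filter.2 ⟨hy₀, hVy₀⟩⟩ a V (fun z hz => by
      rw [Finset.mem_filter] at hz
      have := hV z (hsQ z hz.1)
      have := hz.2
      omega)
  have hyQ := hsQ y (Finset.mem_filter.1 hy).1
  have hVy : 0 < V y := by
    have := hV y hyQ
    have := (Finset.mem_filter.1 hy).2
    omega
  have hVy₀' : 0 < V y₀ := by
    have := hV y₀ (hsQ y₀ hy₀)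
    omega
  have hay : a y < 0 := by
    have := hmin y₀ (Finset.mem_filter.2 ⟨hy₀, hVy₀⟩)
    by_contra h
    push Not at h
    nlinarith
  -- the functional which defines the ray of `y`, a face to which `H` applies
  let ψ : L →+ ℤ := (V y) • a - (a y) • V
  have hψ : ∀ z, ψ z = V y * a z - a y * V z := fun z => by simp [ψ]
  have hψpos : ∀ z ∈ Q, 0 ≤ ψ z := nonneg_of_generators hs fun z hz => by
    rw [hψ]
    by_cases h0 : V z = 0
    · rw [h0, mul_zero, sub_zero]
      exact mul_nonneg hVy.le (hV0 z (hsQ z hz) h0)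
    · have := hmin z (Finset.mem_filter.2 ⟨hz, h0⟩)
      linarith [mul_comm (a z) (V y)]
  have hyface : y ∈ zeroFace Q ψ := ⟨hyQ, by rw [hψ]; ring⟩
  have hvert := H (zeroFace Q ψ) (isFaceOf_zeroFace Q ψ hψpos)
    (fun h => by
      rw [h] at hyface
      have : y = 0 := hyface
      rw [this, map_zero] at hVy
      omega)
    (fun h => by
      have := h.2
      rw [hψ, haρ, hVρ] at this
      omega)
  -- since this face has a vertex, `ψ g` is a multiple of `ψ ρ`, so the slope of the ray is integral
  obtain ⟨n, k, hk, k', hk', e⟩ := hvert g hgQ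
  have e1 := congrArg ψ e
  rw [map_add, map_add, hk.2, hk'.2, map_nsmul, hψ, hψ, hag, hVg, haρ, hVρ] at e1
  have e2 : V y = n * (-a y) := by
    rw [nsmul_eq_mul] at e1
    linarith
  have hn : 0 < n := by
    rcases Nat.eq_zero_or_pos n with h | h
    · rw [h] at e2; simp at e2; omega
    · exact h
  refine ⟨n, hn, fun x => ⟨fun hx => ⟨?_, hV x hx⟩, fun hx => ?_⟩⟩
  · have h1 := hψpos x hx
    rw [hψ, e2] at h1
    have h2 : 0 ≤ (-a y) * (n * a x + V x) := by linarith
    exact nonneg_of_mul_nonneg_right h2 (by omega)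
  · -- the second extremal ray is generated by `(-1, n)`
    let z : L := (n : ℤ) • ρ - g
    have haz : a z = -1 := by simp [z, haρ, hag]
    have hVz : V z = n := by simp [z, hVρ, hVg]
    have hz : z ∈ Q := by
      refine hsat (-a y).toNat z (by omega) ?_
      have : ((-a y).toNat : ℤ) • z = y := by
        rw [Int.toNat_of_nonneg (by omega)]
        refine sub_eq_zero.1 (hinj' _ ?_ ?_)
        · simp only [map_sub, map_zsmul, hVz, e2, smul_eq_mul]; ring
        · simp only [map_sub, map_zsmul, haz, smul_eq_mul]; ring
      rw [← natCast_zsmul, this]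
      exact hyQ
    rcases le_or_gt 0 (a x) with h0 | h0
    · exact hpos x h0 hx.2
    · have h1 : x = (-a x).toNat • z + (x - (-a x).toNat • z) := by abel
      rw [h1]
      have h2 : (((-a x).toNat : ℕ) : ℤ) = -a x := Int.toNat_of_nonneg (by omega)
      refine Q.add_mem (Q.nsmul_mem hz _) (hpos _ ?_ ?_)
      · rw [map_sub, map_nsmul, haz, nsmul_eq_mul]; push_cast [h2]; omega
      · rw [map_sub, map_nsmul, hVz, nsmul_eq_mul]; push_cast [h2]; nlinarith [hx.1]

end Combinatorics

/-! ### Faces of fine saturated monoids -/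

section Faces

variable {P : Type*} [CommMonoid P]

/-- A submonoid which contains the factors of its elements. -/
def IsFace (F : Submonoid P) : Prop := ∀ p q, p * q ∈ F → p ∈ F

/-- `P` becomes `ℕ ρ` modulo units after inverting the face `G`. -/
def IsVertexFace (G : Submonoid P) (ρ : P) : Prop :=
  ρ ∉ G ∧ ∀ p, ∃ n : ℕ, ∃ g ∈ G, ∃ g' ∈ G, p * g = ρ ^ n * g'

lemma IsVertexFace.unique {G : Submonoid P} {ρ : P}
    (hcan : ∀ a b c : P, a * c = b * c → a = b) (hG : IsFace G) (h : IsVertexFace G ρ)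
    {p g g' k k' : P} {n m : ℕ} (hg : g ∈ G) (hg' : g' ∈ G) (hk : k ∈ G) (hk' : k' ∈ G)
    (e : p * g = ρ ^ n * g') (f : p * k = ρ ^ m * k') : n = m ∧ g' * k = k' * g := by
  have key : ∀ {g g' k k' : P} {n m : ℕ}, g ∈ G → g' ∈ G → k ∈ G → k' ∈ G → n ≤ m →
      p * g = ρ ^ n * g' → p * k = ρ ^ m * k' → n = m ∧ g' * k = k' * g := by
    intro g g' k k' n m hg hg' hk hk' hnm e f
    obtain ⟨d, rfl⟩ := Nat.exists_eq_add_of_le hnm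
    have e1 : g' * k = ρ ^ d * (k' * g) := by
      refine hcan _ _ (ρ ^ n) ?_
      calc g' * k * ρ ^ n = ρ ^ n * g' * k := by rw [mul_comm, mul_assoc]
        _ = p * k * g := by rw [← e, mul_assoc, mul_assoc, mul_comm g k]
        _ = ρ ^ d * (k' * g) * ρ ^ n := by
          rw [f, pow_add, mul_comm _ (ρ ^ n), ← mul_assoc, ← mul_assoc]
    rcases Nat.eq_zero_or_pos d with rfl | hd
    · exact ⟨rfl, by simpa using e1⟩
    · exfalso
      obtain ⟨d', rfl⟩ := Nat.exists_eq_succ_of_ne_zero hd.ne'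
      have : ρ * (ρ ^ d' * (k' * g)) ∈ G := by
        rw [← mul_assoc, ← pow_succ', ← e1]
        exact G.mul_mem hg' hk
      exact h.1 (hG _ _ this)
  rcases le_total n m with hnm | hnm
  · exact key hg hg' hk hk' hnm e f
  · obtain ⟨h1, h2⟩ := key hk hk' hg hg' hnm f e
    exact ⟨h1.symm, h2.symm⟩

/-- The homomorphism `P → ℕ` of a face `G` with `P / G = ℕ ρ`. -/
lemma IsVertexFace.exists_hom {G : Submonoid P} {ρ : P}
    (hcan : ∀ a b c : P, a * c = b * c → a = b) (hG : IsFace G) (h : IsVertexFace G ρ) :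
    ∃ V : Additive P →+ ℕ, V (.ofMul ρ) = 1 ∧ (∀ p, V (.ofMul p) = 0 ↔ p ∈ G) ∧
      ∀ p, ∃ g ∈ G, ∃ g' ∈ G, p * g = ρ ^ V (.ofMul p) * g' := by
  choose n g hg g' hg' e using h.2
  let V : Additive P →+ ℕ :=
    { toFun := fun p => n p.toMul
      map_zero' := by
        refine (h.unique hcan hG (hg _) (hg' _) G.one_mem G.one_mem (m := 0) (e _) ?_).1
        simp
      map_add' := fun p q => by
        refine (h.unique hcan hG (hg _) (hg' _) (G.mul_mem (hg p.toMul) (hg q.toMul))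
          (G.mul_mem (hg' p.toMul) (hg' q.toMul)) (e _) ?_).1
        rw [toMul_add, mul_mul_mul_comm, e, e, pow_add, mul_mul_mul_comm] }
  refine ⟨V, ?_, fun p => ⟨fun h0 => ?_, fun h0 => ?_⟩, fun p => ⟨_, hg p, _, hg' p, e p⟩⟩
  · refine (h.unique hcan hG (hg _) (hg' _) G.one_mem G.one_mem (m := 1) (e _) ?_).1
    simp
  · have := e p
    rw [show n p = 0 from h0, pow_zero, one_mul] at this
    exact hG p (g p) (this ▸ hg' p)
  · refine (h.unique hcan hG (hg p) (hg' p) G.one_mem h0 (m := 0) (e p) ?_).1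
    simp

/-- A homomorphism from a face `G` with `P / G = ℕ ρ` to a group extends to `P`, with `ρ ↦ 1`. -/
lemma IsVertexFace.exists_extension {G : Submonoid P} {ρ : P}
    (hcan : ∀ a b c : P, a * c = b * c → a = b) (hG : IsFace G) (h : IsVertexFace G ρ)
    {H : Type*} [AddCommGroup H] (χ : P → H) (hχ1 : χ 1 = 0)
    (hχ : ∀ g ∈ G, ∀ g' ∈ G, χ (g * g') = χ g + χ g') :
    ∃ w : Additive P →+ H, w (.ofMul ρ) = 0 ∧ (∀ g ∈ G, w (.ofMul g) = χ g) ∧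
      ∀ p, ∀ g ∈ G, ∀ g' ∈ G, ∀ n : ℕ, p * g = ρ ^ n * g' → w (.ofMul p) = χ g' - χ g := by
  choose n g hg g' hg' e using h.2
  have key : ∀ p, ∀ k ∈ G, ∀ k' ∈ G, ∀ m : ℕ, p * k = ρ ^ m * k' →
      χ (g' p) - χ (g p) = χ k' - χ k := by
    intro p k hk k' hk' m f
    have h1 := (h.unique hcan hG (hg p) (hg' p) hk hk' (e p) f).2
    have h2 := congrArg χ h1
    rw [hχ _ (hg' p) _ hk, hχ _ hk' _ (hg p)] at h2
    rw [sub_eq_sub_iff_add_eq_add, h2]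
  let w : Additive P →+ H :=
    { toFun := fun p => χ (g' p.toMul) - χ (g p.toMul)
      map_zero' := by
        rw [key _ 1 G.one_mem 1 G.one_mem 0 (by simp), sub_self]
      map_add' := fun p q => by
        rw [key (p + q).toMul (g p.toMul * g q.toMul) (G.mul_mem (hg _) (hg _))
          (g' p.toMul * g' q.toMul) (G.mul_mem (hg' _) (hg' _)) (n p.toMul + n q.toMul)
          (by rw [toMul_add, mul_mul_mul_comm, e, e, pow_add, mul_mul_mul_comm]),
          hχ _ (hg _) _ (hg _), hχ _ (hg' _) _ (hg' _)]
        abel }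
  refine ⟨w, ?_, fun k hk => ?_, fun p k hk k' hk' m f => key p k hk k' hk' m f⟩
  · refine (key _ 1 G.one_mem 1 G.one_mem 1 (by simp)).trans (sub_self _)
  · refine (key k 1 G.one_mem k hk 0 (by simp)).trans ?_
    rw [hχ1, sub_zero]

/-- The group of all quotients of elements of `F`. -/
def fractionSubgroup (F : Submonoid P) : Subgroup (Algebra.GrothendieckGroup P) where
  carrier := {x | ∃ f ∈ F, ∃ f' ∈ F,
    x = Algebra.GrothendieckGroup.of f / Algebra.GrothendieckGroup.of f'}
  one_mem' := ⟨1, F.one_mem, 1, F.one_mem, by simp⟩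
  mul_mem' := by
    rintro _ _ ⟨a, ha, b, hb, rfl⟩ ⟨c, hc, d, hd, rfl⟩
    exact ⟨a * c, F.mul_mem ha hc, b * d, F.mul_mem hb hd, by
      rw [map_mul, map_mul, div_mul_div_comm]⟩
  inv_mem' := by
    rintro _ ⟨a, ha, b, hb, rfl⟩
    exact ⟨b, hb, a, ha, inv_div _ _⟩

/-- `(P / F)ᵍᵖ`. -/
abbrev QuotGp (F : Submonoid P) : Type _ :=
  Additive (Algebra.GrothendieckGroup P ⧸ fractionSubgroup F)

/-- The canonical map `P → (P / F)ᵍᵖ`. -/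
def toQuotGp (F : Submonoid P) : Additive P →+ QuotGp F :=
  MonoidHom.toAdditive ((QuotientGroup.mk' (fractionSubgroup F)).comp Algebra.GrothendieckGroup.of)

lemma toQuotGp_eq_iff (hcan : ∀ a b c : P, a * c = b * c → a = b) {F : Submonoid P} (p p' : P) :
    toQuotGp F (.ofMul p) = toQuotGp F (.ofMul p') ↔ ∃ f ∈ F, ∃ f' ∈ F, p * f = p' * f' := by
  have : IsCancelMul P :=
    { mul_right_cancel := fun c a b h => hcan a b c h
      mul_left_cancel := fun c a b h => hcan a b c (by simpa [mul_comm] using h) }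
  have hinj := Algebra.GrothendieckGroup.of_injective (M := P)
  have h1 : toQuotGp F (.ofMul p) = toQuotGp F (.ofMul p') ↔
      (Algebra.GrothendieckGroup.of p : Algebra.GrothendieckGroup P ⧸ fractionSubgroup F) =
        (Algebra.GrothendieckGroup.of p' : Algebra.GrothendieckGroup P ⧸ fractionSubgroup F) :=
    Iff.rfl
  rw [h1, QuotientGroup.eq]
  constructor
  · rintro ⟨f, hf, f', hf', e⟩
    refine ⟨f, hf, f', hf', hinj ?_⟩
    rw [map_mul, map_mul]
    rw [inv_mul_eq_iff_eq_mul] at e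
    rw [e, ← mul_div_assoc, div_mul_cancel]
  · rintro ⟨f, hf, f', hf', e⟩
    refine ⟨f, hf, f', hf', ?_⟩
    rw [inv_mul_eq_iff_eq_mul, ← mul_div_assoc, eq_div_iff_mul_eq', ← map_mul, ← map_mul,
      ← e]

lemma exists_eq_sub_toQuotGp {F : Submonoid P} (x : QuotGp F) :
    ∃ p p' : P, x = toQuotGp F (.ofMul p) - toQuotGp F (.ofMul p') := by
  obtain ⟨y, rfl⟩ := QuotientGroup.mk_surjective (s := fractionSubgroup F) x.toMul
  induction y using Localization.induction_on with
  | H y =>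
    refine ⟨y.1, y.2, ?_⟩
    have : (Localization.mk y.1 y.2 : Algebra.GrothendieckGroup P) =
        Algebra.GrothendieckGroup.of y.1 / Algebra.GrothendieckGroup.of y.2.1 := by
      rw [eq_div_iff_mul_eq', Localization.mk_eq_monoidOf_mk']
      exact (Localization.monoidOf (⊤ : Submonoid P)).mk'_spec y.1 y.2
    rw [this]
    rfl

lemma exists_descend {F : Submonoid P} (w : Additive P →+ ℤ) (hw : ∀ f ∈ F, w (.ofMul f) = 0) :
    ∃ w' : QuotGp F →+ ℤ, ∀ p, w' (toQuotGp F p) = w p := by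
  let w₁ : Algebra.GrothendieckGroup P →* Multiplicative ℤ :=
    Algebra.GrothendieckGroup.lift (AddMonoidHom.toMultiplicativeRight w)
  have h1 : ∀ p, w₁ (Algebra.GrothendieckGroup.of p) = Multiplicative.ofAdd (w (.ofMul p)) :=
    fun p => DFunLike.congr_fun (Algebra.GrothendieckGroup.lift.symm_apply_apply
      (AddMonoidHom.toMultiplicativeRight w)) p
  let w₂ : Algebra.GrothendieckGroup P ⧸ fractionSubgroup F →* Multiplicative ℤ :=
    QuotientGroup.lift _ w₁ (by
      rintro _ ⟨f, hf, f', hf', rfl⟩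
      rw [MonoidHom.mem_ker, map_div, h1, h1, hw f hf, hw f' hf', div_self'])
  exact ⟨MonoidHom.toAdditiveLeft w₂, fun p => congrArg Multiplicative.toAdd (h1 p.toMul)⟩

/-- Classification of the quotient of a fine saturated monoid by a face: it is `ℕ ρ`, or `ℕ²` or the
monoid of all `(x, y)` with `y ≥ 0` and `e x + y ≥ 0`, where `ρ` corresponds to `(0, 1)` and the
coordinates are `a` and `V`. -/
theorem classify_face_quotient (hP : IsFineSaturated P) {F : Submonoid P} (hF : IsFace F) {ρ : P}
    {V : Additive P →+ ℕ} {w : Additive P →+ ℤ}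
    (hVρ : V (.ofMul ρ) = 1) (hwρ : w (.ofMul ρ) = 0)
    (hVN : ∀ p, ∃ g g', V (.ofMul g) = 0 ∧ V (.ofMul g') = 0 ∧ p * g = ρ ^ V (.ofMul p) * g')
    (hVF : ∀ f ∈ F, V (.ofMul f) = 0) (hwF : ∀ f ∈ F, w (.ofMul f) = 0)
    (hw : ∀ p, V (.ofMul p) = 0 → p ∉ F → 0 < w (.ofMul p))
    (H : ∀ G : Submonoid P, IsFace G → F < G → ρ ∉ G → IsVertexFace G ρ) :
    (∀ p, V (.ofMul p) = 0 → p ∈ F) ∨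
    ∃ (a : Additive P →+ ℤ) (d : ℤ), 0 < d ∧ (∀ p, w p = d * a p) ∧ a (.ofMul ρ) = 0 ∧
      (∀ p p', V (.ofMul p) = V (.ofMul p') → a (.ofMul p) = a (.ofMul p') →
        ∃ f ∈ F, ∃ f' ∈ F, p * f = p' * f') ∧
      (∃ g, a (.ofMul g) = 1 ∧ V (.ofMul g) = 0) ∧
      ((∀ x y : ℤ, (∃ p, a (.ofMul p) = x ∧ (V (.ofMul p) : ℤ) = y) ↔ 0 ≤ x ∧ 0 ≤ y) ∨
        ∃ e : ℕ, 0 < e ∧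
          ∀ x y : ℤ, (∃ p, a (.ofMul p) = x ∧ (V (.ofMul p) : ℤ) = y) ↔ 0 ≤ e * x + y ∧ 0 ≤ y) := by
  classical
  have hcan := hP.integral
  let π := toQuotGp F
  let Q : AddSubmonoid (QuotGp F) := AddMonoidHom.mrange π
  have hπ : ∀ p p', π (.ofMul p) = π (.ofMul p') ↔ ∃ f ∈ F, ∃ f' ∈ F, p * f = p' * f' :=
    toQuotGp_eq_iff hcan
  have hπF : ∀ p, π (.ofMul p) = 0 ↔ p ∈ F := by
    intro p
    have : (0 : QuotGp F) = π (.ofMul 1) := (map_zero π).symm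
    rw [this, hπ]
    exact ⟨fun ⟨f, hf, f', hf', e⟩ => hF p f (by rw [e, one_mul]; exact hf'),
      fun hp => ⟨1, F.one_mem, p, hp, by simp⟩⟩
  have hmem : ∀ p, π (.ofMul p) ∈ Q := fun p => ⟨_, rfl⟩
  -- `V` and `w` vanish on `F`, hence they are functionals on `(P / F)ᵍᵖ`
  obtain ⟨V', hV'⟩ := exists_descend (F := F) ((Nat.castAddMonoidHom ℤ).comp V)
    (fun f hf => by simp [hVF f hf])
  obtain ⟨w', hw'⟩ := exists_descend (F := F) w hwF
  replace hV' : ∀ p, V' (π p) = V p := hV'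
  replace hw' : ∀ p, w' (π p) = w p := hw'
  have hfg : Module.Finite ℤ (QuotGp F) := by
    have := hP.fg
    have : Group.FG (Algebra.GrothendieckGroup P) := Group.fg_iff_monoid_fg.2 inferInstance
    infer_instance
  have hsat : ∀ (n : ℕ) (x : QuotGp F), n ≠ 0 → n • x ∈ Q → x ∈ Q := by
    rintro n x hn ⟨q, hq⟩
    obtain ⟨p, p', rfl⟩ := exists_eq_sub_toQuotGp x
    have h1 : π (.ofMul (p ^ n)) = π (.ofMul (p' ^ n * q.toMul)) := by
      rw [ofMul_mul, ofMul_pow, ofMul_pow, map_add, map_nsmul, map_nsmul]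
      have : π (Additive.ofMul q.toMul) = n • (π (.ofMul p) - π (.ofMul p')) := hq
      rw [this, smul_sub]
      abel
    obtain ⟨f, hf, f', hf', e⟩ := (hπ _ _).1 h1
    obtain ⟨d, hd⟩ := hP.saturated n (p * f) p' (q.toMul * f' * f ^ (n - 1)) hn (by
      obtain ⟨k, rfl⟩ := Nat.exists_eq_succ_of_ne_zero hn
      rw [mul_pow, pow_succ f, Nat.succ_sub_one]
      calc p ^ (k + 1) * (f ^ k * f) = p ^ (k + 1) * f * f ^ k := by
            rw [mul_comm (f ^ k), mul_assoc]
        _ = _ := by rw [show p ^ (k + 1) * f = p' ^ (k + 1) * q.toMul * f' from e]; simp only [mul_assoc])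
    refine ⟨.ofMul d, ?_⟩
    have h2 : π (.ofMul (p * f)) = π (.ofMul (p' * d)) := by rw [hd]
    rw [ofMul_mul, ofMul_mul, map_add, map_add, (hπF f).2 hf, add_zero] at h2
    change π (.ofMul d) = π (.ofMul p) - π (.ofMul p')
    rw [h2]
    abel
  have hsharp : ∀ x ∈ Q, -x ∈ Q → x = 0 := by
    rintro _ ⟨p, rfl⟩ ⟨p', hp'⟩
    have : π (.ofMul (p.toMul * p'.toMul)) = 0 := by
      change π (p + p') = 0
      rw [map_add, hp']
      abel
    rw [hπF] at this
    exact (hπF p.toMul).2 (hF _ _ this)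
  -- torsion elements and their negatives lie in the sharp saturated monoid `Q`
  have htf : Module.IsTorsionFree ℤ (QuotGp F) := by
    rw [Module.isTorsionFree_int_iff_isAddTorsionFree,
      isAddTorsionFree_iff_not_isOfFinAddOrder]
    intro x hx hfin
    obtain ⟨n, hn, hnx⟩ := isOfFinAddOrder_iff_nsmul_eq_zero.1 hfin
    exact hx (hsharp x (hsat n x hn.ne' (hnx ▸ Q.zero_mem))
      (hsat n (-x) hn.ne' (by rw [smul_neg, hnx, neg_zero]; exact Q.zero_mem)))
  obtain ⟨S, hS⟩ := hP.fg.fg_top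
  have hs : AddSubmonoid.closure ((S.image fun p => π (.ofMul p) : Finset _) : Set (QuotGp F)) =
      Q := by
    apply le_antisymm
    · rw [AddSubmonoid.closure_le]
      intro x hx
      obtain ⟨p, -, rfl⟩ := Finset.mem_image.1 (Finset.mem_coe.1 hx)
      exact hmem p
    · rintro _ ⟨p, rfl⟩
      obtain ⟨p, rfl⟩ := Additive.ofMul.surjective p
      have : p ∈ Submonoid.closure (S : Set P) := hS ▸ Submonoid.mem_top _
      induction this using Submonoid.closure_induction with
      | mem x hx =>
        exact AddSubmonoid.subset_closure (Finset.mem_coe.2 (Finset.mem_image_of_mem _ hx))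
      | one => exact (map_zero π) ▸ AddSubmonoid.zero_mem _
      | mul x y _ _ hx hy => rw [ofMul_mul, map_add]; exact AddSubmonoid.add_mem _ hx hy
  -- faces of `Q` correspond to faces of `P` which contain `F`
  have key := classify_rank_two (Q := Q) (V := V') (w := w') (ρ := π (.ofMul ρ)) hs
    (fun x => by
      obtain ⟨p, p', h⟩ := exists_eq_sub_toQuotGp x
      exact ⟨_, hmem p, _, hmem p', h⟩)
    hsat
    (by rintro _ ⟨p, rfl⟩; rw [hV']; positivity)
    (hmem ρ) (by rw [hV', hVρ]; rfl) (by rw [hw', hwρ])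
    (by
      rintro _ ⟨p, rfl⟩
      obtain ⟨g, g', h1, h2, h3⟩ := hVN p.toMul
      refine ⟨_, hmem g, _, hmem g', by rw [hV', h1]; rfl, by rw [hV', h2]; rfl, ?_⟩
      have := congrArg (fun q => π (.ofMul q)) h3
      simp only [ofMul_mul, map_add, ofMul_pow, map_nsmul] at this
      rw [hV', natCast_zsmul]
      exact this)
    (by
      rintro _ ⟨p, rfl⟩ h0 h1
      rw [hV'] at h0
      rw [hw']
      exact hw p.toMul (by exact_mod_cast h0) (fun h => h1 ((hπF p.toMul).2 h)))
    (by
      intro G hG hne hρG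
      let G' : Submonoid P :=
        { carrier := {p | π (.ofMul p) ∈ G}
          one_mem' := by
            change π 0 ∈ G
            rw [map_zero]
            exact G.zero_mem
          mul_mem' := fun {a b} ha hb => by
            change π (.ofMul a + .ofMul b) ∈ G
            rw [map_add]
            exact G.add_mem ha hb }
      have hface : IsFace G' := fun p q hpq => by
        refine hG.mem_of_add_mem _ (hmem p) _ (hmem q) ?_
        rw [← map_add]
        exact hpq
      have hlt : F < G' := by
        refine lt_of_le_of_ne (fun f hf => ?_) ?_
        · change π (.ofMul f) ∈ G
          rw [(hπF f).2 hf]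
          exact G.zero_mem
        · intro he
          apply hne
          rw [eq_bot_iff]
          intro x hx
          obtain ⟨p, rfl⟩ := hG.le hx
          have : p.toMul ∈ F := he ▸ (show π (.ofMul p.toMul) ∈ G from hx)
          exact (hπF p.toMul).2 this
      have hvert := H G' hface hlt hρG
      rintro _ ⟨p, rfl⟩
      obtain ⟨n, g, hg, g', hg', e⟩ := hvert.2 p.toMul
      refine ⟨n, _, hg, _, hg', ?_⟩
      have := congrArg (fun q => π (.ofMul q)) e
      simp only [ofMul_mul, map_add, ofMul_pow, map_nsmul] at this
      exact this)
  rcases key with key | ⟨a, d, hd, hwa, hinj, haρ, ⟨g, ⟨g', rfl⟩, hag, hVg⟩, hQ⟩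
  · left
    intro p hp
    exact (hπF p).1 (key _ (hmem p) (by rw [hV', hp]; rfl))
  · right
    have hpair : ∀ x y : ℤ, (∃ p, a (π (.ofMul p)) = x ∧ (V (.ofMul p) : ℤ) = y) ↔
        ∃ z ∈ Q, a z = x ∧ V' z = y := by
      intro x y
      constructor
      · rintro ⟨p, h1, h2⟩
        exact ⟨_, hmem p, h1, by rw [hV', h2]⟩
      · rintro ⟨_, ⟨p, rfl⟩, h1, h2⟩
        exact ⟨p.toMul, h1, by rw [← h2, hV']; rfl⟩
    -- every pair of integers is the pair of coordinates of an element of `(P / F)ᵍᵖ`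
    have hsurj : ∀ x y : ℤ, ∃ z, a z = x ∧ V' z = y := fun x y =>
      ⟨x • π g' + y • π (.ofMul ρ), by simp [hag, haρ], by simp [hVg, hV', hVρ]⟩
    refine ⟨a.comp π, d, hd, fun p => by rw [← hw', hwa]; rfl, haρ, fun p p' h1 h2 => ?_,
      ⟨g'.toMul, hag, by exact_mod_cast (hV' g').symm.trans hVg⟩, ?_⟩
    · rw [← hπ, ← sub_eq_zero]
      refine hinj _ ?_ ?_
      · rw [map_sub, hV', hV', h1, sub_self]
      · rw [map_sub, sub_eq_zero]
        exact h2
    · rcases hQ with hQ | ⟨e, he, hQ⟩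
      · left
        intro x y
        refine (hpair x y).trans ⟨?_, fun h => ?_⟩
        · rintro ⟨z, hz, rfl, rfl⟩
          exact (hQ z).1 hz
        · obtain ⟨z, rfl, rfl⟩ := hsurj x y
          exact ⟨z, (hQ z).2 h, rfl, rfl⟩
      · right
        refine ⟨e, he, fun x y => (hpair x y).trans ⟨?_, fun h => ?_⟩⟩
        · rintro ⟨z, hz, rfl, rfl⟩
          exact (hQ z).1 hz
        · obtain ⟨z, rfl, rfl⟩ := hsurj x y
          exact ⟨z, (hQ z).2 h, rfl, rfl⟩

end Faces

/-! ### Formal smoothness in characteristic zero -/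

section FormalSmoothness

open scoped TensorProduct KaehlerDifferential Polynomial

/-- The additive group of an ideal of square zero, embedded into the units by `i ↦ 1 + i`. -/
def onePlus {B : Type*} [CommRing B] (I : Ideal B) (hI : I ^ 2 = ⊥) : I →+ Additive Bˣ where
  toFun i := .ofMul ⟨1 + i, 1 - i, by
      have : (i : B) * i = 0 := by
        have := Ideal.pow_mem_pow i.2 2
        rwa [hI, Ideal.mem_bot, pow_two] at this
      linear_combination -this, by
      have : (i : B) * i = 0 := by
        have := Ideal.pow_mem_pow i.2 2
        rwa [hI, Ideal.mem_bot, pow_two] at this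
      linear_combination -this⟩
  map_zero' := by
    apply Additive.toMul.injective
    ext
    simp
  map_add' i j := by
    have : (i : B) * j = 0 := by
      have := Ideal.mul_mem_mul i.2 j.2
      rwa [← pow_two, hI, Ideal.mem_bot] at this
    apply Additive.toMul.injective
    ext
    change 1 + ((i : B) + j) = (1 + i) * (1 + j)
    linear_combination -this

/-- In characteristic zero the group of units of a ring is the product of the group of units modulo
an ideal of square zero and of the divisible, hence injective, group `1 + I`. -/
lemma exists_section_units (κ : Type*) [Field κ] [CharZero κ] {B : Type u} [CommRing B]
    [Algebra κ B] (I : Ideal B) (hI : I ^ 2 = ⊥) :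
    ∃ s : (B ⧸ I)ˣ →* Bˣ, ∀ x, Ideal.Quotient.mk I (s x) = x := by
  let : DivisibleBy I ℤ :=
    { div := fun i n => (n : κ)⁻¹ • i
      div_zero := fun i => by simp
      div_cancel := fun {n} i hn => by
        have : (n : κ) ≠ 0 := by exact_mod_cast hn
        rw [← Int.cast_smul_eq_zsmul κ, smul_smul, mul_inv_cancel₀ this, one_smul] }
  have hinj := AddCommGrpCat.injective_of_divisible I
  let e := onePlus I hI
  have he : Function.Injective e := by
    intro i j h
    have := congrArg (fun x => ((Additive.toMul x : Bˣ) : B)) h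
    exact Subtype.ext (add_left_cancel this)
  have hmono : Mono (AddCommGrpCat.ofHom e) := (AddCommGrpCat.mono_iff_injective _).2 he
  let r' := Injective.factorThru (𝟙 (AddCommGrpCat.of I)) (AddCommGrpCat.ofHom e)
  have hr' : AddCommGrpCat.ofHom e ≫ r' = 𝟙 _ := Injective.comp_factorThru _ _
  let r : Additive Bˣ →+ I := r'.hom
  have hr : ∀ i, r (e i) = i := fun i =>
    DFunLike.congr_fun (congrArg AddCommGrpCat.Hom.hom hr') i
  let φ : Bˣ →* Bˣ := AddMonoidHom.toMultiplicative (AddMonoidHom.id (Additive Bˣ) - e.comp r)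
  have hφ : ∀ x, φ x = x / Additive.toMul (e (r (.ofMul x))) := fun x => rfl
  let π : Bˣ →* (B ⧸ I)ˣ := Units.map (Ideal.Quotient.mk I : B →* B ⧸ I)
  have hπe : ∀ i, π (Additive.toMul (e i)) = 1 := by
    intro i
    ext
    change Ideal.Quotient.mk I (1 + i) = 1
    rw [map_add, map_one, Ideal.Quotient.eq_zero_iff_mem.2 i.2, add_zero]
  have hker : ∀ x, π x = 1 → φ x = 1 := by
    intro x hx
    have h1 : Ideal.Quotient.mk I ((x : B) - 1) = 0 := by
      rw [map_sub, map_one, sub_eq_zero]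
      exact congrArg Units.val hx
    let i : I := ⟨x - 1, Ideal.Quotient.eq_zero_iff_mem.1 h1⟩
    have h2 : Additive.ofMul x = e i := by
      apply Additive.toMul.injective
      ext
      change (x : B) = 1 + (x - 1)
      ring
    rw [hφ, h2, hr, ← h2]
    exact div_self' _
  have hsurj : Function.Surjective π := by
    intro y
    obtain ⟨a, ha⟩ := Ideal.Quotient.mk_surjective (y : B ⧸ I)
    obtain ⟨b, hb⟩ := Ideal.Quotient.mk_surjective ((y⁻¹ : (B ⧸ I)ˣ) : B ⧸ I)
    have hu : IsUnit a := by
      have : Ideal.Quotient.mk I (a * b - 1) = 0 := by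
        rw [map_sub, map_mul, ha, hb, map_one, Units.mul_inv, sub_self]
      have h2 := Ideal.pow_mem_pow (Ideal.Quotient.eq_zero_iff_mem.1 this) 2
      rw [hI, Ideal.mem_bot] at h2
      exact IsUnit.of_mul_eq_one (b * (2 - a * b)) (by linear_combination -h2)
    exact ⟨hu.unit, Units.ext ha⟩
  have hφeq : ∀ x y, π x = π y → φ x = φ y := by
    intro x y h
    have := hker (x / y) (by rw [map_div, h, div_self'])
    rwa [map_div, div_eq_one] at this
  have hπφ : ∀ x, π (φ x) = π x := by
    intro x
    rw [hφ, map_div, hπe, div_one]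
  refine ⟨MonoidHom.mk' (fun y => φ (Function.surjInv hsurj y)) fun y z => ?_, fun y => ?_⟩
  · rw [← map_mul]
    apply hφeq
    rw [map_mul, Function.surjInv_eq hsurj, Function.surjInv_eq hsurj, Function.surjInv_eq hsurj]
  · have := congrArg Units.val (hπφ (Function.surjInv hsurj y))
    rw [Function.surjInv_eq hsurj] at this
    exact this

/-- An algebra which is formally smooth over the monoid algebra of `F × ℕ` or of `F`, where the
elements of `F` become invertible, is formally smooth: the choice of a section of `Bˣ → (B/I)ˣ`
allows to lift homomorphisms. The monoid `G` is given up to elements of `F`. -/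
lemma formallySmooth_of_monoidAlgebra {κ : Type u} [Field κ] [CharZero κ] {G : Type u}
    [CommMonoid G] (hcan : ∀ a b c : G, a * c = b * c → a = b) (F : Submonoid G)
    (a : Additive G →+ ℕ) (g : G)
    (ha : ∀ p, ∃ f ∈ F, ∃ f' ∈ F, p * f = g ^ a (.ofMul p) * f')
    {T : Type u} [CommRing T] [Algebra κ T] [Algebra (MonoidAlgebra κ G) T]
    [IsScalarTower κ (MonoidAlgebra κ G) T] [Algebra.FormallySmooth (MonoidAlgebra κ G) T]
    (hF : ∀ f ∈ F, IsUnit (algebraMap (MonoidAlgebra κ G) T (MonoidAlgebra.of κ G f))) :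
    Algebra.FormallySmooth κ T := by
  refine Algebra.FormallySmooth.of_comp_surjective fun B _ _ I hI φ => ?_
  obtain ⟨s, hs⟩ := exists_section_units κ I hI
  let ψ : G →* T := (algebraMap (MonoidAlgebra κ G) T : MonoidAlgebra κ G →* T).comp
    (MonoidAlgebra.of κ G)
  let v : F →* (B ⧸ I)ˣ := (Units.map (φ : T →* B ⧸ I)).comp
    { toFun := fun f => (hF f f.2).unit
      map_one' := Units.ext (map_one ψ)
      map_mul' := fun x y => Units.ext (map_mul ψ (x : G) y) }
  have hv : ∀ f, (v f : B ⧸ I) = φ (ψ f) := fun f => rfl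
  choose n hn d hd hnd using ha
  -- the part of an element of `G` in the units; it is multiplicative by cancellation, and it lifts by `s`
  let r : G →* (B ⧸ I)ˣ :=
    { toFun := fun p => v ⟨d p, hd p⟩ / v ⟨n p, hn p⟩
      map_one' := by
        have h := hnd 1
        have e : n 1 = d 1 := by simpa using h
        rw [div_eq_one]
        congr 1
        exact Subtype.ext e.symm
      map_mul' := fun p q => by
        rw [div_mul_div_comm, div_eq_div_iff_mul_eq_mul]
        simp only [← map_mul]
        congr 1
        apply Subtype.ext
        change d (p * q) * (n p * n q) = d p * d q * n (p * q)
        have h1 := hnd p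
        have h2 := hnd q
        have h3 := hnd (p * q)
        rw [ofMul_mul, map_add, pow_add] at h3
        apply hcan _ _ (g ^ a (.ofMul p) * g ^ a (.ofMul q))
        calc d (p * q) * (n p * n q) * (g ^ a (.ofMul p) * g ^ a (.ofMul q))
            = (g ^ a (.ofMul p) * g ^ a (.ofMul q) * d (p * q)) * (n p * n q) := by
              simp only [mul_comm, mul_left_comm, mul_assoc]
          _ = (p * n p) * (q * n q) * n (p * q) := by
              rw [← h3]; simp only [mul_comm, mul_left_comm, mul_assoc]
          _ = _ := by
              rw [h1, h2]; simp only [mul_comm, mul_left_comm, mul_assoc] }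
  obtain ⟨b, hb⟩ := Ideal.Quotient.mk_surjective (I := I) (φ (ψ g))
  -- a lift of the monomials: the powers of `g` can be lifted arbitrarily
  let θ : G →* B :=
    { toFun := fun p => s (r p) * b ^ a (.ofMul p)
      map_one' := by simp
      map_mul' := fun p q => by
        rw [map_mul, map_mul, Units.val_mul, ofMul_mul, map_add, pow_add]
        ring }
  have hθ : ∀ p, Ideal.Quotient.mk I (θ p) = φ (ψ p) := by
    intro p
    change Ideal.Quotient.mk I (s (r p) * b ^ a (.ofMul p)) = _
    rw [map_mul, map_pow, hb, hs]
    have h1 : (r p : B ⧸ I) * v ⟨n p, hn p⟩ = v ⟨d p, hd p⟩ := by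
      rw [← Units.val_mul]
      congr 1
      exact div_mul_cancel _ _
    rw [hv, hv] at h1
    have h2 : IsUnit (φ (ψ (n p))) := (v ⟨n p, hn p⟩).isUnit
    apply h2.mul_left_injective
    have h3 := congrArg (fun x => φ (ψ x)) (hnd p)
    simp only [map_mul, map_pow] at h3
    dsimp only at h1 ⊢
    rw [h3, mul_right_comm, h1, mul_comm]
  let Θ : MonoidAlgebra κ G →ₐ[κ] B := MonoidAlgebra.lift κ B G θ
  let : Algebra (MonoidAlgebra κ G) B := Θ.toRingHom.toAlgebra
  have : IsScalarTower κ (MonoidAlgebra κ G) B :=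
    .of_algebraMap_eq fun x => (Θ.commutes x).symm
  have hcomp : (Ideal.Quotient.mkₐ κ I).comp Θ =
      φ.comp (IsScalarTower.toAlgHom κ (MonoidAlgebra κ G) T) := by
    refine MonoidAlgebra.algHom_ext (fun p => ?_) (by ext)
    change Ideal.Quotient.mk I (Θ (MonoidAlgebra.single p 1)) = φ (ψ p)
    rw [← hθ]
    congr 1
    simp [Θ]
  let φ' : T →ₐ[MonoidAlgebra κ G] B ⧸ I :=
    { φ with commutes' := fun x => (DFunLike.congr_fun hcomp x).symm }
  obtain ⟨f, hf⟩ := Algebra.FormallySmooth.comp_surjective (MonoidAlgebra κ G) T I hI φ'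
  refine ⟨f.restrictScalars κ, ?_⟩
  ext x
  exact DFunLike.congr_fun hf x

/-- On a formally smooth local algebra over a field of characteristic zero there is a derivation
which maps a given element of `𝔪 ∖ 𝔪²` to a unit. -/
lemma exists_derivation_isUnit {κ B : Type u} [Field κ] [CharZero κ] [CommRing B] [IsLocalRing B]
    [Algebra κ B] [Algebra.FormallySmooth κ B] [Algebra.EssFiniteType κ B]
    (x : B) (hx : x ∈ IsLocalRing.maximalIdeal B) (hx2 : x ∉ IsLocalRing.maximalIdeal B ^ 2) :
    ∃ D : Derivation κ B B, IsUnit (D x) := by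
  have hsur : Function.Surjective (algebraMap B (IsLocalRing.ResidueField B)) :=
    IsLocalRing.residue_surjective
  have hker : RingHom.ker (algebraMap B (IsLocalRing.ResidueField B)) =
      IsLocalRing.maximalIdeal B := by
    rw [IsLocalRing.ResidueField.algebraMap_eq, IsLocalRing.ker_residue]
  have hft : Algebra.FiniteType B (IsLocalRing.ResidueField B) :=
    .of_surjective (Algebra.ofId B _) hsur
  have hess : Algebra.EssFiniteType κ (IsLocalRing.ResidueField B) := .comp κ B _
  have hsm : Algebra.FormallySmooth κ (IsLocalRing.ResidueField B) := .of_perfectField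
  have hinj := (Algebra.FormallySmooth.kerCotangentToTensor_injective_iff hsur).2
    hsm.subsingleton_h1Cotangent
  have hx' : x ∈ RingHom.ker (algebraMap B (IsLocalRing.ResidueField B)) := hker ▸ hx
  have h1 : (1 : IsLocalRing.ResidueField B) ⊗ₜ[B] KaehlerDifferential.D κ B x ≠ 0 := by
    intro h0
    have h2 : Ideal.toCotangent _
        (⟨x, hx'⟩ : RingHom.ker (algebraMap B (IsLocalRing.ResidueField B))) = 0 := by
      apply hinj
      rw [map_zero]
      exact h0
    rw [Ideal.toCotangent_eq_zero] at h2
    exact hx2 (hker ▸ h2)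
  have hfree : Module.Free B (Ω[B⁄κ]) := Module.free_of_flat_of_isLocalRing
  by_contra hD
  push Not at hD
  let b := Module.Free.chooseBasis B (Ω[B⁄κ])
  apply h1
  have h3 : ∀ i, b.repr (KaehlerDifferential.D κ B x) i ∈
      RingHom.ker (algebraMap B (IsLocalRing.ResidueField B)) := fun i =>
    hker ▸ hD ((b.coord i).compDer (KaehlerDifferential.D κ B))
  rw [← b.sum_repr (KaehlerDifferential.D κ B x), TensorProduct.tmul_sum]
  refine Finset.sum_eq_zero fun i _ => ?_
  rw [TensorProduct.tmul_smul, TensorProduct.smul_tmul', Algebra.smul_def, (h3 i), zero_mul,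
    TensorProduct.zero_tmul]

lemma maximalIdeal_eq_bot_of_formallySmooth {κ B : Type u} [Field κ] [CharZero κ] [CommRing B]
    [IsLocalRing B] [Algebra κ B] [Algebra.FormallySmooth κ B] [Algebra.EssFiniteType κ B]
    (hnil : IsNilpotent (IsLocalRing.maximalIdeal B)) : IsLocalRing.maximalIdeal B = ⊥ := by
  by_contra hne
  obtain ⟨n, hn⟩ := hnil
  have h2 : ¬ IsLocalRing.maximalIdeal B ≤ IsLocalRing.maximalIdeal B ^ 2 := by
    intro hle
    have : ∀ k, IsLocalRing.maximalIdeal B ≤ IsLocalRing.maximalIdeal B ^ (k + 1) := by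
      intro k
      induction k with
      | zero => simp
      | succ k ih =>
        calc _ ≤ IsLocalRing.maximalIdeal B ^ 2 := hle
          _ = IsLocalRing.maximalIdeal B * IsLocalRing.maximalIdeal B := pow_two _
          _ ≤ IsLocalRing.maximalIdeal B ^ (k + 1) * IsLocalRing.maximalIdeal B :=
            Ideal.mul_mono_left ih
          _ = _ := (pow_succ _ _).symm
    apply hne
    rw [eq_bot_iff]
    calc _ ≤ _ := this n
      _ ≤ IsLocalRing.maximalIdeal B ^ n := Ideal.pow_le_pow_right (Nat.le_succ n)
      _ = ⊥ := by rw [hn]; rfl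
  obtain ⟨x, hx, hx2⟩ := SetLike.not_le_iff_exists.1 h2
  obtain ⟨D, hD⟩ := exists_derivation_isUnit (κ := κ) x hx hx2
  have hxn : x ^ n = 0 := by
    have := Ideal.pow_mem_pow hx n
    rwa [hn] at this
  -- differentiate the smallest vanishing power of `x`
  have hmin : ∀ m, x ^ m ≠ 0 := by
    intro m
    induction m with
    | zero => simp
    | succ m ih =>
      intro h0
      have h1 : D (x ^ (m + 1)) = 0 := by rw [h0, map_zero]
      rw [Derivation.leibniz_pow, Nat.add_sub_cancel, smul_eq_mul, nsmul_eq_mul, ← mul_assoc] at h1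
      have h2 := hD.mul_left_eq_zero.1 h1
      have h3 : IsUnit ((m + 1 : ℕ) : B) := by
        rw [← map_natCast (algebraMap κ B)]
        exact (IsUnit.mk0 _ (Nat.cast_ne_zero.2 (Nat.succ_ne_zero m))).map _
      exact ih (h3.mul_right_eq_zero.1 h2)
  exact hmin n hxn

lemma exists_lift_standardEtalePair {B O : Type u} [CommRing B] [CommRing O] (f : B →+* O)
    (hf : Function.Surjective f) (hker : ∀ x y, f x = 0 → f y = 0 → x * y = 0)
    (E : StandardEtalePair O) : ∃ E' : StandardEtalePair B, E'.map f = E := by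
  obtain ⟨p₁, p₂, n, hp⟩ := E.cond
  obtain ⟨F, hF, -, hFm⟩ := Polynomial.lifts_and_natDegree_eq_and_monic
    ((Polynomial.lifts_iff_coeff_lifts E.f).2 fun n => hf _) E.monic_f
  have hs := Polynomial.map_surjective f hf
  obtain ⟨G, hG⟩ := hs E.g
  obtain ⟨q₁, hq₁⟩ := hs p₁
  obtain ⟨q₂, hq₂⟩ := hs p₂
  have hj : ∀ j : B[X], j.map f = 0 → j * j = 0 := by
    intro j hj
    ext k
    rw [Polynomial.coeff_mul, Polynomial.coeff_zero]
    refine Finset.sum_eq_zero fun x _ => hker _ _ ?_ ?_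
    · rw [← Polynomial.coeff_map, hj, Polynomial.coeff_zero]
    · rw [← Polynomial.coeff_map, hj, Polynomial.coeff_zero]
  have h1 := hj (Polynomial.derivative F * q₁ + F * q₂ - G ^ n) (by
    rw [Polynomial.map_sub, Polynomial.map_add, Polynomial.map_mul, Polynomial.map_mul,
      Polynomial.map_pow, ← Polynomial.derivative_map, hF, hG, hq₁, hq₂, hp, sub_self])
  refine ⟨⟨F, hFm, G, ?_⟩, ?_⟩
  · refine ⟨q₁ * (2 * G ^ n - (Polynomial.derivative F * q₁ + F * q₂)),
      q₂ * (2 * G ^ n - (Polynomial.derivative F * q₁ + F * q₂)), 2 * n, ?_⟩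
    linear_combination -h1
  · rw [StandardEtalePair.map]
    congr

/-- The Jacobian criterion with the conormal sequence tested on a flat algebra. Let `O = P / I` and
let `T'` be flat over `P / 𝔪 I`. If `T' / I T'` is formally smooth, then a section of
`T' → T' / I T'` defines a derivation of `P` with values in `I T'` which is the identity on `I`. -/
lemma formallySmooth_of_flat_lift {κ P O T' T : Type u} [CommRing κ] [CommRing P] [IsLocalRing P]
    [Algebra κ P] [CommRing O] [IsLocalRing O] [Algebra κ O] [Algebra P O] [IsScalarTower κ P O]
    [Algebra.FormallySmooth κ P] [Module.Free P (Ω[P⁄κ])] [Module.Finite P (Ω[P⁄κ])]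
    (h₁ : Function.Surjective (algebraMap P O)) (h₂ : (RingHom.ker (algebraMap P O)).FG)
    [CommRing T'] [Algebra κ T'] [Algebra P T'] [IsScalarTower κ P T']
    [Algebra (P ⧸ (IsLocalRing.maximalIdeal P * RingHom.ker (algebraMap P O))) T']
    [IsScalarTower P (P ⧸ (IsLocalRing.maximalIdeal P * RingHom.ker (algebraMap P O))) T']
    [Module.Flat (P ⧸ (IsLocalRing.maximalIdeal P * RingHom.ker (algebraMap P O))) T']
    (hT' : (IsLocalRing.maximalIdeal P).map (algebraMap P T') ≠ ⊤)
    [CommRing T] [Algebra κ T] [Algebra.FormallySmooth κ T] (r : T' →ₐ[κ] T)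
    (hr : Function.Surjective r)
    (hker : RingHom.ker r = (RingHom.ker (algebraMap P O)).map (algebraMap P T')) :
    Algebra.FormallySmooth κ O := by
  let I := RingHom.ker (algebraMap P O)
  let B := P ⧸ (IsLocalRing.maximalIdeal P * I)
  let K := IsLocalRing.ResidueField O
  have hmI : ∀ x ∈ IsLocalRing.maximalIdeal P * I, algebraMap P T' x = 0 := by
    intro x hx
    rw [IsScalarTower.algebraMap_apply P B T', Ideal.Quotient.algebraMap_eq,
      Ideal.Quotient.eq_zero_iff_mem.2 hx, map_zero]
  have hI : I ≤ IsLocalRing.maximalIdeal P := IsLocalRing.le_maximalIdeal (RingHom.ker_ne_top _)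
  -- the ideal `I T'` is killed by `𝔪`, hence has square zero
  have hmN : ∀ x ∈ IsLocalRing.maximalIdeal P, ∀ t ∈ RingHom.ker r, algebraMap P T' x * t = 0 := by
    intro x hx t ht
    rw [hker] at ht
    refine Submodule.span_induction ?_ (mul_zero _) (fun a b _ _ ha hb => ?_)
      (fun a b _ hb => ?_) ht
    · rintro _ ⟨y, hy, rfl⟩
      rw [← map_mul]
      exact hmI _ (Ideal.mul_mem_mul hx hy)
    · rw [mul_add, ha, hb, add_zero]
    · rw [smul_eq_mul, mul_left_comm, hb, mul_zero]
  have hN2 : (RingHom.ker r) ^ 2 = ⊥ := by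
    rw [pow_two, eq_bot_iff, Ideal.mul_le]
    intro s hs t ht
    rw [hker] at hs
    refine Submodule.span_induction ?_ ?_ (fun a b _ _ ha hb => ?_)
      (fun a b _ hb => ?_) hs
    · rintro _ ⟨y, hy, rfl⟩
      exact hmN y (hI hy) t ht
    · rw [zero_mul]; rfl
    · rw [add_mul]; exact add_mem ha hb
    · rw [smul_eq_mul, mul_assoc]; exact Ideal.mul_mem_left _ _ hb
  let s : T →ₐ[κ] T' := Algebra.FormallySmooth.liftOfSurjective (AlgHom.id κ T) r hr ⟨2, hN2⟩
  have hs : ∀ x, r (s x) = x := fun x =>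
    Algebra.FormallySmooth.liftOfSurjective_apply (AlgHom.id κ T) r hr ⟨2, hN2⟩ x
  let f : P →ₐ[κ] T' := (s.comp r).comp (IsScalarTower.toAlgHom κ P T')
  let δ : Derivation κ P (RingHom.ker r) := derivationToSquareZeroOfLift _ hN2 f (by
    ext x
    change Ideal.Quotient.mk _ (s (r (algebraMap P T' x))) = Ideal.Quotient.mk _ (algebraMap P T' x)
    rw [Ideal.Quotient.eq, RingHom.mem_ker, map_sub]
    exact sub_eq_zero.2 (hs _))
  have hδ : ∀ x, (δ x : T') = s (r (algebraMap P T' x)) - algebraMap P T' x := fun x => rfl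
  have hδI : ∀ x ∈ I, (δ x : T') = - algebraMap P T' x := by
    intro x hx
    have : algebraMap P T' x ∈ RingHom.ker r := hker ▸ Ideal.mem_map_of_mem _ hx
    rw [hδ, RingHom.mem_ker.1 this, map_zero, zero_sub]
  -- `T'` is faithfully flat over `P / 𝔪 I`
  have hBloc : IsLocalRing B := by
    have : Nontrivial B := Ideal.Quotient.nontrivial_iff.2 (ne_top_of_le_ne_top
      (IsLocalRing.maximalIdeal.isMaximal P).ne_top Ideal.mul_le_left)
    exact IsLocalRing.of_surjective' _ Ideal.Quotient.mk_surjective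
  have hff : Module.FaithfullyFlat B T' := by
    refine ⟨fun m hm h => hT' ?_⟩
    rw [Ideal.smul_top_eq_map] at h
    have h1 : m.map (algebraMap B T') = ⊤ := by
      rw [eq_top_iff]
      intro x _
      have h0 : x ∈ (⊤ : Submodule B T') := Submodule.mem_top
      rw [← h] at h0
      exact h0
    have h2 : m ≤ (IsLocalRing.maximalIdeal P).map (algebraMap P B) := by
      intro x hx
      obtain ⟨y, rfl⟩ := Ideal.Quotient.mk_surjective x
      refine Ideal.mem_map_of_mem _ ((IsLocalRing.mem_maximalIdeal _).2 fun hy => ?_)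
      exact hm.ne_top (Ideal.eq_top_of_isUnit_mem _ hx (hy.map (Ideal.Quotient.mk _)))
    rw [eq_top_iff, ← h1, IsScalarTower.algebraMap_eq P B T', ← Ideal.map_map]
    exact Ideal.map_mono h2
  have hinj : Function.Injective (algebraMap B T') := FaithfulSMul.algebraMap_injective B T'
  have hmK : ∀ x, algebraMap P K x = 0 → x ∈ IsLocalRing.maximalIdeal P := by
    intro x hx
    rw [IsLocalRing.mem_maximalIdeal]
    intro hu
    exact (hu.map (algebraMap P K)).ne_zero hx
  rw [Algebra.FormallySmooth.iff_injective_cotangentComplexBaseChange_residueField P h₁ h₂,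
    injective_iff_map_eq_zero]
  have hsurK : Function.Surjective (algebraMap P K) := by
    rw [IsScalarTower.algebraMap_eq P O K]
    exact IsLocalRing.residue_surjective.comp h₁
  have hmk : ∀ y : K ⊗[P] I, ∃ z : I, y = 1 ⊗ₜ z := by
    intro y
    induction y with
    | zero => exact ⟨0, by rw [TensorProduct.tmul_zero]⟩
    | tmul a b =>
      obtain ⟨c, rfl⟩ := hsurK a
      exact ⟨c • b, by rw [TensorProduct.tmul_smul, TensorProduct.smul_tmul', Algebra.smul_def,
        mul_one]⟩
    | add a b ha hb =>
      obtain ⟨a, rfl⟩ := ha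
      obtain ⟨b, rfl⟩ := hb
      exact ⟨a + b, by rw [TensorProduct.tmul_add]⟩
  intro y hy
  obtain ⟨z, rfl⟩ := hmk y
  have hdz : (1 : K) ⊗ₜ[P] KaehlerDifferential.D κ P z.1 = 0 := by
    rw [KaehlerDifferential.cotangentComplexBaseChange_tmul, one_smul] at hy
    exact hy
  -- the differential of `z` is a combination of basis elements with coefficients in `𝔪`
  have hδz : δ z.1 = 0 := by
    let b := Module.Free.chooseBasis P (Ω[P⁄κ])
    have hz : ∀ i, b.repr (KaehlerDifferential.D κ P z.1) i ∈ IsLocalRing.maximalIdeal P := by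
      intro i
      apply hmK
      have h1 := Module.Basis.baseChange_repr_tmul K b 1 (KaehlerDifferential.D κ P z.1) i
      rw [hdz, map_zero, Finsupp.zero_apply, Algebra.smul_def, mul_one] at h1
      exact h1.symm
    rw [← δ.liftKaehlerDifferential_comp_D, ← b.sum_repr (KaehlerDifferential.D κ P z.1), map_sum]
    refine Finset.sum_eq_zero fun i _ => ?_
    rw [map_smul]
    apply Subtype.ext
    change b.repr (KaehlerDifferential.D κ P z.1) i • ((δ.liftKaehlerDifferential (b i) :
      RingHom.ker r) : T') = 0
    rw [Algebra.smul_def]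
    exact hmN _ (hz i) _ (Subtype.mem _)
  have hz0 : z.1 ∈ IsLocalRing.maximalIdeal P * I := by
    rw [← Ideal.Quotient.eq_zero_iff_mem]
    apply hinj
    rw [map_zero]
    have := hδI z.1 z.2
    rw [hδz] at this
    rw [← Ideal.Quotient.algebraMap_eq, ← IsScalarTower.algebraMap_apply]
    exact neg_eq_zero.1 this.symm
  have : ∀ x ∈ IsLocalRing.maximalIdeal P * I, ∃ h : x ∈ I, (1 : K) ⊗ₜ[P] (⟨x, h⟩ : I) = 0 := by
    intro x hx
    refine Submodule.mul_induction_on hx (fun a ha c hc => ⟨Ideal.mul_mem_left _ _ hc, ?_⟩) ?_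
    · have h1 : (⟨a * c, Ideal.mul_mem_left _ _ hc⟩ : I) = a • ⟨c, hc⟩ := rfl
      have h2 : algebraMap P K a = 0 := by
        rw [IsScalarTower.algebraMap_apply P O K, IsLocalRing.ResidueField.algebraMap_eq,
          IsLocalRing.residue_eq_zero_iff, IsLocalRing.mem_maximalIdeal]
        intro hu
        have := IsLocalHom.of_surjective (algebraMap P O) h₁
        exact (IsLocalRing.mem_maximalIdeal _).1 ha (isUnit_of_map_unit _ _ hu)
      rw [h1, TensorProduct.tmul_smul, TensorProduct.smul_tmul', Algebra.smul_def, h2, zero_mul,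
        TensorProduct.zero_tmul]
    · rintro x y ⟨hx, hx'⟩ ⟨hy, hy'⟩
      refine ⟨add_mem hx hy, ?_⟩
      have h1 : (⟨x + y, add_mem hx hy⟩ : I) = ⟨x, hx⟩ + ⟨y, hy⟩ := rfl
      rw [h1, TensorProduct.tmul_add, hx', hy', add_zero]
  exact (this z.1 hz0).2

/-- Formal smoothness descends along standard étale algebras over local rings. -/
lemma formallySmooth_of_standardEtalePresentation {κ P O T : Type u} [CommRing κ] [CommRing P]
    [IsLocalRing P] [Algebra κ P] [CommRing O] [IsLocalRing O] [Algebra κ O] [Algebra P O]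
    [IsScalarTower κ P O] [Algebra.FormallySmooth κ P] [Module.Free P (Ω[P⁄κ])]
    [Module.Finite P (Ω[P⁄κ])] (h₁ : Function.Surjective (algebraMap P O))
    (h₂ : (RingHom.ker (algebraMap P O)).FG) [CommRing T] [Algebra O T] [Algebra κ T]
    [IsScalarTower κ O T] (E₀ : StandardEtalePresentation O T) [Algebra.FormallySmooth κ T]
    (hT : (IsLocalRing.maximalIdeal O).map (algebraMap O T) ≠ ⊤) :
    Algebra.FormallySmooth κ O := by
  have hle : RingHom.ker (algebraMap P O) ≤ IsLocalRing.maximalIdeal P :=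
    IsLocalRing.le_maximalIdeal (RingHom.ker_ne_top _)
  let J := IsLocalRing.maximalIdeal P * RingHom.ker (algebraMap P O)
  -- `B → O` has a kernel of square zero, so the standard étale algebra lifts to `B`
  let B := P ⧸ J
  let fB : B →+* O := Ideal.Quotient.lift J (algebraMap P O) fun x hx =>
    (Ideal.mul_le_right hx : x ∈ RingHom.ker (algebraMap P O))
  have hBsur : Function.Surjective fB := Ideal.Quotient.lift_surjective_of_surjective _ _ h₁
  let : Algebra B O := fB.toAlgebra
  have hBO : ∀ x : P, algebraMap B O (Ideal.Quotient.mk J x) = algebraMap P O x := fun x => rfl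
  obtain ⟨E', hE'⟩ := exists_lift_standardEtalePair (algebraMap B O) hBsur (by
    intro x y hx hy
    obtain ⟨x, rfl⟩ := Ideal.Quotient.mk_surjective x
    obtain ⟨y, rfl⟩ := Ideal.Quotient.mk_surjective y
    rw [← map_mul, Ideal.Quotient.eq_zero_iff_mem]
    exact Ideal.mul_mem_mul (hle hx) hy) E₀.P
  let T' := E'.Ring
  let : Algebra P T' := ((algebraMap B T').comp (algebraMap P B)).toAlgebra
  have hPBT : IsScalarTower P B T' := .of_algebraMap_eq' rfl
  let : Algebra κ T' := ((algebraMap P T').comp (algebraMap κ P)).toAlgebra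
  have hκPT : IsScalarTower κ P T' := .of_algebraMap_eq' rfl
  have hκBT : IsScalarTower κ B T' := .of_algebraMap_eq' rfl
  let E'' : StandardEtalePresentation B T' :=
    ⟨E', E'.X, E'.hasMap_X, by
      rw [StandardEtalePair.lift_X_left]; exact Function.bijective_id⟩
  have he : ∀ E : StandardEtalePair O, E = E₀.P → Nonempty (E₀.P.Ring ≃ₐ[O] E.Ring) := by
    rintro _ rfl
    exact ⟨AlgEquiv.refl⟩
  obtain ⟨e'⟩ := he (E''.baseChange (T := O)).P hE'
  let e : T ≃ₐ[O] O ⊗[B] T' :=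
    E₀.equivRing.trans (e'.trans (E''.baseChange (T := O)).equivRing.symm)
  have hsmT' : Algebra.FormallySmooth κ (O ⊗[B] T') := .of_equiv (e.restrictScalars κ)
  let r : T' →ₐ[κ] O ⊗[B] T' :=
    { (Algebra.TensorProduct.includeRight : T' →ₐ[B] O ⊗[B] T') with
      commutes' := fun c => by
        change (1 : O) ⊗ₜ[B] algebraMap B T' (algebraMap κ B c) = algebraMap κ O c ⊗ₜ[B] (1 : T')
        rw [Algebra.algebraMap_eq_smul_one, TensorProduct.tmul_smul, TensorProduct.smul_tmul',
          ← Algebra.algebraMap_eq_smul_one, IsScalarTower.algebraMap_apply κ P O, ← hBO]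
        rfl }
  have hr : ∀ t, r t = 1 ⊗ₜ t := fun t => rfl
  have hrker : RingHom.ker r = (RingHom.ker (algebraMap B O)).map (algebraMap B T') := by
    have h1 := Algebra.TensorProduct.rTensor_ker (R := B) (C := T') (Algebra.ofId B O)
      hBsur
    have h2 : RingHom.ker r = (RingHom.ker (Algebra.TensorProduct.map (Algebra.ofId B O)
        (AlgHom.id B T'))).comap (Algebra.TensorProduct.lid B T').symm := by
      ext t
      simp [RingHom.mem_ker, hr, Algebra.TensorProduct.lid_symm_apply]
    let L : B ⊗[B] T' →+* T' := (Algebra.TensorProduct.lid B T' : B ⊗[B] T' →ₐ[B] T')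
    let inc : B →+* B ⊗[B] T' := (Algebra.TensorProduct.includeLeft : B →ₐ[B] B ⊗[B] T')
    have h1' : RingHom.ker (Algebra.TensorProduct.map (Algebra.ofId B O) (AlgHom.id B T')) =
      (RingHom.ker (algebraMap B O)).map inc := h1
    have h3 : L.comp inc = algebraMap B T' := by
      ext x
      simp [L, inc, Algebra.smul_def]
    rw [h2, h1']
    refine le_antisymm (fun t ht => ?_) (Ideal.map_le_iff_le_comap.2 fun x hx => ?_)
    · have h4 := Ideal.mem_map_of_mem L (Ideal.mem_comap.1 ht)
      rw [Ideal.map_map, h3] at h4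
      have h5 : L ((Algebra.TensorProduct.lid B T').symm t) = t :=
        (Algebra.TensorProduct.lid B T').apply_symm_apply t
      rwa [h5] at h4
    · rw [Ideal.mem_comap, Ideal.mem_comap]
      have h4 := Ideal.mem_map_of_mem inc hx
      have h5 : (Algebra.TensorProduct.lid B T').symm (algebraMap B T' x) = inc x := by
        rw [AlgEquiv.symm_apply_eq, ← h3]
        rfl
      rwa [h5]
  have hBker : RingHom.ker (algebraMap B O) =
      (RingHom.ker (algebraMap P O)).map (algebraMap P B) := by
    ext x
    obtain ⟨x, rfl⟩ := Ideal.Quotient.mk_surjective x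
    constructor
    · intro hx
      exact Ideal.mem_map_of_mem _ (hx : x ∈ RingHom.ker (algebraMap P O))
    · intro hx
      have : (RingHom.ker (algebraMap P O)).map (algebraMap P B) ≤ RingHom.ker (algebraMap B O) :=
        Ideal.map_le_iff_le_comap.2 fun y hy => hy
      exact this hx
  -- `T'` is étale, hence flat, over `B`, and it reduces to `T`
  refine formallySmooth_of_flat_lift (κ := κ) (P := P) (T' := T') (T := O ⊗[B] T') h₁
    h₂ ?_ r ?_ ?_
  · intro htop
    apply hT
    let r' : T' →+* T := (e.symm : O ⊗[B] T' →+* T).comp (r : T' →+* O ⊗[B] T')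
    have h1 : r'.comp (algebraMap P T') = (algebraMap O T).comp (algebraMap P O) := by
      ext x
      change e.symm ((1 : O) ⊗ₜ[B] algebraMap B T' (Ideal.Quotient.mk J x)) = _
      rw [Algebra.algebraMap_eq_smul_one, TensorProduct.tmul_smul, TensorProduct.smul_tmul',
        ← Algebra.algebraMap_eq_smul_one, hBO]
      exact e.symm.commutes (algebraMap P O x)
    have h2 := congrArg (Ideal.map r') htop
    rw [Ideal.map_map, h1, ← Ideal.map_map, Ideal.map_top] at h2
    rw [eq_top_iff, ← h2]
    refine Ideal.map_mono (Ideal.map_le_iff_le_comap.2 fun x hx => ?_)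
    rw [Ideal.mem_comap, IsLocalRing.mem_maximalIdeal]
    intro hu
    have := IsLocalHom.of_surjective (algebraMap P O) h₁
    exact (IsLocalRing.mem_maximalIdeal _).1 hx (isUnit_of_map_unit _ _ hu)
  · intro y
    induction y with
    | zero => exact ⟨0, map_zero r⟩
    | tmul a b =>
      obtain ⟨a, rfl⟩ := hBsur a
      refine ⟨a • b, ?_⟩
      rw [hr, TensorProduct.tmul_smul, TensorProduct.smul_tmul', Algebra.smul_def, mul_one]
      rfl
    | add a b ha hb =>
      obtain ⟨a, rfl⟩ := ha
      obtain ⟨b, rfl⟩ := hb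
      exact ⟨a + b, map_add r a b⟩
  · rw [hrker, hBker, Ideal.map_map, ← IsScalarTower.algebraMap_eq]

/-- Formal smoothness descends along standard étale algebras. -/
lemma formallySmooth_localization_of_isStandardEtale {κ S T : Type u} [CommRing κ]
    [IsNoetherianRing κ] [CommRing S]
    [Algebra κ S] [Algebra.FiniteType κ S] [CommRing T] [Algebra κ T] [Algebra S T]
    [IsScalarTower κ S T] [Algebra.IsStandardEtale S T] [Algebra.FormallySmooth κ T]
    (p : Ideal S) [p.IsPrime] (q : Ideal T) [q.IsPrime] (hq : q.comap (algebraMap S T) = p)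
    (O : Type u) [CommRing O] [Algebra S O] [IsLocalization.AtPrime O p] [Algebra κ O]
    [IsScalarTower κ S O] :
    Algebra.FormallySmooth κ O := by
  have := IsLocalization.AtPrime.isLocalRing O p
  obtain ⟨n, f₀, hf₀⟩ := Algebra.FiniteType.iff_quotient_mvPolynomial''.1
    (inferInstance : Algebra.FiniteType κ S)
  -- the local ring `O` is a quotient of the local ring `P` of an affine space
  let p₀ := p.comap f₀.toRingHom
  let P := Localization.AtPrime p₀
  let fP : P →ₐ[κ] O := IsLocalization.liftAlgHom (M := p₀.primeCompl)
    (f := (IsScalarTower.toAlgHom κ S O).comp f₀)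
    fun x => IsLocalization.map_units (M := p.primeCompl) O ⟨f₀ x.1, x.2⟩
  have hfP : ∀ x, fP (algebraMap _ P x) = algebraMap S O (f₀ x) := fun x =>
    IsLocalization.lift_eq _ x
  have hfsur : Function.Surjective fP := by
    intro x
    obtain ⟨x, ⟨s, hs⟩, rfl⟩ := IsLocalization.exists_mk'_eq p.primeCompl x
    obtain ⟨x, rfl⟩ := hf₀ x
    obtain ⟨s, rfl⟩ := hf₀ s
    refine ⟨IsLocalization.mk' (M := p₀.primeCompl) _ x ⟨s, hs⟩, ?_⟩
    rw [IsLocalization.eq_mk'_iff_mul_eq]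
    dsimp only
    rw [← hfP, ← hfP, ← map_mul]
    congr 1
    exact IsLocalization.mk'_spec _ x (⟨s, hs⟩ : p₀.primeCompl)
  let : Algebra P O := RingHom.toAlgebra (fP : P →+* O)
  have hst : IsScalarTower κ P O := .of_algebraMap_eq fun x => (fP.commutes x).symm
  have : Algebra.FormallyEtale (MvPolynomial (Fin n) κ) P := .of_isLocalization p₀.primeCompl
  have : Algebra.FormallySmooth κ P := .comp _ (MvPolynomial (Fin n) κ) _
  let ek := KaehlerDifferential.tensorKaehlerEquivOfFormallyEtale κ (MvPolynomial (Fin n) κ) P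
  have : Module.Free P (Ω[P⁄κ]) := .of_equiv ek
  have : Module.Finite P (Ω[P⁄κ]) := .equiv ek
  have : IsNoetherianRing P := IsLocalization.isNoetherianRing p₀.primeCompl P inferInstance
  obtain ⟨E₀⟩ := Algebra.IsStandardEtale.nonempty_standardEtalePresentation (R := S) (S := T)
  have hsmT : Algebra.FormallySmooth κ (O ⊗[S] T) := by
    have h1 : Algebra.FormallyEtale S O := .of_isLocalization p.primeCompl
    have h2 : Algebra.FormallySmooth κ (T ⊗[S] O) := .comp κ T _
    refine .of_equiv (A := T ⊗[S] O) (AlgEquiv.ofRingEquiv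
      (f := (Algebra.TensorProduct.comm S T O).toRingEquiv) fun x => ?_)
    change (1 : O) ⊗ₜ[S] algebraMap κ T x = algebraMap κ O x ⊗ₜ[S] (1 : T)
    rw [IsScalarTower.algebraMap_apply κ S T, IsScalarTower.algebraMap_apply κ S O,
      Algebra.algebraMap_eq_smul_one (algebraMap κ S x), TensorProduct.tmul_smul,
      TensorProduct.smul_tmul', ← Algebra.algebraMap_eq_smul_one]
  refine formallySmooth_of_standardEtalePresentation (κ := κ) (P := P) (T := O ⊗[S] T) hfsur
    (IsNoetherian.noetherian _) E₀.baseChange fun htop => ?_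
  -- `𝔪 (O ⊗ T)` is not the unit ideal, because `q` lies over `p`
  let Tq := Localization.AtPrime q
  let g : O →ₐ[S] Tq := IsLocalization.liftAlgHom (M := p.primeCompl)
    (f := Algebra.ofId S Tq)
    fun x => IsLocalization.map_units (M := q.primeCompl) Tq ⟨algebraMap S T x.1, fun h =>
      x.2 (hq ▸ (h : (x : S) ∈ q.comap (algebraMap S T)))⟩
  let g' : O ⊗[S] T →ₐ[S] Tq :=
    Algebra.TensorProduct.lift g (IsScalarTower.toAlgHom S T Tq) fun _ _ => .all _ _
  have h1 : ((g' : O ⊗[S] T →+* Tq).comp (algebraMap O (O ⊗[S] T))) = (g : O →+* Tq) := by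
    ext x
    change g' (x ⊗ₜ[S] (1 : T)) = g x
    simp [g']
  have h2 := congrArg (Ideal.map (g' : O ⊗[S] T →+* Tq)) htop
  rw [Ideal.map_map, h1, Ideal.map_top, ← IsLocalization.AtPrime.map_eq_maximalIdeal p O,
    Ideal.map_map] at h2
  refine (IsLocalRing.maximalIdeal.isMaximal Tq).ne_top (eq_top_iff.2 (h2 ▸ ?_))
  refine Ideal.map_le_iff_le_comap.2 fun x hx => ?_
  have h3 : g (algebraMap S O x) = algebraMap T Tq (algebraMap S T x) := by
    rw [g.commutes]
    exact IsScalarTower.algebraMap_apply S T Tq x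
  rw [Ideal.mem_comap]
  change g (algebraMap S O x) ∈ _
  rw [h3, ← IsLocalization.AtPrime.map_eq_maximalIdeal q Tq]
  exact Ideal.mem_map_of_mem _ (hq ▸ hx : x ∈ q.comap (algebraMap S T))

end FormalSmoothness

/-! ### The smooth locus and étale morphisms -/

section SmoothLocus

lemma isSmoothAt_iff_mem_smoothLocus {X Y : Scheme.{u}} (f : X ⟶ Y)
    [LocallyOfFinitePresentation f] (x : X) : IsSmoothAt f x ↔ x ∈ f.smoothLocus := by
  constructor
  · rintro ⟨U, hx, hU⟩
    have h1 : (⟨x, hx⟩ : U.toScheme) ∈ (U.ι ≫ f).smoothLocus := by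
      rw [Scheme.Hom.smoothLocus_eq_top]
      trivial
    rwa [← Scheme.Hom.preimage_smoothLocus_eq] at h1
  · intro hx
    refine ⟨f.smoothLocus, hx, ?_⟩
    rw [← Scheme.Hom.smoothLocus_eq_top_iff, ← Scheme.Hom.preimage_smoothLocus_eq, eq_top_iff]
    rintro ⟨y, hy⟩ -
    exact hy

lemma comap_mem_smoothLocus_of_etale {R S T : Type u} [CommRing R] [IsNoetherianRing R] [CommRing S]
    [CommRing T] [Algebra R S] [Algebra S T] [Algebra R T] [IsScalarTower R S T]
    [Algebra.FinitePresentation R S] [Algebra.Etale S T] (q : PrimeSpectrum T)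
    (hq : q ∈ Algebra.smoothLocus R T) :
    PrimeSpectrum.comap (algebraMap S T) q ∈ Algebra.smoothLocus R S := by
  have : Algebra.FinitePresentation R T := .trans R S T
  obtain ⟨f, hf, hT₁⟩ := Algebra.IsEtaleAt.exists_isStandardEtale (R := S) q.asIdeal
  let T₁ := Localization.Away f
  obtain ⟨q₁, rfl⟩ : q ∈ Set.range (PrimeSpectrum.comap (algebraMap T T₁)) := by
    rw [PrimeSpectrum.localization_away_comap_range T₁ f]
    exact hf
  have hq₁ : q₁ ∈ Algebra.smoothLocus R T₁ := by
    rw [← Algebra.smoothLocus_comap_of_isLocalization (A := T) f]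
    exact hq
  have : Algebra.FinitePresentation T T₁ := IsLocalization.Away.finitePresentation f
  have : Algebra.FinitePresentation R T₁ := .trans R T T₁
  have hq₁' : Algebra.IsSmoothAt R q₁.asIdeal := hq₁
  obtain ⟨g, hg, hT₂⟩ := Algebra.IsSmoothAt.exists_notMem_smooth R q₁.asIdeal
  let T₂ := Localization.Away g
  have : Algebra.IsStandardEtale S T₂ := .of_isLocalizationAway (S := T₁) g
  obtain ⟨q₂, rfl⟩ : q₁ ∈ Set.range (PrimeSpectrum.comap (algebraMap T₁ T₂)) := by
    rw [PrimeSpectrum.localization_away_comap_range T₂ g]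
    exact hg
  have := hT₂.formallySmooth
  have e : PrimeSpectrum.comap (algebraMap S T) (PrimeSpectrum.comap (algebraMap T T₁)
      (PrimeSpectrum.comap (algebraMap T₁ T₂) q₂)) = PrimeSpectrum.comap (algebraMap S T₂) q₂ := by
    ext x
    rfl
  rw [e]
  exact formallySmooth_localization_of_isStandardEtale (κ := R) (S := S) (T := T₂)
    (PrimeSpectrum.comap (algebraMap S T₂) q₂).asIdeal q₂.asIdeal rfl
    (Localization.AtPrime (PrimeSpectrum.comap (algebraMap S T₂) q₂).asIdeal)

/-- Smoothness descends along étale morphisms. -/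
lemma mem_smoothLocus_of_etale {V X Y : Scheme.{u}} [IsLocallyNoetherian Y] (f : V ⟶ X)
    [Etale f] (g : X ⟶ Y) [LocallyOfFinitePresentation g] (v : V)
    (hv : v ∈ (f ≫ g).smoothLocus) : f v ∈ g.smoothLocus := by
  obtain ⟨_, ⟨U₀, hU₀, rfl⟩, hxU₀, -⟩ :=
    Y.isBasis_affineOpens.exists_subset_of_mem_open (Set.mem_univ (g (f v))) isOpen_univ
  obtain ⟨_, ⟨U, hU, rfl⟩, hxU, hUU₀⟩ :=
    X.isBasis_affineOpens.exists_subset_of_mem_open hxU₀ (U₀.2.preimage g.continuous)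
  obtain ⟨_, ⟨W, hW, rfl⟩, hxW, hWU⟩ :=
    V.isBasis_affineOpens.exists_subset_of_mem_open hxU (U.2.preimage f.continuous)
  have hWU₀ : W ≤ (f ≫ g) ⁻¹ᵁ U₀ := fun z hz => hUU₀ (hWU hz)
  have hft := g.finitePresentation_appLE hU₀ hU hUU₀
  have het := f.etale_appLE hU hW hWU
  rw [Scheme.Hom.mem_smoothLocus, formallySmooth_stalkMap_iff U₀ hU₀ W hW hWU₀ hxW] at hv
  rw [Scheme.Hom.mem_smoothLocus, formallySmooth_stalkMap_iff U₀ hU₀ U hU hUU₀ hxU]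
  have hcomap := IsAffineOpen.comap_primeIdealOf_appLE (f := f) U hU W hW hWU hxW
  have hnoeth : IsNoetherianRing Γ(Y, U₀) := IsLocallyNoetherian.component_noetherian ⟨U₀, hU₀⟩
  have hcomp : g.appLE U₀ U hUU₀ ≫ f.appLE U W hWU = (f ≫ g).appLE U₀ W hWU₀ :=
    Scheme.Hom.appLE_comp_appLE ..
  rw [← hcomap]
  let a₁ : Algebra Γ(Y, U₀) Γ(X, U) := (g.appLE U₀ U hUU₀).hom.toAlgebra
  let a₂ : Algebra Γ(X, U) Γ(V, W) := (f.appLE U W hWU).hom.toAlgebra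
  let a₃ : Algebra Γ(Y, U₀) Γ(V, W) := ((f ≫ g).appLE U₀ W hWU₀).hom.toAlgebra
  have a₄ : IsScalarTower Γ(Y, U₀) Γ(X, U) Γ(V, W) :=
    .of_algebraMap_eq' (congrArg CommRingCat.Hom.hom hcomp).symm
  have a₅ : Algebra.FinitePresentation Γ(Y, U₀) Γ(X, U) := hft
  have a₆ : Algebra.Etale Γ(X, U) Γ(V, W) := het
  exact comap_mem_smoothLocus_of_etale (R := Γ(Y, U₀)) (S := Γ(X, U)) (T := Γ(V, W)) _ hv

end SmoothLocus

/-! ### Local rings of log smooth curves -/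

section ChartAlgebra

open scoped TensorProduct

/-- Base change along a surjective homomorphism is a quotient. -/
lemma exists_baseChange_of_surjective {S R A : Type u} [CommRing S] [CommRing R] [CommRing A]
    [Algebra S A] (f : S →+* R) (hf : Function.Surjective f) [Module.Flat S A]
    [Algebra.FormallySmooth S A] :
    ∃ (T : Type u) (_ : CommRing T) (_ : Algebra R T) (π : A →+* T),
      Function.Surjective π ∧ RingHom.ker π = (RingHom.ker f).map (algebraMap S A) ∧
      Module.Flat R T ∧ Algebra.FormallySmooth R T ∧
      ∀ s, π (algebraMap S A s) = algebraMap R T (f s) := by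
  let : Algebra S R := f.toAlgebra
  let π : A →+* R ⊗[S] A := (Algebra.TensorProduct.includeRight : A →ₐ[S] R ⊗[S] A)
  have hone : ∀ (s : S) (a : A), (1 : R) ⊗ₜ[S] (s • a) = f s ⊗ₜ a := fun s a => by
    rw [TensorProduct.tmul_smul, TensorProduct.smul_tmul', Algebra.smul_def, mul_one]
    rfl
  have hπ : ∀ s, π (algebraMap S A s) = algebraMap R (R ⊗[S] A) (f s) := fun s => by
    rw [Algebra.algebraMap_eq_smul_one]
    exact hone s 1
  refine ⟨R ⊗[S] A, inferInstance, inferInstance, π, ?_, ?_, inferInstance, inferInstance, hπ⟩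
  · intro y
    induction y with
    | zero => exact ⟨0, map_zero π⟩
    | tmul a b =>
      obtain ⟨a, rfl⟩ := hf a
      exact ⟨a • b, hone a b⟩
    | add a b ha hb =>
      obtain ⟨a, rfl⟩ := ha
      obtain ⟨b, rfl⟩ := hb
      exact ⟨a + b, map_add π a b⟩
  · have h1 := Algebra.TensorProduct.rTensor_ker (R := S) (C := A) (Algebra.ofId S R) hf
    let L : S ⊗[S] A →+* A := (Algebra.TensorProduct.lid S A : S ⊗[S] A →ₐ[S] A)
    let inc : S →+* S ⊗[S] A := (Algebra.TensorProduct.includeLeft : S →ₐ[S] S ⊗[S] A)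
    have h1' : RingHom.ker (Algebra.TensorProduct.map (Algebra.ofId S R) (AlgHom.id S A)) =
      (RingHom.ker f).map inc := h1
    have h3 : L.comp inc = algebraMap S A := by
      ext x
      simp [L, inc, Algebra.smul_def]
    refine le_antisymm (fun t ht => ?_) (Ideal.map_le_iff_le_comap.2 fun x hx => ?_)
    · have h2 : (Algebra.TensorProduct.lid S A).symm t ∈
          RingHom.ker (Algebra.TensorProduct.map (Algebra.ofId S R) (AlgHom.id S A)) := by
        have h0 : (1 : R) ⊗ₜ[S] t = 0 := ht
        simpa [RingHom.mem_ker, Algebra.TensorProduct.lid_symm_apply] using h0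
      rw [h1'] at h2
      have h4 := Ideal.mem_map_of_mem L h2
      rw [Ideal.map_map, h3] at h4
      have h5 : L ((Algebra.TensorProduct.lid S A).symm t) = t :=
        (Algebra.TensorProduct.lid S A).apply_symm_apply t
      rwa [h5] at h4
    · rw [Ideal.mem_comap, RingHom.mem_ker, hπ, hx, map_zero]

variable {κ : Type u} [Field κ] {P : Type u} [CommMonoid P] (h : Multiplicative ℕ →* P)

/-- The image of the generator of `ℕ`. -/
abbrev chartBase : P := h (Multiplicative.ofAdd 1)

variable (κ) in
/-- The monomials in the chart ring. -/
def chartMonomial : P →* ChartRing κ h :=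
  ((Ideal.Quotient.mk (Ideal.span {MonoidAlgebra.of κ P (chartBase h)}) :
    MonoidAlgebra κ P →+* ChartRing κ h) : MonoidAlgebra κ P →* ChartRing κ h).comp
    (MonoidAlgebra.of κ P)

lemma chartMonomial_base : chartMonomial κ h (chartBase h) = 0 :=
  Ideal.Quotient.eq_zero_iff_mem.2 (Ideal.subset_span (Set.mem_singleton _))

open Classical in
variable (κ) in
/-- The restriction of functions to the stratum of a face: monomials outside of the face vanish. -/
def faceProj (G : Submonoid P) (hG : IsFace G) : MonoidAlgebra κ P →ₐ[κ] MonoidAlgebra κ G :=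
  MonoidAlgebra.lift κ (MonoidAlgebra κ G) P
    { toFun := fun p => if hp : p ∈ G then MonoidAlgebra.of κ G ⟨p, hp⟩ else 0
      map_one' := by rw [dif_pos G.one_mem]; rfl
      map_mul' := fun p q => by
        by_cases hp : p ∈ G
        · by_cases hq : q ∈ G
          · rw [dif_pos hp, dif_pos hq, dif_pos (mul_mem hp hq), ← map_mul]
            rfl
          · rw [dif_neg hq, dif_neg (fun h => hq (hG q p (mul_comm p q ▸ h))), mul_zero]
        · rw [dif_neg hp, dif_neg (fun h => hp (hG p q h)), zero_mul] }

lemma faceProj_of_mem {G : Submonoid P} (hG : IsFace G) {p : P} (hp : p ∈ G) :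
    faceProj κ G hG (MonoidAlgebra.of κ P p) = MonoidAlgebra.of κ G ⟨p, hp⟩ := by
  rw [faceProj, MonoidAlgebra.lift_of]
  exact dif_pos hp

lemma faceProj_of_notMem {G : Submonoid P} (hG : IsFace G) {p : P} (hp : p ∉ G) :
    faceProj κ G hG (MonoidAlgebra.of κ P p) = 0 := by
  rw [faceProj, MonoidAlgebra.lift_of]
  exact dif_neg hp

/-- The kernel of the restriction to the stratum of a face is generated by monomials. -/
lemma mem_span_of_faceProj_eq_zero {G : Submonoid P} (hG : IsFace G) (x : MonoidAlgebra κ P)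
    (hx : faceProj κ G hG x = 0) :
    x ∈ Ideal.span (MonoidAlgebra.of κ P '' (G : Set P)ᶜ) := by
  classical
  let s : MonoidAlgebra κ G →ₐ[κ] MonoidAlgebra κ P :=
    MonoidAlgebra.lift κ _ G ((MonoidAlgebra.of κ P).comp G.subtype)
  have key : ∀ y : MonoidAlgebra κ P,
      y - s (faceProj κ G hG y) ∈ Ideal.span (MonoidAlgebra.of κ P '' (G : Set P)ᶜ) := by
    intro y
    induction y using MonoidAlgebra.induction_on with
    | of p =>
      by_cases hp : p ∈ G
      · rw [faceProj_of_mem hG hp, MonoidAlgebra.lift_of]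
        change MonoidAlgebra.of κ P p - MonoidAlgebra.of κ P p ∈ _
        rw [sub_self]
        exact zero_mem _
      · rw [faceProj_of_notMem hG hp, map_zero, sub_zero]
        exact Ideal.subset_span ⟨p, hp, rfl⟩
    | add a b ha hb =>
      rw [map_add, map_add, add_sub_add_comm]
      exact add_mem ha hb
    | smul r a ha =>
      rw [map_smul, map_smul, ← smul_sub, Algebra.smul_def]
      exact Ideal.mul_mem_left _ _ ha
  have := key x
  rwa [hx, map_zero, sub_zero] at this

variable {A : Type u} [CommRing A] [Algebra (ChartRing κ h) A]

variable (κ A) in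
/-- The monomials in an algebra over the chart ring. -/
def chartPsi : P →* A := (algebraMap (ChartRing κ h) A : ChartRing κ h →* A).comp (chartMonomial κ h)

lemma chartPsi_base : chartPsi κ h A (chartBase h) = 0 := by
  change algebraMap (ChartRing κ h) A (chartMonomial κ h (chartBase h)) = 0
  rw [chartMonomial_base, map_zero]

/-- The restriction of a flat and formally smooth algebra over the chart ring to the stratum of a
face is flat and formally smooth over the monoid algebra of the face. -/
lemma exists_face_quotient [Module.Flat (ChartRing κ h) A] [Algebra.FormallySmooth (ChartRing κ h) A]
    (G : Submonoid P) (hG : IsFace G) (hρ : chartBase h ∉ G) :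
    ∃ (T : Type u) (_ : CommRing T) (_ : Algebra (MonoidAlgebra κ G) T) (π : A →+* T),
      Function.Surjective π ∧ RingHom.ker π = Ideal.span (chartPsi κ h A '' (G : Set P)ᶜ) ∧
      Module.Flat (MonoidAlgebra κ G) T ∧ Algebra.FormallySmooth (MonoidAlgebra κ G) T ∧
      (∀ (p : P) (hp : p ∈ G), π (chartPsi κ h A p) =
        algebraMap (MonoidAlgebra κ G) T (MonoidAlgebra.of κ G ⟨p, hp⟩)) ∧
      ∀ c : κ, π (algebraMap (ChartRing κ h) A (algebraMap κ (ChartRing κ h) c)) =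
        algebraMap (MonoidAlgebra κ G) T (algebraMap κ _ c) := by
  let f : ChartRing κ h →ₐ[κ] MonoidAlgebra κ G :=
    Ideal.Quotient.liftₐ _ (faceProj κ G hG) fun a ha => by
      have : Ideal.span {MonoidAlgebra.of κ P (chartBase h)} ≤ RingHom.ker (faceProj κ G hG) := by
        rw [Ideal.span_le, Set.singleton_subset_iff]
        exact faceProj_of_notMem hG hρ
      exact this ha
  have hfmk : ∀ x, f (Ideal.Quotient.mk _ x) = faceProj κ G hG x := fun x =>
    Ideal.Quotient.lift_mk _ _ _
  have hfsur : Function.Surjective f := by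
    intro y
    induction y using MonoidAlgebra.induction_on with
    | of p => exact ⟨Ideal.Quotient.mk _ (MonoidAlgebra.of κ P p), (hfmk _).trans
        (faceProj_of_mem hG p.2)⟩
    | add a b ha hb =>
      obtain ⟨a, rfl⟩ := ha
      obtain ⟨b, rfl⟩ := hb
      exact ⟨a + b, map_add f a b⟩
    | smul r a ha =>
      obtain ⟨a, rfl⟩ := ha
      exact ⟨r • a, map_smul f r a⟩
  have hfker : RingHom.ker (f : ChartRing κ h →+* MonoidAlgebra κ G) =
      Ideal.span (chartMonomial κ h '' (G : Set P)ᶜ) := by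
    refine le_antisymm (fun x hx => ?_) (Ideal.span_le.2 ?_)
    · obtain ⟨x, rfl⟩ := Ideal.Quotient.mk_surjective x
      have h1 := mem_span_of_faceProj_eq_zero hG x ((hfmk x).symm.trans hx)
      have h2 := Ideal.mem_map_of_mem (Ideal.Quotient.mk
        (Ideal.span {MonoidAlgebra.of κ P (chartBase h)})) h1
      rw [Ideal.map_span, ← Set.image_comp] at h2
      exact h2
    · rintro _ ⟨p, hp, rfl⟩
      exact (hfmk _).trans (faceProj_of_notMem hG hp)
  obtain ⟨T, _, _, π, h1, h2, h3, h4, h5⟩ :=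
    exists_baseChange_of_surjective (A := A) (f : ChartRing κ h →+* MonoidAlgebra κ G) hfsur
  refine ⟨T, inferInstance, inferInstance, π, h1, ?_, h3, h4, fun p hp => ?_, fun c => ?_⟩
  · rw [h2, hfker, Ideal.map_span, ← Set.image_comp]
    rfl
  · rw [← faceProj_of_mem hG hp, ← hfmk]
    exact h5 _
  · rw [h5]
    congr 1
    exact f.commutes c

end ChartAlgebra

section LocalChart

variable {κ : Type u} [Field κ]

/-- The face of the monomials which do not vanish at a prime. -/
def primeFace {P A : Type*} [CommMonoid P] [CommRing A] (ψ : P →* A) (q : Ideal A) [q.IsPrime] :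
    Submonoid P := q.primeCompl.comap ψ

lemma mem_primeFace {P A : Type*} [CommMonoid P] [CommRing A] {ψ : P →* A} {q : Ideal A}
    [q.IsPrime] {p : P} : p ∈ primeFace ψ q ↔ ψ p ∉ q := Iff.rfl

lemma isFace_primeFace {P A : Type*} [CommMonoid P] [CommRing A] (ψ : P →* A) (q : Ideal A)
    [q.IsPrime] : IsFace (primeFace ψ q) := fun a b hab ha =>
  hab (by rw [map_mul]; exact Ideal.mul_mem_right _ _ ha)

lemma isSMulRegular_of {G : Type*} [CommMonoid G] (hcan : ∀ a b c : G, a * c = b * c → a = b)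
    (p : G) : IsSMulRegular (MonoidAlgebra κ G) (MonoidAlgebra.of κ G p) := by
  rw [isSMulRegular_iff_right_eq_zero_of_smul]
  intro x hx
  ext g
  have h1 : (MonoidAlgebra.single p (1 : κ) * x).coeff (p * g) = 1 * x.coeff g :=
    MonoidAlgebra.coeff_single_mul_eq_mul_coeff g (fun a _ => by
      rw [mul_comm p a, mul_comm p g]
      exact ⟨fun e => hcan _ _ _ e, fun e => by rw [e]⟩)
  rw [smul_eq_mul, MonoidAlgebra.of_apply] at hx
  rw [hx, one_mul] at h1
  exact h1.symm

/-- In a Noetherian local ring with principal maximal ideal `(t)` every nonzero element is the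
product of a power of `t` and a unit. -/
lemma exists_pow_mul_unit {T : Type*} [CommRing T] [IsLocalRing T] [IsNoetherianRing T]
    (t : T) (ht : IsLocalRing.maximalIdeal T = Ideal.span {t}) {b : T} (hb : b ≠ 0) :
    ∃ (k : ℕ) (w : T), IsUnit w ∧ b = t ^ k * w := by
  classical
  have h1 : ∃ n, b ∉ IsLocalRing.maximalIdeal T ^ n := by
    by_contra hcon
    push Not at hcon
    have := Ideal.iInf_pow_eq_bot_of_isLocalRing (IsLocalRing.maximalIdeal T)
      (IsLocalRing.maximalIdeal.isMaximal T).ne_top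
    exact hb ((Submodule.mem_bot T).1 (this ▸ (Submodule.mem_iInf _).2 hcon))
  have h2 := Nat.find_spec h1
  obtain ⟨k, hk⟩ : ∃ k, Nat.find h1 = k + 1 := by
    refine Nat.exists_eq_succ_of_ne_zero fun h0 => ?_
    rw [h0, pow_zero] at h2
    exact h2 (by rw [Ideal.one_eq_top]; trivial)
  have h3 : b ∈ IsLocalRing.maximalIdeal T ^ k := by
    by_contra hcon
    exact Nat.find_min h1 (by omega : k < Nat.find h1) hcon
  rw [ht, Ideal.span_singleton_pow, Ideal.mem_span_singleton'] at h3
  obtain ⟨w, rfl⟩ := h3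
  refine ⟨k, w, ?_, mul_comm _ _⟩
  by_contra hw
  have h5 : w ∈ IsLocalRing.maximalIdeal T := hw
  rw [ht] at h5
  obtain ⟨w', rfl⟩ := Ideal.mem_span_singleton'.1 h5
  rw [hk, ht, Ideal.span_singleton_pow] at h2
  apply h2
  rw [mul_assoc, ← pow_succ']
  exact Ideal.mul_mem_left _ _ (Ideal.mem_span_singleton_self _)

variable {P : Type u} [CommMonoid P] (h : Multiplicative ℕ →* P)
  {A : Type u} [CommRing A] [Algebra (ChartRing κ h) A]
  [Module.Flat (ChartRing κ h) A] [Algebra.FormallySmooth (ChartRing κ h) A] [IsLocalRing A]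

/-- The strata of a chart which pass through a point are nonempty. -/
lemma exists_primeFace_eq (hcan : ∀ a b c : P, a * c = b * c → a = b) {G : Submonoid P}
    (hG : IsFace G) (hρ : chartBase h ∉ G)
    (hFG : primeFace (chartPsi κ h A) (IsLocalRing.maximalIdeal A) ≤ G) :
    ∃ (q : Ideal A) (_ : q.IsPrime), primeFace (chartPsi κ h A) q = G := by
  obtain ⟨T, _, _, π, hπ, hker, _, _, hof, -⟩ := exists_face_quotient (κ := κ) h (A := A) G hG hρ
  have : Nontrivial T := by
    refine ⟨⟨1, 0, fun h10 => ?_⟩⟩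
    have h1 : (1 : A) ∈ RingHom.ker π := by rw [RingHom.mem_ker, map_one, h10]
    rw [hker] at h1
    have h2 : Ideal.span (chartPsi κ h A '' (G : Set P)ᶜ) ≤ IsLocalRing.maximalIdeal A := by
      rw [Ideal.span_le]
      rintro _ ⟨p, hp, rfl⟩
      by_contra hcon
      exact hp (hFG hcon)
    exact (IsLocalRing.maximalIdeal.isMaximal A).ne_top ((Ideal.eq_top_iff_one _).2 (h2 h1))
  obtain ⟨q, hq⟩ := Ideal.nonempty_minimalPrimes (I := (⊥ : Ideal T)) bot_ne_top
  have hqp : q.IsPrime := hq.1.1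
  refine ⟨q.comap π, inferInstance, ?_⟩
  ext p
  rw [mem_primeFace, Ideal.mem_comap]
  constructor
  · intro hp
    by_contra hpG
    have : chartPsi κ h A p ∈ RingHom.ker π := by
      rw [hker]
      exact Ideal.subset_span ⟨p, hpG, rfl⟩
    rw [(RingHom.mem_ker).1 this] at hp
    exact hp (zero_mem _)
  · intro hp
    rw [hof p hp]
    intro hmem
    have h1 : IsSMulRegular T (algebraMap (MonoidAlgebra κ G) T (MonoidAlgebra.of κ G ⟨p, hp⟩)) :=
      (isSMulRegular_of (κ := κ) (fun a b c e => Subtype.ext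
        (hcan _ _ _ (congrArg Subtype.val e))) (⟨p, hp⟩ : G)).of_flat
    have h2 : algebraMap (MonoidAlgebra κ G) T (MonoidAlgebra.of κ G ⟨p, hp⟩) ∈
        nonZeroDivisors T := by
      rw [mem_nonZeroDivisors_iff_right]
      intro z hz
      refine isSMulRegular_iff_right_eq_zero_of_smul.1 h1 z ?_
      rw [smul_eq_mul, mul_comm, hz]
    exact Set.disjoint_left.1 (Ideal.disjoint_nonZeroDivisors_of_mem_minimalPrimes hq) hmem h2

/-- A one-dimensional stratum whose monomials are powers of one monomial, up to units, is a
branch with this monomial as a parameter, if the maximal ideal is generated by monomials. -/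
lemma eq_span_of_primeFace_eq [IsNoetherianRing A]
    {G : Submonoid P} (hρ : chartBase h ∉ G)
    (hmax : IsLocalRing.maximalIdeal A = Ideal.span (chartPsi κ h A ''
      (primeFace (chartPsi κ h A) (IsLocalRing.maximalIdeal A) : Set P)ᶜ))
    {g : P} (hg : g ∈ G) (hgF : g ∉ primeFace (chartPsi κ h A) (IsLocalRing.maximalIdeal A))
    (ha : ∀ p ∈ G, ∃ n : ℕ, ∃ f ∈ primeFace (chartPsi κ h A) (IsLocalRing.maximalIdeal A),
      ∃ f' ∈ primeFace (chartPsi κ h A) (IsLocalRing.maximalIdeal A), p * f = g ^ n * f')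
    (q : Ideal A) [q.IsPrime] (hq : primeFace (chartPsi κ h A) q = G) :
    q = Ideal.span (chartPsi κ h A '' (G : Set P)ᶜ) ∧
      ∀ b ∉ q, ∃ (k : ℕ) (w : A), IsUnit w ∧ b - chartPsi κ h A g ^ k * w ∈ q := by
  set ψ := chartPsi κ h A with hψ
  have hG : IsFace G := hq ▸ isFace_primeFace _ _
  have hle : Ideal.span (ψ '' (G : Set P)ᶜ) ≤ q := by
    rw [Ideal.span_le]
    rintro _ ⟨p, hp, rfl⟩
    rw [← hq] at hp
    by_contra hcon
    exact hp hcon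
  -- the quotient `T` by the monomials outside of `G`; its maximal ideal is generated by `g`
  obtain ⟨T, _, _, π, hπ, hker, _, _, hof, -⟩ := exists_face_quotient (κ := κ) h (A := A) G hG hρ
  have hkq : RingHom.ker π ≤ q := hker ▸ hle
  have : Nontrivial T := by
    refine ⟨⟨1, 0, fun h10 => ?_⟩⟩
    have h1 : (1 : A) ∈ RingHom.ker π := by rw [RingHom.mem_ker, map_one, h10]
    exact Ideal.IsPrime.ne_top ‹_› ((Ideal.eq_top_iff_one _).2 (hkq h1))
  have : IsLocalRing T := IsLocalRing.of_surjective' π hπ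
  have : IsNoetherianRing T := isNoetherianRing_of_surjective _ _ π hπ
  have hloc : ∀ a : A, π a ∈ IsLocalRing.maximalIdeal T → a ∈ IsLocalRing.maximalIdeal A :=
    fun a ha hu => ha (hu.map π)
  have hloc' : ∀ a : A, IsUnit (π a) → IsUnit a := by
    intro a hu
    by_contra hcon
    obtain ⟨b, hb⟩ := hu.exists_right_inv
    obtain ⟨b, rfl⟩ := hπ b
    have h1 : a * b - 1 ∈ IsLocalRing.maximalIdeal A :=
      IsLocalRing.le_maximalIdeal (Ideal.IsPrime.ne_top ‹q.IsPrime›) (hkq (by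
        rw [RingHom.mem_ker, map_sub, map_mul, hb, map_one, sub_self]))
    have h2 := (Submodule.sub_mem_iff_right _
      (Ideal.mul_mem_right b _ (show a ∈ IsLocalRing.maximalIdeal A from hcon))).1 h1
    exact (IsLocalRing.maximalIdeal.isMaximal A).ne_top ((Ideal.eq_top_iff_one _).2 h2)
  have ht : IsLocalRing.maximalIdeal T = Ideal.span {π (ψ g)} := by
    refine le_antisymm (fun x hx => ?_) ?_
    · obtain ⟨x, rfl⟩ := hπ x
      have hx' := hloc x hx
      rw [hmax] at hx'
      have h1 := Ideal.mem_map_of_mem π hx'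
      rw [Ideal.map_span] at h1
      refine (Ideal.span_le.2 ?_) h1
      rintro _ ⟨_, ⟨p, hp, rfl⟩, rfl⟩
      by_cases hpG : p ∈ G
      · obtain ⟨n, f, hf, f', hf', e⟩ := ha p hpG
        have hn : n ≠ 0 := by
          rintro rfl
          rw [pow_zero, one_mul] at e
          exact hp (isFace_primeFace _ _ p f (e ▸ hf'))
        have hfu : IsUnit (ψ f) := by
          by_contra hcon
          exact hf hcon
        obtain ⟨v, hv⟩ := hfu.exists_right_inv
        rw [SetLike.mem_coe, Ideal.mem_span_singleton]
        have e1 : ψ p = ψ g ^ n * (ψ f' * v) := by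
          rw [← mul_assoc, ← map_pow, ← map_mul, ← e, map_mul, mul_assoc, hv, mul_one]
        rw [e1, map_mul, map_pow]
        exact Dvd.dvd.mul_right (dvd_pow_self _ hn) _
      · have : ψ p ∈ RingHom.ker π := by
          rw [hker]
          exact Ideal.subset_span ⟨p, hpG, rfl⟩
        rw [(RingHom.mem_ker).1 this]
        exact zero_mem _
    · rw [Ideal.span_singleton_le_iff_mem]
      intro hu
      exact hgF fun hcon => hcon (hloc' _ hu)
  have key : ∀ b, π b ≠ 0 → ∃ (k : ℕ) (w : A), IsUnit w ∧ b - ψ g ^ k * w ∈ RingHom.ker π := by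
    intro b hb
    obtain ⟨k, w, hw, e⟩ := exists_pow_mul_unit _ ht hb
    obtain ⟨w, rfl⟩ := hπ w
    refine ⟨k, w, hloc' w hw, ?_⟩
    rw [RingHom.mem_ker, map_sub, e, map_mul, map_pow, sub_self]
  have hgq : ψ g ∉ q := by
    rw [← mem_primeFace, hq]
    exact hg
  -- elements of `q` outside of the kernel would be powers of `g` times units, but `g` is not in `q`
  have hqk : q = RingHom.ker π := by
    refine le_antisymm (fun b hb => ?_) hkq
    by_contra hcon
    obtain ⟨k, w, hw, e⟩ := key b hcon
    have h1 := (Submodule.sub_mem_iff_right _ hb).1 (hkq e)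
    rcases Ideal.IsPrime.mem_or_mem ‹_› h1 with h2 | h2
    · exact hgq (Ideal.IsPrime.mem_of_pow_mem ‹_› _ h2)
    · exact Ideal.IsPrime.ne_top ‹_› (Ideal.eq_top_of_isUnit_mem _ h2 hw)
  refine ⟨hqk.trans hker, fun b hb => ?_⟩
  obtain ⟨k, w, hw, e⟩ := key b fun h0 => hb (hqk ▸ (RingHom.mem_ker).2 h0)
  exact ⟨k, w, hw, hqk ▸ e⟩

variable [CharZero κ] [Algebra κ A] [IsScalarTower κ (ChartRing κ h) A]

/-- If the closed point is the only point of its stratum, then the maximal ideal is generated by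
monomials. -/
lemma maximalIdeal_eq_span_of_unique [IsNoetherianRing A] [Algebra.EssFiniteType κ A]
    (hcan : ∀ a b c : P, a * c = b * c → a = b)
    (huniq : ∀ (q : Ideal A) [q.IsPrime], primeFace (chartPsi κ h A) q =
      primeFace (chartPsi κ h A) (IsLocalRing.maximalIdeal A) → q = IsLocalRing.maximalIdeal A) :
    IsLocalRing.maximalIdeal A = Ideal.span (chartPsi κ h A ''
      (primeFace (chartPsi κ h A) (IsLocalRing.maximalIdeal A) : Set P)ᶜ) := by
  set F := primeFace (chartPsi κ h A) (IsLocalRing.maximalIdeal A) with hFdef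
  have hle : Ideal.span (chartPsi κ h A '' (F : Set P)ᶜ) ≤ IsLocalRing.maximalIdeal A := by
    rw [Ideal.span_le]
    rintro _ ⟨p, hp, rfl⟩
    by_contra hcon
    exact hp hcon
  have hρ : chartBase h ∉ F := fun hmem => hmem (by rw [chartPsi_base]; exact zero_mem _)
  obtain ⟨T, _, _, π, hπ, hker, _, _, hof, hκ⟩ :=
    exists_face_quotient (κ := κ) h (A := A) F (isFace_primeFace _ _) hρ
  have : Nontrivial T := by
    refine ⟨⟨1, 0, fun h10 => ?_⟩⟩
    have h1 : (1 : A) ∈ RingHom.ker π := by rw [RingHom.mem_ker, map_one, h10]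
    rw [hker] at h1
    exact (IsLocalRing.maximalIdeal.isMaximal A).ne_top ((Ideal.eq_top_iff_one _).2 (hle h1))
  have : IsLocalRing T := IsLocalRing.of_surjective' π hπ
  have : IsNoetherianRing T := isNoetherianRing_of_surjective _ _ π hπ
  let : Algebra κ T := ((algebraMap (MonoidAlgebra κ F) T).comp (algebraMap κ _)).toAlgebra
  have : IsScalarTower κ (MonoidAlgebra κ F) T := .of_algebraMap_eq fun _ => rfl
  let π' : A →ₐ[κ] T := { π with
    commutes' := fun c => by
      change π (algebraMap κ A c) = _
      rw [IsScalarTower.algebraMap_apply κ (ChartRing κ h) A, hκ]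
      rfl }
  have : Algebra.EssFiniteType κ T := Algebra.EssFiniteType.of_surjective π' hπ
  have hsm : Algebra.FormallySmooth κ T :=
    formallySmooth_of_monoidAlgebra (G := F) (fun a b c e => Subtype.ext
        (hcan _ _ _ (congrArg Subtype.val e))) ⊤ 0 1
      (fun p => ⟨1, trivial, p, trivial, by simp⟩) (fun f _ => by
        rw [← hof f.1 f.2]
        refine IsUnit.map π ?_
        have := f.2
        by_contra hcon
        exact this hcon)
  -- primes of `T` are primes of `A` in the stratum of the closed point, so there is only one
  have hnil : IsNilpotent (IsLocalRing.maximalIdeal T) := by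
    have h1 : IsLocalRing.maximalIdeal T ≤ nilradical T := by
      rw [nilradical_eq_sInf]
      refine le_sInf fun q (hq : q.IsPrime) => ?_
      have hqc : q.comap π = IsLocalRing.maximalIdeal A := by
        refine huniq _ (le_antisymm (fun p hp => ?_) fun p hp => ?_)
        · by_contra hpF
          have : chartPsi κ h A p ∈ RingHom.ker π := by
            rw [hker]
            exact Ideal.subset_span ⟨p, hpF, rfl⟩
          refine hp ?_
          change π _ ∈ q
          rw [(RingHom.mem_ker).1 this]
          exact zero_mem _
        · intro hmem
          exact hp (IsLocalRing.le_maximalIdeal (Ideal.IsPrime.ne_top inferInstance) hmem)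
      intro x hx
      obtain ⟨a, rfl⟩ := hπ x
      change a ∈ q.comap π
      rw [hqc]
      intro ha
      exact hx (ha.map π)
    obtain ⟨n, hn⟩ := IsNoetherianRing.isNilpotent_nilradical T
    exact ⟨n, le_bot_iff.1 ((Ideal.pow_right_mono h1 n).trans hn.le)⟩
  -- a formally smooth local algebra with a nilpotent maximal ideal is a field in characteristic zero
  have hbot := maximalIdeal_eq_bot_of_formallySmooth (κ := κ) hnil
  refine le_antisymm (fun a ha => ?_) hle
  rw [← hker, RingHom.mem_ker, ← Ideal.mem_bot, ← hbot]
  intro hu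
  obtain ⟨b, hb⟩ := hu.exists_right_inv
  obtain ⟨b, rfl⟩ := hπ b
  have h1 : a * b - 1 ∈ IsLocalRing.maximalIdeal A := hle (by
    rw [← hker, RingHom.mem_ker, map_sub, map_mul, hb, map_one, sub_self])
  have h2 := (Submodule.sub_mem_iff_right _ (Ideal.mul_mem_right b _ ha)).1 h1
  exact (IsLocalRing.maximalIdeal.isMaximal A).ne_top ((Ideal.eq_top_iff_one _).2 h2)

/-- The local rings of a stratum whose monomials are powers of one monomial, up to units, are
smooth. -/
lemma formallySmooth_of_stratum (hcan : ∀ a b c : P, a * c = b * c → a = b) {G : Submonoid P}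
    (hG : IsFace G) (hρ : chartBase h ∉ G) (hzero : ∀ p ∉ G, chartPsi κ h A p = 0)
    (a : Additive P →+ ℕ) (g : P) (hg : g ∈ G)
    (ha : ∀ p ∈ G, ∃ f ∈ primeFace (chartPsi κ h A) (IsLocalRing.maximalIdeal A),
      ∃ f' ∈ primeFace (chartPsi κ h A) (IsLocalRing.maximalIdeal A),
      p * f = g ^ a (.ofMul p) * f') : Algebra.FormallySmooth κ A := by
  obtain ⟨T, _, _, π, hπ, hker, _, _, hof, hκ⟩ :=
    exists_face_quotient (κ := κ) h (A := A) G hG hρ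
  let : Algebra κ T := ((algebraMap (MonoidAlgebra κ G) T).comp (algebraMap κ _)).toAlgebra
  have : IsScalarTower κ (MonoidAlgebra κ G) T := .of_algebraMap_eq fun _ => rfl
  let π' : A →ₐ[κ] T := { π with
    commutes' := fun c => by
      change π (algebraMap κ A c) = _
      rw [IsScalarTower.algebraMap_apply κ (ChartRing κ h) A, hκ]
      rfl }
  have hinj : Function.Injective π := by
    rw [RingHom.injective_iff_ker_eq_bot, hker, Ideal.span_eq_bot]
    rintro _ ⟨p, hp, rfl⟩
    exact hzero p hp
  let F : Submonoid G :=
    (primeFace (chartPsi κ h A) (IsLocalRing.maximalIdeal A)).comap G.subtype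
  have hFG : ∀ f ∈ primeFace (chartPsi κ h A) (IsLocalRing.maximalIdeal A), f ∈ G := by
    intro f hf
    by_contra hcon
    exact hf (by rw [hzero f hcon]; exact zero_mem _)
  have : Algebra.FormallySmooth κ T :=
    formallySmooth_of_monoidAlgebra (G := G) (fun a b c e => Subtype.ext
        (hcan _ _ _ (congrArg Subtype.val e))) F (a.comp (MonoidHom.toAdditive G.subtype)) ⟨g, hg⟩
      (fun p => by
        obtain ⟨f, hf, f', hf', e⟩ := ha p p.2
        exact ⟨⟨f, hFG f hf⟩, hf, ⟨f', hFG f' hf'⟩, hf', Subtype.ext e⟩) (fun f hf => by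
        rw [← hof f.1 f.2]
        refine IsUnit.map π ?_
        by_contra hcon
        exact hf hcon)
  exact Algebra.FormallySmooth.of_equiv (AlgEquiv.ofBijective π' ⟨hinj, hπ⟩).symm

end LocalChart

/-! ### The degree of a principal divisor -/

section PrincipalDivisors

open Polynomial IsLocalRing

/-- A discrete valuation ring which contains a Dedekind domain with the same fraction field is a
local ring of this domain. -/
lemma isLocalization_of_isDiscreteValuationRing {B O K : Type*} [CommRing B] [IsDedekindDomain B]
    [CommRing O] [IsDomain O] [IsDiscreteValuationRing O] [Field K] [Algebra B K]
    [IsFractionRing B K] [Algebra O K] [IsFractionRing O K] [Algebra B O] [IsScalarTower B O K]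
    (hq : (maximalIdeal O).comap (algebraMap B O) ≠ ⊥) :
    IsLocalization.AtPrime O ((maximalIdeal O).comap (algebraMap B O)) := by
  set q := (maximalIdeal O).comap (algebraMap B O) with hqdef
  have hBK : Function.Injective (algebraMap B K) := IsFractionRing.injective B K
  have hOK : Function.Injective (algebraMap O K) := IsFractionRing.injective O K
  have hBO : Function.Injective (algebraMap B O) := by
    rw [IsScalarTower.algebraMap_eq B O K] at hBK
    exact Function.Injective.of_comp hBK
  have : IsDiscreteValuationRing (Localization.AtPrime q) :=
    IsLocalization.AtPrime.isDiscreteValuationRing_of_dedekind_domain B hq _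
  have hdvd : ∀ a b : B, (∃ s ∉ q, ∃ c, s * b = a * c) ∨ ∃ s ∉ q, ∃ c, s * a = b * c := by
    have key : ∀ a b : B, algebraMap B (Localization.AtPrime q) a ∣ algebraMap B _ b →
        ∃ s ∉ q, ∃ c, s * b = a * c := by
      rintro a b ⟨c, hc⟩
      obtain ⟨⟨c, s⟩, rfl⟩ := IsLocalization.mk'_surjective q.primeCompl c
      refine ⟨s, s.2, c, ?_⟩
      have h1 : algebraMap B (Localization.AtPrime q) (s * b) = algebraMap B _ (a * c) := by
        rw [map_mul, hc, map_mul, mul_left_comm, IsLocalization.mk'_spec']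
      exact IsLocalization.injective _ q.primeCompl_le_nonZeroDivisors h1
    intro a b
    exact (ValuationRing.dvd_total (algebraMap B (Localization.AtPrime q) a)
      (algebraMap B _ b)).imp (key a b) (key b a)
  refine
    { map_units := fun s => ?_
      surj := fun x => ?_
      exists_of_eq := fun {a b} e => ⟨1, by rw [hBO e]⟩ }
  · by_contra hcon
    exact s.2 hcon
  · obtain ⟨a, b, hb, hx⟩ := IsFractionRing.div_surjective (A := B) (algebraMap O K x)
    have hb0 : algebraMap B K b ≠ 0 := fun h0 =>
      nonZeroDivisors.ne_zero hb (hBK (by rw [h0, map_zero]))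
    have hxb : x * algebraMap B O b = algebraMap B O a := by
      apply hOK
      rw [map_mul, ← hx, ← IsScalarTower.algebraMap_apply, ← IsScalarTower.algebraMap_apply,
        div_mul_cancel₀ _ hb0]
    have hbO : algebraMap B O b ≠ 0 := fun h0 =>
      nonZeroDivisors.ne_zero hb (hBO (by rw [h0, map_zero]))
    rcases hdvd b a with ⟨s, hs, c, e⟩ | ⟨s, hs, c, e⟩
    · refine ⟨(c, ⟨s, hs⟩), mul_right_cancel₀ hbO ?_⟩
      change x * algebraMap B O s * algebraMap B O b = algebraMap B O c * algebraMap B O b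
      rw [← map_mul, mul_comm c, ← e, map_mul, mul_right_comm, hxb, mul_comm]
    · have h1 : x * algebraMap B O c = algebraMap B O s := by
        refine mul_right_cancel₀ hbO ?_
        rw [← map_mul, e, map_mul, mul_right_comm, hxb]
      refine ⟨(s, ⟨c, fun hc => hs ?_⟩), h1⟩
      change algebraMap B O s ∈ maximalIdeal O
      rw [← h1]
      exact Ideal.mul_mem_left _ _ hc

lemma ord_ringEquiv {O O' : Type*} [CommRing O] [IsDomain O] [IsDiscreteValuationRing O]
    [CommRing O'] [IsDomain O'] [IsDiscreteValuationRing O'] (e : O ≃+* O') {x : O} (hx : x ≠ 0) :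
    Ring.ord O' (e x) = Ring.ord O x := by
  obtain ⟨ϖ, hϖ⟩ := IsDiscreteValuationRing.exists_irreducible O
  obtain ⟨n, hn⟩ := IsDiscreteValuationRing.associated_pow_irreducible hx hϖ
  have h1 : Associated (e x) (e ϖ ^ n) := by
    rw [← map_pow]
    exact hn.map (e : O →* O')
  have h2 : Irreducible (e ϖ) := (MulEquiv.irreducible_iff e).2 hϖ
  rw [Ring.ord_eq_of_associated h1, Ring.ord_eq_of_associated hn,
    Ring.ord_pow (mem_nonZeroDivisors_of_ne_zero h2.ne_zero),
    Ring.ord_pow (mem_nonZeroDivisors_of_ne_zero hϖ.ne_zero),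
    Ring.ord_of_irreducible h2, Ring.ord_of_irreducible hϖ]

/-- The contribution of a zero `y` of the function `X` to the degree formula. -/
lemma ramificationIdx_mul_inertiaDeg {κ : Type*} [Field κ] {B O K : Type*} [CommRing B]
    [IsDedekindDomain B] [CommRing O] [IsDomain O] [IsDiscreteValuationRing O] [Field K]
    [Algebra B K] [IsFractionRing B K] [Algebra O K] [IsFractionRing O K] [Algebra B O]
    [IsScalarTower B O K] [Algebra κ[X] B] [Algebra κ[X] O] [IsScalarTower κ[X] B O]
    [Algebra κ O] [IsScalarTower κ κ[X] O] (hX0 : algebraMap κ[X] O X ≠ 0)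
    (hX : algebraMap κ[X] O X ∈ maximalIdeal O) :
    ((maximalIdeal O).comap (algebraMap B O)).LiesOver (Ideal.span {(X : κ[X])}) ∧
    ((maximalIdeal O).comap (algebraMap B O)).ramificationIdx κ[X] *
      ((maximalIdeal O).comap (algebraMap B O)).inertiaDeg κ[X] =
      (Ring.ord O (algebraMap κ[X] O X)).toNat * Module.finrank κ (ResidueField O) := by
  set q := (maximalIdeal O).comap (algebraMap B O) with hqdef
  have hpmax : (Ideal.span {(X : κ[X])}).IsMaximal :=
    PrincipalIdealRing.isMaximal_of_irreducible irreducible_X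
  have hXB : algebraMap κ[X] B X ∈ q := by
    change algebraMap B O (algebraMap κ[X] B X) ∈ maximalIdeal O
    rwa [← IsScalarTower.algebraMap_apply]
  have hq : q ≠ ⊥ := by
    intro h0
    rw [h0, Ideal.mem_bot] at hXB
    rw [IsScalarTower.algebraMap_apply κ[X] B O, hXB, map_zero] at hX0
    exact hX0 rfl
  have hloc : IsLocalization.AtPrime O q := isLocalization_of_isDiscreteValuationRing (K := K) hq
  have hover : q.LiesOver (Ideal.span {(X : κ[X])}) := by
    constructor
    refine hpmax.eq_of_le (Ideal.IsPrime.ne_top inferInstance) ?_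
    rw [Ideal.span_singleton_le_iff_mem]
    exact hXB
  have hqmax : q.IsMaximal := Ideal.IsPrime.isMaximal inferInstance hq
  refine ⟨hover, ?_⟩
  congr 1
  · rw [Ideal.ramificationIdx_eq (Ideal.span {(X : κ[X])}) q, Ideal.map_span,
      Set.image_singleton]
    have : IsDiscreteValuationRing (Localization.AtPrime q) :=
      IsLocalization.AtPrime.isDiscreteValuationRing_of_dedekind_domain B hq _
    let e := IsLocalization.algEquiv q.primeCompl (Localization.AtPrime q) O
    have h1 : e (algebraMap κ[X] (Localization.AtPrime q) X) = algebraMap κ[X] O X := by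
      rw [IsScalarTower.algebraMap_apply κ[X] B (Localization.AtPrime q), e.commutes,
        ← IsScalarTower.algebraMap_apply]
    have h2 := ord_ringEquiv e.toRingEquiv (x := algebraMap κ[X] (Localization.AtPrime q) X)
      (fun h0 => hX0 (by rw [← h1, h0, map_zero]))
    change Ring.ord O (e _) = _ at h2
    rw [h1] at h2
    rw [h2]
    rfl
  · rw [Ideal.inertiaDeg_eq_of_isMaximal (Ideal.span {(X : κ[X])}) q]
    symm
    let j : κ →+* κ[X] ⧸ Ideal.span {(X : κ[X])} := (Ideal.Quotient.mk _).comp C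
    have hj : Function.Bijective j := by
      refine ⟨j.injective, fun x => ?_⟩
      obtain ⟨x, rfl⟩ := Ideal.Quotient.mk_surjective x
      refine ⟨x.coeff 0, Ideal.Quotient.eq.2 ?_⟩
      rw [Ideal.mem_span_singleton, X_dvd_iff]
      simp
    let l : B ⧸ q ≃+* ResidueField O := IsLocalization.AtPrime.equivQuotMaximalIdeal q O
    refine Algebra.finrank_eq_of_equiv_equiv (RingEquiv.ofBijective j hj) l.symm ?_
    ext c
    rw [RingHom.comp_apply, RingHom.comp_apply]
    refine (RingEquiv.eq_symm_apply l).2 ?_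
    change l (Ideal.Quotient.mk q (algebraMap κ[X] B (C c))) = algebraMap κ (ResidueField O) c
    have : l (Ideal.Quotient.mk q (algebraMap κ[X] B (C c))) =
      IsLocalRing.residue O (algebraMap B O (algebraMap κ[X] B (C c))) := rfl
    rw [this, ← IsScalarTower.algebraMap_apply, ← Polynomial.algebraMap_eq,
      ← IsScalarTower.algebraMap_apply]
    rfl

/-- The elements of the local ring of a prime of a domain, as elements of the fraction field. -/
def IsRegularAt {B K : Type*} [CommRing B] [Field K] [Algebra B K] (q : Ideal B) (x : K) : Prop :=
  ∃ b s : B, s ∉ q ∧ x * algebraMap B K s = algebraMap B K b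

lemma mem_iff_not_isRegularAt {B K : Type*} [CommRing B] [Field K] [Algebra B K]
    [IsFractionRing B K] (q : Ideal B) [q.IsPrime] (b : B) :
    b ∈ q ↔ b = 0 ∨ ¬ IsRegularAt q (algebraMap B K b)⁻¹ := by
  have hBK : Function.Injective (algebraMap B K) := IsFractionRing.injective B K
  by_cases hb0 : b = 0
  · simp [hb0]
  have hb0' : algebraMap B K b ≠ 0 := fun h0 => hb0 (hBK (by rw [h0, map_zero]))
  simp only [hb0, false_or]
  constructor
  · rintro hb ⟨c, s, hs, e⟩
    rw [inv_mul_eq_iff_eq_mul₀ hb0', ← map_mul] at e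
    exact hs (hBK e ▸ Ideal.mul_mem_right _ _ hb)
  · intro h
    by_contra hb
    exact h ⟨1, b, hb, by rw [inv_mul_cancel₀ hb0', map_one]⟩

variable {κ K : Type*} [Field κ] [Field K] [Algebra κ K]

/-- The prime of the ring of functions integral over `κ[X]` which is defined by a zero of `X`. -/
lemma exists_prime_of_zero {O : Type*} [CommRing O] [IsDomain O] [IsDiscreteValuationRing O]
    [Algebra κ O] [Algebra O K] [IsScalarTower κ O K] [IsFractionRing O K]
    [Algebra κ[X] K] [IsScalarTower κ κ[X] K]
    [IsDedekindDomain (integralClosure κ[X] K)] [IsFractionRing (integralClosure κ[X] K) K]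
    (hX0 : algebraMap κ[X] K X ≠ 0) (n : ℕ) (hn0 : 0 < n) (ϖ u : O) (hϖ : Irreducible ϖ)
    (hu : IsUnit u) (hn : algebraMap κ[X] K X = algebraMap O K (u * ϖ ^ n)) :
    ∃ q ∈ (Ideal.span {(X : κ[X])}).primesOver (integralClosure κ[X] K),
      q.ramificationIdx κ[X] * q.inertiaDeg κ[X] = n * Module.finrank κ (ResidueField O) ∧
      ∀ x : K, (∃ a, algebraMap O K a = x) ↔ IsRegularAt q x := by
  have hOK : Function.Injective (algebraMap O K) := IsFractionRing.injective O K
  let : Algebra κ[X] O := (aeval (u * ϖ ^ n)).toAlgebra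
  have hXO : algebraMap κ[X] O X = u * ϖ ^ n := aeval_X _
  have : IsScalarTower κ κ[X] O := .of_algebraMap_eq fun c =>
    ((aeval (u * ϖ ^ n) : κ[X] →ₐ[κ] O).commutes c).symm
  have : IsScalarTower κ[X] O K := by
    refine .of_algebraMap_eq' ?_
    refine Polynomial.ringHom_ext (fun c => ?_) ?_
    · rw [RingHom.comp_apply, ← Polynomial.algebraMap_eq,
        ← IsScalarTower.algebraMap_apply κ κ[X] K, ← IsScalarTower.algebraMap_apply κ κ[X] O,
        ← IsScalarTower.algebraMap_apply κ O K]
    · rw [RingHom.comp_apply, hXO, hn]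
  -- `O` is integrally closed and contains `X`
  have hmem : ∀ b : integralClosure κ[X] K, algebraMap _ K b ∈ (algebraMap O K).range := fun b =>
    IsIntegrallyClosed.isIntegral_iff.1 (IsIntegral.tower_top (A := O) b.2)
  let e : O ≃+* (algebraMap O K).range := RingEquiv.ofBijective (algebraMap O K).rangeRestrict
    ⟨fun a b hab => hOK (congrArg Subtype.val hab), (algebraMap O K).rangeRestrict_surjective⟩
  let j : integralClosure κ[X] K →+* O := (e.symm : _ →+* O).comp
    ((algebraMap (integralClosure κ[X] K) K).codRestrict _ hmem)
  have hj : ∀ b, algebraMap O K (j b) = algebraMap _ K b := fun b =>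
    congrArg Subtype.val (e.apply_symm_apply
      ((algebraMap (integralClosure κ[X] K) K).codRestrict _ hmem b))
  let : Algebra (integralClosure κ[X] K) O := j.toAlgebra
  have : IsScalarTower (integralClosure κ[X] K) O K := .of_algebraMap_eq fun b => (hj b).symm
  have : IsScalarTower κ[X] (integralClosure κ[X] K) O := .of_algebraMap_eq fun b => by
    apply hOK
    change _ = algebraMap O K (j _)
    rw [hj, ← IsScalarTower.algebraMap_apply, ← IsScalarTower.algebraMap_apply]
  have hXm : algebraMap κ[X] O X ∈ maximalIdeal O := by
    rw [hXO]
    exact Ideal.mul_mem_left _ _ (Ideal.pow_mem_of_mem _ hϖ.not_isUnit _ hn0)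
  have hXO0 : algebraMap κ[X] O X ≠ 0 := by
    intro h0
    rw [IsScalarTower.algebraMap_apply κ[X] O K, h0, map_zero] at hX0
    exact hX0 rfl
  obtain ⟨h1, h2⟩ := ramificationIdx_mul_inertiaDeg (κ := κ) (K := K)
    (B := integralClosure κ[X] K) hXO0 hXm
  have hord : Ring.ord O (algebraMap κ[X] O X) = n := by
    rw [hXO, Ring.ord_mul_of_isUnit_left hu,
      Ring.ord_pow (mem_nonZeroDivisors_of_ne_zero hϖ.ne_zero), Ring.ord_of_irreducible hϖ]
    simp
  rw [hord] at h2
  refine ⟨_, ⟨inferInstance, h1⟩, h2, fun x => ?_⟩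
  have hq : (maximalIdeal O).comap (algebraMap (integralClosure κ[X] K) O) ≠ ⊥ := by
    intro h0
    have : algebraMap κ[X] (integralClosure κ[X] K) X ∈
        (maximalIdeal O).comap (algebraMap (integralClosure κ[X] K) O) := by
      rw [Ideal.mem_comap, ← IsScalarTower.algebraMap_apply]
      exact hXm
    rw [h0, Ideal.mem_bot] at this
    apply hXO0
    rw [IsScalarTower.algebraMap_apply κ[X] (integralClosure κ[X] K) O, this, map_zero]
  have hloc := isLocalization_of_isDiscreteValuationRing (K := K) hq
  constructor
  · rintro ⟨a, rfl⟩
    obtain ⟨⟨b, s⟩, e⟩ := IsLocalization.surj (Ideal.primeCompl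
      ((maximalIdeal O).comap (algebraMap (integralClosure κ[X] K) O))) a
    refine ⟨b, s, s.2, ?_⟩
    rw [IsScalarTower.algebraMap_apply (integralClosure κ[X] K) O K, ← map_mul, e,
      ← IsScalarTower.algebraMap_apply]
  · rintro ⟨b, s, hs, e⟩
    have hs' : IsUnit (algebraMap (integralClosure κ[X] K) O s) := by
      by_contra hcon
      exact hs hcon
    obtain ⟨v, hv⟩ := hs'.exists_right_inv
    refine ⟨algebraMap _ O b * v, ?_⟩
    rw [map_mul, ← IsScalarTower.algebraMap_apply, ← e,
      IsScalarTower.algebraMap_apply (integralClosure κ[X] K) O K, mul_assoc, ← map_mul, hv,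
      map_one, mul_one]

/-- The valuation ring of a nonzero prime of a Dedekind domain. -/
lemma exists_valuationSubring {B : Type*} [CommRing B] [IsDedekindDomain B] [Algebra B K]
    [IsFractionRing B K] (q : Ideal B) [q.IsPrime] (hq : q ≠ ⊥) :
    ∃ V : ValuationSubring K, ∀ x, x ∈ V ↔ IsRegularAt q x := by
  have : IsDiscreteValuationRing (Localization.AtPrime q) :=
    IsLocalization.AtPrime.isDiscreteValuationRing_of_dedekind_domain B hq _
  let : Algebra (Localization.AtPrime q) K :=
    IsLocalization.localizationAlgebraOfSubmonoidLe (Localization.AtPrime q) K q.primeCompl (nonZeroDivisors B)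
      q.primeCompl_le_nonZeroDivisors
  have : IsScalarTower B (Localization.AtPrime q) K :=
    IsLocalization.localization_isScalarTower_of_submonoid_le _ _ _ _ _
  have : IsFractionRing (Localization.AtPrime q) K :=
    IsFractionRing.isFractionRing_of_isDomain_of_isLocalization q.primeCompl _ _
  refine ⟨(ValuationRing.valuation (Localization.AtPrime q) K).valuationSubring, fun x => ?_⟩
  have h1 : x ∈ (ValuationRing.valuation (Localization.AtPrime q) K).valuationSubring ↔
      ∃ a, algebraMap (Localization.AtPrime q) K a = x :=
    ValuationRing.mem_integer_iff _ _ x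
  rw [h1]
  have hne : ∀ s ∉ q, algebraMap B K s ≠ 0 := fun s hs h0 => hs (by
    rw [(IsFractionRing.injective B K) (h0.trans (map_zero _).symm)]
    exact zero_mem _)
  constructor
  · rintro ⟨a, rfl⟩
    obtain ⟨⟨b, s⟩, e⟩ := IsLocalization.surj q.primeCompl a
    refine ⟨b, s, s.2, ?_⟩
    rw [IsScalarTower.algebraMap_apply B (Localization.AtPrime q) K, ← map_mul, e,
      ← IsScalarTower.algebraMap_apply]
  · rintro ⟨b, s, hs, e⟩
    refine ⟨IsLocalization.mk' (M := q.primeCompl) _ b ⟨s, hs⟩, mul_right_cancel₀ (hne s hs) ?_⟩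
    rw [e, IsScalarTower.algebraMap_apply B (Localization.AtPrime q) K, ← map_mul,
      show IsLocalization.mk' (M := q.primeCompl) _ b ⟨s, hs⟩ * algebraMap B (Localization.AtPrime q) s = _ from
        IsLocalization.mk'_spec _ b (⟨s, hs⟩ : q.primeCompl), ← IsScalarTower.algebraMap_apply]

open IntermediateField

/-- The number of zeros of a transcendental function is the degree of the field extension which it
defines. -/
theorem finsum_zeros [CharZero κ] {Y : Type*} (O : Y → Type*) [∀ y, CommRing (O y)]
    [∀ y, IsDomain (O y)] [∀ y, IsDiscreteValuationRing (O y)] [∀ y, Algebra κ (O y)]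
    [∀ y, Algebra (O y) K] [∀ y, IsScalarTower κ (O y) K] [∀ y, IsFractionRing (O y) K]
    (hinj : ∀ y y', (∀ x : K, (∃ a, algebraMap (O y) K a = x) ↔ ∃ a, algebraMap (O y') K a = x) →
      y = y')
    (hsurj : ∀ V : ValuationSubring K, (∀ c : κ, algebraMap κ K c ∈ V) → (∃ x, x ∉ V) →
      ∃ y, ∀ x, (∃ a, algebraMap (O y) K a = x) ↔ x ∈ V)
    (f : K) (hf : Transcendental κ f) [FiniteDimensional κ⟮f⟯ K] (n : Y → ℤ)
    (hn : ∀ y, ∃ ϖ u : O y, Irreducible ϖ ∧ IsUnit u ∧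
      f = algebraMap (O y) K u * algebraMap (O y) K ϖ ^ n y) :
    {y | 0 < n y}.Finite ∧
    ∑ᶠ y, (Module.finrank κ (ResidueField (O y)) : ℤ) * max (n y) 0 =
      Module.finrank κ⟮f⟯ K := by
  let : Algebra κ[X] K := (aeval f).toAlgebra
  have hXf : algebraMap κ[X] K X = f := aeval_X f
  have : IsScalarTower κ κ[X] K := .of_algebraMap_eq fun c =>
    ((aeval f : κ[X] →ₐ[κ] K).commutes c).symm
  let : Algebra κ[X] κ⟮f⟯ := (aeval (AdjoinSimple.gen κ f)).toAlgebra
  have hgen : ∀ p : κ[X], algebraMap κ⟮f⟯ K (algebraMap κ[X] κ⟮f⟯ p) = aeval f p := by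
    intro p
    change algebraMap κ⟮f⟯ K (aeval (AdjoinSimple.gen κ f) p) = _
    rw [← aeval_algebraMap_apply, AdjoinSimple.algebraMap_gen]
  have : IsScalarTower κ[X] κ⟮f⟯ K := .of_algebraMap_eq fun p => (hgen p).symm
  have hinjX : Function.Injective (aeval f : κ[X] →ₐ[κ] K) :=
    transcendental_iff_injective.1 hf
  have hinjL : Function.Injective (algebraMap κ[X] κ⟮f⟯) := fun p p' e => hinjX (by
    rw [← hgen, e, hgen])
  have : FaithfulSMul κ[X] κ⟮f⟯ := (faithfulSMul_iff_algebraMap_injective _ _).2 hinjL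
  have : IsFractionRing κ[X] κ⟮f⟯ := by
    refine IsFractionRing.of_field _ _ fun z => ?_
    obtain ⟨r, s, e⟩ := (mem_adjoin_simple_iff κ (z : K)).1 z.2
    refine ⟨r, s, Subtype.ext ?_⟩
    change (z : K) = algebraMap κ⟮f⟯ K (algebraMap _ _ r / algebraMap _ _ s)
    rw [map_div₀, hgen, hgen, e]
  have : CharZero κ⟮f⟯ := charZero_of_injective_algebraMap (algebraMap κ κ⟮f⟯).injective
  have : IsDedekindDomain (integralClosure κ[X] K) :=
    integralClosure.isDedekindDomain κ[X] κ⟮f⟯ K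
  have : IsFractionRing (integralClosure κ[X] K) K :=
    integralClosure.isFractionRing_of_finite_extension κ⟮f⟯ K
  have : Module.Finite κ[X] (integralClosure κ[X] K) :=
    IsIntegralClosure.finite κ[X] κ⟮f⟯ K _
  have hinjB : Function.Injective (algebraMap κ[X] (integralClosure κ[X] K)) := by
    have h1 : Function.Injective (algebraMap κ[X] K) := hinjX
    rw [IsScalarTower.algebraMap_eq κ[X] (integralClosure κ[X] K) K, RingHom.coe_comp] at h1
    exact Function.Injective.of_comp h1
  have : FaithfulSMul κ[X] (integralClosure κ[X] K) :=
    (faithfulSMul_iff_algebraMap_injective _ _).2 hinjB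
  have : Module.IsTorsionFree κ[X] (integralClosure κ[X] K) := inferInstance
  have : Module.Free κ[X] (integralClosure κ[X] K) := inferInstance
  have hpmax : (Ideal.span {(X : κ[X])}).IsMaximal :=
    PrincipalIdealRing.isMaximal_of_irreducible irreducible_X
  have hfin := IsDedekindDomain.primesOver_finite (Ideal.span {(X : κ[X])})
    (integralClosure κ[X] K)
  let : Fintype ((Ideal.span {(X : κ[X])}).primesOver (integralClosure κ[X] K)) := hfin.fintype
  -- the formula `∑ e f = n` for the primes over zero
  have hsum := Ideal.sum_ramification_inertia_eq_finrank (Ideal.span {(X : κ[X])})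
    (integralClosure κ[X] K)
  rw [← IsFractionRing.finrank_eq κ[X] κ⟮f⟯ (integralClosure κ[X] K) K] at hsum
  have hf0 : f ≠ 0 := by
    rintro rfl
    exact hf (isAlgebraic_zero)
  have hX0 : algebraMap κ[X] K X ≠ 0 := by rwa [hXf]
  have hprime : ∀ y : {y // 0 < n y},
      ∃ q ∈ (Ideal.span {(X : κ[X])}).primesOver (integralClosure κ[X] K),
      ((q.ramificationIdx κ[X] * q.inertiaDeg κ[X] : ℕ) : ℤ) =
        Module.finrank κ (ResidueField (O y)) * max (n y) 0 ∧
      ∀ x : K, (∃ a, algebraMap (O y) K a = x) ↔ IsRegularAt q x := by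
    rintro ⟨y, hy⟩
    obtain ⟨ϖ, u, hϖ, hu, e⟩ := hn y
    obtain ⟨k, hk⟩ := Int.eq_ofNat_of_zero_le hy.le
    have hk0 : 0 < k := by omega
    obtain ⟨q, hq, h1, h2⟩ := exists_prime_of_zero (κ := κ) (K := K) (O := O y) hX0 k hk0 ϖ u hϖ hu
      (by rw [hXf, e, hk, map_mul, map_pow, zpow_natCast])
    refine ⟨q, hq, ?_, h2⟩
    rw [h1, hk]
    push_cast
    rw [max_eq_left (by positivity), mul_comm]
  choose q hq hqn hqx using hprime
  let F : {y // 0 < n y} → (Ideal.span {(X : κ[X])}).primesOver (integralClosure κ[X] K) :=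
    fun y => ⟨q y, hq y⟩
  have hext : ∀ (q q' : Ideal (integralClosure κ[X] K)) [q.IsPrime] [q'.IsPrime],
      (∀ x : K, IsRegularAt q x ↔ IsRegularAt q' x) → q = q' := by
    intro q q' _ _ h
    ext b
    rw [mem_iff_not_isRegularAt (K := K), mem_iff_not_isRegularAt (K := K) q', h]
  -- zeros of `f` correspond to primes over zero, since both are determined by their valuation rings
  have hF : Function.Bijective F := by
    constructor
    · intro y y' e
      have e' : q y = q y' := congrArg Subtype.val e
      refine Subtype.ext (hinj _ _ fun x => ?_)
      rw [hqx y, hqx y', e']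
    · rintro ⟨p, hp⟩
      have hpp : p.IsPrime := hp.1
      have hover := hp.2
      have hXp : algebraMap κ[X] (integralClosure κ[X] K) X ∈ p := by
        change X ∈ p.comap (algebraMap κ[X] (integralClosure κ[X] K))
        rw [← Ideal.under_def, ← hover.over]
        exact Ideal.mem_span_singleton_self _
      have hp0 : p ≠ ⊥ := by
        rintro rfl
        rw [Ideal.mem_bot, ← map_zero (algebraMap κ[X] (integralClosure κ[X] K))] at hXp
        exact X_ne_zero (hinjB hXp)
      have hfp : ¬ IsRegularAt p f⁻¹ := by
        have := ((mem_iff_not_isRegularAt (K := K) p _).1 hXp).resolve_left fun h0 => by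
          rw [h0] at hXp
          exact X_ne_zero (hinjB (h0.trans (map_zero _).symm))
        rwa [← IsScalarTower.algebraMap_apply, hXf] at this
      -- the local ring of `p` is the local ring of a point `y`, which is a zero of `f`
      obtain ⟨V, hV⟩ := exists_valuationSubring (K := K) p hp0
      have hreg : ∀ b : integralClosure κ[X] K, IsRegularAt p (algebraMap _ K b) := fun b =>
        ⟨b, 1, fun h1 => hpp.ne_top ((Ideal.eq_top_iff_one _).2 h1), by rw [map_one, mul_one]⟩
      obtain ⟨y, hy⟩ := hsurj V (fun c => (hV _).2 (by
          rw [IsScalarTower.algebraMap_apply κ (integralClosure κ[X] K) K]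
          exact hreg _)) ⟨f⁻¹, fun hm => hfp ((hV _).1 hm)⟩
      have hny : 0 < n y := by
        by_contra hcon
        obtain ⟨ϖ, u, hϖ, hu, e⟩ := hn y
        obtain ⟨v, hv⟩ := hu.exists_right_inv
        obtain ⟨k, hk⟩ := Int.eq_ofNat_of_zero_le (neg_nonneg.2 (not_lt.1 hcon))
        apply hfp
        rw [← hV, ← hy]
        refine ⟨v * ϖ ^ k, ?_⟩
        have huv : algebraMap (O y) K u * algebraMap (O y) K v = 1 := by rw [← map_mul, hv, map_one]
        rw [e, mul_inv, ← zpow_neg, hk, map_mul, map_pow, zpow_natCast,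
          eq_inv_of_mul_eq_one_right huv]
      refine ⟨⟨y, hny⟩, Subtype.ext ?_⟩
      have : (q ⟨y, hny⟩).IsPrime := (hq ⟨y, hny⟩).1
      exact hext _ _ fun x => by rw [← hqx, hy, hV]
  have hfinY : {y | 0 < n y}.Finite := Set.finite_coe_iff.1 (Finite.of_injective F hF.1)
  refine ⟨hfinY, ?_⟩
  have h1 : ∑ᶠ y, (Module.finrank κ (ResidueField (O y)) : ℤ) * max (n y) 0 =
      ∑ᶠ y : {y // 0 < n y}, (Module.finrank κ (ResidueField (O y)) : ℤ) * max (n y) 0 := by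
    rw [finsum_subtype_eq_finsum_cond (fun y => 0 < n y)
      (f := fun y => (Module.finrank κ (ResidueField (O y)) : ℤ) * max (n y) 0)]
    refine finsum_congr fun y => ?_
    by_cases h : 0 < n y
    · simp [h]
    · simp [h, max_eq_right (not_lt.1 h)]
  have h2 : ∀ y : {y // 0 < n y},
      (Module.finrank κ (ResidueField (O y)) : ℤ) * max (n y) 0 =
        (((F y).1.ramificationIdx κ[X] * (F y).1.inertiaDeg κ[X] : ℕ) : ℤ) :=
    fun y => (hqn y).symm
  rw [h1, finsum_eq_of_bijective (g := fun p : (Ideal.span {(X : κ[X])}).primesOver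
    (integralClosure κ[X] K) => ((p.1.ramificationIdx κ[X] * p.1.inertiaDeg κ[X] : ℕ) : ℤ)) F hF h2,
    finsum_eq_sum_of_fintype, ← Nat.cast_sum, hsum]

/-- The degree of the principal divisor of a nonzero function on a complete curve is zero. The
points of the curve are given by their local rings, which are all the valuation rings over `κ`. -/
theorem finsum_ord_eq_zero [CharZero κ] {Y : Type*} (O : Y → Type*) [∀ y, CommRing (O y)]
    [∀ y, IsDomain (O y)] [∀ y, IsDiscreteValuationRing (O y)] [∀ y, Algebra κ (O y)]
    [∀ y, Algebra (O y) K] [∀ y, IsScalarTower κ (O y) K] [∀ y, IsFractionRing (O y) K]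
    (hinj : ∀ y y', (∀ x : K, (∃ a, algebraMap (O y) K a = x) ↔ ∃ a, algebraMap (O y') K a = x) →
      y = y')
    (hsurj : ∀ V : ValuationSubring K, (∀ c : κ, algebraMap κ K c ∈ V) → (∃ x, x ∉ V) →
      ∃ y, ∀ x, (∃ a, algebraMap (O y) K a = x) ↔ x ∈ V)
    [Algebra.EssFiniteType κ K] (htr : Algebra.trdeg κ K ≤ 1) (f : K) (hf0 : f ≠ 0) (n : Y → ℤ)
    (hn : ∀ y, ∃ ϖ u : O y, Irreducible ϖ ∧ IsUnit u ∧
      f = algebraMap (O y) K u * algebraMap (O y) K ϖ ^ n y) :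
    {y | n y ≠ 0}.Finite ∧
    ∑ᶠ y, (Module.finrank κ (ResidueField (O y)) : ℤ) * n y = 0 := by
  by_cases hf : Transcendental κ f
  · have halg : Algebra.IsAlgebraic κ⟮f⟯ K := by
      have h1 : AlgebraicIndependent κ fun _ : Unit => f :=
        (algebraicIndependent_unique_type_iff).2 hf
      have h2 : IsTranscendenceBasis κ fun _ : Unit => f :=
        h1.isTranscendenceBasis_of_lift_trdeg_le_of_finite (by simpa using htr)
      have h3 := h2.isAlgebraic_field
      rwa [Set.range_const] at h3
    have : Algebra.EssFiniteType κ⟮f⟯ K := Algebra.EssFiniteType.of_comp κ κ⟮f⟯ K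
    have : FiniteDimensional κ⟮f⟯ K := Algebra.finite_of_essFiniteType_of_isAlgebraic
    have hf' : κ⟮f⁻¹⟯ = κ⟮f⟯ := by
      refine le_antisymm (adjoin_simple_le_iff.2 (inv_mem (mem_adjoin_simple_self κ f)))
        (adjoin_simple_le_iff.2 ?_)
      have := inv_mem (mem_adjoin_simple_self κ f⁻¹)
      rwa [inv_inv] at this
    have : FiniteDimensional κ⟮f⁻¹⟯ K := by rwa [hf']
    -- `f` has as many zeros as poles, which are the zeros of `f⁻¹`, because `κ(f) = κ(f⁻¹)`
    obtain ⟨h1, h2⟩ := finsum_zeros O hinj hsurj f hf n hn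
    obtain ⟨h3, h4⟩ := finsum_zeros O hinj hsurj f⁻¹ (fun h => hf (by simpa using h.inv))
      (fun y => - n y) (fun y => by
        obtain ⟨ϖ, u, hϖ, hu, e⟩ := hn y
        obtain ⟨v, hv⟩ := hu.exists_right_inv
        refine ⟨ϖ, v, hϖ, IsUnit.of_mul_eq_one_right u hv, ?_⟩
        have huv : algebraMap (O y) K u * algebraMap (O y) K v = 1 := by rw [← map_mul, hv, map_one]
        rw [e, mul_inv, ← zpow_neg, eq_inv_of_mul_eq_one_right huv])
    rw [hf'] at h4
    refine ⟨(h1.union h3).subset fun y hy => ?_, ?_⟩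
    · rcases lt_or_gt_of_ne (show n y ≠ 0 from hy) with h | h
      · exact Or.inr (neg_pos.2 h)
      · exact Or.inl h
    · have h5 : ∀ y, (Module.finrank κ (ResidueField (O y)) : ℤ) * n y =
          (Module.finrank κ (ResidueField (O y)) : ℤ) * max (n y) 0 -
          (Module.finrank κ (ResidueField (O y)) : ℤ) * max (- n y) 0 := by
        intro y
        rw [← mul_sub]
        congr 1
        omega
      rw [finsum_congr h5, finsum_sub_distrib, h2, h4, sub_self]
      · refine h1.subset fun y hy => ?_
        by_contra hcon
        exact hy (by
          dsimp only
          rw [max_eq_right (not_lt.1 hcon), mul_zero])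
      · refine h3.subset fun y hy => ?_
        by_contra hcon
        exact hy (by
          dsimp only
          rw [max_eq_right (not_lt.1 hcon), mul_zero])
  · -- a constant function is a unit in all local rings
    have h0 : ∀ y, n y = 0 := by
      intro y
      obtain ⟨ϖ, u, hϖ, hu, e⟩ := hn y
      have hfa : IsIntegral κ f := (not_not.1 hf : IsAlgebraic κ f).isIntegral
      have hfa' : IsIntegral κ f⁻¹ := (not_not.1 hf : IsAlgebraic κ f).inv.isIntegral
      obtain ⟨a, ha⟩ := IsIntegrallyClosed.isIntegral_iff.1 (hfa.tower_top (A := O y))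
      obtain ⟨b, hb⟩ := IsIntegrallyClosed.isIntegral_iff.1 (hfa'.tower_top (A := O y))
      have hOK : Function.Injective (algebraMap (O y) K) := IsFractionRing.injective _ _
      have hab : a * b = 1 := hOK (by rw [map_mul, ha, hb, map_one, mul_inv_cancel₀ hf0])
      have hua := IsUnit.of_mul_eq_one b hab
      have hϖ0 : algebraMap (O y) K ϖ ≠ 0 := fun h => hϖ.ne_zero (hOK (h.trans (map_zero _).symm))
      rcases Int.natAbs_eq (n y) with hk | hk
      · rw [hk, zpow_natCast, ← ha, ← map_pow, ← map_mul] at e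
        rw [hOK e] at hua
        by_contra hne
        have := isUnit_of_mul_isUnit_right hua
        exact hϖ.not_isUnit ((isUnit_pow_iff (Int.natAbs_ne_zero.2 hne)).1 this)
      · rw [hk, zpow_neg, zpow_natCast, ← ha, ← map_pow] at e
        have e2 : a * ϖ ^ (n y).natAbs = u := hOK (by
          rw [map_mul, e, mul_assoc, inv_mul_cancel₀, mul_one]
          rw [map_pow]
          exact pow_ne_zero _ hϖ0)
        rw [← e2] at hu
        by_contra hne
        have := isUnit_of_mul_isUnit_right hu
        exact hϖ.not_isUnit ((isUnit_pow_iff (Int.natAbs_ne_zero.2 hne)).1 this)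
    refine ⟨?_, ?_⟩
    · simp [h0]
    · simp [h0]

end PrincipalDivisors

/-! ### Normalization of affine curves -/

section AffineNormalization

variable {κ : Type u} [Field κ]

/-- The function field of an affine curve has transcendence degree at most one. -/
lemma trdeg_le_one_of_dimensionLEOne {B K : Type u} [CommRing B] [IsDomain B] [Algebra κ B]
    [Algebra.FiniteType κ B] [Ring.DimensionLEOne B] [Field K] [Algebra B K] [IsFractionRing B K]
    [Algebra κ K] [IsScalarTower κ B K] : Algebra.trdeg κ K ≤ 1 := by
  obtain ⟨s, g, hg, hfin⟩ := exists_finite_inj_algHom_of_fg κ B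
  let : Algebra (MvPolynomial (Fin s) κ) B := g.toRingHom.toAlgebra
  have : IsScalarTower κ (MvPolynomial (Fin s) κ) B := .of_algebraMap_eq fun c => (g.commutes c).symm
  have hfin' : Module.Finite (MvPolynomial (Fin s) κ) B := hfin
  have : FaithfulSMul (MvPolynomial (Fin s) κ) B := (faithfulSMul_iff_algebraMap_injective _ _).2 hg
  have hdim : Ring.DimensionLEOne (MvPolynomial (Fin s) κ) := by
    refine ⟨fun {p} hp hpp => ?_⟩
    obtain ⟨q, -, hq, hqp⟩ := Ideal.exists_ideal_over_prime_of_isIntegral (S := B) p (⊥ : Ideal B) (by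
      intro x hx
      have : algebraMap _ B x = 0 := hx
      rw [← map_zero (algebraMap (MvPolynomial (Fin s) κ) B)] at this
      rw [hg this]
      exact zero_mem _)
    have hq0 : q ≠ ⊥ := by
      rintro rfl
      apply hp
      exact hqp.symm.trans (Ideal.comap_bot_of_injective _ hg)
    have := hq.isMaximal hq0
    rw [← hqp]
    exact Ideal.isMaximal_comap_of_isIntegral_of_isMaximal q
  have hs : s ≤ 1 := by
    have h1 : Ring.KrullDimLE 1 (MvPolynomial (Fin s) κ) := inferInstance
    have h2 := (Ring.krullDimLE_iff).1 h1
    rw [MvPolynomial.ringKrullDim_of_isNoetherianRing, ringKrullDim_eq_zero_of_field] at h2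
    simpa using h2
  let : Algebra (MvPolynomial (Fin s) κ) K := ((algebraMap B K).comp (algebraMap _ B)).toAlgebra
  have : IsScalarTower (MvPolynomial (Fin s) κ) B K := .of_algebraMap_eq fun _ => rfl
  have : IsScalarTower κ (MvPolynomial (Fin s) κ) K := .of_algebraMap_eq fun c => by
    rw [IsScalarTower.algebraMap_apply κ B K, IsScalarTower.algebraMap_apply κ (MvPolynomial (Fin s) κ) B]
    rfl
  have : FaithfulSMul (MvPolynomial (Fin s) κ) K := (faithfulSMul_iff_algebraMap_injective _ _).2
    ((IsFractionRing.injective B K).comp hg)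
  have : Algebra.IsAlgebraic B K := IsLocalization.isAlgebraic K (nonZeroDivisors B)
  have : Algebra.IsAlgebraic (MvPolynomial (Fin s) κ) K := Algebra.IsAlgebraic.trans _ B _
  have h0 : Algebra.trdeg (MvPolynomial (Fin s) κ) K = 0 := trdeg_eq_zero
  rw [← trdeg_add_eq κ (MvPolynomial (Fin s) κ) (A := K), h0, add_zero,
    MvPolynomial.trdeg_of_isDomain]
  simpa using hs

variable {A B K : Type u} [CommRing A] [CommRing B] [Field K] [Algebra κ A] [Algebra A B]
  [Algebra B K] [Algebra A K] [IsScalarTower A B K]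

/-- The normalization of an integral affine curve over a field of characteristic zero is finite, and
it is the spectrum of a Dedekind domain. -/
theorem isDedekindDomain_of_isIntegralClosure [CharZero κ] [Algebra.FiniteType κ A]
    [IsIntegralClosure B A K]
    (hfrac : ∀ x : K, ∃ r s : A, algebraMap A K s ≠ 0 ∧ x * algebraMap A K s = algebraMap A K r)
    (hdim : ∀ q m : Ideal A, q.IsPrime → m.IsPrime → RingHom.ker (algebraMap A K) ≤ q → q ≤ m →
      q = RingHom.ker (algebraMap A K) ∨ q = m) :
    IsDedekindDomain B ∧ IsFractionRing B K ∧ Module.Finite A B := by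
  have hBK : Function.Injective (algebraMap B K) := IsIntegralClosure.algebraMap_injective B A K
  have hBdom : IsDomain B := Function.Injective.isDomain _ hBK
  let I := RingHom.ker (algebraMap A K)
  have hI : I.IsPrime := RingHom.ker_isPrime _
  let : Algebra (A ⧸ I) K := (Ideal.Quotient.lift I (algebraMap A K) fun a ha => ha).toAlgebra
  let : Algebra (A ⧸ I) B := (Ideal.Quotient.lift I (algebraMap A B) fun a ha => hBK (by
    rw [← IsScalarTower.algebraMap_apply, map_zero]; exact ha)).toAlgebra
  have : IsScalarTower A (A ⧸ I) K := .of_algebraMap_eq fun _ => rfl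
  have : IsScalarTower A (A ⧸ I) B := .of_algebraMap_eq fun _ => rfl
  have : IsScalarTower (A ⧸ I) B K := .of_algebraMap_eq fun x => by
    obtain ⟨x, rfl⟩ := Ideal.Quotient.mk_surjective x
    exact IsScalarTower.algebraMap_apply A B K x
  have hAK : Function.Injective (algebraMap (A ⧸ I) K) := RingHom.kerLift_injective (algebraMap A K)
  have : FaithfulSMul (A ⧸ I) K := (faithfulSMul_iff_algebraMap_injective _ _).2 hAK
  have : IsFractionRing (A ⧸ I) K := by
    refine IsFractionRing.of_field _ _ fun z => ?_
    obtain ⟨r, s, hs, e⟩ := hfrac z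
    exact ⟨Ideal.Quotient.mk I r, Ideal.Quotient.mk I s, (eq_div_iff hs).2 e⟩
  have : FaithfulSMul B K := (faithfulSMul_iff_algebraMap_injective _ _).2 hBK
  have hBfrac : IsFractionRing B K := by
    refine IsFractionRing.of_field _ _ fun z => ?_
    obtain ⟨r, s, hs, e⟩ := hfrac z
    refine ⟨algebraMap A B r, algebraMap A B s, ?_⟩
    rw [← IsScalarTower.algebraMap_apply, ← IsScalarTower.algebraMap_apply]
    exact (eq_div_iff hs).2 e
  have hdim' : Ring.DimensionLEOne (A ⧸ I) := by
    refine ⟨fun {q} hq hqp => ?_⟩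
    obtain ⟨m, hm, hqm⟩ := Ideal.exists_le_maximal q hqp.ne_top
    have hsur := Ideal.Quotient.mk_surjective (I := I)
    rcases hdim (q.comap (Ideal.Quotient.mk I)) (m.comap (Ideal.Quotient.mk I)) inferInstance
      inferInstance (fun a ha => by
        rw [Ideal.mem_comap, Ideal.Quotient.eq_zero_iff_mem.2 ha]; exact zero_mem _)
      (Ideal.comap_mono hqm) with h | h
    · exfalso
      apply hq
      rw [eq_bot_iff]
      intro x hx
      obtain ⟨x, rfl⟩ := hsur x
      have hx' : x ∈ q.comap (Ideal.Quotient.mk I) := hx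
      rw [h] at hx'
      exact Ideal.Quotient.eq_zero_iff_mem.2 hx'
    · rwa [Ideal.comap_injective_of_surjective _ hsur h]
  have hint : IsIntegralClosure B (A ⧸ I) K :=
    ⟨hBK, fun {x} => by
      rw [← IsIntegralClosure.isIntegral_iff (A := B) (R := A)]
      exact ⟨fun h => isIntegral_trans (R := A) (A := A ⧸ I) x h, fun h => h.tower_top⟩⟩
  -- over the polynomial ring of a Noether normalization, which is integrally closed, the integral closure
  -- in a finite separable extension is finite
  obtain ⟨s, g, hg, hfin⟩ := exists_finite_inj_algHom_of_fg κ (A ⧸ I)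
  let : Algebra (MvPolynomial (Fin s) κ) (A ⧸ I) := g.toRingHom.toAlgebra
  have hfin' : Module.Finite (MvPolynomial (Fin s) κ) (A ⧸ I) := hfin
  have : IsScalarTower κ (MvPolynomial (Fin s) κ) (A ⧸ I) :=
    .of_algebraMap_eq fun c => (g.commutes c).symm
  let : Algebra (MvPolynomial (Fin s) κ) K := ((algebraMap (A ⧸ I) K).comp (algebraMap _ _)).toAlgebra
  have : IsScalarTower (MvPolynomial (Fin s) κ) (A ⧸ I) K := .of_algebraMap_eq fun _ => rfl
  let : Algebra (MvPolynomial (Fin s) κ) B := ((algebraMap (A ⧸ I) B).comp (algebraMap _ _)).toAlgebra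
  have : IsScalarTower (MvPolynomial (Fin s) κ) (A ⧸ I) B := .of_algebraMap_eq fun _ => rfl
  have : IsScalarTower (MvPolynomial (Fin s) κ) B K := .of_algebraMap_eq fun x => by
    change algebraMap (A ⧸ I) K _ = algebraMap B K (algebraMap (A ⧸ I) B _)
    exact IsScalarTower.algebraMap_apply (A ⧸ I) B K _
  have hinj : Function.Injective (algebraMap (MvPolynomial (Fin s) κ) K) := hAK.comp hg
  have : FaithfulSMul (MvPolynomial (Fin s) κ) K :=
    (faithfulSMul_iff_algebraMap_injective _ _).2 hinj
  let L := FractionRing (MvPolynomial (Fin s) κ)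
  let : Algebra L K := FractionRing.liftAlgebra _ _
  have : IsScalarTower (MvPolynomial (Fin s) κ) L K := FractionRing.isScalarTower_liftAlgebra _ _
  have : Algebra.IsAlgebraic (A ⧸ I) K := IsLocalization.isAlgebraic K (nonZeroDivisors (A ⧸ I))
  have : Algebra.IsAlgebraic (MvPolynomial (Fin s) κ) K := Algebra.IsAlgebraic.trans _ (A ⧸ I) _
  have : Algebra.IsAlgebraic L K :=
    (IsFractionRing.comap_isAlgebraic_iff (A := MvPolynomial (Fin s) κ) (K := L) (C := K)).1 this
  have : Algebra.EssFiniteType (A ⧸ I) K := Algebra.EssFiniteType.of_isLocalization K (nonZeroDivisors (A ⧸ I))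
  have : Algebra.EssFiniteType (MvPolynomial (Fin s) κ) K := Algebra.EssFiniteType.comp _ (A ⧸ I) _
  have : Algebra.EssFiniteType L K := Algebra.EssFiniteType.of_comp (MvPolynomial (Fin s) κ) L K
  have : FiniteDimensional L K := Algebra.finite_of_essFiniteType_of_isAlgebraic
  have : CharZero L := charZero_of_injective_algebraMap
    (algebraMap κ L).injective
  have hint' : IsIntegralClosure B (MvPolynomial (Fin s) κ) K :=
    ⟨hBK, fun {x} => by
      rw [← IsIntegralClosure.isIntegral_iff (A := B) (R := A ⧸ I)]
      exact ⟨fun h => h.tower_top, fun h =>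
        isIntegral_trans (R := MvPolynomial (Fin s) κ) (A := A ⧸ I) x h⟩⟩
  have hfinB : Module.Finite (MvPolynomial (Fin s) κ) B := IsIntegralClosure.finite _ L K B
  have hfinB' : Module.Finite (A ⧸ I) B := Module.Finite.of_restrictScalars_finite (MvPolynomial (Fin s) κ) _ _
  have hfinB'' : Module.Finite A B := Module.Finite.trans (A ⧸ I) B
  refine ⟨?_, hBfrac, hfinB''⟩
  have hN : IsNoetherianRing B := IsNoetherianRing.of_finite (MvPolynomial (Fin s) κ) B
  have hD : Ring.DimensionLEOne B := Ring.DimensionLEOne.of_isIntegral (A ⧸ I) B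
  have hC : IsIntegrallyClosed B := by
    refine (isIntegrallyClosed_iff K).2 fun {x} hx => ?_
    have : Algebra.IsIntegral A B := inferInstance
    exact (IsIntegralClosure.isIntegral_iff (A := B) (R := A)).1 (isIntegral_trans (R := A) (A := B) x hx)
  exact { hD, hC, hN, hBdom with }

end AffineNormalization

namespace PrestableLogCurve

variable {κ : Type u} [Field κ] (X : PrestableLogCurve κ)

/-! ### The topology of the curve -/

lemma eq_or_eq_of_specializes {η c c' : X.C} (hη : η ∈ genericPoints X.C) (h : η ⤳ c)
    (h' : c ⤳ c') : c = η ∨ c = c' := by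
  by_contra hcon
  push Not at hcon
  have hdim := X.dim_eq_one (closure {η}) hη
  let Z := closure ({η} : Set X.C)
  let cl : Z → IrreducibleCloseds Z := fun z => ⟨closure {z}, isIrreducible_singleton.closure, isClosed_closure⟩
  have hlt : ∀ {a b : Z}, (a : X.C) ⤳ b → (a : X.C) ≠ b → cl b < cl a := by
    intro a b hab hne
    have hab' : a ⤳ b := (subtype_specializes_iff _ _).2 hab
    refine lt_of_le_not_ge (specializes_iff_closure_subset.1 hab') fun hle => ?_
    exact hne (hab.antisymm ((subtype_specializes_iff _ _).1 (specializes_iff_closure_subset.2 hle))).eq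
  let a0 : Z := ⟨η, subset_closure rfl⟩
  let a1 : Z := ⟨c, specializes_iff_mem_closure.1 h⟩
  let a2 : Z := ⟨c', specializes_iff_mem_closure.1 (h.trans h')⟩
  let l : LTSeries (IrreducibleCloseds Z) :=
    { length := 2
      toFun := ![cl a2, cl a1, cl a0]
      step := by
        intro i
        fin_cases i
        · exact hlt h' hcon.2
        · exact hlt h (fun e => hcon.1 e.symm) }
  have h2 := Order.LTSeries.length_le_krullDim l
  have h3 : ((2 : ℕ) : WithBot ℕ∞) ≤ 1 := h2.trans hdim.le
  exact absurd h3 (by decide)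

end PrestableLogCurve

/-! ### The normalization of a component -/

/-- Germs of functions are fractions of functions on an affine open subset. -/
lemma exists_mul_germ_eq {Z : Scheme.{u}} {U : Z.Opens} (hU : IsAffineOpen U) {z : Z} (hz : z ∈ U)
    (w : Z.presheaf.stalk z) : ∃ r s : Γ(Z, U), IsUnit (Z.presheaf.germ U z hz s) ∧
      w * Z.presheaf.germ U z hz s = Z.presheaf.germ U z hz r := by
  have key : ∀ (z : U) (w : Z.presheaf.stalk z.1), ∃ r s : Γ(Z, U),
      IsUnit (Z.presheaf.germ U z.1 z.2 s) ∧
      w * Z.presheaf.germ U z.1 z.2 s = Z.presheaf.germ U z.1 z.2 r := by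
    intro z w
    have := hU.isLocalization_stalk z
    obtain ⟨⟨r, s⟩, h⟩ := IsLocalization.surj (hU.primeIdealOf z).asIdeal.primeCompl w
    exact ⟨r, s, IsLocalization.map_units (Z.presheaf.stalk z.1) s, h⟩
  exact key ⟨z, hz⟩ w

section AffineOpen

variable {Z : Scheme.{u}} {η : Z} {U : Z.Opens}

lemma exists_mul_evaluation_eq (hU : IsAffineOpen U) (hη : η ∈ U) (z : Z.residueField η) :
    ∃ r s : Γ(Z, U), Z.evaluation U η hη s ≠ 0 ∧
      z * Z.evaluation U η hη s = Z.evaluation U η hη r := by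
  obtain ⟨w, rfl⟩ := Z.residue_surjective η z
  obtain ⟨r, s, h1, h⟩ := exists_mul_germ_eq hU hη w
  refine ⟨r, s, (h1.map (Z.residue η).hom).ne_zero, ?_⟩
  have h2 := congrArg (Z.residue η).hom h
  rw [map_mul] at h2
  exact h2

lemma preimage_fromSpecResidueField (hη : η ∈ U) : Z.fromSpecResidueField η ⁻¹ᵁ U = ⊤ := by
  ext z
  simpa using hη

lemma toNormalization_mem (hη : η ∈ U) : (⊤ : (Spec (Z.residueField η)).Opens) ≤
    (Z.fromSpecResidueField η).toNormalization ⁻¹ᵁ ((Z.fromSpecResidueField η).fromNormalization ⁻¹ᵁ U) := by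
  intro z _
  change (Z.fromSpecResidueField η).fromNormalization
    ((Z.fromSpecResidueField η).toNormalization z) ∈ U
  rw [← Scheme.Hom.comp_apply, Scheme.Hom.toNormalization_fromNormalization]
  simpa using hη

/-- Functions on the preimage of an affine open subset in the normalization, as elements of the
residue field of the generic point. -/
def normalizationEval (hη : η ∈ U) : Γ((Z.fromSpecResidueField η).normalization, (Z.fromSpecResidueField η).fromNormalization ⁻¹ᵁ U) →+*
    Z.residueField η :=
  (Scheme.ΓSpecIso (Z.residueField η)).hom.hom.comp
    ((Z.fromSpecResidueField η).toNormalization.appLE ((Z.fromSpecResidueField η).fromNormalization ⁻¹ᵁ U) ⊤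
      (toNormalization_mem hη)).hom

lemma appLE_fromSpecResidueField (hη : η ∈ U) :
    (Z.fromSpecResidueField η).appLE U ⊤ (preimage_fromSpecResidueField hη).ge ≫
      (Scheme.ΓSpecIso (Z.residueField η)).hom = Z.evaluation U η hη := by
  have h : Z.fromSpecResidueField η = Spec.map (Z.residue η) ≫ Z.fromSpecStalk η := rfl
  simp only [h]
  rw [Scheme.Hom.comp_appLE, Scheme.fromSpecStalk_app hη, ← Scheme.germ_residue]
  simp only [Category.assoc]
  congr 1
  rw [Iso.inv_comp_eq, ← Scheme.ΓSpecIso_naturality, ← Category.assoc]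
  erw [Scheme.Hom.map_appLE]
  congr 1

lemma appLE_eq_of_comp_eq {V W Z : Scheme.{u}} {t : V ⟶ W} {g : W ⟶ Z} {f : V ⟶ Z} (h : t ≫ g = f)
    (U : Z.Opens) (V' : V.Opens) (e : V' ≤ f ⁻¹ᵁ U) (e' : V' ≤ t ⁻¹ᵁ (g ⁻¹ᵁ U)) :
    f.appLE U V' e = g.app U ≫ t.appLE (g ⁻¹ᵁ U) V' e' := by
  subst h
  exact Scheme.Hom.comp_appLE _ _ _ _ _

lemma normalizationEval_app (hη : η ∈ U) (a : Γ(Z, U)) :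
    normalizationEval hη ((Z.fromSpecResidueField η).fromNormalization.app U a) = Z.evaluation U η hη a := by
  rw [← appLE_fromSpecResidueField hη]
  have h : (Z.fromSpecResidueField η).appLE U ⊤ (preimage_fromSpecResidueField hη).ge =
      (Z.fromSpecResidueField η).fromNormalization.app U ≫ (Z.fromSpecResidueField η).toNormalization.appLE
        ((Z.fromSpecResidueField η).fromNormalization ⁻¹ᵁ U) ⊤ (toNormalization_mem hη) :=
    appLE_eq_of_comp_eq (Z.fromSpecResidueField η).toNormalization_fromNormalization _ _ _ _
  rw [h]
  rfl

lemma isIntegralClosure_normalizationEval (hU : IsAffineOpen U) (hη : η ∈ U) :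
    letI := ((Z.fromSpecResidueField η).fromNormalization.app U).hom.toAlgebra
    letI := (Z.evaluation U η hη).hom.toAlgebra
    letI := (normalizationEval hη).toAlgebra
    IsIntegralClosure Γ((Z.fromSpecResidueField η).normalization, (Z.fromSpecResidueField η).fromNormalization ⁻¹ᵁ U) Γ(Z, U)
      (Z.residueField η) := by
  let i1 := ((Z.fromSpecResidueField η).app U).hom.toAlgebra
  let i2 := (Z.evaluation U η hη).hom.toAlgebra
  let e : Γ(Spec (Z.residueField η), Z.fromSpecResidueField η ⁻¹ᵁ U) ≅ Z.residueField η :=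
    (Spec (Z.residueField η)).presheaf.mapIso (eqToIso (preimage_fromSpecResidueField hη).symm).op ≪≫
      Scheme.ΓSpecIso _
  let ea : Γ(Spec (Z.residueField η), Z.fromSpecResidueField η ⁻¹ᵁ U) ≃ₐ[Γ(Z, U)] Z.residueField η :=
    AlgEquiv.ofRingEquiv (f := e.commRingCatIsoToRingEquiv) (fun a => by
      change (((Z.fromSpecResidueField η).app U ≫ (Spec (Z.residueField η)).presheaf.map _) ≫
        (Scheme.ΓSpecIso _).hom) a = Z.evaluation U η hη a
      rw [← appLE_fromSpecResidueField hη]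
      rfl)
  have key : ∀ b, normalizationEval hη b = ea (((Z.fromSpecResidueField η).normalizationObjIso hU).hom b).1 := by
    intro b
    have h := congrArg (fun k => ((k ≫ (Spec (Z.residueField η)).presheaf.map
      (eqToHom (preimage_fromSpecResidueField hη).symm).op) ≫ (Scheme.ΓSpecIso _).hom) b)
      ((Z.fromSpecResidueField η).normalizationObjIso_hom_val hU)
    refine Eq.trans ?_ h.symm
    dsimp only
    rw [Scheme.Hom.appLE_map]
    rfl
  let i3 := ((Z.fromSpecResidueField η).fromNormalization.app U).hom.toAlgebra
  let i4 := (normalizationEval hη).toAlgebra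
  refine ⟨?_, fun {x} => ?_⟩
  · intro b b' h
    have h' : normalizationEval hη b = normalizationEval hη b' := h
    rw [key, key] at h'
    exact ((Z.fromSpecResidueField η).normalizationObjIso hU).commRingCatIsoToRingEquiv.injective (Subtype.ext (ea.injective h'))
  · obtain ⟨k, rfl⟩ := ea.surjective x
    rw [isIntegral_algEquiv]
    constructor
    · intro hk
      obtain ⟨b, hb⟩ := ((Z.fromSpecResidueField η).normalizationObjIso hU).commRingCatIsoToRingEquiv.surjective ⟨k, hk⟩
      refine ⟨b, ?_⟩
      change normalizationEval hη b = _
      rw [key]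
      exact congrArg (fun z => ea z.1) hb
    · rintro ⟨b, hb⟩
      have h' : normalizationEval hη b = ea k := hb
      rw [key] at h'
      rw [← ea.injective h']
      exact (((Z.fromSpecResidueField η).normalizationObjIso hU).hom b).2

/-- The ring of functions on an affine open subset of the normalization of a one-dimensional
component. -/
theorem isDedekindDomain_normalization {κ : Type u} [Field κ] [CharZero κ] (π : Z ⟶ Spec (.of κ))
    [LocallyOfFiniteType π] (hU : IsAffineOpen U)
    (hη : ∀ c c' : Z, η ⤳ c → c ⤳ c' → c = η ∨ c = c') (hηU : η ∈ U) :
    IsDedekindDomain Γ((Z.fromSpecResidueField η).normalization, (Z.fromSpecResidueField η).fromNormalization ⁻¹ᵁ U) ∧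
    ((Z.fromSpecResidueField η).fromNormalization.app U).hom.Finite ∧
    ∀ b : Γ((Z.fromSpecResidueField η).normalization, (Z.fromSpecResidueField η).fromNormalization ⁻¹ᵁ U),
      ∃ r s : Γ(Z, U), (Z.fromSpecResidueField η).fromNormalization.app U s ≠ 0 ∧
        b * (Z.fromSpecResidueField η).fromNormalization.app U s =
          (Z.fromSpecResidueField η).fromNormalization.app U r := by
  let i0 := ((Z.fromSpecResidueField η).fromNormalization.app U).hom.toAlgebra
  let i1 := (Z.evaluation U η hηU).hom.toAlgebra
  let i2 := (normalizationEval hηU).toAlgebra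
  have hic : IsIntegralClosure Γ((Z.fromSpecResidueField η).normalization, (Z.fromSpecResidueField η).fromNormalization ⁻¹ᵁ U) Γ(Z, U)
      (Z.residueField η) := isIntegralClosure_normalizationEval hU hηU
  have : IsScalarTower Γ(Z, U) Γ((Z.fromSpecResidueField η).normalization, (Z.fromSpecResidueField η).fromNormalization ⁻¹ᵁ U)
      (Z.residueField η) := .of_algebraMap_eq fun a => (normalizationEval_app hηU a).symm
  let i3 : Algebra κ Γ(Z, U) := ((π.appLE ⊤ U le_top).hom.comp
    (Scheme.ΓSpecIso (.of κ)).inv.hom).toAlgebra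
  have hft : Algebra.FiniteType κ Γ(Z, U) := by
    have h1 : (π.appLE ⊤ U le_top).hom.FiniteType := π.finiteType_appLE (isAffineOpen_top _) hU le_top
    exact h1.comp (RingHom.FiniteType.of_surjective _
      (Scheme.ΓSpecIso (.of κ)).symm.commRingCatIsoToRingEquiv.surjective)
  have hker : RingHom.ker (algebraMap Γ(Z, U) (Z.residueField η)) =
      (hU.primeIdealOf ⟨η, hηU⟩).asIdeal := by
    rw [hU.primeIdealOf_eq_map_closedPoint]
    ext a
    exact IsLocalRing.residue_eq_zero_iff _
  obtain ⟨h1, h2, h3⟩ := isDedekindDomain_of_isIntegralClosure (κ := κ) (A := Γ(Z, U))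
    (B := Γ((Z.fromSpecResidueField η).normalization, (Z.fromSpecResidueField η).fromNormalization ⁻¹ᵁ U)) (K := Z.residueField η)
    (fun z => exists_mul_evaluation_eq hU hηU z) (by
      intro q m hq hm h1 h2
      rw [hker] at h1 ⊢
      let q' : Spec Γ(Z, U) := ⟨q, hq⟩
      let m' : Spec Γ(Z, U) := ⟨m, hm⟩
      have hηe : hU.fromSpec (hU.primeIdealOf ⟨η, hηU⟩) = η := hU.fromSpec_primeIdealOf ⟨η, hηU⟩
      have hs1 : η ⤳ hU.fromSpec q' := by
        have := ((PrimeSpectrum.le_iff_specializes (hU.primeIdealOf ⟨η, hηU⟩) q').1 h1).map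
          hU.fromSpec.continuous
        rwa [hηe] at this
      have hs2 : hU.fromSpec q' ⤳ hU.fromSpec m' :=
        ((PrimeSpectrum.le_iff_specializes q' m').1 h2).map hU.fromSpec.continuous
      have hinj : Function.Injective hU.fromSpec := hU.fromSpec.isOpenEmbedding.injective
      rcases hη _ _ hs1 hs2 with h | h
      · left
        exact congrArg PrimeSpectrum.asIdeal (hinj (h.trans hηe.symm))
      · right
        exact congrArg PrimeSpectrum.asIdeal (hinj h))
  refine ⟨h1, h3, fun b => ?_⟩
  obtain ⟨r, s, hs, e⟩ := exists_mul_evaluation_eq hU hηU (normalizationEval hηU b)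
  have hinj : Function.Injective (normalizationEval hηU) :=
    IsIntegralClosure.algebraMap_injective _ Γ(Z, U) (Z.residueField η)
  refine ⟨r, s, fun h0 => hs ?_, hinj ?_⟩
  · rw [← normalizationEval_app hηU, h0, map_zero]
  · rw [map_mul, normalizationEval_app, normalizationEval_app, e]

end AffineOpen

namespace PrestableLogCurve

variable {κ : Type u} [Field κ] (X : PrestableLogCurve κ) {η : X.C} {U : X.C.Opens}

/-- The ring of functions on an affine open subset of the normalization. -/
theorem isDedekindDomain_normalizedComponent [CharZero κ] (hU : IsAffineOpen U)
    (hη : η ∈ genericPoints X.C) (hηU : η ∈ U) :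
    IsDedekindDomain Γ(X.normalizedComponent η, X.toCurve η ⁻¹ᵁ U) ∧
    ((X.toCurve η).app U).hom.Finite ∧
    ∀ b : Γ(X.normalizedComponent η, X.toCurve η ⁻¹ᵁ U), ∃ r s : Γ(X.C, U),
      (X.toCurve η).app U s ≠ 0 ∧ b * (X.toCurve η).app U s = (X.toCurve η).app U r :=
  have := X.isProper
  isDedekindDomain_normalization X.π hU (fun _ _ h h' => X.eq_or_eq_of_specializes hη h h') hηU

end PrestableLogCurve

/-! ### Divisors of rational functions on a complete regular curve -/

section CompleteCurve

variable {κ : Type u} [Field κ] {Y : Scheme.{u}} (p : Y ⟶ Spec (.of κ))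

/-- The structure map from the base field to the local rings of a scheme over a field. -/
def stalkScalars (y : Y) : κ →+* Y.presheaf.stalk y :=
  ((Scheme.ΓSpecIso (.of κ)).inv ≫ p.appTop ≫ Y.presheaf.germ ⊤ y trivial).hom

lemma stalkSpecializes_stalkScalars {y z : Y} (h : z ⤳ y) (c : κ) :
    Y.presheaf.stalkSpecializes h (stalkScalars p y c) = stalkScalars p z c := by
  have : ((Scheme.ΓSpecIso (.of κ)).inv ≫ p.appTop ≫ Y.presheaf.germ ⊤ y trivial) ≫
      Y.presheaf.stalkSpecializes h =
      ((Scheme.ΓSpecIso (.of κ)).inv ≫ p.appTop ≫ Y.presheaf.germ ⊤ z trivial) := by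
    rw [Category.assoc, Category.assoc]
    congr 2
    exact Y.presheaf.germ_stalkSpecializes (U := ⊤) trivial h
  exact congrArg (fun k => k.hom c) this

lemma fromSpecStalk_comp_eq (y : Y) :
    Y.fromSpecStalk y ≫ p = Spec.map (CommRingCat.ofHom (stalkScalars p y)) := by
  have h : CommRingCat.ofHom (stalkScalars p y) = (Scheme.ΓSpecIso (.of κ)).inv ≫
    p.appTop ≫ Y.presheaf.germ ⊤ y trivial := rfl
  rw [h, Spec.map_comp, Spec.map_comp, Category.assoc, ← Scheme.fromSpecStalk_toSpecΓ,
    Category.assoc, ← Scheme.toSpecΓ_naturality_assoc, ← SpecMap_ΓSpecIso_hom, ← Spec.map_comp,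
    Iso.inv_hom_id, Spec.map_id, Category.comp_id]

variable [IsIntegral Y]

lemma spec_algebraMap_fromSpecStalk (y : Y) :
    Spec.map (CommRingCat.ofHom (algebraMap (Y.presheaf.stalk y) Y.functionField)) ≫
      Y.fromSpecStalk y = Y.fromSpecStalk (genericPoint Y) :=
  Scheme.SpecMap_stalkSpecializes_fromSpecStalk ((genericPoint_spec Y).specializes trivial)

lemma algebraMap_stalkScalars (y : Y) (c : κ) :
    algebraMap (Y.presheaf.stalk y) Y.functionField (stalkScalars p y c) =
      stalkScalars p (genericPoint Y) c :=
  stalkSpecializes_stalkScalars p _ c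

/-- On a separated scheme a point is determined by its local ring. -/
lemma eq_of_range_algebraMap_eq [IsSeparated p] (y y' : Y) [ValuationRing (Y.presheaf.stalk y)]
    (h : ∀ x : Y.functionField, (∃ a, algebraMap (Y.presheaf.stalk y) Y.functionField a = x) ↔
      ∃ a, algebraMap (Y.presheaf.stalk y') Y.functionField a = x) : y = y' := by
  have inj : ∀ z, Function.Injective (algebraMap (Y.presheaf.stalk z) Y.functionField) :=
    fun z => IsFractionRing.injective _ _
  let e : Y.presheaf.stalk y' ≃+* Y.presheaf.stalk y :=
    ((RingEquiv.ofBijective (algebraMap (Y.presheaf.stalk y') Y.functionField).rangeRestrict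
      ⟨fun a b hab => inj _ (congrArg Subtype.val hab), RingHom.rangeRestrict_surjective _⟩).trans
    (RingEquiv.subringCongr (by ext x; exact (h x).symm))).trans
    (RingEquiv.ofBijective (algebraMap (Y.presheaf.stalk y) Y.functionField).rangeRestrict
      ⟨fun a b hab => inj _ (congrArg Subtype.val hab), RingHom.rangeRestrict_surjective _⟩).symm
  have he : ∀ a, algebraMap (Y.presheaf.stalk y) Y.functionField (e a) =
      algebraMap (Y.presheaf.stalk y') Y.functionField a := by
    intro a
    have := congrArg Subtype.val ((RingEquiv.ofBijective (algebraMap (Y.presheaf.stalk y) Y.functionField).rangeRestrict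
      ⟨fun a b hab => inj _ (congrArg Subtype.val hab), RingHom.rangeRestrict_surjective _⟩).apply_symm_apply
        (RingEquiv.subringCongr (by ext x; exact (h x).symm) ((algebraMap (Y.presheaf.stalk y') Y.functionField).rangeRestrict a)))
    exact this
  have hD : IsDomain (Y.presheaf.stalk y) := inferInstance
  let S : ValuativeCommSq p := @ValuativeCommSq.mk _ _ p (Y.presheaf.stalk y) _ hD _ Y.functionField
    _ _ _ (Y.fromSpecStalk (genericPoint Y)) (Y.fromSpecStalk y ≫ p) ⟨by
      rw [← spec_algebraMap_fromSpecStalk y, Category.assoc]⟩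
  have hS := IsSeparated.valuativeCriterion p S
  let l₁ : S.commSq.LiftStruct := ⟨Y.fromSpecStalk y, spec_algebraMap_fromSpecStalk y, rfl⟩
  have hcomp : Spec.map (CommRingCat.ofHom (algebraMap (Y.presheaf.stalk y) Y.functionField)) ≫
      Spec.map (CommRingCat.ofHom e.toRingHom) =
      Spec.map (CommRingCat.ofHom (algebraMap (Y.presheaf.stalk y') Y.functionField)) := by
    rw [← Spec.map_comp]
    congr 1
    ext a
    exact he a
  let l₂ : S.commSq.LiftStruct := ⟨Spec.map (CommRingCat.ofHom e.toRingHom) ≫ Y.fromSpecStalk y', by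
      change Spec.map (CommRingCat.ofHom (algebraMap (Y.presheaf.stalk y) Y.functionField)) ≫
        Spec.map (CommRingCat.ofHom e.toRingHom) ≫ Y.fromSpecStalk y' = Y.fromSpecStalk (genericPoint Y)
      rw [← Category.assoc, hcomp, spec_algebraMap_fromSpecStalk], by
      change (Spec.map (CommRingCat.ofHom e.toRingHom) ≫ Y.fromSpecStalk y') ≫ p =
        Y.fromSpecStalk y ≫ p
      rw [Category.assoc, fromSpecStalk_comp_eq, fromSpecStalk_comp_eq, ← Spec.map_comp]
      congr 1
      ext c
      apply inj y
      change algebraMap _ _ (e (stalkScalars p y' c)) = algebraMap _ _ (stalkScalars p y c)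
      rw [he, algebraMap_stalkScalars, algebraMap_stalkScalars]⟩
  have hl : l₁.l = l₂.l := congrArg _ (Subsingleton.elim l₁ l₂)
  have h1 : Y.fromSpecStalk y (IsLocalRing.closedPoint (Y.presheaf.stalk y)) = y :=
    Scheme.fromSpecStalk_closedPoint
  have h2 : Spec.map (CommRingCat.ofHom e.toRingHom) (IsLocalRing.closedPoint (Y.presheaf.stalk y)) =
      IsLocalRing.closedPoint (Y.presheaf.stalk y') := by
    have : IsLocalHom e.toRingHom := ⟨fun a ha => (MulEquiv.isUnit_map e).1 ha⟩
    exact IsLocalRing.comap_closedPoint e.toRingHom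
  have h3 : l₂.l (IsLocalRing.closedPoint (Y.presheaf.stalk y)) = y' := by
    change Y.fromSpecStalk y' (Spec.map (CommRingCat.ofHom e.toRingHom) _) = y'
    rw [h2]
    exact Scheme.fromSpecStalk_closedPoint
  rw [← h3, ← hl]
  exact h1.symm

/-- On a universally closed scheme every valuation ring of the function field over the base has a
center; if the center is a regular point of codimension one, then its local ring is the valuation
ring. -/
lemma exists_stalk_eq_valuationSubring [UniversallyClosed p]
    (hdvr : ∀ y : Y, y ≠ genericPoint Y → IsDiscreteValuationRing (Y.presheaf.stalk y))
    (V : ValuationSubring Y.functionField)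
    (hV : ∀ c : κ, stalkScalars p (genericPoint Y) c ∈ V) (hV' : ∃ x, x ∉ V) :
    ∃ y : Y, y ≠ genericPoint Y ∧ ∀ x, (∃ a, algebraMap (Y.presheaf.stalk y) Y.functionField a = x) ↔ x ∈ V := by
  let k : κ →+* V := (stalkScalars p (genericPoint Y)).codRestrict V.toSubring hV
  let S : ValuativeCommSq p :=
    { R := V
      K := Y.functionField
      i₁ := Y.fromSpecStalk (genericPoint Y)
      i₂ := Spec.map (CommRingCat.ofHom k)
      commSq := ⟨by
        rw [fromSpecStalk_comp_eq, ← Spec.map_comp]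
        rfl⟩ }
  have hE : ValuativeCriterion.Existence p := by
    have : UniversallyClosed p := inferInstance
    rw [UniversallyClosed.eq_valuativeCriterion] at this
    exact this.1
  obtain ⟨⟨l, hl1, hl2⟩⟩ := hE S
  let y : Y := l (IsLocalRing.closedPoint V)
  let ψ : Y.presheaf.stalk y ⟶ .of V := Scheme.stalkClosedPointTo (R := .of V) l
  have hψ : Spec.map ψ ≫ Y.fromSpecStalk y = l := Scheme.Spec_stalkClosedPointTo_fromSpecStalk (R := .of V) l
  have hloc : IsLocalHom ψ.hom := inferInstanceAs (IsLocalHom (Scheme.stalkClosedPointTo (R := .of V) l).hom)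
  have hcomp : ∀ a, ((ψ.hom a : V) : Y.functionField) = algebraMap (Y.presheaf.stalk y) Y.functionField a := by
    have h1 : Spec.map (CommRingCat.ofHom (algebraMap V Y.functionField)) ≫ Spec.map ψ =
        Spec.map (CommRingCat.ofHom (algebraMap (Y.presheaf.stalk y) Y.functionField)) := by
      rw [← cancel_mono (Y.fromSpecStalk y), Category.assoc, hψ, spec_algebraMap_fromSpecStalk]
      exact hl1
    rw [← Spec.map_comp, Spec.map_inj] at h1
    intro a
    exact congrArg (fun k => k.hom a) h1
  have hy : y ≠ genericPoint Y := by
    intro hy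
    obtain ⟨x, hx⟩ := hV'
    have : ∃ a, algebraMap (Y.presheaf.stalk y) Y.functionField a = x := by
      clear hcomp hψ
      clear_value ψ
      clear hloc ψ
      generalize y = z at hy
      subst hy
      refine ⟨x, ?_⟩
      change Y.presheaf.stalkSpecializes _ x = x
      rw [TopCat.Presheaf.stalkSpecializes_refl]
      rfl
    obtain ⟨a, rfl⟩ := this
    exact hx (hcomp a ▸ (ψ.hom a).2)
  refine ⟨y, hy, fun x => ⟨?_, fun hx => ?_⟩⟩
  · rintro ⟨a, rfl⟩
    rw [← hcomp]
    exact (ψ.hom a).2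
  · have := hdvr y hy
    by_cases h0 : x = 0
    · exact ⟨0, by rw [map_zero, h0]⟩
    rcases ValuationRing.isInteger_or_isInteger (Y.presheaf.stalk y) x with h | ⟨a, ha⟩
    · exact h
    · by_cases ha' : IsUnit a
      · obtain ⟨b, hb⟩ := ha'.exists_right_inv
        refine ⟨b, ?_⟩
        have := congrArg (algebraMap (Y.presheaf.stalk y) Y.functionField) hb
        rw [map_mul, ha, map_one] at this
        rw [inv_mul_eq_one₀ h0] at this
        exact this.symm
      · exfalso
        apply ha'
        refine isUnit_of_map_unit ψ.hom a (IsUnit.of_mul_eq_one ⟨x, hx⟩ (Subtype.ext ?_))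
        change ((ψ.hom a : V) : Y.functionField) * x = 1
        rw [hcomp, ha, inv_mul_cancel₀ h0]

lemma orderAt_genericPoint (f : Y.functionField) : orderAt f (genericPoint Y) = 0 := by
  unfold orderAt
  split_ifs with h
  · apply Scheme.ord_eq_zero_of_coheight_neq_one
    intro hco
    have h1 := ringKrullDim_stalk_eq_coheight (genericPoint Y)
    rw [hco, ringKrullDim_eq_zero_of_field Y.functionField] at h1
    exact absurd h1 (by decide)
  · rfl

/-- The order of vanishing at a regular point of codimension one, in terms of a uniformizer. -/
lemma orderAt_eq_of_eq_mul_zpow [IsLocallyNoetherian Y] {y : Y}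
    [IsDiscreteValuationRing (Y.presheaf.stalk y)] {f : Y.functionField}
    {ϖ v : Y.presheaf.stalk y} (hϖ : Irreducible ϖ) (hv : IsUnit v) {n : ℤ}
    (h : f = algebraMap _ Y.functionField v * algebraMap _ Y.functionField ϖ ^ n) :
    orderAt f y = n := by
  have hN : IsLocallyNoetherian Y := inferInstance
  have hco : Order.coheight y = 1 := by
    have h1 := ringKrullDim_stalk_eq_coheight y
    rw [IsDiscreteValuationRing.ringKrullDim_eq_one] at h1
    exact_mod_cast h1.symm
  have inj : Function.Injective (algebraMap (Y.presheaf.stalk y) Y.functionField) :=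
    IsFractionRing.injective _ _
  have hf : f ≠ 0 := by
    rw [h]
    exact mul_ne_zero ((map_ne_zero_iff _ inj).2 hv.ne_zero)
      (zpow_ne_zero _ ((map_ne_zero_iff _ inj).2 hϖ.ne_zero))
  unfold orderAt
  rw [dif_pos hN, Scheme.ord_eq_iff hco hf, h, map_mul, map_zpow₀]
  have : Ring.KrullDimLE 1 (Y.presheaf.stalk y) := krullDimLE_of_coheight_le hco.le
  have h1 : Scheme.ordHom y hco (algebraMap _ Y.functionField v) = 1 := Ring.ordFrac_of_isUnit hv
  have h2 : Scheme.ordHom y hco (algebraMap _ Y.functionField ϖ) = WithZero.exp 1 :=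
    Ring.ordFrac_irreducible hϖ
  rw [h1, h2, one_mul, ← WithZero.exp_zsmul]
  simp [WithZero.exp]

lemma exists_eq_mul_zpow {y : Y} [IsDiscreteValuationRing (Y.presheaf.stalk y)]
    {f : Y.functionField} (hf : f ≠ 0) : ∃ (ϖ v : Y.presheaf.stalk y) (n : ℤ), Irreducible ϖ ∧
      IsUnit v ∧ f = algebraMap _ Y.functionField v * algebraMap _ Y.functionField ϖ ^ n := by
  obtain ⟨ϖ, hϖ⟩ := IsDiscreteValuationRing.exists_irreducible (Y.presheaf.stalk y)
  have inj : Function.Injective (algebraMap (Y.presheaf.stalk y) Y.functionField) :=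
    IsFractionRing.injective _ _
  obtain ⟨a, b, hb, rfl⟩ := IsFractionRing.div_surjective (A := Y.presheaf.stalk y) f
  have hb0 := nonZeroDivisors.ne_zero hb
  have ha0 : a ≠ 0 := by
    rintro rfl
    simp at hf
  obtain ⟨m, v, rfl⟩ := IsDiscreteValuationRing.eq_unit_mul_pow_irreducible ha0 hϖ
  obtain ⟨n, w, rfl⟩ := IsDiscreteValuationRing.eq_unit_mul_pow_irreducible hb0 hϖ
  refine ⟨ϖ, ↑(v * w⁻¹), (m : ℤ) - n, hϖ, Units.isUnit _, ?_⟩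
  have h0 := (map_ne_zero_iff _ inj).2 hϖ.ne_zero
  have hw : algebraMap _ Y.functionField (w : Y.presheaf.stalk y) *
      algebraMap _ Y.functionField ((w⁻¹ : (Y.presheaf.stalk y)ˣ) : Y.presheaf.stalk y) = 1 := by
    rw [← map_mul, Units.mul_inv, map_one]
  have hw0 := left_ne_zero_of_mul_eq_one hw
  rw [zpow_sub₀ h0, Units.val_mul, map_mul, map_mul, map_mul, map_pow, map_pow, zpow_natCast,
    zpow_natCast, eq_inv_of_mul_eq_one_right hw]
  field_simp

lemma residueDegree_eq_finrank (y : Y) :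
    letI := (stalkScalars p y).toAlgebra
    p.residueDegree y = Module.finrank κ (IsLocalRing.ResidueField (Y.presheaf.stalk y)) := by
  let _ := (stalkScalars p y).toAlgebra
  let φ : κ →+* (Spec (.of κ)).residueField (p y) :=
    ((Spec (.of κ)).Γevaluation (p y)).hom.comp (Scheme.ΓSpecIso (.of κ)).inv.hom
  have hφ : Function.Surjective φ := by
    intro z
    obtain ⟨r, s, hs, e⟩ := exists_mul_evaluation_eq (isAffineOpen_top (Spec (.of κ))) trivial z
    obtain ⟨r, rfl⟩ := (Scheme.ΓSpecIso (.of κ)).symm.commRingCatIsoToRingEquiv.surjective r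
    obtain ⟨s, rfl⟩ := (Scheme.ΓSpecIso (.of κ)).symm.commRingCatIsoToRingEquiv.surjective s
    refine ⟨r / s, ?_⟩
    rw [map_div₀]
    exact ((eq_div_iff hs).2 e).symm
  let i : κ ≃+* (Spec (.of κ)).residueField (p y) := RingEquiv.ofBijective φ ⟨φ.injective, hφ⟩
  let _ : Algebra ((Spec (.of κ)).residueField (p y)) (Y.residueField y) :=
    (p.residueFieldMap y).hom.toAlgebra
  let _ : Algebra κ (Y.residueField y) :=
    inferInstanceAs (Algebra κ (IsLocalRing.ResidueField (Y.presheaf.stalk y)))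
  refine (Algebra.finrank_eq_of_equiv_equiv i (RingEquiv.refl (Y.residueField y)) ?_).symm
  ext c
  have h := congrArg (fun k => k.hom ((Scheme.ΓSpecIso (.of κ)).inv c))
    (Scheme.Γevaluation_naturality p y)
  exact h

/-- The degree of a principal divisor on a complete regular curve is zero. -/
theorem finsum_residueDegree_mul_orderAt [CharZero κ] [IsLocallyNoetherian Y] [IsSeparated p]
    [UniversallyClosed p]
    (hdvr : ∀ y : Y, y ≠ genericPoint Y → IsDiscreteValuationRing (Y.presheaf.stalk y))
    (hft : (stalkScalars p (genericPoint Y)).EssFiniteType)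
    (htr : letI := (stalkScalars p (genericPoint Y)).toAlgebra
      Algebra.trdeg κ Y.functionField ≤ 1) {f : Y.functionField} (hf : f ≠ 0) :
    {y | orderAt f y ≠ 0}.Finite ∧ ∑ᶠ y : Y, (p.residueDegree y : ℤ) * orderAt f y = 0 := by
  let : ∀ y : Y, Algebra κ (Y.presheaf.stalk y) := fun y => (stalkScalars p y).toAlgebra
  let : Algebra κ Y.functionField := (stalkScalars p (genericPoint Y)).toAlgebra
  have hsc : ∀ y : Y, IsScalarTower κ (Y.presheaf.stalk y) Y.functionField := fun y =>
    .of_algebraMap_eq fun c => (algebraMap_stalkScalars p y c).symm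
  have hdvr' : ∀ y : {y : Y // y ≠ genericPoint Y}, IsDiscreteValuationRing (Y.presheaf.stalk y.1) :=
    fun y => hdvr y.1 y.2
  have hess : Algebra.EssFiniteType κ Y.functionField := hft
  obtain ⟨h1, h2⟩ := finsum_ord_eq_zero (κ := κ) (K := Y.functionField)
    (Y := {y : Y // y ≠ genericPoint Y}) (fun y => Y.presheaf.stalk y.1)
    (fun y y' h => Subtype.ext (eq_of_range_algebraMap_eq p y.1 y'.1 h))
    (fun V hV hV' => by
      obtain ⟨y, hy, h⟩ := exists_stalk_eq_valuationSubring p hdvr V hV hV'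
      exact ⟨⟨y, hy⟩, h⟩) htr f hf (fun y => orderAt f y.1) (fun y => by
      obtain ⟨ϖ, v, n, h1, h2, h3⟩ := exists_eq_mul_zpow (y := y.1) hf
      refine ⟨ϖ, v, h1, h2, ?_⟩
      rw [orderAt_eq_of_eq_mul_zpow h1 h2 h3]
      exact h3)
  constructor
  · refine (h1.image Subtype.val).subset fun y hy => ?_
    exact ⟨⟨y, fun h => hy (by rw [h]; exact orderAt_genericPoint f)⟩, hy, rfl⟩
  · classical
    rw [← h2, finsum_subtype_eq_finsum_cond (fun y : Y => y ≠ genericPoint Y)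
      (f := fun y : Y => (Module.finrank κ (IsLocalRing.ResidueField (Y.presheaf.stalk y)) : ℤ) * orderAt f y)]
    refine finsum_congr fun y => ?_
    by_cases hy : y = genericPoint Y
    · subst hy
      simp [orderAt_genericPoint]
    · rw [finsum_eq_if, if_pos hy, residueDegree_eq_finrank]

end CompleteCurve

namespace PrestableLogCurve

variable {κ : Type u} [Field κ] (X : PrestableLogCurve κ) {η : X.C}

instance : IsProper X.π := X.isProper

instance : IsIntegralHom (X.toCurve η) :=
  inferInstanceAs (IsIntegralHom (X.C.fromSpecResidueField η).fromNormalization)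

instance : IsSeparated (X.toCurve η ≫ X.π) := inferInstance

instance : UniversallyClosed (X.toCurve η ≫ X.π) := inferInstance

lemma toCurve_genericPoint : X.toCurve η (genericPoint (X.normalizedComponent η)) = η := by
  let t : Spec (X.C.residueField η) ⟶ X.normalizedComponent η :=
    (X.C.fromSpecResidueField η).toNormalization
  have hd : IsDominant t := inferInstanceAs (IsDominant (X.C.fromSpecResidueField η).toNormalization)
  let z : Spec (X.C.residueField η) := default
  have hz : genericPoint (X.normalizedComponent η) = t z := by
    refine (genericPoint_spec (X.normalizedComponent η)).eq ?_
    have h := t.denseRange.closure_eq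
    rw [Set.range_unique] at h
    exact h
  rw [hz]
  change (t ≫ X.toCurve η) z = η
  have : t ≫ X.toCurve η = X.C.fromSpecResidueField η :=
    (X.C.fromSpecResidueField η).toNormalization_fromNormalization
  rw [this, Scheme.fromSpecResidueField_apply]

lemma specializes_toCurve (y : X.normalizedComponent η) : η ⤳ X.toCurve η y := by
  have h := ((genericPoint_spec (X.normalizedComponent η)).specializes (Set.mem_univ y)).map
    (X.toCurve η).continuous
  rwa [toCurve_genericPoint] at h

section

variable {X} {U : X.C.Opens}

lemma isAffineOpen_preimage (hU : IsAffineOpen U) : IsAffineOpen (X.toCurve η ⁻¹ᵁ U) :=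
  hU.preimage _

lemma genericPoint_mem_preimage (hηU : η ∈ U) :
    genericPoint (X.normalizedComponent η) ∈ X.toCurve η ⁻¹ᵁ U := by
  change X.toCurve η _ ∈ U
  rwa [toCurve_genericPoint]

lemma primeIdealOf_genericPoint_eq_bot {Y : Scheme.{u}} [IsIntegral Y] {W : Y.Opens} (hW : IsAffineOpen W)
    (h : genericPoint Y ∈ W) : (hW.primeIdealOf ⟨genericPoint Y, h⟩).asIdeal = ⊥ := by
  rw [hW.primeIdealOf_eq_map_closedPoint]
  have hne : Nonempty W := ⟨⟨_, h⟩⟩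
  ext a
  rw [Ideal.mem_bot]
  have h1 : a ∈ (Spec.map (Y.presheaf.germ W (genericPoint Y) h) (IsLocalRing.closedPoint _)).asIdeal ↔
      ¬ IsUnit (Y.presheaf.germ W (genericPoint Y) h a) := Iff.rfl
  rw [h1]
  have h2 : IsUnit (Y.presheaf.germ W (genericPoint Y) h a) ↔
    Y.presheaf.germ W (genericPoint Y) h a ≠ 0 := isUnit_iff_ne_zero (G₀ := Y.functionField)
  rw [h2, not_not]
  exact map_eq_zero_iff _ (germ_injective_of_isIntegral Y (genericPoint Y) h)

lemma eq_genericPoint_of_primeIdealOf_eq_bot {Y : Scheme.{u}} [IsIntegral Y] {W : Y.Opens}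
    (hW : IsAffineOpen W) {y : Y} (hy : y ∈ W) (h : (hW.primeIdealOf ⟨y, hy⟩).asIdeal = ⊥) :
    y = genericPoint Y := by
  have hg : genericPoint Y ∈ W := ((genericPoint_spec Y).mem_open_set_iff W.2).2 ⟨y, trivial, hy⟩
  have : hW.primeIdealOf ⟨y, hy⟩ = hW.primeIdealOf ⟨genericPoint Y, hg⟩ :=
    PrimeSpectrum.ext (h.trans (primeIdealOf_genericPoint_eq_bot hW hg).symm)
  have h2 := congrArg hW.fromSpec this
  rwa [hW.fromSpec_primeIdealOf, hW.fromSpec_primeIdealOf] at h2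

end

variable [CharZero κ]

lemma isLocallyNoetherian_normalizedComponent (hη : η ∈ genericPoints X.C) :
    IsLocallyNoetherian (X.normalizedComponent η) := by
  choose U hU hmem hle using fun y : X.normalizedComponent η =>
    exists_isAffineOpen_mem_and_subset (U := ⊤) (x := X.toCurve η y) trivial
  refine isLocallyNoetherian_of_affine_cover
    (S := fun y => ⟨X.toCurve η ⁻¹ᵁ U y, isAffineOpen_preimage (hU y)⟩) ?_ fun y => ?_
  · ext y
    simp only [Opens.coe_iSup, Set.mem_iUnion, Opens.coe_top, Set.mem_univ, iff_true]
    exact ⟨y, hmem y⟩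
  · have := (X.isDedekindDomain_normalizedComponent (hU y) hη
      ((X.specializes_toCurve y).mem_open (Opens.isOpen _) (hmem y))).1
    exact inferInstanceAs (IsNoetherianRing Γ(X.normalizedComponent η, X.toCurve η ⁻¹ᵁ U y))

lemma isDiscreteValuationRing_stalk (hη : η ∈ genericPoints X.C) {y : X.normalizedComponent η}
    (hy : y ≠ genericPoint (X.normalizedComponent η)) :
    IsDiscreteValuationRing ((X.normalizedComponent η).presheaf.stalk y) := by
  obtain ⟨U, hU, hyU, -⟩ := exists_isAffineOpen_mem_and_subset (U := ⊤) (x := X.toCurve η y) trivial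
  have hηU := (X.specializes_toCurve y).mem_open U.2 hyU
  have hD := (X.isDedekindDomain_normalizedComponent hU hη hηU).1
  have hW := isAffineOpen_preimage (η := η) hU
  have key : ∀ w : (X.toCurve η ⁻¹ᵁ U : (X.normalizedComponent η).Opens),
      w.1 ≠ genericPoint (X.normalizedComponent η) →
      IsDiscreteValuationRing ((X.normalizedComponent η).presheaf.stalk w.1) := by
    intro w hw
    have := hW.isLocalization_stalk w
    exact IsLocalization.AtPrime.isDiscreteValuationRing_of_dedekind_domain
      Γ(X.normalizedComponent η, X.toCurve η ⁻¹ᵁ U) (P := (hW.primeIdealOf w).asIdeal)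
      (fun h => hw (eq_genericPoint_of_primeIdealOf_eq_bot hW w.2 h)) _
  exact key ⟨y, hyU⟩ hy

/-- The divisor of a rational function on the normalization of a component has degree zero. -/
theorem finsum_residueDegree_orderAt (hη : η ∈ genericPoints X.C)
    {f : (X.normalizedComponent η).functionField} (hf : f ≠ 0) :
    {y | orderAt f y ≠ 0}.Finite ∧
      ∑ᶠ y, ((X.toCurve η ≫ X.π).residueDegree y : ℤ) * orderAt f y = 0 := by
  have := X.isLocallyNoetherian_normalizedComponent hη
  obtain ⟨U, hU, hηU, -⟩ := exists_isAffineOpen_mem_and_subset (U := ⊤) (x := η) trivial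
  obtain ⟨hD, hfin, -⟩ := X.isDedekindDomain_normalizedComponent hU hη hηU
  have hW := isAffineOpen_preimage (η := η) hU
  have hgW := genericPoint_mem_preimage hηU
  have hne : Nonempty (X.toCurve η ⁻¹ᵁ U : (X.normalizedComponent η).Opens) := ⟨⟨_, hgW⟩⟩
  have hfrac := functionField_isFractionRing_of_isAffineOpen _ _ hW
  let _ : Algebra κ Γ(X.normalizedComponent η, X.toCurve η ⁻¹ᵁ U) :=
    (((X.toCurve η).app U).hom.comp ((X.π.appLE ⊤ U le_top).hom.comp
      (Scheme.ΓSpecIso (.of κ)).inv.hom)).toAlgebra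
  have hft : Algebra.FiniteType κ Γ(X.normalizedComponent η, X.toCurve η ⁻¹ᵁ U) := by
    have h1 : (X.π.appLE ⊤ U le_top).hom.FiniteType := X.π.finiteType_appLE (isAffineOpen_top _) hU le_top
    exact hfin.finiteType.comp (h1.comp (RingHom.FiniteType.of_surjective _
      (Scheme.ΓSpecIso (.of κ)).symm.commRingCatIsoToRingEquiv.surjective))
  let _ : Algebra κ (X.normalizedComponent η).functionField :=
    (stalkScalars (X.toCurve η ≫ X.π) (genericPoint _)).toAlgebra
  have hsc : IsScalarTower κ Γ(X.normalizedComponent η, X.toCurve η ⁻¹ᵁ U)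
      (X.normalizedComponent η).functionField := by
    refine .of_algebraMap_eq fun c => ?_
    have : (X.toCurve η ≫ X.π).appTop ≫ (X.normalizedComponent η).presheaf.germ ⊤ _ trivial =
      X.π.appLE ⊤ U le_top ≫ (X.toCurve η).app U ≫ (X.normalizedComponent η).presheaf.germ _ _ hgW := by
      have h1 : X.π.appLE ⊤ U le_top = X.π.appTop ≫ X.C.presheaf.map (homOfLE le_top).op := rfl
      rw [h1, Scheme.Hom.comp_appTop, Category.assoc, Category.assoc]
      congr 1
      rw [← Category.assoc (X.C.presheaf.map _), (X.toCurve η).naturality, Category.assoc]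
      congr 1
      exact ((X.normalizedComponent η).presheaf.germ_res (homOfLE le_top) _ hgW).symm
    exact congrArg (fun k => k.hom ((Scheme.ΓSpecIso (.of κ)).inv c)) this
  have hess : Algebra.EssFiniteType κ (X.normalizedComponent η).functionField := by
    have := Algebra.EssFiniteType.of_isLocalization (R := Γ(X.normalizedComponent η, X.toCurve η ⁻¹ᵁ U))
      (X.normalizedComponent η).functionField (nonZeroDivisors _)
    exact Algebra.EssFiniteType.comp κ Γ(X.normalizedComponent η, X.toCurve η ⁻¹ᵁ U) _
  exact finsum_residueDegree_mul_orderAt (X.toCurve η ≫ X.π)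
    (fun y hy => X.isDiscreteValuationRing_stalk hη hy) hess
    (trdeg_le_one_of_dimensionLEOne (B := Γ(X.normalizedComponent η, X.toCurve η ⁻¹ᵁ U))) hf

/-- Every rational function on the normalization is near any point a quotient of functions on the curve. -/
lemma exists_mul_stalkMap_eq (hη : η ∈ genericPoints X.C) (y : X.normalizedComponent η) (f : (X.normalizedComponent η).functionField) :
    ∃ b c : X.C.presheaf.stalk (X.toCurve η y),
      algebraMap _ (X.normalizedComponent η).functionField ((X.toCurve η).stalkMap y c) ≠ 0 ∧
      f * algebraMap _ (X.normalizedComponent η).functionField ((X.toCurve η).stalkMap y c) =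
        algebraMap _ (X.normalizedComponent η).functionField ((X.toCurve η).stalkMap y b) := by
  obtain ⟨U, hU, hyU, -⟩ := exists_isAffineOpen_mem_and_subset (U := ⊤) (x := X.toCurve η y) trivial
  have hηU := (X.specializes_toCurve y).mem_open U.2 hyU
  obtain ⟨hD, -, hfr⟩ := X.isDedekindDomain_normalizedComponent hU hη hηU
  have hW := isAffineOpen_preimage (η := η) hU
  have hne : Nonempty (X.toCurve η ⁻¹ᵁ U : (X.normalizedComponent η).Opens) := ⟨⟨y, hyU⟩⟩
  have hfrac := functionField_isFractionRing_of_isAffineOpen _ _ hW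
  let F := algebraMap Γ(X.normalizedComponent η, X.toCurve η ⁻¹ᵁ U) (X.normalizedComponent η).functionField
  have hF : Function.Injective F := IsFractionRing.injective _ _
  have hmap : ∀ a : Γ(X.C, U), algebraMap _ (X.normalizedComponent η).functionField
      ((X.toCurve η).stalkMap y (X.C.presheaf.germ U _ hyU a)) = F ((X.toCurve η).app U a) := by
    intro a
    have h1 : (X.toCurve η).stalkMap y (X.C.presheaf.germ U _ hyU a) =
      (X.normalizedComponent η).presheaf.germ (X.toCurve η ⁻¹ᵁ U) y hyU ((X.toCurve η).app U a) :=
      Scheme.Hom.germ_stalkMap_apply _ _ _ _ _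
    rw [h1]
    exact Scheme.algebraMap_germ_eq_germToFunctionField (X.normalizedComponent η) hyU _
  obtain ⟨n, d, hd, rfl⟩ := IsFractionRing.div_surjective (A := Γ(X.normalizedComponent η, X.toCurve η ⁻¹ᵁ U)) f
  obtain ⟨r, s, hs, e⟩ := hfr n
  obtain ⟨r', s', hs', e'⟩ := hfr d
  have hd0 := nonZeroDivisors.ne_zero hd
  have hr' : (X.toCurve η).app U r' ≠ 0 := by rw [← e']; exact mul_ne_zero hd0 hs'
  refine ⟨X.C.presheaf.germ U _ hyU (r * s'), X.C.presheaf.germ U _ hyU (s * r'), ?_, ?_⟩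
  · rw [hmap, map_mul]
    exact (map_ne_zero_iff F hF).2 (mul_ne_zero hs hr')
  · rw [hmap, hmap, map_mul ((X.toCurve η).app U).hom, map_mul ((X.toCurve η).app U).hom, ← e, ← e']
    have : F d ≠ 0 := (map_ne_zero_iff F hF).2 hd0
    change F n / F d * _ = _
    rw [map_mul F, map_mul F, map_mul F, map_mul F]
    field_simp

end PrestableLogCurve

/-! ### Germs of étale log structures -/

section EtaleGerms

variable {X : Scheme.{u}} (N : EtaleLogStructure X) {c : X} {V W : X.Etale}

/-- The set of lifts to `V` of the geometric point over `c`. -/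
abbrev etaleFiber (c : X) (V : X.Etale) : Type u :=
  (Scheme.pointSmallEtale (geomPoint c)).fiber.obj V

/-- The map on lifts of the geometric point induced by a morphism of étale schemes. -/
abbrev etaleFiberMap {c : X} {V W : X.Etale} (f : W ⟶ V) : etaleFiber c W → etaleFiber c V :=
  (Scheme.pointSmallEtale (geomPoint c)).fiber.map f

/-- The point of `V` under a lift of the geometric point. -/
def etalePoint (a : etaleFiber c V) : V.left :=
  (Scheme.pointSmallEtaleFiberObjToPreimage (geomPoint c) (geomPoint_apply c default) a).1

lemma hom_etalePoint (a : etaleFiber c V) : V.hom (etalePoint a) = c :=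
  (Scheme.pointSmallEtaleFiberObjToPreimage (geomPoint c) (geomPoint_apply c default) a).2

lemma exists_etalePoint_eq (v : V.left) (hv : V.hom v = c) : ∃ a : etaleFiber c V, etalePoint a = v := by
  obtain ⟨a, ha⟩ := Scheme.pointSmallEtaleFiberObjToPreimage_surjective (geomPoint c)
    (geomPoint_apply c default) V ⟨v, hv⟩
  exact ⟨a, congrArg Subtype.val ha⟩

lemma etalePoint_map (f : W ⟶ V) (b : etaleFiber c W) :
    etalePoint (etaleFiberMap f b) = f.left (etalePoint b) := rfl

lemma etaleFiberMap_comp {V' : X.Etale} (g : V' ⟶ W) (f : W ⟶ V) (b : etaleFiber c V') :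
    etaleFiberMap (g ≫ f) b = etaleFiberMap f (etaleFiberMap g b) := by
  simp [etaleFiberMap]

/-- The germ of a section at a lift of the geometric point. -/
def etaleGerm (a : etaleFiber c V) : N.sections V →* etaleStalk N c :=
  ((Scheme.pointSmallEtale (geomPoint c)).toPresheafFiber V a N.M.obj).hom

lemma etaleGerm_res (f : W ⟶ V) (b : etaleFiber c W) (s : N.sections V) :
    etaleGerm N b (N.res f s) = etaleGerm N (etaleFiberMap f b) s :=
  congrArg (fun k => k.hom s) ((Scheme.pointSmallEtale (geomPoint c)).toPresheafFiber_w f b N.M.obj)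

lemma etaleGerm_eq_iff (a : etaleFiber c V) (s t : N.sections V) :
    etaleGerm N a s = etaleGerm N a t ↔ ∃ (W : X.Etale) (f : W ⟶ V) (b : etaleFiber c W),
      etaleFiberMap f b = a ∧ N.res f s = N.res f t :=
  (Scheme.pointSmallEtale (geomPoint c)).toPresheafFiber_eq_iff' (P := N.M.obj) V a s t

lemma exists_etaleFiber_refinement (a : etaleFiber c V) (b : etaleFiber c W) :
    ∃ (V' : X.Etale) (d : etaleFiber c V') (f : V' ⟶ V) (g : V' ⟶ W),
      etaleFiberMap f d = a ∧ etaleFiberMap g d = b := by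
  have := (Scheme.pointSmallEtale (geomPoint c)).isCofiltered
  let A : (Scheme.pointSmallEtale (geomPoint c)).fiber.Elements := ⟨V, a⟩
  let B : (Scheme.pointSmallEtale (geomPoint c)).fiber.Elements := ⟨W, b⟩
  exact ⟨(IsCofiltered.min A B).1, (IsCofiltered.min A B).2, (IsCofiltered.minToLeft A B).1,
    (IsCofiltered.minToRight A B).1, (IsCofiltered.minToLeft A B).2,
    (IsCofiltered.minToRight A B).2⟩

lemma exists_etaleGerm_eq (a : etaleFiber c V) (s : etaleStalk N c) :
    ∃ (W : X.Etale) (f : W ⟶ V) (b : etaleFiber c W) (t : N.sections W),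
      etaleFiberMap f b = a ∧ etaleGerm N b t = s := by
  obtain ⟨W, b, t, rfl⟩ := (Scheme.pointSmallEtale (geomPoint c)).toPresheafFiber_jointly_surjective
    (P := N.M.obj) s
  obtain ⟨V', d, f, g, h1, h2⟩ := exists_etaleFiber_refinement a b
  refine ⟨V', f, d, N.res g t, h1, ?_⟩
  rw [etaleGerm_res, h2]
  rfl

lemma exists_lift_of_mem_sieve (a : etaleFiber c V) {S : Sieve V} (hS : S ∈ X.smallEtaleTopology V) :
    ∃ (W : X.Etale) (f : W ⟶ V) (b : etaleFiber c W), S f ∧ etaleFiberMap f b = a := by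
  obtain ⟨W, f, hf, b, hb⟩ := (Scheme.pointSmallEtale (geomPoint c)).jointly_surjective S hS a
  exact ⟨W, f, b, hf, hb⟩

lemma res_comp {V' : X.Etale} (g : V' ⟶ W) (f : W ⟶ V) (s : N.sections V) :
    N.res (g ≫ f) s = N.res g (N.res f s) := by
  have h : N.M.obj.map (g ≫ f).op = N.M.obj.map f.op ≫ N.M.obj.map g.op := by
    rw [op_comp, Functor.map_comp]
  exact congrArg (fun k => k.hom s) h

lemma etaleAlpha_res (f : W ⟶ V) (s : N.sections V) :
    etaleAlpha N W (N.res f s) = f.left.appTop (etaleAlpha N V s) :=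
  congrArg (fun k => k.hom s) (N.α.naturality f.op)

/-- An open subscheme of an étale scheme. -/
def etaleOpen (V : X.Etale) (U : V.left.Opens) : X.Etale :=
  Scheme.Etale.mk (U.ι ≫ V.hom)

/-- The inclusion of an open subscheme of an étale scheme. -/
def etaleOpenMap (V : X.Etale) (U : V.left.Opens) : etaleOpen V U ⟶ V :=
  MorphismProperty.Over.homMk U.ι rfl

lemma exists_lift_opens {T Z : Scheme.{u}} (f : T ⟶ Z) (U : Z.Opens) (h : ∀ t, f t ∈ U) :
    ∃ l : T ⟶ U.toScheme, l ≫ U.ι = f := by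
  have hr : Set.range f ⊆ Set.range U.ι := by
    rintro _ ⟨z, rfl⟩
    simpa using h z
  exact ⟨IsOpenImmersion.lift U.ι f hr, IsOpenImmersion.lift_fac _ _ _⟩

lemma exists_etaleFiberMap_etaleOpenMap (a : etaleFiber c V) (U : V.left.Opens) (h : etalePoint a ∈ U) :
    ∃ b : etaleFiber c (etaleOpen V U), etaleFiberMap (etaleOpenMap V U) b = a := by
  let a' : Spec (.of (AlgebraicClosure (X.residueField c))) ⟶ V.left := a.left
  have ha' : a' ≫ V.hom = geomPoint c := Over.w a
  obtain ⟨l, hl⟩ := exists_lift_opens a' U (fun z => by rw [Subsingleton.elim z default]; exact h)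
  refine ⟨Over.homMk l ?_, Over.OverMorphism.ext hl⟩
  change l ≫ U.ι ≫ V.hom = geomPoint c
  rw [← Category.assoc, hl, ha']

/-- A section of a log structure is invertible if its image in the structure sheaf is. -/
lemma isUnit_of_isUnit_etaleAlpha {s : N.sections V} (h : IsUnit (etaleAlpha N V s)) : IsUnit s := by
  obtain ⟨u, hu⟩ := h
  obtain ⟨t, ht, -⟩ := N.existsUnique_unit V u⁻¹
  obtain ⟨m, hm, huniq⟩ := N.existsUnique_unit V 1
  have h1 : s * t = m := huniq _ (by
    change etaleAlpha N V (s * t) = _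
    rw [map_mul, ← hu]
    have ht' : etaleAlpha N V t = ((u⁻¹ : Γ(V.left, ⊤)ˣ) : Γ(V.left, ⊤)) := ht
    rw [ht']
    exact u.mul_inv)
  have h2 : (1 : N.sections V) = m := huniq _ (map_one (etaleAlpha N V))
  exact IsUnit.of_mul_eq_one t (h1.trans h2.symm)

/-- A section of a log structure whose germ is invertible becomes invertible on an étale neighbourhood. -/
lemma exists_isUnit_res {a : etaleFiber c V} {s : N.sections V} (h : IsUnit (etaleGerm N a s)) :
    ∃ (W : X.Etale) (f : W ⟶ V) (b : etaleFiber c W), etaleFiberMap f b = a ∧ IsUnit (N.res f s) := by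
  obtain ⟨t, ht⟩ := h.exists_right_inv
  obtain ⟨W, f, b, t, rfl, rfl⟩ := exists_etaleGerm_eq N a t
  rw [← etaleGerm_res, ← map_mul, ← map_one (etaleGerm N b), etaleGerm_eq_iff] at ht
  obtain ⟨W', g, d, rfl, h'⟩ := ht
  refine ⟨W', g ≫ f, d, etaleFiberMap_comp g f d, ?_⟩
  rw [map_mul, map_one] at h'
  rw [res_comp]
  exact IsUnit.of_mul_eq_one _ h'

/-- The germ at a point of the étale scheme `V` of a function on `V`. -/
abbrev germTop {Z : Scheme.{u}} (z : Z) : Γ(Z, ⊤) →+* Z.presheaf.stalk z :=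
  (Z.presheaf.germ ⊤ z trivial).hom

lemma isUnit_of_germTop {Z : Scheme.{u}} {s : Γ(Z, ⊤)} (h : ∀ z, IsUnit (germTop z s)) : IsUnit s :=
  Z.toRingedSpace.isUnit_of_isUnit_germ ⊤ s fun z _ => h z

lemma germTop_appTop {Y Z : Scheme.{u}} (f : Y ⟶ Z) (y : Y) (s : Γ(Z, ⊤)) :
    germTop y (f.appTop s) = f.stalkMap y (germTop (f y) s) :=
  (Scheme.Hom.germ_stalkMap_apply f ⊤ y trivial s).symm

lemma isUnit_etaleGerm_iff (a : etaleFiber c V) (s : N.sections V) :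
    IsUnit (etaleGerm N a s) ↔ IsUnit (germTop (etalePoint a) (etaleAlpha N V s)) := by
  constructor
  · intro h
    obtain ⟨W, f, b, rfl, h'⟩ := exists_isUnit_res N h
    have h1 := (h'.map (etaleAlpha N W)).map (germTop (etalePoint b))
    rw [etaleAlpha_res, germTop_appTop] at h1
    exact isUnit_of_map_unit (f.left.stalkMap (etalePoint b)).hom _ h1
  · intro h
    let U := V.left.basicOpen (etaleAlpha N V s)
    have hU : etalePoint a ∈ U := (V.left.mem_basicOpen _ _ (U := ⊤) trivial).2 h
    obtain ⟨b, rfl⟩ := exists_etaleFiberMap_etaleOpenMap a U hU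
    rw [← etaleGerm_res]
    apply IsUnit.map
    apply isUnit_of_isUnit_etaleAlpha
    rw [etaleAlpha_res]
    refine isUnit_of_germTop fun z => ?_
    have hz : U.ι z ∈ U := z.2
    have h1 : IsUnit (germTop (U.ι z) (etaleAlpha N V s)) :=
      (V.left.mem_basicOpen _ _ (U := ⊤) trivial).1 hz
    have h2 := germTop_appTop U.ι z (etaleAlpha N V s)
    exact h2 ▸ h1.map (U.ι.stalkMap z).hom

lemma topPoint_unique (a : etaleFiber c (etaleTop X)) : a = topPoint c := by
  apply Over.OverMorphism.ext
  have h : a.left ≫ 𝟙 X = geomPoint c := Over.w a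
  exact (Category.comp_id _).symm.trans h

lemma globalGerm_eq (a : etaleFiber c V) (s : N.sections (etaleTop X)) :
    globalGerm N c s = etaleGerm N a (N.res (toEtaleTop V) s) := by
  rw [etaleGerm_res, topPoint_unique (etaleFiberMap (toEtaleTop V) a)]
  rfl

end EtaleGerms

/-! ### Charts and stalks of the ghost sheaf -/

section ChartGhost

variable {X : Scheme.{u}} {N : EtaleLogStructure X} {c : X} {V : X.Etale} {P : Type u}
  [CommMonoid P] (β : P →* N.sections V) (v : V.left)

/-- A chart defines a homomorphism from the monoid to the local rings. -/
def chartFunction : P →* V.left.presheaf.stalk v :=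
  ((germTop v : Γ(V.left, ⊤) →+* _).toMonoidHom).comp ((etaleAlpha N V).comp β)

/-- The elements of the monoid of a chart which become invertible at a point. -/
def chartFace : Submonoid P := primeFace (chartFunction β v) (IsLocalRing.maximalIdeal _)

variable {β v}

lemma mem_chartFace {p : P} : p ∈ chartFace β v ↔ IsUnit (germTop v (etaleAlpha N V (β p))) := by
  rw [chartFace, mem_primeFace, IsLocalRing.mem_maximalIdeal, mem_nonunits_iff, not_not]
  rfl

variable (β) in
/-- The map from the monoid of a chart to a stalk of the ghost sheaf. -/
def chartGhost (a : etaleFiber c V) : P →* Associates (etaleStalk N c) :=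
  Associates.mkMonoidHom.comp ((etaleGerm N a).comp β)

lemma chartGhost_surjective (hβ : N.IsChart β) (a : etaleFiber c V) :
    Function.Surjective (chartGhost β a) := by
  rintro ⟨s⟩
  obtain ⟨W, f, b, t, rfl, rfl⟩ := exists_etaleGerm_eq N a s
  obtain ⟨S, hS, h⟩ := hβ.surj f t
  obtain ⟨W', g, d, hg, rfl⟩ := exists_lift_of_mem_sieve b hS
  obtain ⟨p, x, hx⟩ := h g hg
  refine ⟨p, ?_⟩
  change Associates.mk (etaleGerm N _ (β p)) = Associates.mk _
  rw [← etaleGerm_res N g d t, hx, map_mul, ← etaleFiberMap_comp, ← etaleGerm_res]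
  exact Associates.mk_eq_mk_iff_associated.2 ⟨x.map (etaleGerm N d), rfl⟩

lemma chartGhost_eq_iff (hβ : N.IsChart β) (a : etaleFiber c V) (p p' : P) :
    chartGhost β a p = chartGhost β a p' ↔
      ∃ b ∈ chartFace β (etalePoint a), ∃ b' ∈ chartFace β (etalePoint a), p * b = p' * b' := by
  constructor
  · intro h
    obtain ⟨x, hx⟩ := (Associates.mk_eq_mk_iff_associated.1 h).symm
    obtain ⟨W, f, b, t, rfl, ht⟩ := exists_etaleGerm_eq N a (x : etaleStalk N c)
    have htu : IsUnit (etaleGerm N b t) := ht ▸ x.isUnit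
    obtain ⟨W', g, d, rfl, ⟨y, hy⟩⟩ := exists_isUnit_res N htu
    have hx' : etaleGerm N (etaleFiberMap f (etaleFiberMap g d)) (β p') * x =
      etaleGerm N (etaleFiberMap f (etaleFiberMap g d)) (β p) := hx
    rw [← ht, ← etaleFiberMap_comp, ← etaleGerm_res, ← etaleGerm_res, ← etaleGerm_res, ← hy, ← map_mul,
      etaleGerm_eq_iff] at hx'
    obtain ⟨W₂, g₂, d₂, rfl, e⟩ := hx'
    rw [map_mul, ← res_comp, ← res_comp] at e
    obtain ⟨S, hS, h'⟩ := hβ.inj (g₂ ≫ g ≫ f) p p' (y.map (N.res g₂)) e.symm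
    obtain ⟨W₃, g₃, d₃, hg₃, rfl⟩ := exists_lift_of_mem_sieve d₂ hS
    obtain ⟨q, q', hq, hq', e', -⟩ := h' g₃ hg₃
    have key : ∀ q, IsUnit (N.res (g₃ ≫ g₂ ≫ g ≫ f) (β q)) → q ∈ chartFace β (etalePoint
        (etaleFiberMap f (etaleFiberMap g (etaleFiberMap g₂ (etaleFiberMap g₃ d₃))))) := by
      intro q hq
      rw [mem_chartFace, ← isUnit_etaleGerm_iff, ← etaleFiberMap_comp, ← etaleFiberMap_comp,
        ← etaleFiberMap_comp, ← etaleGerm_res]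
      exact hq.map _
    exact ⟨q, key q hq, q', key q' hq', e'⟩
  · rintro ⟨b, hb, b', hb', e⟩
    have key : ∀ q ∈ chartFace β (etalePoint a), chartGhost β a q = 1 := by
      intro q hq
      rw [mem_chartFace, ← isUnit_etaleGerm_iff] at hq
      exact Associates.mk_eq_one.2 hq
    have := congrArg (chartGhost β a) e
    rwa [map_mul, map_mul, key b hb, key b' hb', mul_one, mul_one] at this

lemma baseGhost_eq_chartGhost {q : Multiplicative ℕ →* N.sections (etaleTop X)} (a : etaleFiber c V)
    {h : Multiplicative ℕ →* P} (hq : ∀ n, β (h n) = N.res (toEtaleTop V) (q n)) (n : ℕ) :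
    baseGhost q c n = Additive.ofMul (chartGhost β a (h (Multiplicative.ofAdd n))) := by
  change Additive.ofMul (Associates.mk (globalGerm N c (q _))) = Additive.ofMul (Associates.mk _)
  rw [globalGerm_eq N a]
  change _ = Additive.ofMul (Associates.mk (etaleGerm N a (β (h _))))
  rw [hq]

end ChartGhost

/-! ### Local rings of schemes over an affine scheme -/

section SpecStalk

variable {Z : Scheme.{u}} {S : Type u} [CommRing S] (r : Z ⟶ Spec (.of S)) (v : Z)

/-- The homomorphism to a local ring defined by a morphism to an affine scheme. -/
def specStalkHom : S →+* Z.presheaf.stalk v :=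
  ((Scheme.ΓSpecIso (.of S)).inv ≫ r.appTop ≫ Z.presheaf.germ ⊤ v trivial).hom

/-- Up to a localization, the homomorphism is the map on stalks. -/
lemma exists_localization_specStalkHom : ∃ (B : CommRingCat.{u}) (_ : Algebra S B) (T : Submonoid S)
    (_ : IsLocalization T B) (φ : B ⟶ Z.presheaf.stalk v),
    specStalkHom r v = φ.hom.comp (algebraMap S B) ∧ (Smooth r → φ.hom.Flat ∧ φ.hom.FormallySmooth) ∧
    (LocallyOfFiniteType r → φ.hom.EssFiniteType) ∧
    ∀ [LocallyOfFinitePresentation r], φ.hom.FormallySmooth → v ∈ r.smoothLocus := by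
  let x : PrimeSpectrum S := r v
  refine ⟨(Spec.structureSheaf S).presheaf.stalk x,
    (inferInstance : Algebra S ((Spec.structureSheaf S).presheaf.stalk x)), x.asIdeal.primeCompl,
    (inferInstance : IsLocalization.AtPrime ((Spec.structureSheaf S).presheaf.stalk x) x.asIdeal),
    r.stalkMap v, ?_, fun h => ⟨Flat.stalkMap r v, ?_⟩, fun h => LocallyOfFiniteType.stalkMap r v,
    fun h => h⟩
  · have h : (Scheme.ΓSpecIso (.of S)).inv ≫ r.appTop ≫ Z.presheaf.germ ⊤ v trivial =
        ((Scheme.ΓSpecIso (.of S)).inv ≫ (Spec (.of S)).presheaf.germ ⊤ (r v) trivial) ≫ r.stalkMap v := by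
      rw [Category.assoc]
      congr 1
      exact (Scheme.Hom.germ_stalkMap r ⊤ v trivial).symm
    exact congrArg CommRingCat.Hom.hom h
  · have : v ∈ r.smoothLocus := by
      rw [Scheme.Hom.smoothLocus_eq_top]
      trivial
    exact this

lemma flat_specStalkHom [hr : Smooth r] : (specStalkHom r v).Flat := by
  obtain ⟨B, _, T, _, φ, h, h1, -⟩ := exists_localization_specStalkHom r v
  have : Module.Flat S B := IsLocalization.flat _ T
  rw [h]
  exact RingHom.Flat.comp ((RingHom.flat_algebraMap_iff).2 this) (h1 hr).1

lemma formallySmooth_specStalkHom [hr : Smooth r] : (specStalkHom r v).FormallySmooth := by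
  obtain ⟨B, _, T, _, φ, h, h1, -⟩ := exists_localization_specStalkHom r v
  have : Algebra.FormallySmooth S B := Algebra.FormallySmooth.of_isLocalization T
  rw [h]
  exact RingHom.FormallySmooth.comp (RingHom.formallySmooth_algebraMap.2 this) (h1 hr).2

lemma mem_smoothLocus_of_formallySmooth [LocallyOfFinitePresentation r]
    (hs : (specStalkHom r v).FormallySmooth) : v ∈ r.smoothLocus := by
  obtain ⟨B, _, T, _, φ, h, -, -, h1⟩ := exists_localization_specStalkHom r v
  refine h1 ?_
  let := (specStalkHom r v).toAlgebra
  let : Algebra B (Z.presheaf.stalk v) := φ.hom.toAlgebra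
  have : IsScalarTower S B (Z.presheaf.stalk v) := .of_algebraMap_eq' h
  have : Algebra.FormallyEtale S B := Algebra.FormallyEtale.of_isLocalization T
  have h2 : Algebra.FormallySmooth S (Z.presheaf.stalk v) := hs
  have h3 : Algebra.FormallySmooth B (Z.presheaf.stalk v) :=
    Algebra.FormallySmooth.iff_restrictScalars.1 h2
  exact h3

lemma essFiniteType_specStalkHom [hr : LocallyOfFiniteType r] : (specStalkHom r v).EssFiniteType := by
  obtain ⟨B, _, T, _, φ, h, -, h1, -⟩ := exists_localization_specStalkHom r v
  have : Algebra.EssFiniteType S B := Algebra.EssFiniteType.of_isLocalization _ T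
  rw [h]
  exact RingHom.EssFiniteType.comp (RingHom.essFiniteType_algebraMap.2 this) (h1 hr)

end SpecStalk

/-! ### Generizations of a point and prime ideals of its local ring -/

section Generizations

variable {Z : Scheme.{u}} {v : Z}

/-- The prime ideal of the local ring at `v` which corresponds to a generization of `v`. -/
def primeOf {ξ : Z} (h : ξ ⤳ v) : Ideal (Z.presheaf.stalk v) :=
  (IsLocalRing.maximalIdeal (Z.presheaf.stalk ξ)).comap (Z.presheaf.stalkSpecializes h).hom

instance {ξ : Z} (h : ξ ⤳ v) : (primeOf h).IsPrime := Ideal.comap_isPrime _ _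

lemma mem_primeOf {ξ : Z} (h : ξ ⤳ v) (a : Z.presheaf.stalk v) :
    a ∈ primeOf h ↔ ¬ IsUnit (Z.presheaf.stalkSpecializes h a) := Iff.rfl

lemma fromSpecStalk_primeOf {ξ : Z} (h : ξ ⤳ v) : Z.fromSpecStalk v ⟨primeOf h, inferInstance⟩ = ξ := by
  have h1 := congrArg (fun k => k (IsLocalRing.closedPoint (Z.presheaf.stalk ξ)))
    (Scheme.SpecMap_stalkSpecializes_fromSpecStalk h)
  exact h1.trans Scheme.fromSpecStalk_closedPoint

lemma eq_of_primeOf_eq {ξ ξ' : Z} {h : ξ ⤳ v} {h' : ξ' ⤳ v} (e : primeOf h = primeOf h') : ξ = ξ' := by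
  rw [← fromSpecStalk_primeOf h, ← fromSpecStalk_primeOf h']
  congr 1
  exact PrimeSpectrum.ext e

lemma exists_primeOf_eq (q : Ideal (Z.presheaf.stalk v)) [hq : q.IsPrime] :
    ∃ (ξ : Z) (h : ξ ⤳ v), primeOf h = q := by
  have h1 : Z.fromSpecStalk v ⟨q, hq⟩ ∈ Set.range (Z.fromSpecStalk v) := ⟨_, rfl⟩
  rw [Scheme.range_fromSpecStalk] at h1
  refine ⟨_, h1, ?_⟩
  have h2 := (Z.fromSpecStalk v).isEmbedding.injective (fromSpecStalk_primeOf h1)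
  exact congrArg PrimeSpectrum.asIdeal h2

lemma primeOf_refl : primeOf (specializes_rfl (x := v)) = IsLocalRing.maximalIdeal _ := by
  ext a
  rw [mem_primeOf, TopCat.Presheaf.stalkSpecializes_refl]
  rfl

lemma stalkSpecializes_germTop {ξ : Z} (h : ξ ⤳ v) (s : Γ(Z, ⊤)) :
    Z.presheaf.stalkSpecializes h (germTop v s) = germTop ξ s :=
  Z.presheaf.germ_stalkSpecializes_apply (U := ⊤) trivial h s

/-- The map on local rings of an étale morphism is unramified. -/
lemma maximalIdeal_le_map_stalkMap {Y : Scheme.{u}} (f : Z ⟶ Y) [Etale f] (v : Z) :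
    (IsLocalRing.maximalIdeal (Y.presheaf.stalk (f v))).map (f.stalkMap v).hom =
      IsLocalRing.maximalIdeal (Z.presheaf.stalk v) := by
  let : Algebra (Y.presheaf.stalk (f v)) (Z.presheaf.stalk v) := (f.stalkMap v).hom.toAlgebra
  have : IsLocalHom (algebraMap (Y.presheaf.stalk (f v)) (Z.presheaf.stalk v)) :=
    inferInstanceAs <| IsLocalHom (f.stalkMap v).hom
  have : Algebra.EssFiniteType (Y.presheaf.stalk (f v)) (Z.presheaf.stalk v) :=
    LocallyOfFiniteType.stalkMap f v
  have : Algebra.FormallyUnramified (Y.presheaf.stalk (f v)) (Z.presheaf.stalk v) :=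
    FormallyUnramified.stalkMap f v
  exact Algebra.FormallyUnramified.map_maximalIdeal

lemma isLocalHom_stalkSpecializes_of_eq {x y : Z} (e : x = y) (h : x ⤳ y) :
    IsLocalHom (Z.presheaf.stalkSpecializes h).hom := by
  subst e
  rw [TopCat.Presheaf.stalkSpecializes_refl]
  exact ⟨fun a ha => ha⟩

/-- There are no specializations in the fibres of an étale morphism. -/
lemma eq_of_specializes_of_etale {Y : Scheme.{u}} (f : Z ⟶ Y) [Etale f] {ξ v : Z} (h : ξ ⤳ v)
    (e : f ξ = f v) : ξ = v := by
  refine eq_of_primeOf_eq (h := h) (h' := specializes_rfl) ?_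
  rw [primeOf_refl]
  refine le_antisymm (IsLocalRing.le_maximalIdeal (Ideal.IsPrime.ne_top inferInstance)) ?_
  rw [← maximalIdeal_le_map_stalkMap f v, Ideal.map_le_iff_le_comap]
  intro a ha
  have h1 := congrArg (fun k => k.hom a) (f.stalkSpecializes_stalkMap ξ v h)
  have h2 : ¬ IsUnit (f.stalkMap ξ (Y.presheaf.stalkSpecializes (h.map f.continuous) a)) := by
    intro h3
    have h4 := isUnit_of_map_unit (f.stalkMap ξ).hom _ h3
    have := isLocalHom_stalkSpecializes_of_eq e (h.map f.continuous)
    exact ha (isUnit_of_map_unit (Y.presheaf.stalkSpecializes (h.map f.continuous)).hom _ h4)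
  intro h3
  exact h2 ((congrArg IsUnit h1).mpr h3)

end Generizations

section

variable {X : Scheme.{u}} {N : EtaleLogStructure X} {V : X.Etale} {P : Type u}
  [CommMonoid P] (β : P →* N.sections V) {v : V.left}

lemma primeFace_primeOf {ξ : V.left} (h : ξ ⤳ v) :
    primeFace (chartFunction β v) (primeOf h) = chartFace β ξ := by
  ext p
  rw [mem_primeFace, mem_primeOf, not_not, mem_chartFace, chartFunction]
  change IsUnit (V.left.presheaf.stalkSpecializes h (germTop v _)) ↔ _
  rw [stalkSpecializes_germTop]
  rfl

lemma chartFace_le {ξ : V.left} (h : ξ ⤳ v) : chartFace β v ≤ chartFace β ξ := by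
  intro p hp
  rw [mem_chartFace] at hp ⊢
  rw [← stalkSpecializes_germTop h]
  exact hp.map (V.left.presheaf.stalkSpecializes h).hom

end

/-! ### Generic points and special points -/

lemma exists_genericPoints_specializes {Z : Type*} [TopologicalSpace Z] [QuasiSober Z] (z : Z) :
    ∃ ζ ∈ genericPoints Z, ζ ⤳ z := by
  have h := IsIrreducible.isGenericPoint_genericPoint isIrreducible_irreducibleComponent
    (isClosed_irreducibleComponent (x := z))
  refine ⟨_, ?_, h.specializes mem_irreducibleComponent⟩
  change closure {_} ∈ irreducibleComponents Z
  rw [h]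
  exact irreducibleComponent_mem_irreducibleComponents z

lemma eq_of_specializes_genericPoints {Z : Type*} [TopologicalSpace Z] [T0Space Z] {η ξ : Z}
    (hη : η ∈ genericPoints Z) (h : ξ ⤳ η) : ξ = η := by
  have h1 : closure {η} ⊆ closure {ξ} := specializes_iff_closure_subset.1 h
  have h2 : closure {ξ} ⊆ closure {η} := hη.2 isIrreducible_singleton.closure h1
  exact (h.antisymm (specializes_iff_closure_subset.2 h2)).eq

namespace PrestableLogCurve

variable {κ : Type u} [Field κ] (X : PrestableLogCurve κ)

instance : IsLocallyNoetherian X.C := LocallyOfFiniteType.isLocallyNoetherian X.π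

instance : CompactSpace X.C := by
  have := QuasiCompact.isCompact_preimage (f := X.π) Set.univ isOpen_univ isCompact_univ
  exact ⟨by simpa using this⟩

instance : IsNoetherian X.C where

instance : IsReduced X.C := by
  have := X.geometricallyReduced
  exact GeometricallyReduced.geometrically_isReduced (f := X.π) (𝟙 _) (𝟙 _) X.π
    (IsPullback.of_horiz_isIso ⟨by simp⟩)

lemma baseGhost_injective {c : X.C} (hc : IsSmoothAt X.π c) :
    Function.Injective (baseGhost X.q c) := by
  obtain ⟨θ, hθ⟩ := X.ghost c hc
  intro a b hab
  have := congrArg θ hab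
  rw [hθ, hθ] at this
  exact congrArg Prod.fst this

lemma isSmoothAt_of_mem_genericPoints [CharZero κ] {η : X.C} (hη : η ∈ genericPoints X.C) :
    IsSmoothAt X.π η := by
  rw [isSmoothAt_iff_mem_smoothLocus]
  have hd : Dense (X.π.smoothLocus : Set X.C) := X.π.dense_smoothLocus_of_perfectField
  have hfin : (genericPoints X.C).Finite := genericPoints.finite
    NoetherianSpace.finite_irreducibleComponents
  let S : Set X.C := genericPoints X.C ∩ X.π.smoothLocus
  have hS : S.Finite := hfin.inter_of_left _
  have h1 : IsClosed (⋃ ζ ∈ S, closure {ζ}) := hS.isClosed_biUnion fun _ _ => isClosed_closure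
  have h2 : (X.π.smoothLocus : Set X.C) ⊆ ⋃ ζ ∈ S, closure {ζ} := by
    intro x hx
    obtain ⟨ζ, hζ, h⟩ := exists_genericPoints_specializes x
    exact Set.mem_biUnion ⟨hζ, h.mem_open X.π.smoothLocus.2 hx⟩ (specializes_iff_mem_closure.1 h)
  have h3 : η ∈ ⋃ ζ ∈ S, closure {ζ} := closure_minimal h2 h1 (hd η)
  obtain ⟨ζ, hζ, h⟩ := Set.mem_iUnion₂.1 h3
  have := eq_of_specializes_genericPoints hη (specializes_iff_mem_closure.2 h)
  exact this ▸ hζ.2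

lemma isClosed_singleton_of_isMarked {c : X.C} (hc : X.IsMarked c) : IsClosed {c} := by
  obtain ⟨i, rfl⟩ := hc
  have := isClosedImmersion_of_comp_eq_id _ _ (X.sec_π i)
  have h := (X.sec i).isClosedEmbedding.isClosed_range
  rwa [Set.range_unique] at h

lemma not_isMarked_of_mem_genericPoints {η : X.C} (hη : η ∈ genericPoints X.C) :
    ¬ X.IsMarked η := by
  intro h
  have h1 := X.dim_eq_one (closure {η}) hη
  rw [(X.isClosed_singleton_of_isMarked h).closure_eq] at h1
  have h2 := topologicalKrullDim_zero_of_discreteTopology ({η} : Set X.C)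
  rw [h1] at h2
  exact absurd h2 (by decide)

/-- A point with a specialization is the generic point of a component. -/
lemma mem_genericPoints_of_specializes {c c' : X.C} (h : c ⤳ c') (hne : c ≠ c') :
    c ∈ genericPoints X.C := by
  obtain ⟨ζ, hζ, h'⟩ := exists_genericPoints_specializes c
  obtain rfl := (X.eq_or_eq_of_specializes hζ h' h).resolve_right hne
  exact hζ

lemma isClosed_specialPoints (η : X.C) : IsClosed (X.specialPoints η) := by
  have h1 : IsClosed {c : X.C | X.IsNode c} := by
    have : {c : X.C | X.IsNode c} = (X.π.smoothLocus : Set X.C)ᶜ := by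
      ext c
      exact not_congr (isSmoothAt_iff_mem_smoothLocus X.π c)
    rw [this]
    exact X.π.smoothLocus.2.isClosed_compl
  have h2 : IsClosed {c : X.C | X.IsMarked c} := by
    have : {c : X.C | X.IsMarked c} = ⋃ i, {X.sec i default} := by
      ext c
      simp [IsMarked, eq_comm]
    rw [this]
    exact isClosed_iUnion_of_finite fun i => X.isClosed_singleton_of_isMarked ⟨i, rfl⟩
  exact (h2.union h1).preimage (X.toCurve η).continuous

variable [CharZero κ] {η : X.C}

lemma eq_of_specializes_normalizedComponent (hη : η ∈ genericPoints X.C)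
    {z y : X.normalizedComponent η} (h : z ⤳ y)
    (hz : z ≠ genericPoint (X.normalizedComponent η)) : z = y := by
  have hy : y ≠ genericPoint (X.normalizedComponent η) := by
    rintro rfl
    exact hz (((genericPoint_spec (X.normalizedComponent η)).specializes trivial).antisymm h).eq.symm
  have hD := X.isDiscreteValuationRing_stalk hη hy
  have h1 : ∀ w : X.normalizedComponent η, ∀ hw : w ⤳ y, primeOf hw = ⊥ ∨ w = y := by
    intro w hw
    by_cases h0 : primeOf hw = ⊥
    · exact Or.inl h0
    · right
      refine eq_of_primeOf_eq (h := hw) (h' := specializes_rfl) ?_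
      rw [primeOf_refl]
      exact IsLocalRing.eq_maximalIdeal (Ring.DimensionLEOne.maximalOfPrime h0 inferInstance)
  have h2 := h1 _ ((genericPoint_spec (X.normalizedComponent η)).specializes (Set.mem_univ y))
  refine (h1 z h).resolve_left fun h0 => hz ?_
  exact eq_of_primeOf_eq (h0.trans (h2.resolve_right (Ne.symm hy)).symm)

lemma genericPoint_notMem_specialPoints (hη : η ∈ genericPoints X.C) :
    genericPoint (X.normalizedComponent η) ∉ X.specialPoints η := by
  rintro (h | h)
  · rw [toCurve_genericPoint] at h
    exact X.not_isMarked_of_mem_genericPoints hη h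
  · rw [toCurve_genericPoint] at h
    exact h (X.isSmoothAt_of_mem_genericPoints hη)

lemma isNoetherian_normalizedComponent (hη : η ∈ genericPoints X.C) :
    IsNoetherian (X.normalizedComponent η) := by
  have := X.isLocallyNoetherian_normalizedComponent hη
  have h : CompactSpace (X.normalizedComponent η) := by
    have := QuasiCompact.isCompact_preimage (f := X.toCurve η) Set.univ isOpen_univ isCompact_univ
    exact ⟨by simpa using this⟩
  exact { }

/-- A closed subset of a normalized component without the generic point is finite. -/
lemma finite_of_isClosed (hη : η ∈ genericPoints X.C) {Z : Set (X.normalizedComponent η)}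
    (hZ : IsClosed Z) (h : genericPoint (X.normalizedComponent η) ∉ Z) : Z.Finite := by
  have := X.isNoetherian_normalizedComponent hη
  obtain ⟨S, hS, hcl, hirr, rfl⟩ := NoetherianSpace.exists_finite_set_isClosed_irreducible hZ
  refine hS.sUnion fun t ht => ?_
  have hg := (hirr t ht).isGenericPoint_genericPoint (hcl t ht)
  refine (Set.finite_singleton ((hirr t ht).genericPoint)).subset fun x hx => ?_
  have hsp := hg.specializes hx
  refine (X.eq_of_specializes_normalizedComponent hη hsp fun e => h ?_).symm
  rw [← e]
  exact ⟨t, ht, hg.mem⟩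

theorem finite_specialPoints (hη : η ∈ genericPoints X.C) : (X.specialPoints η).Finite :=
  X.finite_of_isClosed hη (X.isClosed_specialPoints η) (X.genericPoint_notMem_specialPoints hη)

/-- At the generic point of a component every element of the ghost stalk comes from the base. -/
lemma exists_eq_baseGhost (hη : η ∈ genericPoints X.C) (m : EtaleGhost X.N η) :
    ∃ n, m = baseGhost X.q η n := by
  obtain ⟨θ, hθ⟩ := X.ghost η (X.isSmoothAt_of_mem_genericPoints hη)
  refine ⟨(θ m).1, θ.injective ?_⟩
  rw [hθ]
  ext i
  · rfl
  · exact absurd ⟨i.1, i.2⟩ (X.not_isMarked_of_mem_genericPoints hη)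

end PrestableLogCurve

/-! ### Charts of log smooth curves -/

/-- A chart of a log smooth curve: a chart of the morphism to the standard log point together with
the smooth morphism to the spectrum of the chart ring. -/
structure LogChart {κ : Type u} [Field κ] (X : PrestableLogCurve κ) where
  V : X.C.Etale
  P : Type u
  [commMonoid : CommMonoid P]
  h : Multiplicative ℕ →* P
  β : P →* X.N.sections V
  isFineSaturated : IsFineSaturated P
  isChart : X.N.IsChart β
  base : ∀ n, β (h n) = X.N.res (toEtaleTop V) (X.q n)
  r : V.left ⟶ Spec (.of (ChartRing κ h))
  smooth : Smooth r
  comp_eq : r ≫ Spec.map (CommRingCat.ofHom (algebraMap κ (ChartRing κ h))) = V.hom ≫ X.π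
  alpha_eq : ∀ p : P, etaleAlpha X.N V (β p) = r.appTop ((Scheme.ΓSpecIso (.of (ChartRing κ h))).inv
    (Ideal.Quotient.mk _ (MonoidAlgebra.of κ P p)))

attribute [instance] LogChart.commMonoid LogChart.smooth

namespace LogChart

variable {κ : Type u} [Field κ] {X : PrestableLogCurve κ}

lemma exists_mem (c : X.C) : ∃ (L : LogChart X) (v : L.V.left), L.V.hom v = c := by
  obtain ⟨V, P, _, h, β, ⟨v, hv⟩, h1, h2, h3, -, -, r, h4, h5, h6⟩ := X.logSmooth c
  exact ⟨⟨V, P, h, β, h1, h2, h3, r, h4, h5, h6⟩, v, hv⟩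

variable (L : LogChart X) (v : L.V.left)

/-- The element of the monoid of a chart which comes from the generator of the log structure of the
standard log point. -/
abbrev ρ : L.P := chartBase L.h

/-- The local ring at a point of a chart, as an algebra over the chart ring. -/
abbrev localRing : Type u := L.V.left.presheaf.stalk v

instance : Algebra (ChartRing κ L.h) (L.localRing v) := (specStalkHom L.r v).toAlgebra

instance : Algebra κ (L.localRing v) :=
  ((specStalkHom L.r v).comp (algebraMap κ (ChartRing κ L.h))).toAlgebra

instance : IsScalarTower κ (ChartRing κ L.h) (L.localRing v) :=
  IsScalarTower.of_algebraMap_eq (R := κ) (S := ChartRing κ L.h) (A := L.localRing v) fun _ => rfl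

instance : Module.Flat (ChartRing κ L.h) (L.localRing v) := flat_specStalkHom L.r v

instance : Algebra.FormallySmooth (ChartRing κ L.h) (L.localRing v) :=
  formallySmooth_specStalkHom L.r v

instance : IsLocallyNoetherian L.V.left := LocallyOfFiniteType.isLocallyNoetherian (Y := X.C) L.V.hom

instance : IsNoetherianRing (L.localRing v) :=
  inferInstanceAs (IsNoetherianRing (L.V.left.presheaf.stalk v))

lemma algebraMap_eq : algebraMap κ (L.localRing v) = specStalkHom (L.V.hom ≫ X.π) v := by
  have h : CommRingCat.ofHom (algebraMap κ (ChartRing κ L.h)) ≫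
      (Scheme.ΓSpecIso (.of (ChartRing κ L.h))).inv =
      (Scheme.ΓSpecIso (.of κ)).inv ≫ (Spec.map (CommRingCat.ofHom (algebraMap κ (ChartRing κ L.h)))).appTop :=
    Scheme.ΓSpecIso_inv_naturality _
  have h2 : CommRingCat.ofHom (algebraMap κ (ChartRing κ L.h)) ≫
      (Scheme.ΓSpecIso (.of (ChartRing κ L.h))).inv ≫ L.r.appTop ≫ L.V.left.presheaf.germ ⊤ v trivial =
      (Scheme.ΓSpecIso (.of κ)).inv ≫ (L.V.hom ≫ X.π).appTop ≫ L.V.left.presheaf.germ ⊤ v trivial := by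
    rw [← L.comp_eq, Scheme.Hom.comp_appTop, reassoc_of% h, Category.assoc]
  exact congrArg CommRingCat.Hom.hom h2

instance : Algebra.EssFiniteType κ (L.localRing v) := by
  have h := essFiniteType_specStalkHom (L.V.hom ≫ X.π) v
  rw [← algebraMap_eq] at h
  exact RingHom.essFiniteType_algebraMap.1 h

lemma chartPsi_eq : chartPsi κ L.h (L.localRing v) = chartFunction L.β v := by
  ext p
  change specStalkHom L.r v _ = germTop v (etaleAlpha X.N L.V (L.β p))
  rw [L.alpha_eq]
  rfl

lemma chartFunction_ρ : chartFunction L.β v L.ρ = 0 := by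
  rw [← chartPsi_eq, chartPsi_base]

lemma integral (a b c : L.P) (h : a * c = b * c) : a = b := L.isFineSaturated.integral a b c h

/-- The face of the elements of the monoid which are invertible at `v`. -/
abbrev face : Submonoid L.P := chartFace L.β v

lemma isFace_face : IsFace (L.face v) := isFace_primeFace _ _

lemma ρ_notMem_face : L.ρ ∉ L.face v := fun h => h (by rw [chartFunction_ρ]; exact zero_mem _)

variable {v}

lemma primeFace_eq {ξ : L.V.left} (h : ξ ⤳ v) :
    primeFace (chartPsi κ L.h (L.localRing v)) (primeOf h) = L.face ξ := by
  rw [chartPsi_eq]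
  exact primeFace_primeOf L.β h

lemma primeFace_maximalIdeal :
    primeFace (chartPsi κ L.h (L.localRing v)) (IsLocalRing.maximalIdeal (L.localRing v)) = L.face v := by
  rw [chartPsi_eq]
  rfl

/-- At a proper generization the ghost stalk is generated by the base. -/
lemma isVertexFace_face_of_mem_genericPoints [CharZero κ] {ξ : L.V.left}
    (hξ : L.V.hom ξ ∈ genericPoints X.C) : IsVertexFace (L.face ξ) L.ρ := by
  refine ⟨L.ρ_notMem_face ξ, fun p => ?_⟩
  obtain ⟨a, ha⟩ := exists_etalePoint_eq (c := L.V.hom ξ) ξ rfl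
  obtain ⟨n, hn⟩ := X.exists_eq_baseGhost hξ (Additive.ofMul (chartGhost L.β a p))
  rw [baseGhost_eq_chartGhost a L.base] at hn
  obtain ⟨g, hg, g', hg', e⟩ := (chartGhost_eq_iff L.isChart a _ _).1 (Additive.ofMul.injective hn)
  rw [ha] at hg hg'
  refine ⟨n, g, hg, g', hg', ?_⟩
  rw [e, ← map_pow, ← ofAdd_nsmul, nsmul_eq_mul, mul_one]
  rfl

lemma mem_genericPoints_of_specializes {ξ : L.V.left} (h : ξ ⤳ v) (hne : ξ ≠ v) :
    L.V.hom ξ ∈ genericPoints X.C :=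
  X.mem_genericPoints_of_specializes (h.map L.V.hom.continuous)
    fun e => hne (eq_of_specializes_of_etale L.V.hom h e)

/-- Every face which contains the face of `v` but not `ρ` is the face of a generization. -/
lemma exists_face_eq {G : Submonoid L.P} (hG : IsFace G) (hρ : L.ρ ∉ G) (hle : L.face v ≤ G) :
    ∃ (ξ : L.V.left) (_ : ξ ⤳ v), L.face ξ = G := by
  rw [← primeFace_maximalIdeal] at hle
  obtain ⟨q, _, rfl⟩ := exists_primeFace_eq L.h L.integral hG hρ hle
  obtain ⟨ξ, h, rfl⟩ := exists_primeOf_eq q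
  exact ⟨ξ, h, (L.primeFace_eq h).symm⟩

lemma isVertexFace_of_lt [CharZero κ] {G : Submonoid L.P} (hG : IsFace G) (hlt : L.face v < G)
    (hρ : L.ρ ∉ G) : IsVertexFace G L.ρ := by
  obtain ⟨ξ, h, rfl⟩ := L.exists_face_eq hG hρ hlt.le
  refine L.isVertexFace_face_of_mem_genericPoints (L.mem_genericPoints_of_specializes h ?_)
  rintro rfl
  exact lt_irrefl _ hlt

/-- If the ghost stalk at `v` is not generated by the base, then the maximal ideal of the local ring
is generated by monomials. -/
lemma maximalIdeal_eq_span [CharZero κ] (hv : ¬ IsVertexFace (L.face v) L.ρ) :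
    IsLocalRing.maximalIdeal (L.localRing v) = Ideal.span (chartPsi κ L.h (L.localRing v) ''
      (primeFace (chartPsi κ L.h (L.localRing v)) (IsLocalRing.maximalIdeal (L.localRing v)) :
        Set L.P)ᶜ) := by
  refine maximalIdeal_eq_span_of_unique L.h L.integral fun q hq hqF => ?_
  obtain ⟨ξ, h, rfl⟩ := exists_primeOf_eq q
  rw [primeFace_eq, primeFace_maximalIdeal] at hqF
  by_cases hne : ξ = v
  · subst hne
    exact primeOf_refl
  · exact absurd (hqF ▸ L.isVertexFace_face_of_mem_genericPoints
      (L.mem_genericPoints_of_specializes h hne)) hv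

/-- The generization with face generated by the face of `v` and one element `g`: it is unique, and
modulo its prime ideal every function is a power of `g` up to units. -/
lemma exists_pow_of_face [CharZero κ] (hv : ¬ IsVertexFace (L.face v) L.ρ) {ξ : L.V.left} (h : ξ ⤳ v)
    {g : L.P} (hg : g ∈ L.face ξ) (hgv : g ∉ L.face v)
    (ha : ∀ p ∈ L.face ξ, ∃ n : ℕ, ∃ f ∈ L.face v, ∃ f' ∈ L.face v, p * f = g ^ n * f') :
    (∀ {ξ' : L.V.left} (_ : ξ' ⤳ v), L.face ξ' = L.face ξ → ξ' = ξ) ∧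
    ∀ b : L.localRing v, b ∉ primeOf h → ∃ (k : ℕ) (w : L.localRing v), IsUnit w ∧
      b - chartFunction L.β v g ^ k * w ∈ primeOf h := by
  have key : ∀ {ξ' : L.V.left} (h' : ξ' ⤳ v), L.face ξ' = L.face ξ → _ := fun {ξ'} h' e =>
    eq_span_of_primeFace_eq L.h (A := L.localRing v) (L.ρ_notMem_face ξ) (L.maximalIdeal_eq_span hv) hg
      (by rwa [primeFace_maximalIdeal]) (by rwa [primeFace_maximalIdeal]) (primeOf h')
      ((L.primeFace_eq h').trans e)
  refine ⟨fun h' e => eq_of_primeOf_eq ((key h' e).1.trans (key h rfl).1.symm), ?_⟩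
  have := (key h rfl).2
  rwa [chartPsi_eq] at this

/-- If the ghost stalk at `v` is free, with `ρ` as one of the generators, then the curve is smooth. -/
lemma isSmoothAt_of_free [CharZero κ] {G : Submonoid L.P} (hG : IsFace G) (hρ : L.ρ ∉ G)
    (hzero : ∀ p ∉ G, chartFunction L.β v p = 0) (a : Additive L.P →+ ℕ) (g : L.P) (hg : g ∈ G)
    (ha : ∀ p ∈ G, ∃ f ∈ L.face v, ∃ f' ∈ L.face v, p * f = g ^ a (.ofMul p) * f') :
    IsSmoothAt X.π (L.V.hom v) := by
  have h1 : Algebra.FormallySmooth κ (L.localRing v) :=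
    formallySmooth_of_stratum L.h L.integral hG hρ (by rwa [chartPsi_eq]) a g hg
      (by rwa [primeFace_maximalIdeal])
  have h2 := RingHom.formallySmooth_algebraMap.2 h1
  rw [algebraMap_eq] at h2
  rw [isSmoothAt_iff_mem_smoothLocus]
  exact mem_smoothLocus_of_etale L.V.hom X.π v (mem_smoothLocus_of_formallySmooth _ _ h2)

end LogChart

/-! ### Étale neighbourhoods of a point of a normalized component -/

/-- The normalized discrete valuation of the fraction field of a discrete valuation ring. -/
lemma exists_order_of_isDiscreteValuationRing (R E : Type*) [CommRing R] [IsDomain R]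
    [IsDiscreteValuationRing R] [Field E] [Algebra R E] [IsFractionRing R E] :
    ∃ ν : E → ℤ, (∀ x y, x ≠ 0 → y ≠ 0 → ν (x * y) = ν x + ν y) ∧
      (∀ a : R, IsUnit a → ν (algebraMap R E a) = 0) ∧
      (∀ a : R, Irreducible a → ν (algebraMap R E a) = 1) ∧
      ∀ a : R, a ≠ 0 → ¬ IsUnit a → 0 < ν (algebraMap R E a) := by
  let w := (IsDiscreteValuationRing.maximalIdeal R).valuation E
  have hmul : ∀ x y, x ≠ 0 → y ≠ 0 → -WithZero.log (w (x * y)) = -WithZero.log (w x) + -WithZero.log (w y) := by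
    intro x y hx hy
    rw [map_mul, WithZero.log_mul ((w.ne_zero_iff).2 hx) ((w.ne_zero_iff).2 hy), neg_add]
  have hunit : ∀ a : R, IsUnit a → -WithZero.log (w (algebraMap R E a)) = 0 := by
    intro a ha
    have h1 : w (algebraMap R E a) = 1 := by
      rw [IsDedekindDomain.HeightOneSpectrum.valuation_of_algebraMap]
      rw [IsDedekindDomain.HeightOneSpectrum.intValuation_eq_one_iff]
      exact fun h => h ha
    rw [h1, WithZero.log_one, neg_zero]
  have hirr : ∀ a : R, Irreducible a → -WithZero.log (w (algebraMap R E a)) = 1 := by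
    intro a ha
    have h1 : w (algebraMap R E a) = WithZero.exp (-1 : ℤ) := by
      rw [IsDedekindDomain.HeightOneSpectrum.valuation_of_algebraMap]
      exact IsDedekindDomain.HeightOneSpectrum.intValuation_singleton _ ha.ne_zero ha.maximalIdeal_eq
    rw [h1, WithZero.log_exp, neg_neg]
  refine ⟨fun x => -WithZero.log (w x), hmul, hunit, hirr, fun a ha hu => ?_⟩
  obtain ⟨ϖ, hϖ⟩ := IsDiscreteValuationRing.exists_irreducible R
  obtain ⟨n, u, rfl⟩ := IsDiscreteValuationRing.eq_unit_mul_pow_irreducible ha hϖ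
  have h0 : algebraMap R E ϖ ≠ 0 := fun h => hϖ.ne_zero (IsFractionRing.injective R E (by rw [h, map_zero]))
  have hp : ∀ k : ℕ, -WithZero.log (w (algebraMap R E (ϖ ^ k))) = k := by
    intro k
    induction k with
    | zero => rw [pow_zero]; exact (hunit 1 isUnit_one).trans (by simp)
    | succ k ih =>
      rw [pow_succ, map_mul, hmul _ _ (by rw [map_pow]; exact pow_ne_zero _ h0) h0, ih, hirr ϖ hϖ]
      push_cast
      ring
  have hn : n ≠ 0 := by
    rintro rfl
    exact hu (by simp)
  dsimp only
  rw [map_mul, hmul _ _ (fun h => u.ne_zero (IsFractionRing.injective R E (by rw [h, map_zero])))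
    (by rw [map_pow]; exact pow_ne_zero _ h0), hunit _ u.isUnit, hp, zero_add]
  exact_mod_cast Nat.pos_of_ne_zero hn

/-- A flat and unramified Noetherian local algebra over a discrete valuation ring is a discrete
valuation ring. -/
lemma isDiscreteValuationRing_of_flat_of_map_maximalIdeal {R₀ R : Type u} [CommRing R₀] [IsDomain R₀]
    [IsDiscreteValuationRing R₀] [CommRing R] [IsLocalRing R] [IsNoetherianRing R] [Algebra R₀ R]
    [Module.Flat R₀ R]
    (h : (IsLocalRing.maximalIdeal R₀).map (algebraMap R₀ R) = IsLocalRing.maximalIdeal R) :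
    ∃ _ : IsDomain R, IsDiscreteValuationRing R ∧
      ∀ a : R₀, Irreducible a → Irreducible (algebraMap R₀ R a) := by
  have hmax : ∀ a : R₀, Irreducible a → IsLocalRing.maximalIdeal R = Ideal.span {algebraMap R₀ R a} := by
    intro a ha
    rw [← h, ha.maximalIdeal_eq, Ideal.map_span, Set.image_singleton]
  obtain ⟨ϖ, hϖ⟩ := IsDiscreteValuationRing.exists_irreducible R₀
  set t := algebraMap R₀ R ϖ with ht
  have hreg : ∀ b : R, t * b = 0 → b = 0 := by
    intro b hb
    have h1 : IsSMulRegular R ϖ := by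
      have h0 : IsSMulRegular R₀ ϖ := (IsRegular.of_ne_zero hϖ.ne_zero).left.isSMulRegular
      have h2 : IsSMulRegular R (algebraMap R₀ R ϖ) := h0.of_flat
      exact fun x y hxy => h2 (by simpa only [Algebra.smul_def, Algebra.algebraMap_self, RingHom.id_apply] using hxy)
    rw [isSMulRegular_iff_right_eq_zero_of_smul] at h1
    refine h1 b ?_
    rw [Algebra.smul_def]
    exact hb
  have hpow : ∀ (n : ℕ) (b : R), t ^ n * b = 0 → b = 0 := by
    intro n
    induction n with
    | zero => intro b hb; simpa using hb
    | succ n ih =>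
      intro b hb
      rw [pow_succ', mul_assoc] at hb
      exact ih b (hreg _ hb)
  have hdec : ∀ b : R, b ≠ 0 → ∃ (k : ℕ) (w : R), IsUnit w ∧ b = t ^ k * w :=
    fun b hb => exists_pow_mul_unit t (hmax ϖ hϖ) hb
  have hdom : IsDomain R := by
    have : NoZeroDivisors R := ⟨fun {a b} hab => by
      by_contra! hcon
      obtain ⟨k, w, hw, rfl⟩ := hdec a hcon.1
      rw [mul_assoc] at hab
      have h2 := hpow k _ hab
      exact hcon.2 (by rwa [hw.mul_right_eq_zero] at h2)⟩
    exact NoZeroDivisors.to_isDomain R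
  have ht0 : t ≠ 0 := fun h0 => one_ne_zero (hreg 1 (by rw [h0, zero_mul]))
  have hirr : ∀ a : R₀, Irreducible a → Irreducible (algebraMap R₀ R a) := by
    intro a ha
    refine ((Ideal.span_singleton_prime ?_).1 ?_).irreducible
    · intro h0
      have h1 := hmax a ha
      rw [h0, hmax ϖ hϖ, Ideal.span_singleton_eq_span_singleton] at h1
      exact ht0 ((associated_zero_iff_eq_zero _).1 h1)
    · rw [← hmax a ha]
      exact (IsLocalRing.maximalIdeal.isMaximal R).isPrime
  refine ⟨hdom, IsDiscreteValuationRing.ofHasUnitMulPowIrreducibleFactorization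
    ⟨t, hirr ϖ hϖ, fun {b} hb => ?_⟩, hirr⟩
  obtain ⟨k, w, hw, rfl⟩ := hdec b hb
  exact ⟨k, hw.unit, rfl⟩

lemma spec_map_fromSpecStalk_of_specializes {X : Scheme.{u}} {T : CommRingCat.{u}} {c c' : X}
    (h : c ⤳ c') (a : X.presheaf.stalk c ⟶ T) (a' : X.presheaf.stalk c' ⟶ T)
    (e : X.presheaf.stalkSpecializes h ≫ a = a') :
    Spec.map a ≫ X.fromSpecStalk c = Spec.map a' ≫ X.fromSpecStalk c' := by
  rw [← e, Spec.map_comp, Category.assoc, Scheme.SpecMap_stalkSpecializes_fromSpecStalk]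

lemma spec_map_stalkMap_fromSpecStalk {X Y : Scheme.{u}} {T : CommRingCat.{u}} (f : X ⟶ Y) {x : X}
    (b : X.presheaf.stalk x ⟶ T) :
    Spec.map (f.stalkMap x ≫ b) ≫ Y.fromSpecStalk (f x) = Spec.map b ≫ X.fromSpecStalk x ≫ f := by
  rw [Spec.map_comp, Category.assoc, Scheme.SpecMap_stalkMap_fromSpecStalk]

lemma stalkMap_germ_eq {Z X Y C : Scheme.{u}} {p : Z ⟶ X} {f : X ⟶ C} {p' : Z ⟶ Y} {g : Y ⟶ C}
    (h : p ≫ f = p' ≫ g) (z : Z) (U : C.Opens) (s : Γ(C, U)) (h₁ : f (p z) ∈ U) (h₂ : g (p' z) ∈ U) :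
    p.stalkMap z (f.stalkMap (p z) (C.presheaf.germ U _ h₁ s)) =
      p'.stalkMap z (g.stalkMap (p' z) (C.presheaf.germ U _ h₂ s)) := by
  have key : ∀ (F G : Z ⟶ C) (_ : F = G) (hF : z ∈ F ⁻¹ᵁ U) (hG : z ∈ G ⁻¹ᵁ U),
      Z.presheaf.germ (F ⁻¹ᵁ U) z hF (F.app U s) = Z.presheaf.germ (G ⁻¹ᵁ U) z hG (G.app U s) := by
    rintro F _ rfl _ _
    rfl
  have key₂ : ∀ {X : Scheme.{u}} (p : Z ⟶ X) (f : X ⟶ C) (h : f (p z) ∈ U),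
      p.stalkMap z (f.stalkMap (p z) (C.presheaf.germ U _ h s)) =
        Z.presheaf.germ ((p ≫ f) ⁻¹ᵁ U) z h ((p ≫ f).app U s) := fun p f h =>
    (congrArg (fun k => k.hom (C.presheaf.germ U _ h s)) (Scheme.Hom.stalkMap_comp p f z)).symm.trans
      (Scheme.Hom.germ_stalkMap_apply (p ≫ f) U z h s)
  exact (key₂ p f h₁).trans ((key _ _ h h₁ h₂).trans (key₂ p' g h₂).symm)

lemma eq_of_spec_map_eq {X : Scheme.{u}} {E : Type u} [Field E] {c c' : X}
    (a : X.presheaf.stalk c ⟶ .of E) (a' : X.presheaf.stalk c' ⟶ .of E) [IsLocalHom a.hom]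
    [IsLocalHom a'.hom]
    (h : Spec.map a ≫ X.fromSpecStalk c = Spec.map a' ≫ X.fromSpecStalk c') : c = c' := by
  have h1 : ∀ {c : X} (a : X.presheaf.stalk c ⟶ .of E) [IsLocalHom a.hom],
      (Spec.map a ≫ X.fromSpecStalk c) (IsLocalRing.closedPoint E) = c := fun {c} a _ => by
    have h2 : Spec.map a (IsLocalRing.closedPoint E) = IsLocalRing.closedPoint (X.presheaf.stalk c) :=
      IsLocalRing.comap_closedPoint a.hom
    exact (congrArg (X.fromSpecStalk c) h2).trans Scheme.fromSpecStalk_closedPoint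
  rw [← h1 a, h, h1 a']

/-- A point with values in a local ring determines the values of functions. -/
lemma germ_eq_of_spec_map_eq {X : Scheme.{u}} {T : CommRingCat.{u}} {c c' : X}
    (a : X.presheaf.stalk c ⟶ T) (a' : X.presheaf.stalk c' ⟶ T)
    (h : Spec.map a ≫ X.fromSpecStalk c = Spec.map a' ≫ X.fromSpecStalk c') (U : X.Opens)
    (hc : c ∈ U) (hc' : c' ∈ U) : X.presheaf.germ U c hc ≫ a = X.presheaf.germ U c' hc' ≫ a' := by
  have h1 : Spec.map a ≫ U.fromSpecStalkOfMem c hc = Spec.map a' ≫ U.fromSpecStalkOfMem c' hc' := by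
    rw [← cancel_mono U.ι, Category.assoc, Category.assoc, Scheme.Opens.fromSpecStalkOfMem_ι,
      Scheme.Opens.fromSpecStalkOfMem_ι, h]
  have h2 := congrArg (· ≫ U.toSpecΓ) h1
  simp only [Category.assoc, Scheme.Opens.fromSpecStalkOfMem_toSpecΓ, ← Spec.map_comp] at h2
  exact Spec.map_injective h2

variable {κ : Type u} [Field κ] (X : PrestableLogCurve κ)

/-- For a point `v` of an étale scheme `V → C` and a point `y` of a normalized component over the
same point of `C`, a field `E` which is the field of fractions of a local ring of the fibre product
at a point over `v` and `y`, with its valuation `ν`. The point `ξ` is the image of the generic point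
of this local ring. -/
structure LocalBranch (η : X.C) {V : Scheme.{u}} (f : V ⟶ X.C) (v : V)
    (y : X.normalizedComponent η) where
  ξ : V
  specializes : ξ ⤳ v
  map_ξ : f ξ = η
  E : Type u
  [field : Field E]
  j : V.presheaf.stalk ξ →+* E
  isLocalHom_j : IsLocalHom j
  i : (X.normalizedComponent η).functionField →+* E
  comm : ∀ (U : X.C.Opens) (s : Γ(X.C, U)) (h₁ : f ξ ∈ U)
    (h₂ : X.toCurve η (genericPoint (X.normalizedComponent η)) ∈ U),
    j (f.stalkMap ξ (X.C.presheaf.germ U _ h₁ s)) =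
      i ((X.toCurve η).stalkMap (genericPoint (X.normalizedComponent η)) (X.C.presheaf.germ U _ h₂ s))
  ν : E → ℤ
  ν_mul : ∀ x y, x ≠ 0 → y ≠ 0 → ν (x * y) = ν x + ν y
  ν_i : ∀ x, x ≠ 0 → ν (i x) = orderAt x y
  ν_unit : ∀ b : V.presheaf.stalk v, IsUnit b → ν (j (V.presheaf.stalkSpecializes specializes b)) = 0
  ν_pos : ∀ b : V.presheaf.stalk v, ¬ IsUnit b → j (V.presheaf.stalkSpecializes specializes b) ≠ 0 →
    0 < ν (j (V.presheaf.stalkSpecializes specializes b))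
  exists_ν_eq_add_one : ∃ b c : V.presheaf.stalk v,
    j (V.presheaf.stalkSpecializes specializes b) ≠ 0 ∧
    j (V.presheaf.stalkSpecializes specializes c) ≠ 0 ∧
    ν (j (V.presheaf.stalkSpecializes specializes b)) =
      ν (j (V.presheaf.stalkSpecializes specializes c)) + 1

attribute [instance] LocalBranch.field

variable {X} [CharZero κ] {η : X.C}

/-- The order of a rational function on an étale scheme over the normalized component. -/
lemma order_eq_orderAt {Y : Scheme.{u}} [IsIntegral Y] [IsLocallyNoetherian Y] {y : Y}
    [IsDiscreteValuationRing (Y.presheaf.stalk y)] {R E : Type u} [CommRing R] [Field E]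
    [Algebra R E] (φ : Y.presheaf.stalk y →+* R) (i : Y.functionField →+* E)
    (hi : ∀ a, i (algebraMap (Y.presheaf.stalk y) Y.functionField a) = algebraMap R E (φ a))
    (hirr : ∀ a, Irreducible a → Irreducible (φ a))
    (ν : E → ℤ) (h1 : ∀ x y, x ≠ 0 → y ≠ 0 → ν (x * y) = ν x + ν y)
    (h2 : ∀ a : R, IsUnit a → ν (algebraMap R E a) = 0)
    (h3 : ∀ a : R, Irreducible a → ν (algebraMap R E a) = 1) (x : Y.functionField) (hx : x ≠ 0) :
    ν (i x) = orderAt x y := by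
  obtain ⟨ϖ, v, n, hϖ, hv, e⟩ := exists_eq_mul_zpow (y := y) hx
  rw [orderAt_eq_of_eq_mul_zpow hϖ hv e, e]
  have hpow : ∀ x : E, x ≠ 0 → ∀ n : ℕ, ν (x ^ n) = n * ν x := by
    intro x hx n
    induction n with
    | zero =>
      have := h1 1 1 one_ne_zero one_ne_zero
      rw [mul_one] at this
      simp only [pow_zero, CharP.cast_eq_zero, zero_mul]
      omega
    | succ n ih =>
      rw [pow_succ, h1 _ _ (pow_ne_zero _ hx) hx, ih]
      push_cast
      ring
  have ha : ∀ a : Y.presheaf.stalk y, a ≠ 0 → i (algebraMap _ Y.functionField a) ≠ 0 := fun a ha h =>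
    ha (IsFractionRing.injective _ Y.functionField ((map_eq_zero_iff i i.injective).1 h |>.trans (map_zero _).symm))
  have hϖ0 := ha ϖ hϖ.ne_zero
  have hν : ν (i (algebraMap _ Y.functionField ϖ)) = 1 := by
    rw [hi]
    exact h3 _ (hirr ϖ hϖ)
  have hz : ν (i (algebraMap _ Y.functionField ϖ) ^ n) = n := by
    obtain ⟨k, rfl | rfl⟩ := n.eq_nat_or_neg
    · rw [zpow_natCast, hpow _ hϖ0, hν, mul_one]
    · have h4 := h1 (i (algebraMap _ Y.functionField ϖ) ^ (-k : ℤ)) (i (algebraMap _ Y.functionField ϖ) ^ k)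
        (zpow_ne_zero _ hϖ0) (pow_ne_zero _ hϖ0)
      have h5 : ν (1 : E) = 0 := by rw [← map_one (algebraMap R E)]; exact h2 1 isUnit_one
      rw [zpow_neg, zpow_natCast, inv_mul_cancel₀ (pow_ne_zero _ hϖ0), h5, hpow _ hϖ0, hν] at h4
      rw [zpow_neg, zpow_natCast]
      omega
  rw [map_mul, map_zpow₀, h1 _ _ (ha v hv.ne_zero) (zpow_ne_zero _ hϖ0), hz, hi, h2 _ (hv.map φ), zero_add]

theorem nonempty_localBranch (hη : η ∈ genericPoints X.C) {V : Scheme.{u}} (f : V ⟶ X.C) [Etale f]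
    (v : V) (y : X.normalizedComponent η) (hy : y ≠ genericPoint (X.normalizedComponent η))
    (h : f v = X.toCurve η y) : Nonempty (LocalBranch X η f v y) := by
  let g := X.toCurve η
  let p₁ : pullback f g ⟶ V := pullback.fst f g
  let p₂ : pullback f g ⟶ X.normalizedComponent η := pullback.snd f g
  have : IsLocallyNoetherian (X.normalizedComponent η) := X.isLocallyNoetherian_normalizedComponent hη
  have hp₂ : Etale p₂ := inferInstanceAs (Etale (pullback.snd f g))
  have : IsLocallyNoetherian (pullback f g) := LocallyOfFiniteType.isLocallyNoetherian p₂
  -- the local ring `R` of the fibre product is étale over the discrete valuation ring at `y`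
  obtain ⟨z, rfl, rfl⟩ : ∃ z, p₁ z = v ∧ p₂ z = y := Scheme.Pullback.exists_preimage_pullback v y h
  have hD := X.isDiscreteValuationRing_stalk hη hy
  let R := (pullback f g).presheaf.stalk z
  let R₀ := (X.normalizedComponent η).presheaf.stalk (p₂ z)
  let φ : R₀ ⟶ R := p₂.stalkMap z
  let : Algebra R₀ R := φ.hom.toAlgebra
  have : Module.Flat R₀ R := Flat.stalkMap p₂ z
  obtain ⟨_, _, hirr⟩ := isDiscreteValuationRing_of_flat_of_map_maximalIdeal (R₀ := R₀) (R := R)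
    (maximalIdeal_le_map_stalkMap p₂ z)
  obtain ⟨E, _, _, _⟩ : ∃ (E : Type u) (_ : Field E) (_ : Algebra R E), IsFractionRing R E :=
    ⟨FractionRing R, inferInstance, inferInstance, inferInstance⟩
  let α : R ⟶ .of E := CommRingCat.ofHom (algebraMap R E)
  obtain ⟨ν, ν1, ν2, ν3, ν4⟩ := exists_order_of_isDiscreteValuationRing R E
  have hinj : Function.Injective ((algebraMap R E).comp φ.hom) := by
    refine (IsFractionRing.injective R E).comp ((injective_iff_map_eq_zero φ.hom).2 fun a ha => ?_)
    by_contra h0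
    obtain ⟨ϖ, hϖ⟩ := IsDiscreteValuationRing.exists_irreducible R₀
    obtain ⟨n, u, rfl⟩ := IsDiscreteValuationRing.eq_unit_mul_pow_irreducible h0 hϖ
    rw [map_mul, map_pow] at ha
    exact mul_ne_zero (u.isUnit.map φ.hom).ne_zero (pow_ne_zero n (hirr ϖ hϖ).ne_zero) ha
  let i : (X.normalizedComponent η).functionField →+* E := IsFractionRing.lift hinj
  have hi : ∀ a, i (algebraMap R₀ _ a) = algebraMap R E (φ.hom a) := IsFractionRing.lift_algebraMap hinj
  -- the generic point of the local ring at `z`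
  let ι : (X.normalizedComponent η).presheaf.stalk (genericPoint (X.normalizedComponent η)) ⟶ .of E :=
    CommRingCat.ofHom i
  let e : Spec (.of E) ⟶ pullback f g := Spec.map α ≫ Scheme.fromSpecStalk _ z
  let ζ := e (IsLocalRing.closedPoint E)
  have hζ : ζ ⤳ z := by
    have h1 : ζ ∈ Set.range (Scheme.fromSpecStalk (pullback f g) z) := ⟨_, rfl⟩
    rwa [Scheme.range_fromSpecStalk] at h1
  let j₀ : (pullback f g).presheaf.stalk ζ ⟶ .of E := Scheme.stalkClosedPointTo e
  have hj₀ : Spec.map j₀ ≫ Scheme.fromSpecStalk _ ζ = e := Scheme.Spec_stalkClosedPointTo_fromSpecStalk e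
  have hj₁ : (pullback f g).presheaf.stalkSpecializes hζ ≫ j₀ = α := by
    apply Spec.map_injective
    rw [← cancel_mono (Scheme.fromSpecStalk _ z), Spec.map_comp, Category.assoc,
      Scheme.SpecMap_stalkSpecializes_fromSpecStalk, hj₀]
  let j : V.presheaf.stalk (p₁ ζ) ⟶ .of E := p₁.stalkMap ζ ≫ j₀
  have hξ : p₁ ζ ⤳ p₁ z := hζ.map p₁.continuous
  have hj : ∀ b, j (V.presheaf.stalkSpecializes hξ b) = algebraMap R E (p₁.stalkMap z b) := by
    intro b
    have h1 : V.presheaf.stalkSpecializes hξ ≫ j = p₁.stalkMap z ≫ α := by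
      rw [← hj₁, ← Category.assoc, ← Category.assoc, Scheme.Hom.stalkSpecializes_stalkMap p₁ ζ z hζ]
    exact congrArg (fun k => k.hom b) h1
  have hcomm : p₁ ≫ f = p₂ ≫ g := pullback.condition
  have he : Spec.map ι ≫ Scheme.fromSpecStalk _ (genericPoint (X.normalizedComponent η)) = e ≫ p₂ := by
    have h1 : (X.normalizedComponent η).presheaf.stalkSpecializes
        ((genericPoint_spec (X.normalizedComponent η)).specializes (Set.mem_univ (p₂ z))) ≫ ι = φ ≫ α :=
      CommRingCat.hom_ext (RingHom.ext hi)
    rw [spec_map_fromSpecStalk_of_specializes _ ι _ h1, Spec.map_comp, Category.assoc, Category.assoc,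
      Scheme.SpecMap_stalkMap_fromSpecStalk]
  -- both sides are the point of `X.C` with values in `E`
  have hspec : Spec.map (f.stalkMap (p₁ ζ) ≫ j) ≫ Scheme.fromSpecStalk _ _ =
      Spec.map (g.stalkMap (genericPoint (X.normalizedComponent η)) ≫ ι) ≫ Scheme.fromSpecStalk _ _ := by
    refine (spec_map_stalkMap_fromSpecStalk f j).trans (Eq.trans ?_ (spec_map_stalkMap_fromSpecStalk g ι).symm)
    have h1 : Spec.map j ≫ Scheme.fromSpecStalk _ _ = e ≫ p₁ := by
      refine (spec_map_stalkMap_fromSpecStalk p₁ j₀).trans ?_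
      rw [← Category.assoc, hj₀]
    rw [← Category.assoc, h1, Category.assoc, hcomm, ← Category.assoc, ← Category.assoc, he]
  refine ⟨{
    ξ := p₁ ζ
    specializes := hξ
    map_ξ := ?_
    E := E
    j := j.hom
    isLocalHom_j := RingHom.isLocalHom_comp (Scheme.stalkClosedPointTo e).hom (p₁.stalkMap ζ).hom
    i := i
    comm := fun U s h₁ h₂ => congrArg (fun k => k.hom s) (germ_eq_of_spec_map_eq _ _ hspec U h₁ h₂)
    ν := ν
    ν_mul := ν1
    ν_i := order_eq_orderAt φ.hom i hi hirr ν ν1 ν2 ν3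
    ν_unit := fun b hb => ?_
    ν_pos := fun b hb hb0 => ?_
    exists_ν_eq_add_one := ?_ }⟩
  · have h0 : IsLocalHom ι.hom := inferInstanceAs (IsLocalHom i)
    have h0' : IsLocalHom j₀.hom := inferInstanceAs (IsLocalHom (Scheme.stalkClosedPointTo e).hom)
    have h1 : IsLocalHom (f.stalkMap (p₁ ζ) ≫ j).hom :=
      RingHom.isLocalHom_comp (j₀.hom.comp (p₁.stalkMap ζ).hom) (f.stalkMap (p₁ ζ)).hom
    have h2 : IsLocalHom (g.stalkMap (genericPoint (X.normalizedComponent η)) ≫ ι).hom :=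
      RingHom.isLocalHom_comp ι.hom (g.stalkMap _).hom
    exact (eq_of_spec_map_eq _ _ hspec).trans X.toCurve_genericPoint
  · exact (congrArg ν (hj b)).trans (ν2 _ (hb.map (p₁.stalkMap z).hom))
  · have h1 : j (V.presheaf.stalkSpecializes hξ b) ≠ 0 := hb0
    rw [hj] at h1
    have h2 := ν4 (p₁.stalkMap z b) (fun h0 => h1 (by rw [h0, map_zero]))
      fun hu => hb (isUnit_of_map_unit (p₁.stalkMap z).hom _ hu)
    rw [← hj] at h2
    exact h2
  · obtain ⟨ϖ, hϖ⟩ := IsDiscreteValuationRing.exists_irreducible R₀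
    -- a uniformizer at `y` is a quotient of functions on the curve
    obtain ⟨b, c, hc, hbc⟩ := X.exists_mul_stalkMap_eq hη (p₂ z)
      (algebraMap R₀ (X.normalizedComponent η).functionField ϖ)
    have hϖ0 : algebraMap R₀ (X.normalizedComponent η).functionField ϖ ≠ 0 := fun h0 =>
      hϖ.ne_zero (IsFractionRing.injective R₀ _ (by rw [h0, map_zero]))
    have key : ∀ b : X.C.presheaf.stalk (g (p₂ z)), ∃ b' : V.presheaf.stalk (p₁ z),
        j (V.presheaf.stalkSpecializes hξ b') = i (algebraMap R₀ _ (g.stalkMap (p₂ z) b)) := by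
      intro b
      obtain ⟨U, hU, s, rfl⟩ := X.C.presheaf.exists_germ_eq b
      have hU' : f (p₁ z) ∈ U := by rw [h]; exact hU
      refine ⟨f.stalkMap (p₁ z) (X.C.presheaf.germ U _ hU' s), ?_⟩
      rw [hj, stalkMap_germ_eq hcomm z U s hU' hU, hi]
    obtain ⟨b', hb'⟩ := key b
    obtain ⟨c', hc'⟩ := key c
    have hic : i (algebraMap R₀ _ (g.stalkMap (p₂ z) c)) ≠ 0 := fun h0 => hc
      (i.injective (h0.trans (map_zero i).symm))
    have hiϖ : i (algebraMap R₀ _ ϖ) ≠ 0 := fun h0 => hϖ0 (i.injective (h0.trans (map_zero i).symm))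
    have hbc' := congrArg i hbc
    rw [map_mul] at hbc'
    refine ⟨b', c', ?_, ?_, ?_⟩
    · change j (V.presheaf.stalkSpecializes hξ b') ≠ 0
      rw [hb']
      exact hbc' ▸ mul_ne_zero hiϖ hic
    · change j (V.presheaf.stalkSpecializes hξ c') ≠ 0
      rwa [hc']
    · change ν (j (V.presheaf.stalkSpecializes hξ b')) = ν (j (V.presheaf.stalkSpecializes hξ c')) + 1
      rw [hb', hc']
      refine (congrArg ν hbc'.symm).trans ((ν1 _ _ hiϖ hic).trans ?_)
      rw [hi]
      exact (congrArg (· + _) (ν3 _ (hirr ϖ hϖ))).trans (add_comm _ _)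

/-! ### Vertex positions and orders of vanishing in a chart -/

namespace LocalBranch

variable {κ : Type u} [Field κ] {X : PrestableLogCurve κ} {η : X.C} {V : Scheme.{u}} {f : V ⟶ X.C} {v : V}
    {y : X.normalizedComponent η} (B : LocalBranch X η f v y)

/-- The evaluation of functions at the generic point of a branch. -/
def eval : V.presheaf.stalk v →+* B.E := B.j.comp (V.presheaf.stalkSpecializes B.specializes).hom

lemma eval_eq_zero_iff (b : V.presheaf.stalk v) : B.eval b = 0 ↔ b ∈ primeOf B.specializes := by
  have := B.isLocalHom_j
  rw [mem_primeOf]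
  constructor
  · intro h hu
    exact (hu.map B.j).ne_zero h
  · intro h
    by_contra h0
    exact h (isUnit_of_map_unit B.j _ (isUnit_iff_ne_zero.2 h0))

lemma ν_pow {x : B.E} (hx : x ≠ 0) (n : ℕ) : B.ν (x ^ n) = n * B.ν x := by
  induction n with
  | zero =>
    have := B.ν_mul 1 1 one_ne_zero one_ne_zero
    rw [mul_one] at this
    simp only [pow_zero, CharP.cast_eq_zero, zero_mul]
    omega
  | succ n ih =>
    rw [pow_succ, B.ν_mul _ _ (pow_ne_zero _ hx) hx, ih]
    push_cast
    ring

end LocalBranch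

/-- A face with quotient generated by `ρ` is maximal among the faces without `ρ`. -/
lemma IsVertexFace.eq_of_le {P : Type*} [CommMonoid P] {F G : Submonoid P} {ρ : P}
    (h : IsVertexFace F ρ) (hF : IsFace F) (hG : IsFace G) (hρ : ρ ∉ G) (hle : F ≤ G) : F = G := by
  refine le_antisymm hle fun p hp => ?_
  obtain ⟨n, f, hf, f', hf', e⟩ := h.2 p
  cases n with
  | zero =>
    rw [pow_zero, one_mul] at e
    exact hF p f (e ▸ hf')
  | succ n =>
    refine absurd (hG ρ (ρ ^ n * f') ?_) hρ
    rw [← mul_assoc, ← pow_succ', ← e]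
    exact mul_mem hp (hle hf)

namespace LogChart

variable {κ : Type u} [Field κ] {X : PrestableLogCurve κ} (L : LogChart X) {η : X.C}
  {v : L.V.left} {y : X.normalizedComponent η}

lemma isVertexFace_face_ξ [CharZero κ] (hη : η ∈ genericPoints X.C) (B : LocalBranch X η L.V.hom v y) :
    IsVertexFace (L.face B.ξ) L.ρ :=
  L.isVertexFace_face_of_mem_genericPoints (by rw [B.map_ξ]; exact hη)

lemma eval_chartFunction_ne_zero_iff (B : LocalBranch X η L.V.hom v y) (p : L.P) :
    B.eval (chartFunction L.β v p) ≠ 0 ↔ p ∈ L.face B.ξ :=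
  (not_congr (B.eval_eq_zero_iff _)).trans
    (SetLike.ext_iff.1 (primeFace_primeOf L.β B.specializes) p)

/-- The numerical invariants of a branch of the curve at `v`: the position `V` of the vertex, with
`V = 0` on the face of the branch, and the homomorphism `w` given by orders of vanishing on this
face, extended by `ρ ↦ 0`. -/
structure BranchInvariants (B : LocalBranch X η L.V.hom v y) (V : Additive L.P →+ ℕ)
    (w : Additive L.P →+ ℤ) : Prop where
  V_ρ : V (.ofMul L.ρ) = 1
  V_eq_zero : ∀ p, V (.ofMul p) = 0 ↔ p ∈ L.face B.ξ
  V_eq : ∀ p, ∃ g ∈ L.face B.ξ, ∃ g' ∈ L.face B.ξ, p * g = L.ρ ^ V (.ofMul p) * g'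
  w_ρ : w (.ofMul L.ρ) = 0
  w_eq : ∀ p, ∀ g ∈ L.face B.ξ, ∀ g' ∈ L.face B.ξ, ∀ n : ℕ, p * g = L.ρ ^ n * g' →
    w (.ofMul p) = B.ν (B.eval (chartFunction L.β v g')) - B.ν (B.eval (chartFunction L.β v g))
  w_face : ∀ f ∈ L.face v, w (.ofMul f) = 0

lemma exists_branchInvariants [CharZero κ] (hη : η ∈ genericPoints X.C) (B : LocalBranch X η L.V.hom v y) :
    ∃ V w, L.BranchInvariants B V w := by
  have hvert := L.isVertexFace_face_ξ hη B
  obtain ⟨V, hV1, hV2, hV3⟩ := hvert.exists_hom L.integral (L.isFace_face _)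
  have hχ : ∀ g ∈ L.face B.ξ, ∀ g' ∈ L.face B.ξ, B.ν (B.eval (chartFunction L.β v (g * g'))) =
      B.ν (B.eval (chartFunction L.β v g)) + B.ν (B.eval (chartFunction L.β v g')) := by
    intro g hg g' hg'
    rw [map_mul, map_mul, B.ν_mul _ _ ((L.eval_chartFunction_ne_zero_iff B g).2 hg)
      ((L.eval_chartFunction_ne_zero_iff B g').2 hg')]
  obtain ⟨w, hw1, hw2, hw3⟩ := hvert.exists_extension L.integral (L.isFace_face _)
    (fun p => B.ν (B.eval (chartFunction L.β v p))) (by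
      have := hχ 1 (one_mem _) 1 (one_mem _)
      rw [mul_one] at this
      change B.ν _ = 0
      omega) hχ
  refine ⟨V, w, hV1, hV2, hV3, hw1, hw3, fun f hf => ?_⟩
  rw [hw2 f (chartFace_le L.β B.specializes hf)]
  exact B.ν_unit _ (mem_chartFace.1 hf)

/-- At a point where the ghost stalk is generated by the base the curve is smooth. -/
lemma isSmoothAt_of_isVertexFace [CharZero κ] (hv : IsVertexFace (L.face v) L.ρ) :
    IsSmoothAt X.π (L.V.hom v) := by
  refine L.isSmoothAt_of_free (L.isFace_face v) (L.ρ_notMem_face v) (fun p hp => ?_) 0 1 (one_mem _)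
    fun p hp => ⟨1, one_mem _, p, hp, by simp⟩
  obtain ⟨n, g, hg, g', hg', e⟩ := hv.2 p
  cases n with
  | zero => exact absurd (L.isFace_face v p g (by rw [e, pow_zero, one_mul]; exact hg')) hp
  | succ n =>
    have h1 := congrArg (chartFunction L.β v) e
    rw [map_mul, map_mul, map_pow, chartFunction_ρ, zero_pow n.succ_ne_zero, zero_mul] at h1
    exact (mem_chartFace.1 hg).mul_left_eq_zero.1 h1

variable {L} {B : LocalBranch X η L.V.hom v y} {V : Additive L.P →+ ℕ} {w : Additive L.P →+ ℤ}

lemma BranchInvariants.w_eq_order (I : L.BranchInvariants B V w) {p : L.P} (hp : p ∈ L.face B.ξ) :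
    w (.ofMul p) = B.ν (B.eval (chartFunction L.β v p)) := by
  have h1 := I.w_eq p 1 (one_mem _) p hp 0 (by rw [pow_zero, mul_one, one_mul])
  have h2 := B.ν_mul 1 1 one_ne_zero one_ne_zero
  rw [mul_one] at h2
  rw [map_one, map_one] at h1
  omega

lemma BranchInvariants.w_eq_zero (I : L.BranchInvariants B V w) (h : L.face B.ξ = L.face v) (p : L.P) :
    w (.ofMul p) = 0 := by
  obtain ⟨g, hg, g', hg', e⟩ := I.V_eq p
  have h1 := congrArg w (congrArg Additive.ofMul e)
  rw [ofMul_mul, ofMul_mul, ofMul_pow, map_add, map_add, map_nsmul, I.w_ρ, I.w_face g (h ▸ hg),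
    I.w_face g' (h ▸ hg')] at h1
  simpa using h1

/-- If the branch has a ghost stalk which is not generated by the base, then the position and the
order of vanishing identify the ghost stalk with one of two monoids of rank two. That the order of
vanishing is not divisible follows from the fact that the local ring of the chart modulo the ideal
of the branch has uniformizers of the normalization in its field of fractions. -/
theorem BranchInvariants.classify [CharZero κ] (hη : η ∈ genericPoints X.C) (I : L.BranchInvariants B V w)
    (hne : ¬ IsVertexFace (L.face v) L.ρ) :
    (∀ p p', V (.ofMul p) = V (.ofMul p') → w (.ofMul p) = w (.ofMul p') →
      ∃ f ∈ L.face v, ∃ f' ∈ L.face v, p * f = p' * f') ∧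
    (∃ g ∈ L.face B.ξ, w (.ofMul g) = 1) ∧
    ((∀ x y : ℤ, (∃ p, w (.ofMul p) = x ∧ (V (.ofMul p) : ℤ) = y) ↔ 0 ≤ x ∧ 0 ≤ y) ∨
      ∃ e : ℕ, 0 < e ∧ ∀ x y : ℤ, (∃ p, w (.ofMul p) = x ∧ (V (.ofMul p) : ℤ) = y) ↔
        0 ≤ e * x + y ∧ 0 ≤ y) := by
  have hvert := L.isVertexFace_face_ξ hη B
  have hle := chartFace_le L.β B.specializes
  rcases classify_face_quotient L.isFineSaturated (L.isFace_face v) I.V_ρ I.w_ρ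
    (fun p => by
      obtain ⟨g, hg, g', hg', e⟩ := I.V_eq p
      exact ⟨g, g', (I.V_eq_zero g).2 hg, (I.V_eq_zero g').2 hg', e⟩)
    (fun f hf => (I.V_eq_zero f).2 (hle hf)) I.w_face
    (fun p hp hpv => by
      have hp' := (I.V_eq_zero p).1 hp
      rw [I.w_eq_order hp']
      exact B.ν_pos _ (fun hu => hpv (mem_chartFace.2 hu)) ((L.eval_chartFunction_ne_zero_iff B p).2 hp'))
    (fun G hG hlt hρ => L.isVertexFace_of_lt hG hlt hρ) with h | ⟨a, d, hd, hwa, haρ, hsep, ⟨g, hag, hVg⟩, hcone⟩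
  · refine absurd ?_ hne
    have : L.face v = L.face B.ξ := le_antisymm hle fun p hp => h p ((I.V_eq_zero p).2 hp)
    rw [this]
    exact hvert
  have hg := (I.V_eq_zero g).1 hVg
  have hgv : g ∉ L.face v := fun h => by
    have := I.w_face g h
    rw [hwa, hag] at this
    omega
  have hnn : ∀ p, V (.ofMul p) = 0 → 0 ≤ a (.ofMul p) := by
    intro p hp
    rcases hcone with h | ⟨e, he, h⟩
    · exact ((h _ _).1 ⟨p, rfl, rfl⟩).1
    · have := ((h _ _).1 ⟨p, rfl, rfl⟩).1
      rw [hp, Nat.cast_zero, add_zero] at this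
      exact nonneg_of_mul_nonneg_right this (by exact_mod_cast he)
  obtain ⟨-, hpow⟩ := L.exists_pow_of_face hne B.specializes hg hgv fun p hp => by
    have hp' := (I.V_eq_zero p).2 hp
    refine ⟨(a (.ofMul p)).toNat, ?_⟩
    refine hsep _ _ ?_ ?_
    · rw [hp', ofMul_pow, map_nsmul, hVg, smul_zero]
    · rw [ofMul_pow, map_nsmul, hag, nsmul_eq_mul, mul_one, Int.toNat_of_nonneg (hnn p hp')]
  -- modulo the ideal of the branch every function is a unit times a power of `g`, and `g` has order `d`
  have hdvd : ∀ b : L.V.left.presheaf.stalk v, B.eval b ≠ 0 → d ∣ B.ν (B.eval b) := by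
    intro b hb
    obtain ⟨k, u, hu, hq⟩ := hpow b (fun h => hb ((B.eval_eq_zero_iff b).2 h))
    have h1 := (B.eval_eq_zero_iff _).2 hq
    rw [map_sub, sub_eq_zero, map_mul, map_pow] at h1
    have hg0 := (L.eval_chartFunction_ne_zero_iff B g).2 hg
    rw [h1, B.ν_mul _ _ (pow_ne_zero _ hg0) (hu.map B.eval).ne_zero, B.ν_pow hg0, ← I.w_eq_order hg, hwa, hag]
    have h2 : B.ν (B.eval u) = 0 := B.ν_unit u hu
    rw [h2]
    exact ⟨k, by ring⟩
  have hd1 : d = 1 := by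
    obtain ⟨b, c, hb, hc, hbc⟩ := B.exists_ν_eq_add_one
    have h1 : d ∣ B.ν (B.eval c) + 1 := hbc ▸ hdvd b hb
    have h2 := (Int.dvd_add_right (hdvd c hc)).1 h1
    exact Int.eq_one_of_dvd_one hd.le h2
  obtain rfl : w = a := by
    exact AddMonoidHom.ext fun p => by rw [hwa, hd1, one_mul]
  exact ⟨hsep, ⟨g, hg, hag⟩, hcone⟩

/-- At a point where the ghost stalk is the free monoid on `ρ` and one more generator the curve is
smooth. -/
lemma BranchInvariants.isSmoothAt_of_quadrant [CharZero κ] (I : L.BranchInvariants B V w)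
    (hsep : ∀ p p', V (.ofMul p) = V (.ofMul p') → w (.ofMul p) = w (.ofMul p') →
      ∃ f ∈ L.face v, ∃ f' ∈ L.face v, p * f = p' * f')
    {g : L.P} (hg : g ∈ L.face B.ξ) (hwg : w (.ofMul g) = 1) (hw : ∀ p, 0 ≤ w p) :
    IsSmoothAt X.π (L.V.hom v) := by
  let a : Additive L.P →+ ℕ :=
    { toFun := fun p => (w p).toNat
      map_zero' := by simp
      map_add' := fun p q => by rw [map_add, Int.toNat_add (hw p) (hw q)] }
  have ha : ∀ p, (a p : ℤ) = w p := fun p => Int.toNat_of_nonneg (hw p)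
  have hVg := (I.V_eq_zero g).2 hg
  have key : ∀ p, ∃ f ∈ L.face v, ∃ f' ∈ L.face v,
      p * f = L.ρ ^ V (.ofMul p) * g ^ a (.ofMul p) * f' := by
    intro p
    refine hsep _ _ ?_ ?_
    · rw [ofMul_mul, ofMul_pow, ofMul_pow, map_add, map_nsmul, map_nsmul, I.V_ρ, hVg]
      simp
    · rw [ofMul_mul, ofMul_pow, ofMul_pow, map_add, map_nsmul, map_nsmul, I.w_ρ, hwg, ← ha]
      simp
  refine L.isSmoothAt_of_free (L.isFace_face B.ξ) (L.ρ_notMem_face _) (fun p hp => ?_) a g hg fun p hp => ?_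
  · obtain ⟨f, hf, f', -, e⟩ := key p
    have h1 := congrArg (chartFunction L.β v) e
    rw [map_mul, map_mul, map_mul, map_pow, chartFunction_ρ, zero_pow (fun h => hp ((I.V_eq_zero p).1 h)),
      zero_mul, zero_mul] at h1
    exact (mem_chartFace.1 hf).mul_left_eq_zero.1 h1
  · obtain ⟨f, hf, f', hf', e⟩ := key p
    rw [(I.V_eq_zero p).2 hp, pow_zero, one_mul] at e
    exact ⟨f, hf, f', hf', e⟩

end LogChart

/-! ### Gluing sections of étale log structures -/

section Gluing

/-- Homomorphisms from the free commutative monoid on one generator. -/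
def homEquivOfFree (A : CommMonCat.{u}) : (CommMonCat.of (ULift.{u} (Multiplicative ℕ)) ⟶ A) ≃ A where
  toFun f := f.hom ⟨Multiplicative.ofAdd 1⟩
  invFun a := CommMonCat.ofHom ((powersHom A a).comp MulEquiv.ulift.toMonoidHom)
  left_inv f := by
    ext ⟨n⟩
    have h : (⟨n⟩ : ULift (Multiplicative ℕ)) = ⟨Multiplicative.ofAdd 1⟩ ^ n.toAdd := by
      apply ULift.ext
      change n = Multiplicative.ofAdd 1 ^ n.toAdd
      rw [← ofAdd_nsmul, nsmul_eq_mul, mul_one]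
      rfl
    change f.hom _ ^ n.toAdd = _
    rw [h, map_pow]
  right_inv a := by
    change powersHom A a (Multiplicative.ofAdd 1) = a
    simp

lemma isSheaf_forget {E : Type*} [Category E] {J : GrothendieckTopology E} (F : Sheaf J CommMonCat.{u}) :
    Presieve.IsSheaf J (F.obj ⋙ forget CommMonCat.{u}) := fun _ S hS =>
  Presieve.isSheafFor_of_nat_equiv (fun _ => homEquivOfFree _) (fun _ _ _ _ => rfl)
    (F.property (CommMonCat.of (ULift.{u} (Multiplicative ℕ))) S hS)

variable {X : Scheme.{u}} (N : EtaleLogStructure X) {V W : X.Etale}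

lemma eq_of_forall_res_eq {S : Sieve V} (hS : S ∈ X.smallEtaleTopology V) {s t : N.sections V}
    (h : ∀ {W : X.Etale} (f : W ⟶ V), S f → N.res f s = N.res f t) : s = t :=
  (isSheaf_forget N.M S hS).isSeparatedFor.ext fun _ f hf => h f hf

/-- Étale descent along one surjective étale morphism. -/
lemma exists_res_eq (f : W ⟶ V) (hf : Function.Surjective f.left) (x : N.sections W)
    (hx : ∀ {Z : X.Etale} (a b : Z ⟶ W), a ≫ f = b ≫ f → N.res a x = N.res b x) :
    (∃ t, N.res f t = x) ∧ ∀ s t, N.res f s = N.res f t → s = t := by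
  have h1 : Sieve.ofArrows (fun _ : Unit => W) (fun _ => f) ∈ X.smallEtaleTopology V := by
    rw [Scheme.ofArrows_mem_smallEtaleTopology_iff]
    exact Set.eq_univ_of_forall fun v => Set.mem_iUnion.2 ⟨(), hf v⟩
  have h2 := isSheaf_forget N.M _ h1
  rw [Sieve.ofArrows, ← Presieve.isSheafFor_iff_generate, Presieve.ofArrows_pUnit] at h2
  have h3 := Presieve.isSheafFor_singleton.1 h2
  refine ⟨(h3 x fun a b h => hx a b h).exists, fun s t hst => ?_⟩
  refine (h3 (N.res f s) fun a b h => ?_).unique rfl hst.symm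
  have h4 : N.res (a ≫ f) s = N.res (b ≫ f) s := by rw [h]
  rw [res_comp, res_comp] at h4
  exact h4

end Gluing

lemma comp_toEtaleTop {X : Scheme.{u}} {V W : X.Etale} (f : W ⟶ V) : f ≫ toEtaleTop V = toEtaleTop W :=
  MorphismProperty.Over.Hom.ext (MorphismProperty.Over.w f)

namespace LogChart

variable {κ : Type u} [Field κ] {X : PrestableLogCurve κ} (L : LogChart X)

/-- Invertible sections of the log structure are not annihilated by sections from the base. -/
lemma unit_eq_of_mul_eq {Z : X.C.Etale} (f : Z ⟶ L.V) (n : Multiplicative ℕ) (x x' : (X.N.sections Z)ˣ)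
    (h : X.N.res (toEtaleTop Z) (X.q n) * x = X.N.res (toEtaleTop Z) (X.q n) * x') : x = x' := by
  have hq : X.N.res (toEtaleTop Z) (X.q n) = X.N.res f (L.β (L.h n)) := by
    rw [L.base, ← res_comp, comp_toEtaleTop]
  have h1 : X.N.res f (L.β (L.h n)) = X.N.res f (L.β (L.h n)) * (x' * x⁻¹ : (X.N.sections Z)ˣ) := by
    rw [Units.val_mul, ← mul_assoc, ← hq, ← h, mul_assoc, Units.mul_inv, mul_one]
  obtain ⟨S, hS, h2⟩ := L.isChart.inj f _ _ _ h1
  refine Units.ext (eq_of_forall_res_eq X.N hS fun g hg => ?_)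
  obtain ⟨b, b', hb, hb', e, e'⟩ := h2 g hg
  obtain rfl : b = b' := L.integral b b' (L.h n) (by rw [mul_comm, e, mul_comm])
  have h3 : X.N.res g ((x' * x⁻¹ : (X.N.sections Z)ˣ) : X.N.sections Z) = 1 :=
    hb.mul_left_cancel (by rw [← e', mul_one])
  rw [Units.val_mul, map_mul] at h3
  calc X.N.res g x = X.N.res g x' * X.N.res g (x⁻¹ : (X.N.sections Z)ˣ) * X.N.res g x := by
        rw [h3, one_mul]
    _ = X.N.res g x' := by rw [mul_assoc, ← map_mul, Units.inv_mul, map_one, mul_one]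

end LogChart

/-! ### Cospecialization in charts -/

section Cospecialization

variable {X : Scheme.{u}} {N : EtaleLogStructure X} {c : X} {U V : X.Etale}

/-- Sections with associated germs agree up to an invertible section on an étale neighbourhood. -/
lemma exists_res_eq_mul_unit (a : etaleFiber c U) (s : N.sections U) (b : etaleFiber c V) (t : N.sections V)
    (h : Associates.mk (etaleGerm N a s) = Associates.mk (etaleGerm N b t)) :
    ∃ (W : X.Etale) (f : W ⟶ U) (g : W ⟶ V) (d : etaleFiber c W) (x : (N.sections W)ˣ),
      etaleFiberMap f d = a ∧ etaleFiberMap g d = b ∧ N.res f s = N.res g t * x := by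
  obtain ⟨x, hx⟩ := (Associates.mk_eq_mk_iff_associated.1 h).symm
  obtain ⟨W₀, d₀, f₀, g₀, rfl, rfl⟩ : ∃ (W : X.Etale) (d : etaleFiber c W) (f : W ⟶ U) (g : W ⟶ V),
    etaleFiberMap f d = a ∧ etaleFiberMap g d = b := exists_etaleFiber_refinement a b
  obtain ⟨W₁, f₁, d₁, t₁, rfl, ht₁⟩ := exists_etaleGerm_eq N d₀ (x : etaleStalk N c)
  obtain ⟨W₂, f₂, d₂, rfl, ⟨x₂, hx₂⟩⟩ := exists_isUnit_res N (ht₁ ▸ x.isUnit : IsUnit (etaleGerm N d₁ t₁))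
  rw [← ht₁, ← etaleFiberMap_comp, ← etaleFiberMap_comp, ← etaleFiberMap_comp, ← etaleFiberMap_comp,
    ← etaleGerm_res, ← etaleGerm_res, ← etaleGerm_res, ← hx₂, ← map_mul, etaleGerm_eq_iff] at hx
  obtain ⟨W₃, f₃, d₃, rfl, e⟩ := hx
  refine ⟨W₃, f₃ ≫ f₂ ≫ f₁ ≫ f₀, f₃ ≫ f₂ ≫ f₁ ≫ g₀, d₃, x₂.map (N.res f₃), ?_, ?_, ?_⟩
  · rw [etaleFiberMap_comp, etaleFiberMap_comp, etaleFiberMap_comp]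
  · rw [etaleFiberMap_comp, etaleFiberMap_comp, etaleFiberMap_comp]
  · rw [map_mul, ← res_comp, ← res_comp] at e
    exact e.symm

variable {M : ZariskiLogStructure X} (φ : ZariskiToEtaleHom M N)

/-- The étale section defined by a section over a Zariski open. -/
abbrev ZariskiToEtaleHom.app (U : X.Opens) : M.sections U →* N.sections ((openToEtale X).obj U) :=
  (φ.hom.app (op U)).hom

lemma ZariskiToEtaleHom.app_res {U U' : X.Opens} (i : U' ⟶ U) (m : M.sections U) :
    φ.app U' (M.res i m) = N.res ((openToEtale X).map i) (φ.app U m) :=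
  congrArg (fun k => k.hom m) (φ.hom.naturality i.op)

lemma germ_stalkDesc {X : TopCat.{u}} (F : TopCat.Presheaf CommMonCat.{u} X) (x : X)
    (T : CommMonCat.{u}) (f : ∀ U : Opens X, x ∈ U → (F.obj (op U) ⟶ T))
    (hf : ∀ (U V : Opens X) (i : U ⟶ V) (hU : x ∈ U), F.map i.op ≫ f U hU = f V (i.le hU))
    (U : Opens X) (hU : x ∈ U) : F.germ U x hU ≫ stalkDesc F x T f hf = f U hU :=
  colimit.ι_desc (F := (OpenNhds.inclusion x).op ⋙ F) _ (op ⟨U, hU⟩)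

lemma ZariskiToEtaleHom.stalkMap_zGerm {U : X.Opens} (hU : c ∈ U) (m : M.sections U) :
    φ.stalkMap c (zGerm M U c hU m) = etaleGerm N (openPoint hU) (φ.app U m) :=
  congrArg (fun k => k.hom m) (germ_stalkDesc (X := X.toTopCat) M.M.obj c (etaleStalk N c) _ _ U hU)

lemma ZariskiToEtaleHom.ghostMap_ghostGerm {U : X.Opens} (hU : c ∈ U) (m : M.sections U) :
    φ.ghostMap c (ghostGerm M hU m) =
      Additive.ofMul (Associates.mk (etaleGerm N (openPoint hU) (φ.app U m))) := by
  rw [← φ.stalkMap_zGerm hU]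
  rfl

lemma etaleFiber_openToEtale_unique {U : X.Opens} (hU : c ∈ U) (a : etaleFiber c ((openToEtale X).obj U)) :
    a = openPoint hU := by
  apply Over.OverMorphism.ext
  have h1 : a.left ≫ U.ι = geomPoint c := Over.w a
  exact (cancel_mono U.ι).1 (h1.trans (geomPointLift_ι hU).symm)

lemma exists_zGerm_eq {M : ZariskiLogStructure X} (m : zariskiStalk M c) :
    ∃ (U : X.Opens) (hU : c ∈ U) (s : M.sections U), zGerm M U c hU s = m := by
  obtain ⟨U, hU, s, h⟩ := TopCat.Presheaf.exists_germ_eq (C := CommMonCat.{u}) (X := X.toTopCat) M.M.obj m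
  exact ⟨U, hU, s, h⟩

lemma exists_ghostGerm_eq {M : ZariskiLogStructure X} (m : Ghost M c) :
    ∃ (U : X.Opens) (hU : c ∈ U) (s : M.sections U), ghostGerm M hU s = m := by
  obtain ⟨m, rfl⟩ := Associates.mk_surjective m.toMul
  obtain ⟨U, hU, s, rfl⟩ := exists_zGerm_eq m
  exact ⟨U, hU, s, rfl⟩

lemma stalkSpecializes_zGerm {M : ZariskiLogStructure X} {z : X} (h : z ⤳ c) {U : X.Opens} (hU : c ∈ U)
    (s : M.sections U) :
    TopCat.Presheaf.stalkSpecializes (C := CommMonCat.{u}) (X := X.toTopCat) M.M.obj h (zGerm M U c hU s) =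
      zGerm M U z (h.mem_open U.2 hU) s :=
  TopCat.Presheaf.germ_stalkSpecializes_apply (X := X.toTopCat) _ hU h s

lemma generization_ghostGerm {M : ZariskiLogStructure X} {z : X} (h : z ⤳ c) {U : X.Opens} (hU : c ∈ U)
    (s : M.sections U) :
    generization M h (ghostGerm M hU s) = ghostGerm M (h.mem_open U.2 hU) s :=
  congrArg (fun m => Additive.ofMul (Associates.mk m)) (stalkSpecializes_zGerm h hU s)

end Cospecialization

/-! ### Values of sections at generic points -/

section OpenUnit

variable {X : Scheme.{u}} {N : EtaleLogStructure X} {c : X}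

/-- Functions on a Zariski open, viewed as an étale scheme. -/
def openFunction (U : X.Opens) : Γ(((openToEtale X).obj U).left, ⊤) →+* Γ(X, U) := U.topIso.hom.hom

lemma openFunction_map {U U' : X.Opens} (i : U' ⟶ U) (s : Γ(((openToEtale X).obj U).left, ⊤)) :
    openFunction U' (((openToEtale X).map i).left.appTop s) =
      X.presheaf.map (homOfLE i.le).op (openFunction U s) := by
  have h : (X.homOfLE i.le).appTop ≫ U'.topIso.hom = U.topIso.hom ≫ X.presheaf.map (homOfLE i.le).op := by
    rw [Scheme.homOfLE_appTop, Scheme.Opens.topIso_hom, Scheme.Opens.topIso_hom]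
    exact (X.presheaf.map_comp _ _).symm.trans
      (X.presheaf.map_comp (eqToHom U.ι_image_top.symm).op (homOfLE i.le).op)
  exact congrArg (fun k => k.hom s) h

/-- The invertible function on a Zariski open defined by an invertible section over it. -/
def openUnit (U : X.Opens) : (N.sections ((openToEtale X).obj U))ˣ →* Γ(X, U)ˣ :=
  Units.map ((openFunction U).toMonoidHom.comp (etaleAlpha N _))

lemma openUnit_res {U U' : X.Opens} (i : U' ⟶ U) (b : (N.sections ((openToEtale X).obj U))ˣ) :
    openUnit U' (Units.map (N.res ((openToEtale X).map i)) b) = unitRes i.le (openUnit U b) := by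
  have h1 := etaleAlpha_res N ((openToEtale X).map i) b.val
  have h2 := openFunction_map i (etaleAlpha N ((openToEtale X).obj U) b.val)
  rw [← h1] at h2
  exact Units.ext h2

lemma res_injective {V W : X.Etale} (f : W ⟶ V) (hf : Function.Surjective f.left) {s t : N.sections V}
    (h : N.res f s = N.res f t) : s = t :=
  (exists_res_eq N f hf (N.res f s) fun a b hab => by rw [← res_comp, ← res_comp, hab]).2 s t h

/-- Étale neighbourhoods of a geometric point have open images. -/
lemma exists_surjective_openToEtale {U : X.Opens} {W : X.Etale} (d : etaleFiber c W)
    (f : W ⟶ (openToEtale X).obj U) :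
    ∃ (U' : X.Opens) (i : U' ⟶ U) (_ : c ∈ U') (f' : W ⟶ (openToEtale X).obj U'),
      Function.Surjective f'.left ∧ f' ≫ (openToEtale X).map i = f := by
  have hf : f.left ≫ U.ι = W.hom := MorphismProperty.Over.w f
  let R : X.Opens := ⟨Set.range W.hom, W.hom.isOpenMap.isOpen_range⟩
  obtain ⟨l, hl⟩ := exists_lift_opens W.hom R fun w => ⟨w, rfl⟩
  have hle : R ≤ U := by
    rintro _ ⟨w, rfl⟩
    rw [← hf]
    exact (f.left w).2
  refine ⟨R, homOfLE hle, ⟨etalePoint d, hom_etalePoint d⟩,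
    MorphismProperty.Over.homMk l hl, ?_, MorphismProperty.Over.Hom.ext ?_⟩
  · rintro ⟨_, ⟨w, rfl⟩⟩
    refine ⟨w, Subtype.ext ?_⟩
    have := congrArg (fun k => k w) hl
    exact this
  · have h1 : (l ≫ X.homOfLE hle) ≫ U.ι = f.left ≫ U.ι := by
      rw [Category.assoc, X.homOfLE_ι, hl, hf]
    exact (cancel_mono U.ι).1 h1

end OpenUnit

namespace PrestableLogCurve

variable {κ : Type u} [Field κ] [CharZero κ] {X : PrestableLogCurve κ} {M : ZariskiLogStructure X.C}
  (φ : ZariskiToEtaleHom M X.N) {ζ : X.C}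

/-- Near `ζ` the germ `m` is the product of a section from the base and of an invertible section
with germ `f`. At a generic point this holds for exactly one `f`: multiplying by sections from the
base is a trivialization of the restriction of the torsors of ghost sections. -/
def IsValue (m : zariskiStalk M ζ) (f : (X.C.presheaf.stalk ζ)ˣ) : Prop :=
  ∃ (U : X.C.Opens) (hU : ζ ∈ U) (s : M.sections U) (n : Multiplicative ℕ)
    (b : (X.N.sections ((openToEtale X.C).obj U))ˣ), zGerm M U ζ hU s = m ∧
    φ.app U s = X.N.res (toEtaleTop ((openToEtale X.C).obj U)) (X.q n) * b ∧ unitGerm hU (openUnit U b) = f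

variable {φ}

lemma app_res_eq {U U' : X.C.Opens} (i : U' ⟶ U) {s : M.sections U} {n : Multiplicative ℕ}
    {b : (X.N.sections ((openToEtale X.C).obj U))ˣ}
    (h : φ.app U s = X.N.res (toEtaleTop ((openToEtale X.C).obj U)) (X.q n) * b) :
    φ.app U' (M.res i s) = X.N.res (toEtaleTop ((openToEtale X.C).obj U')) (X.q n) *
      (Units.map (X.N.res ((openToEtale X.C).map i)) b : (X.N.sections _)ˣ) := by
  rw [φ.app_res, h, map_mul, ← res_comp, comp_toEtaleTop]
  rfl

lemma ghostMap_eq_baseGhost {U : X.C.Opens} (hU : ζ ∈ U) {s : M.sections U} {n : Multiplicative ℕ}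
    {b : (X.N.sections ((openToEtale X.C).obj U))ˣ}
    (h : φ.app U s = X.N.res (toEtaleTop ((openToEtale X.C).obj U)) (X.q n) * b) :
    φ.ghostMap ζ (ghostGerm M hU s) = baseGhost X.q ζ n.toAdd := by
  rw [φ.ghostMap_ghostGerm, h, map_mul, ← globalGerm_eq]
  refine congrArg Additive.ofMul (Associates.mk_eq_mk_iff_associated.2 ?_)
  exact associated_mul_unit_left _ _ (b.isUnit.map _)

lemma exists_isValue (hζ : ζ ∈ genericPoints X.C) (m : zariskiStalk M ζ) : ∃ f, IsValue φ m f := by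
  obtain ⟨U, hU, s, rfl⟩ := exists_zGerm_eq m
  obtain ⟨n, hn⟩ := X.exists_eq_baseGhost hζ (φ.ghostMap ζ (ghostGerm M hU s))
  obtain ⟨L, v, hv⟩ := LogChart.exists_mem ζ
  obtain ⟨a, rfl⟩ := exists_etalePoint_eq v hv
  rw [φ.ghostMap_ghostGerm] at hn
  have h1 : Associates.mk (etaleGerm X.N (openPoint hU) (φ.app U s)) =
      Associates.mk (etaleGerm X.N a (X.N.res (toEtaleTop _) (X.q (.ofAdd n)))) := by
    rw [← globalGerm_eq]
    exact hn
  obtain ⟨W, f, g, d, x, -, -, h⟩ := exists_res_eq_mul_unit _ _ _ _ h1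
  rw [← res_comp, comp_toEtaleTop] at h
  obtain ⟨U', i, hU', f', hf', rfl⟩ := exists_surjective_openToEtale d f
  have hx : ∀ {Z : X.C.Etale} (a b : Z ⟶ W), a ≫ f' = b ≫ f' →
      Units.map (X.N.res a) x = Units.map (X.N.res b) x := fun {Z} a b hab => by
    refine L.unit_eq_of_mul_eq (a ≫ g) (.ofAdd n) _ _ ?_
    have h2 : ∀ k : Z ⟶ W, X.N.res (toEtaleTop Z) (X.q (.ofAdd n)) * X.N.res k x =
        X.N.res (k ≫ f' ≫ (openToEtale X.C).map i) (φ.app U s) := fun k => by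
      rw [res_comp, h, map_mul, ← res_comp, comp_toEtaleTop]
    refine (h2 a).trans (Eq.trans ?_ (h2 b).symm)
    rw [reassoc_of% hab]
  obtain ⟨t, ht⟩ := (exists_res_eq X.N f' hf' x fun a b hab => congrArg Units.val (hx a b hab)).1
  obtain ⟨t', ht'⟩ := (exists_res_eq X.N f' hf' (x⁻¹ : (X.N.sections W)ˣ) fun a b hab => by
    have := congrArg Units.val (congrArg (fun k => k⁻¹) (hx a b hab))
    rwa [← map_inv, ← map_inv] at this).1
  have htt : t * t' = 1 := res_injective f' hf' (by rw [map_mul, ht, ht', Units.mul_inv, map_one])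
  refine ⟨_, U', hU', M.res i s, .ofAdd n, ⟨t, t', htt, by rw [mul_comm, htt]⟩, zGerm_res M i hU' s, ?_, rfl⟩
  refine res_injective f' hf' ?_
  rw [φ.app_res, ← res_comp, h, map_mul, ← res_comp, comp_toEtaleTop, ht]

lemma IsValue.unique (hζ : ζ ∈ genericPoints X.C) {m : zariskiStalk M ζ} {f f' : (X.C.presheaf.stalk ζ)ˣ}
    (h : IsValue φ m f) (h' : IsValue φ m f') : f = f' := by
  obtain ⟨U₁, hU₁, s₁, n, b₁, rfl, e₁, rfl⟩ := h
  obtain ⟨U₂, hU₂, s₂, n₂, b₂, h, e₂, rfl⟩ := h'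
  obtain ⟨U, hU, i₁, i₂, hs⟩ : ∃ (U : X.C.Opens) (_ : ζ ∈ U) (i₁ : U ⟶ U₁) (i₂ : U ⟶ U₂),
      M.res i₁ s₁ = M.res i₂ s₂ :=
    TopCat.Presheaf.germ_eq (C := CommMonCat.{u}) (X := X.C.toTopCat) M.M.obj ζ hU₁ hU₂ s₁ s₂ h.symm
  have e₁' := app_res_eq i₁ e₁
  have e₂' := app_res_eq i₂ e₂
  have g₁ := ghostMap_eq_baseGhost hU e₁'
  rw [hs, ghostMap_eq_baseGhost hU e₂'] at g₁
  obtain rfl : n₂ = n := X.baseGhost_injective (X.isSmoothAt_of_mem_genericPoints hζ) g₁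
  obtain ⟨L, v, hv⟩ := LogChart.exists_mem ζ
  obtain ⟨a, rfl⟩ := exists_etalePoint_eq v hv
  obtain ⟨Z, d, f, g, -, -⟩ : ∃ (Z : X.C.Etale) (d : etaleFiber ζ Z) (f : Z ⟶ (openToEtale X.C).obj U)
    (g : Z ⟶ L.V), etaleFiberMap f d = openPoint hU ∧ etaleFiberMap g d = a :=
    exists_etaleFiber_refinement _ _
  obtain ⟨U', i, hU', f', hf', rfl⟩ := exists_surjective_openToEtale d f
  have e₁'' := app_res_eq (i ≫ i₁) e₁
  have e₂'' := app_res_eq (i ≫ i₂) e₂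
  have hs' : M.res (i ≫ i₁) s₁ = M.res (i ≫ i₂) s₂ := by
    have h3 : ∀ {A : X.C.Opens} (k : U ⟶ A) (x : M.sections A), M.res (i ≫ k) x = M.res i (M.res k x) :=
      fun k x => congrArg (fun k => k.hom x) (M.M.obj.map_comp k.op i.op)
    rw [h3, h3, hs]
  rw [hs', e₂''] at e₁''
  have h4 := congrArg (X.N.res f') e₁''
  rw [map_mul, map_mul, ← res_comp, comp_toEtaleTop] at h4
  have hb := L.unit_eq_of_mul_eq g n₂ (Units.map (X.N.res f') _) (Units.map (X.N.res f') _) h4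
  have hb' := Units.ext (res_injective f' hf' (congrArg Units.val hb))
  have hu := congrArg (openUnit U') hb'
  rw [openUnit_res, openUnit_res] at hu
  rw [← unitGerm_unitRes (i ≫ i₁).le hU', ← unitGerm_unitRes (i ≫ i₂).le hU', hu]

lemma isValue_one : IsValue φ (1 : zariskiStalk M ζ) 1 :=
  ⟨⊤, trivial, 1, 1, 1, map_one _, by rw [map_one, map_one, map_one, one_mul]; rfl, by rw [map_one, map_one]⟩

lemma IsValue.mul {m m' : zariskiStalk M ζ} {f f' : (X.C.presheaf.stalk ζ)ˣ}
    (h : IsValue φ m f) (h' : IsValue φ m' f') : IsValue φ (m * m') (f * f') := by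
  obtain ⟨U₁, hU₁, s₁, n₁, b₁, rfl, e₁, rfl⟩ := h
  obtain ⟨U₂, hU₂, s₂, n₂, b₂, rfl, e₂, rfl⟩ := h'
  have e₁' := app_res_eq (homOfLE inf_le_left : U₁ ⊓ U₂ ⟶ U₁) e₁
  have e₂' := app_res_eq (homOfLE inf_le_right : U₁ ⊓ U₂ ⟶ U₂) e₂
  have hU : ζ ∈ U₁ ⊓ U₂ := ⟨hU₁, hU₂⟩
  refine ⟨U₁ ⊓ U₂, hU,
    M.res (homOfLE inf_le_left : U₁ ⊓ U₂ ⟶ U₁) s₁ * M.res (homOfLE inf_le_right : U₁ ⊓ U₂ ⟶ U₂) s₂, n₁ * n₂,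
    Units.map (X.N.res ((openToEtale X.C).map (homOfLE inf_le_left : U₁ ⊓ U₂ ⟶ U₁))) b₁ *
      Units.map (X.N.res ((openToEtale X.C).map (homOfLE inf_le_right : U₁ ⊓ U₂ ⟶ U₂))) b₂, ?_, ?_, ?_⟩
  · rw [map_mul, zGerm_res, zGerm_res]
  · rw [map_mul, e₁', e₂', map_mul, map_mul, Units.val_mul, mul_mul_mul_comm]
  · rw [map_mul, map_mul, openUnit_res, openUnit_res, unitGerm_unitRes, unitGerm_unitRes]

lemma alphaStalk_zGerm {U : X.C.Opens} (hU : ζ ∈ U) (s : M.sections U) :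
    alphaStalk M ζ (zGerm M U ζ hU s) = X.C.presheaf.germ U ζ hU (zariskiAlpha M U s) :=
  congrArg (fun k => k.hom s)
    (germ_stalkDesc (X := X.C.toTopCat) M.M.obj ζ (CommMonCat.of (X.C.presheaf.stalk ζ)) _ _ U hU)

/-- The value of an invertible germ is the corresponding invertible function. -/
lemma IsValue.eq_of_isUnit (hζ : ζ ∈ genericPoints X.C) {m : zariskiStalk M ζ}
    {f : (X.C.presheaf.stalk ζ)ˣ} (h : IsValue φ m f) (hm : IsUnit m) : (f : X.C.presheaf.stalk ζ) = alphaStalk M ζ m := by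
  obtain ⟨U, hU, s, n, b, rfl, e, rfl⟩ := h
  have h1 := ghostMap_eq_baseGhost hU e
  have h2 : ghostGerm M hU s = 0 := congrArg Additive.ofMul (Associates.mk_eq_one.2 hm)
  rw [h2, map_zero, ← map_zero (baseGhost X.q ζ)] at h1
  obtain rfl : n = 1 := (X.baseGhost_injective (X.isSmoothAt_of_mem_genericPoints hζ) h1).symm
  rw [map_one, map_one, one_mul] at e
  rw [alphaStalk_zGerm]
  have h3 := φ.comm U s
  rw [show φ.hom.app (op U) s = (b : X.N.sections _) from e] at h3
  change X.C.presheaf.germ U ζ hU (openFunction U (etaleAlpha X.N _ b)) = _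
  exact congrArg _ ((congrArg (openFunction U) h3).trans (congrArg (fun k => k.hom (zariskiAlpha M U s)) U.topIso.inv_hom_id))

variable (φ) in
/-- The values of the germs of `M` at a generic point. -/
def genericValue (hζ : ζ ∈ genericPoints X.C) : zariskiStalk M ζ →* (X.C.presheaf.stalk ζ)ˣ where
  toFun m := (exists_isValue (φ := φ) hζ m).choose
  map_one' := (exists_isValue hζ 1).choose_spec.unique hζ isValue_one
  map_mul' m m' := (exists_isValue hζ (m * m')).choose_spec.unique hζ
    ((exists_isValue hζ m).choose_spec.mul (exists_isValue hζ m').choose_spec)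

lemma isValue_genericValue (hζ : ζ ∈ genericPoints X.C) (m : zariskiStalk M ζ) :
    IsValue φ m (genericValue φ hζ m) := (exists_isValue hζ m).choose_spec

end PrestableLogCurve

/-! ### Presentations of sections in charts -/

namespace LogChart

variable {κ : Type u} [Field κ] {X : PrestableLogCurve κ} (L : LogChart X)

/-- The restriction of a chart along an étale morphism. -/
def pullback {W : X.C.Etale} (b : W ⟶ L.V) : LogChart X where
  V := W
  P := L.P
  h := L.h
  β := (X.N.res b).comp L.β
  isFineSaturated := L.isFineSaturated
  isChart :=
    { surj := fun f m => by
        obtain ⟨S, hS, h⟩ := L.isChart.surj (f ≫ b) m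
        refine ⟨S, hS, fun g hg => ?_⟩
        obtain ⟨p, a, e⟩ := h g hg
        refine ⟨p, a, ?_⟩
        rw [e, MonoidHom.comp_apply, ← res_comp, Category.assoc]
      inj := fun f p p' a h => by
        rw [MonoidHom.comp_apply, MonoidHom.comp_apply, ← res_comp, ← res_comp] at h
        obtain ⟨S, hS, h⟩ := L.isChart.inj (f ≫ b) p p' a h
        refine ⟨S, hS, fun g hg => ?_⟩
        obtain ⟨p₁, p₂, e⟩ := h g hg
        refine ⟨p₁, p₂, ?_⟩
        rwa [MonoidHom.comp_apply, MonoidHom.comp_apply, ← res_comp, ← res_comp, Category.assoc] }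
  base n := by rw [MonoidHom.comp_apply, L.base, ← res_comp, comp_toEtaleTop]
  r := b.left ≫ L.r
  smooth := inferInstance
  comp_eq := by
    rw [Category.assoc, L.comp_eq, ← Category.assoc, show b.left ≫ L.V.hom = W.hom from MorphismProperty.Over.w b]
  alpha_eq p := by
    rw [MonoidHom.comp_apply, etaleAlpha_res, L.alpha_eq, Scheme.Hom.comp_appTop]
    rfl

variable {L} {M : ZariskiLogStructure X.C} {φ : ZariskiToEtaleHom M X.N}

lemma openToEtale_hom_ext {U : X.C.Opens} {Z : X.C.Etale} (a b : Z ⟶ (openToEtale X.C).obj U) : a = b := by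
  refine MorphismProperty.Over.Hom.ext ?_
  have ha : a.left ≫ U.ι = Z.hom := MorphismProperty.Over.w a
  have hb : b.left ≫ U.ι = Z.hom := MorphismProperty.Over.w b
  exact (cancel_mono U.ι).1 (ha.trans hb.symm)

/-- Every section of `M` is given by an element of the monoid of a chart. -/
lemma exists_presentation {c : X.C} {U : X.C.Opens} (hU : c ∈ U) (s : M.sections U) :
    ∃ (L : LogChart X) (_ : etaleFiber c L.V) (f : L.V ⟶ (openToEtale X.C).obj U) (p : L.P)
      (x : (X.N.sections L.V)ˣ), X.N.res f (φ.app U s) = L.β p * x := by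
  obtain ⟨L, v, hv⟩ := exists_mem c
  obtain ⟨a, -⟩ := exists_etalePoint_eq v hv
  obtain ⟨p, hp⟩ := chartGhost_surjective L.isChart a (Associates.mk (etaleGerm X.N (openPoint hU) (φ.app U s)))
  obtain ⟨W, f, g, d, x, -, -, e⟩ := exists_res_eq_mul_unit _ _ a (L.β p) hp.symm
  exact ⟨L.pullback g, d, f, p, x, e⟩

lemma ghostMap_ghostGerm {c : X.C} {U : X.C.Opens} (hU : c ∈ U) {s : M.sections U}
    {f : L.V ⟶ (openToEtale X.C).obj U} {p : L.P} {x : (X.N.sections L.V)ˣ}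
    (hp : X.N.res f (φ.app U s) = L.β p * x) (a : etaleFiber c L.V) :
    φ.ghostMap c (ghostGerm M hU s) = Additive.ofMul (chartGhost L.β a p) := by
  rw [φ.ghostMap_ghostGerm, ← etaleFiber_openToEtale_unique hU (etaleFiberMap f a), ← etaleGerm_res, hp, map_mul]
  exact congrArg Additive.ofMul (Associates.mk_eq_mk_iff_associated.2
    (associated_mul_unit_left _ _ (x.isUnit.map _)))

lemma chartGhost_eq_base {c : X.C} (a : etaleFiber c L.V) {p g g' : L.P} {n : ℕ}
    (hg : g ∈ L.face (etalePoint a)) (hg' : g' ∈ L.face (etalePoint a)) (e : p * g = L.ρ ^ n * g') :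
    Additive.ofMul (chartGhost L.β a p) = baseGhost X.q c n := by
  rw [baseGhost_eq_chartGhost a L.base]
  refine congrArg Additive.ofMul ((chartGhost_eq_iff L.isChart a _ _).2 ⟨g, hg, g', hg', ?_⟩)
  rw [e]
  congr 1
  change L.h (Multiplicative.ofAdd 1) ^ n = _
  rw [← map_pow, ← ofAdd_nsmul, nsmul_eq_mul, mul_one]
  rfl

/-- Positions of vertices in charts. -/
lemma ghostMap_eq_baseGhost {ξ : L.V.left} {ζ : X.C} (hξ : L.V.hom ξ = ζ) {U : X.C.Opens} (hU : ζ ∈ U)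
    {s : M.sections U} {f : L.V ⟶ (openToEtale X.C).obj U} {p : L.P} {x : (X.N.sections L.V)ˣ}
    (hp : X.N.res f (φ.app U s) = L.β p * x) {g g' : L.P} {n : ℕ}
    (hg : g ∈ L.face ξ) (hg' : g' ∈ L.face ξ) (e : p * g = L.ρ ^ n * g') :
    φ.ghostMap ζ (ghostGerm M hU s) = baseGhost X.q ζ n := by
  obtain ⟨a, rfl⟩ := exists_etalePoint_eq ξ hξ
  rw [ghostMap_ghostGerm hU hp a, chartGhost_eq_base a hg hg' e]

lemma stalkMap_injective_of_flat {Y Z : Scheme.{u}} (f : Y ⟶ Z) [Flat f] (y : Y) :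
    Function.Injective (f.stalkMap y).hom := by
  have h : (f.stalkMap y).hom.Flat := Flat.stalkMap f y
  algebraize [(f.stalkMap y).hom]
  have : IsLocalHom (algebraMap (Z.presheaf.stalk (f y)) (Y.presheaf.stalk y)) :=
    inferInstanceAs (IsLocalHom (f.stalkMap y).hom)
  have := Module.FaithfullyFlat.of_flat_of_isLocalHom (A := Z.presheaf.stalk (f y)) (B := Y.presheaf.stalk y)
  exact FaithfulSMul.algebraMap_injective _ _

lemma stalkMap_ι_germ {Z : Scheme.{u}} (U : Z.Opens) (z : U.toScheme) (hz : U.ι z ∈ U) (s : Γ(U.toScheme, ⊤)) :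
    U.ι.stalkMap z (Z.presheaf.germ U _ hz (U.topIso.hom s)) = germTop z s := by
  have h1 := Scheme.Hom.germ_stalkMap_apply U.ι U z hz (U.topIso.hom s)
  have h2 : U.topIso.hom ≫ U.ι.app U = U.toScheme.presheaf.map (homOfLE (le_top : U.ι ⁻¹ᵁ U ≤ ⊤)).op := by
    rw [Scheme.Opens.topIso_hom, Scheme.Opens.ι_app]
    exact (Z.presheaf.map_comp _ _).symm
  have h3 : U.ι.app U (U.topIso.hom s) = U.toScheme.presheaf.map (homOfLE (le_top : U.ι ⁻¹ᵁ U ≤ ⊤)).op s :=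
    congrArg (fun k => k.hom s) h2
  rw [h3] at h1
  exact h1.trans (U.toScheme.presheaf.germ_res_apply (homOfLE le_top) z hz s)

lemma stalkMap_germ_eq_germTop {Y Z V : Scheme.{u}} {U : Z.Opens} (k : Y ⟶ V) (f : V ⟶ Z) (l : Y ⟶ U.toScheme)
    (h : l ≫ U.ι = k ≫ f) (y : Y) (hy : f (k y) ∈ U) (s : Γ(U.toScheme, ⊤)) :
    k.stalkMap y (f.stalkMap (k y) (Z.presheaf.germ U _ hy (U.topIso.hom s))) = germTop y (l.appTop s) := by
  have hy' : U.ι (l y) ∈ U := (l y).2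
  rw [stalkMap_germ_eq h.symm y U _ hy hy', stalkMap_ι_germ, germTop_appTop]

lemma exists_unit_mul_eq {ξ : L.V.left} {U U' : X.C.Opens} (i : U' ⟶ U) {s : M.sections U}
    {f : L.V ⟶ (openToEtale X.C).obj U} {p : L.P} {x : (X.N.sections L.V)ˣ}
    (hp : X.N.res f (φ.app U s) = L.β p * x) {g g' : L.P} {n : ℕ}
    (hg : g ∈ L.face ξ) (hg' : g' ∈ L.face ξ) (e : p * g = L.ρ ^ n * g')
    {b : (X.N.sections ((openToEtale X.C).obj U'))ˣ}
    (hb : φ.app U' (M.res i s) = X.N.res (toEtaleTop ((openToEtale X.C).obj U')) (X.q (.ofAdd n)) * b)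
    (hU' : L.V.hom ξ ∈ U') :
    ∃ (Z : X.C.Etale) (z : Z.left) (k₁ : Z ⟶ (openToEtale X.C).obj U') (k₂ : Z ⟶ L.V), k₂.left z = ξ ∧
      X.N.res k₁ b * X.N.res k₂ (L.β g) = X.N.res k₂ (L.β g') * X.N.res k₂ x := by
  obtain ⟨a, ha⟩ := exists_etalePoint_eq (c := L.V.hom ξ) ξ rfl
  obtain ⟨Z, d, k₁, k₂, -, hd⟩ : ∃ (Z : X.C.Etale) (d : etaleFiber (L.V.hom ξ) Z)
    (k₁ : Z ⟶ (openToEtale X.C).obj U') (k₂ : Z ⟶ L.V),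
      etaleFiberMap k₁ d = openPoint hU' ∧ etaleFiberMap k₂ d = a := exists_etaleFiber_refinement _ _
  have hz : k₂.left (etalePoint d) = ξ := by rw [← etalePoint_map, hd, ha]
  have hu : IsUnit (etaleGerm X.N d (X.N.res k₂ (L.β (g * g')))) := by
    rw [etaleGerm_res, hd, isUnit_etaleGerm_iff, ha]
    exact mem_chartFace.1 (mul_mem hg hg')
  obtain ⟨Z', k, d', rfl, hu'⟩ := exists_isUnit_res X.N hu
  rw [← res_comp, map_mul, map_mul, IsUnit.mul_iff] at hu'
  obtain ⟨⟨y, hy⟩, y', hy'⟩ := hu'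
  have e1 : X.N.res (k ≫ k₁) (φ.app U' (M.res i s)) = X.N.res (k ≫ k₂) (L.β p * x) := by
    rw [← hp, ← res_comp, φ.app_res, ← res_comp, openToEtale_hom_ext ((k ≫ k₁) ≫ _) ((k ≫ k₂) ≫ f)]
  have e2 : L.β p * L.β g = X.N.res (toEtaleTop L.V) (X.q (.ofAdd n)) * L.β g' := by
    rw [← map_mul, e, map_mul, ← L.base]
    congr 2
    change L.h (Multiplicative.ofAdd 1) ^ n = _
    rw [← map_pow, ← ofAdd_nsmul, nsmul_eq_mul, mul_one]
    rfl
  have e3 := congrArg (X.N.res (k ≫ k₂)) e2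
  rw [map_mul, map_mul, ← res_comp, comp_toEtaleTop] at e3
  rw [hb, map_mul, map_mul, ← res_comp, comp_toEtaleTop] at e1
  have e4 := L.unit_eq_of_mul_eq (k ≫ k₂) (.ofAdd n) (Units.map (X.N.res (k ≫ k₁)) b * y)
    (y' * Units.map (X.N.res (k ≫ k₂)) x) (by
      rw [Units.val_mul, Units.val_mul, Units.coe_map, Units.coe_map, hy, hy', ← mul_assoc, ← mul_assoc, ← e3]
      refine (congrArg (· * _) e1).trans ?_
      rw [mul_right_comm])
  have e5 := congrArg Units.val e4
  rw [Units.val_mul, Units.val_mul, Units.coe_map, Units.coe_map, hy, hy'] at e5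
  exact ⟨Z', etalePoint d', k ≫ k₁, k ≫ k₂, hz, e5⟩

/-- The value at a generic point of a section of `M`, in terms of a presentation in a chart. -/
lemma germ_mul_eq {ξ : L.V.left} {U U' : X.C.Opens} (i : U' ⟶ U) {s : M.sections U}
    {f : L.V ⟶ (openToEtale X.C).obj U} {p : L.P} {x : (X.N.sections L.V)ˣ}
    (hp : X.N.res f (φ.app U s) = L.β p * x) {g g' : L.P} {n : ℕ}
    (hg : g ∈ L.face ξ) (hg' : g' ∈ L.face ξ) (e : p * g = L.ρ ^ n * g')
    {b : (X.N.sections ((openToEtale X.C).obj U'))ˣ}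
    (hb : φ.app U' (M.res i s) = X.N.res (toEtaleTop ((openToEtale X.C).obj U')) (X.q (.ofAdd n)) * b)
    (hU' : L.V.hom ξ ∈ U') :
    Scheme.Hom.stalkMap (X := L.V.left) (Y := X.C) L.V.hom ξ
        (X.C.presheaf.germ U' _ hU' (openUnit U' b : Γ(X.C, U'))) *
      germTop ξ (etaleAlpha X.N L.V (L.β g)) =
    germTop ξ (etaleAlpha X.N L.V (L.β g')) * germTop ξ (etaleAlpha X.N L.V x) := by
  obtain ⟨Z, z, k₁, k₂, hz, e4⟩ := exists_unit_mul_eq i hp hg hg' e hb hU'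
  have hw : k₁.left ≫ U'.ι = k₂.left ≫ L.V.hom :=
    (MorphismProperty.Over.w k₁).trans (MorphismProperty.Over.w k₂).symm
  have e5 := congrArg (fun y => germTop z (etaleAlpha X.N Z y)) e4
  rw [map_mul, map_mul, map_mul, map_mul, etaleAlpha_res, etaleAlpha_res, etaleAlpha_res, etaleAlpha_res,
    germTop_appTop k₂.left, germTop_appTop k₂.left, germTop_appTop k₂.left] at e5
  subst hz
  refine stalkMap_injective_of_flat k₂.left z ?_
  have h := stalkMap_germ_eq_germTop k₂.left L.V.hom k₁.left hw z hU'
    (etaleAlpha X.N ((openToEtale X.C).obj U') b)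
  refine (map_mul _ _ _).trans (Eq.trans ?_ (map_mul _ _ _).symm)
  exact (congrArg (· * (k₂.left.stalkMap z).hom (germTop (k₂.left z) (etaleAlpha X.N L.V (L.β g)))) h).trans e5

end LogChart

lemma LocalBranch.orderAt_eq {κ : Type u} [Field κ] {X : PrestableLogCurve κ} {η : X.C} {V : Scheme.{u}}
    {f : V ⟶ X.C} {v : V} {y : X.normalizedComponent η} (B : LocalBranch X η f v y)
    {a : (X.normalizedComponent η).functionField} {c c' z : B.E} (ha : a ≠ 0) (hc : c ≠ 0) (hc' : c' ≠ 0)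
    (hz : z ≠ 0) (h : B.i a * c = c' * z) (h0 : B.ν z = 0) : orderAt a y = B.ν c' - B.ν c := by
  have h1 := congrArg B.ν h
  rw [B.ν_mul _ _ ((map_ne_zero B.i).2 ha) hc, B.ν_mul _ _ hc' hz, B.ν_i _ ha, h0] at h1
  omega

/-! ### Orders of vanishing of sections -/

section OrderAt

variable {Y : Scheme.{u}} [IsIntegral Y] [IsLocallyNoetherian Y] {y : Y}

lemma orderAt_mul {f g : Y.functionField} (hf : f ≠ 0) (hg : g ≠ 0) :
    orderAt (f * g) y = orderAt f y + orderAt g y := by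
  have hN : IsLocallyNoetherian Y := inferInstance
  unfold orderAt
  rw [dif_pos hN, dif_pos hN, dif_pos hN]
  exact Scheme.ord_mul hf hg

lemma orderAt_germ_of_isUnit {a : Y.presheaf.stalk y} (ha : IsUnit a) :
    orderAt (Y.presheaf.stalkSpecializes (genericPoint_specializes y) a : Y.functionField) y = 0 := by
  obtain ⟨u, rfl⟩ := ha
  obtain ⟨U, hU, s, hs⟩ := Y.presheaf.exists_germ_eq (u : Y.presheaf.stalk y)
  obtain ⟨V, i, hV, hs'⟩ : ∃ (V : Y.Opens) (i : V ≤ U) (_ : y ∈ V), IsUnit (Y.presheaf.map (homOfLE i).op s) :=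
    ⟨Y.basicOpen s, Y.basicOpen_le s, (Scheme.mem_basicOpen _ _ _ hU).2 (hs ▸ u.isUnit),
      RingedSpace.isUnit_res_basicOpen _ s⟩
  have hne : Nonempty V := ⟨⟨y, hV⟩⟩
  have hN : IsLocallyNoetherian Y := inferInstance
  rw [← hs, ← Y.presheaf.germ_res_apply (homOfLE i) y hV s, TopCat.Presheaf.germ_stalkSpecializes_apply]
  unfold orderAt
  rw [dif_pos hN]
  exact Scheme.ord_of_isUnit hs' hV

end OrderAt

namespace PrestableLogCurve

variable {κ : Type u} [Field κ] [CharZero κ] {X : PrestableLogCurve κ} {M : ZariskiLogStructure X.C}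
  (φ : ZariskiToEtaleHom M X.N) {η : X.C}

lemma toCurve_genericPoint_mem (hη : η ∈ genericPoints X.C) :
    X.toCurve η (genericPoint (X.normalizedComponent η)) ∈ genericPoints X.C := by
  rwa [X.toCurve_genericPoint]

lemma toCurve_genericPoint_specializes (y : X.normalizedComponent η) :
    X.toCurve η (genericPoint (X.normalizedComponent η)) ⤳ X.toCurve η y :=
  (genericPoint_specializes y).map (X.toCurve η).continuous

/-- The values of germs of `M` at the generic point of a component as rational functions on the
normalization. -/
def rationalValue (hη : η ∈ genericPoints X.C) :
    zariskiStalk M (X.toCurve η (genericPoint (X.normalizedComponent η))) →*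
      ((X.normalizedComponent η).functionField)ˣ :=
  (Units.map ((X.toCurve η).stalkMap (genericPoint (X.normalizedComponent η))).hom.toMonoidHom).comp
    (genericValue φ (toCurve_genericPoint_mem hη))

variable (M) in
/-- The generization map from the stalk of `M` at a point of the normalization to the stalk at the
generic point. -/
abbrev toGeneric (y : X.normalizedComponent η) : zariskiStalk M (X.toCurve η y) →*
    zariskiStalk M (X.toCurve η (genericPoint (X.normalizedComponent η))) :=
  (TopCat.Presheaf.stalkSpecializes (C := CommMonCat.{u}) (X := X.C.toTopCat) M.M.obj
    (toCurve_genericPoint_specializes y)).hom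

lemma alphaStalk_toGeneric (y : X.normalizedComponent η) (m : zariskiStalk M (X.toCurve η y)) :
    alphaStalk M _ (toGeneric M y m) =
      X.C.presheaf.stalkSpecializes (toCurve_genericPoint_specializes y) (alphaStalk M _ m) := by
  obtain ⟨U, hU, s, rfl⟩ := exists_zGerm_eq m
  rw [stalkSpecializes_zGerm, alphaStalk_zGerm, alphaStalk_zGerm, TopCat.Presheaf.germ_stalkSpecializes_apply]

/-- The value of an invertible germ is the corresponding invertible function. -/
lemma rationalValue_toGeneric_of_isUnit (hη : η ∈ genericPoints X.C) (y : X.normalizedComponent η)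
    {m : zariskiStalk M (X.toCurve η y)} (hm : IsUnit m) :
    (rationalValue φ hη (toGeneric M y m) : (X.normalizedComponent η).functionField) =
      (X.normalizedComponent η).presheaf.stalkSpecializes (genericPoint_specializes y)
        ((X.toCurve η).stalkMap y (alphaStalk M _ m)) := by
  have h1 := (isValue_genericValue (φ := φ) (toCurve_genericPoint_mem hη) (toGeneric M y m)).eq_of_isUnit
    (toCurve_genericPoint_mem hη) (hm.map _)
  rw [alphaStalk_toGeneric] at h1
  have h2 := congrArg (fun k => k.hom (alphaStalk M _ m))
    (Scheme.Hom.stalkSpecializes_stalkMap (X.toCurve η) _ y (genericPoint_specializes y))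
  exact (congrArg (fun a => ((X.toCurve η).stalkMap _).hom a) h1).trans h2

lemma orderAt_rationalValue_mul (hη : η ∈ genericPoints X.C) (y : X.normalizedComponent η)
    (m m' : zariskiStalk M (X.toCurve η y)) :
    orderAt (rationalValue φ hη (toGeneric M y (m * m')) : (X.normalizedComponent η).functionField) y =
      orderAt (rationalValue φ hη (toGeneric M y m) : (X.normalizedComponent η).functionField) y +
      orderAt (rationalValue φ hη (toGeneric M y m') : (X.normalizedComponent η).functionField) y := by
  have := X.isLocallyNoetherian_normalizedComponent hη
  rw [map_mul, map_mul, Units.val_mul, orderAt_mul (Units.ne_zero _) (Units.ne_zero _)]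

/-- The order of vanishing at a point of the normalization, on the ghost stalk of `M`. At special
points this is the contact order. -/
def vanishingOrder (hη : η ∈ genericPoints X.C) (y : X.normalizedComponent η) :
    Ghost M (X.toCurve η y) →+ ℤ where
  toFun m := Quotient.liftOn m.toMul
    (fun m => orderAt (rationalValue φ hη (toGeneric M y m) : (X.normalizedComponent η).functionField) y)
    (by
      rintro m _ ⟨v, rfl⟩
      have := X.isLocallyNoetherian_normalizedComponent hη
      dsimp only
      rw [orderAt_rationalValue_mul, rationalValue_toGeneric_of_isUnit φ hη y v.isUnit,
        orderAt_germ_of_isUnit ((v.isUnit.map (alphaStalk M _)).map _), add_zero])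
  map_zero' := by
    have h := orderAt_rationalValue_mul φ hη y 1 1
    rw [mul_one] at h
    exact left_eq_add.1 h
  map_add' := by
    rintro ⟨m⟩ ⟨m'⟩
    exact orderAt_rationalValue_mul φ hη y m m'

lemma vanishingOrder_genericPoint (hη : η ∈ genericPoints X.C) (m) :
    vanishingOrder (M := M) φ hη (genericPoint (X.normalizedComponent η)) m = 0 := by
  obtain ⟨m, rfl⟩ := Associates.mk_surjective m.toMul
  exact orderAt_genericPoint _

/-- The order of vanishing of a section in terms of a chart. -/
lemma vanishingOrder_eq (hη : η ∈ genericPoints X.C) {y : X.normalizedComponent η} {L : LogChart X} {v : L.V.left}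
    {B : LocalBranch X η L.V.hom v y} {V : Additive L.P →+ ℕ} {w : Additive L.P →+ ℤ}
    (I : L.BranchInvariants B V w) {U : X.C.Opens} (hU : X.toCurve η y ∈ U) {s : M.sections U}
    {f : L.V ⟶ (openToEtale X.C).obj U} {p : L.P} {x : (X.N.sections L.V)ˣ}
    (hp : X.N.res f (φ.app U s) = L.β p * x) :
    vanishingOrder φ hη y (ghostGerm M hU s) = w (.ofMul p) := by
  have hε := toCurve_genericPoint_mem hη
  have hB : L.V.hom B.ξ = X.toCurve η (genericPoint (X.normalizedComponent η)) :=
    B.map_ξ.trans X.toCurve_genericPoint.symm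
  have hU₀ := (toCurve_genericPoint_specializes y).mem_open U.2 hU
  obtain ⟨g, hg, g', hg', e⟩ := I.V_eq p
  have hf := isValue_genericValue (φ := φ) hε (toGeneric M y (zGerm M U _ hU s))
  rw [stalkSpecializes_zGerm] at hf
  obtain ⟨U₂, hU₂, s₂, n, b₂, h, e₂, hval⟩ := hf
  obtain ⟨U', hU', i₁, i₂, hs⟩ : ∃ (U' : X.C.Opens) (_ : _ ∈ U') (i₁ : U' ⟶ U) (i₂ : U' ⟶ U₂),
      M.res i₁ s = M.res i₂ s₂ :=
    TopCat.Presheaf.germ_eq (C := CommMonCat.{u}) (X := X.C.toTopCat) M.M.obj _ hU₀ hU₂ s s₂ h.symm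
  have e₂' := app_res_eq i₂ e₂
  rw [← hs] at e₂'
  have hn := ghostMap_eq_baseGhost hU' e₂'
  rw [ghostGerm_res, LogChart.ghostMap_eq_baseGhost hB hU₀ hp hg hg' e] at hn
  obtain rfl : n = .ofAdd (V (.ofMul p)) := (X.baseGhost_injective (X.isSmoothAt_of_mem_genericPoints hε) hn).symm
  have hξU' : L.V.hom B.ξ ∈ U' := by rw [hB]; exact hU'
  have h1 := congrArg B.j (LogChart.germ_mul_eq i₁ hp hg hg' e e₂' hξU')
  have hne : ∀ q ∈ L.face B.ξ, B.j (germTop B.ξ (etaleAlpha X.N L.V (L.β q))) ≠ 0 ∧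
      B.ν (B.j (germTop B.ξ (etaleAlpha X.N L.V (L.β q)))) = B.ν (B.eval (chartFunction L.β v q)) := by
    intro q hq
    have h2 : B.eval (chartFunction L.β v q) = B.j (germTop B.ξ (etaleAlpha X.N L.V (L.β q))) :=
      congrArg B.j (stalkSpecializes_germTop B.specializes _)
    rw [← h2]
    exact ⟨(L.eval_chartFunction_ne_zero_iff B q).2 hq, rfl⟩
  have hx : B.ν (B.j (germTop B.ξ (etaleAlpha X.N L.V x))) = 0 := by
    rw [← stalkSpecializes_germTop B.specializes]
    exact B.ν_unit _ ((x.isUnit.map (etaleAlpha X.N L.V)).map (germTop v))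
  have hx0 : B.j (germTop B.ξ (etaleAlpha X.N L.V x)) ≠ 0 :=
    (((x.isUnit.map (etaleAlpha X.N L.V)).map (germTop B.ξ)).map B.j).ne_zero
  rw [map_mul, map_mul, B.comm U' _ hξU' hU'] at h1
  have hF : (X.toCurve η).stalkMap _ (X.C.presheaf.germ U' _ hU' (openUnit U' (Units.map (X.N.res
      ((openToEtale X.C).map i₂)) b₂) : Γ(X.C, U'))) =
      (rationalValue φ hη (zGerm M U _ hU₀ s) : (X.normalizedComponent η).functionField) := by
    refine congrArg ((X.toCurve η).stalkMap _) ?_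
    have h3 := hval
    rw [← unitGerm_unitRes i₂.le hU', ← openUnit_res] at h3
    exact congrArg Units.val h3
  rw [hF] at h1
  have h4 := B.orderAt_eq (Units.ne_zero _) (hne g hg).1 (hne g' hg').1 hx0 h1 hx
  rw [I.w_eq p g hg g' hg' _ e]
  have h5 : vanishingOrder φ hη y (ghostGerm M hU s) =
      orderAt (rationalValue φ hη (zGerm M U _ hU₀ s) : (X.normalizedComponent η).functionField) y :=
    congrArg (fun m => orderAt (rationalValue φ hη m : (X.normalizedComponent η).functionField) y)
      (stalkSpecializes_zGerm (toCurve_genericPoint_specializes y) hU s)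
  exact h5.trans (h4.trans (congrArg₂ (· - ·) (hne g' hg').2 (hne g hg).2))

end PrestableLogCurve

/-! ### The local structure at unmarked points, marked points and nodes -/

lemma exists_addEquiv_of_surjective {A B C : Type*} [AddCommMonoid A] [AddCommMonoid B] [AddCommMonoid C]
    (f : A →+ B) (F : A →+ C) (hf : Function.Surjective f) (hF : Function.Surjective F)
    (h : ∀ a a', f a = f a' ↔ F a = F a') : ∃ θ : B ≃+ C, ∀ a, θ (f a) = F a := by
  have h1 : ∀ a, F (Function.surjInv hf (f a)) = F a := fun a => (h _ _).1 (Function.surjInv_eq hf _)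
  let t : B →+ C :=
    { toFun := fun b => F (Function.surjInv hf b)
      map_zero' := by rw [← map_zero f, h1, map_zero]
      map_add' := fun b b' => by
        obtain ⟨a, rfl⟩ := hf b
        obtain ⟨a', rfl⟩ := hf b'
        rw [← map_add, h1, h1, h1, map_add] }
  refine ⟨AddEquiv.ofBijective t ⟨fun b b' hb => ?_, fun c => ?_⟩, h1⟩
  · obtain ⟨a, rfl⟩ := hf b
    obtain ⟨a', rfl⟩ := hf b'
    exact (h _ _).2 ((h1 a).symm.trans (hb.trans (h1 a')))
  · obtain ⟨a, rfl⟩ := hF c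
    exact ⟨f a, h1 a⟩

/-- The number `e` is determined by the monoid `ℕ ⊕_ℕ ℕ²`: it is the least multiple of the diagonal
which has a summand off the diagonal. -/
lemma le_of_nodeMonoid_equiv {G : Type*} [AddCommMonoid G] {e e' : ℕ} (θ : G ≃+ nodeMonoid e)
    (θ' : G ≃+ nodeMonoid e') (b : ℕ → G) (h : ∀ n, (θ (b n) : ℕ × ℕ) = (n, n))
    (h' : ∀ n, (θ' (b n) : ℕ × ℕ) = (n, n)) (he' : 0 < e') : e ≤ e' := by
  have h1 : (e', 0) ∈ nodeMonoid e' := by simp [nodeMonoid, Nat.ModEq]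
  have h2 : (0, e') ∈ nodeMonoid e' := by simp [nodeMonoid, Nat.ModEq]
  have h3 : θ'.symm ⟨_, h1⟩ + θ'.symm ⟨_, h2⟩ = b e' := by
    apply θ'.injective
    rw [map_add, θ'.apply_symm_apply, θ'.apply_symm_apply]
    apply Subtype.ext
    rw [h']
    simp
  have h4 : θ (θ'.symm ⟨_, h1⟩) + θ (θ'.symm ⟨_, h2⟩) = θ (b e') := by rw [← map_add, h3]
  have h5 := congrArg Subtype.val h4
  rw [h] at h5
  rcases hx : θ (θ'.symm ⟨_, h1⟩) with ⟨⟨x, y⟩, hxy⟩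
  rw [hx] at h5
  have h6 := congrArg Prod.fst h5
  have h7 := congrArg Prod.snd h5
  simp only [AddSubmonoid.coe_add, Prod.fst_add, Prod.snd_add] at h6 h7
  have hne : x ≠ y := by
    rintro rfl
    have h8 : θ (θ'.symm ⟨_, h1⟩) = θ (b x) := Subtype.ext (by rw [hx, h])
    have h9 := congrArg Subtype.val (congrArg θ' (θ.injective h8))
    rw [θ'.apply_symm_apply, h'] at h9
    have := congrArg Prod.fst h9
    have := congrArg Prod.snd h9
    simp only at *
    omega
  have hmod : x ≡ y [MOD e] := hxy
  rcases lt_or_gt_of_ne hne with hlt | hlt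
  · have := Nat.le_of_dvd (by omega) ((Nat.modEq_iff_dvd' hlt.le).1 hmod)
    omega
  · have := Nat.le_of_dvd (by omega) ((Nat.modEq_iff_dvd' hlt.le).1 hmod.symm)
    omega

namespace LogChart

variable {κ : Type u} [Field κ] [CharZero κ] {X : PrestableLogCurve κ} {L : LogChart X} {η c : X.C}

lemma isVertexFace_face_of_base (a : etaleFiber c L.V) (h : ∀ m : EtaleGhost X.N c, ∃ n, m = baseGhost X.q c n) :
    IsVertexFace (L.face (etalePoint a)) L.ρ := by
  refine ⟨L.ρ_notMem_face _, fun p => ?_⟩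
  obtain ⟨n, hn⟩ := h (Additive.ofMul (chartGhost L.β a p))
  rw [baseGhost_eq_chartGhost a L.base] at hn
  obtain ⟨g, hg, g', hg', e⟩ := (chartGhost_eq_iff L.isChart a _ _).1 (Additive.ofMul.injective hn)
  refine ⟨n, g, hg, g', hg', ?_⟩
  rw [e, ← map_pow, ← ofAdd_nsmul, nsmul_eq_mul, mul_one]
  rfl

variable {y : X.normalizedComponent η} {a : etaleFiber c L.V} {B : LocalBranch X η L.V.hom (etalePoint a) y}
  {V : Additive L.P →+ ℕ} {w : Additive L.P →+ ℤ}

/-- The map from the monoid of a chart to the ghost stalk, additively. -/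
abbrev ghost (a : etaleFiber c L.V) : Additive L.P →+ EtaleGhost X.N c := (chartGhost L.β a).toAdditive

lemma ghost_eq_iff (p p' : L.P) : ghost a (.ofMul p) = ghost a (.ofMul p') ↔
    ∃ f ∈ L.face (etalePoint a), ∃ f' ∈ L.face (etalePoint a), p * f = p' * f' :=
  (Additive.ofMul.injective.eq_iff).trans (chartGhost_eq_iff L.isChart a p p')

lemma ghost_ρ (n : ℕ) : ghost a (.ofMul (L.ρ ^ n)) = baseGhost X.q c n :=
  chartGhost_eq_base a (one_mem _) (one_mem _) rfl

lemma BranchInvariants.eq_of_ghost_eq (I : L.BranchInvariants B V w) {p p' : Additive L.P}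
    (h : ghost a p = ghost a p') : V p = V p' ∧ w p = w p' := by
  obtain ⟨f, hf, f', hf', e⟩ := (ghost_eq_iff p.toMul p'.toMul).1 h
  have hV : ∀ f ∈ L.face (etalePoint a), V (.ofMul f) = 0 := fun f hf =>
    (I.V_eq_zero f).2 (chartFace_le L.β B.specializes hf)
  have h1 := congrArg V (congrArg Additive.ofMul e)
  have h2 := congrArg w (congrArg Additive.ofMul e)
  rw [ofMul_mul, ofMul_mul, map_add, map_add, hV f hf, hV f' hf', add_zero, add_zero] at h1
  rw [ofMul_mul, ofMul_mul, map_add, map_add, I.w_face f hf, I.w_face f' hf', add_zero, add_zero] at h2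
  exact ⟨h1, h2⟩

lemma BranchInvariants.w_eq_zero_of_base (I : L.BranchInvariants B V w)
    (h : ∀ m : EtaleGhost X.N c, ∃ n, m = baseGhost X.q c n) (p : L.P) : w (.ofMul p) = 0 :=
  I.w_eq_zero ((isVertexFace_face_of_base a h).eq_of_le (L.isFace_face _) (L.isFace_face _)
    (L.ρ_notMem_face _) (chartFace_le L.β B.specializes)).symm p

/-- At a marked point the order of vanishing is the second coordinate of the ghost stalk. -/
lemma BranchInvariants.snd_eq (hη : η ∈ genericPoints X.C) (I : L.BranchInvariants B V w)
    (θ : EtaleGhost X.N c ≃+ ℕ × ℕ) (hθ : ∀ n, θ (baseGhost X.q c n) = (n, 0)) (p : Additive L.P) :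
    ((θ (ghost a p)).2 : ℤ) = w p := by
  have hsurj : Function.Surjective (ghost a) := fun x => by
    obtain ⟨p, hp⟩ := chartGhost_surjective L.isChart a x.toMul
    exact ⟨.ofMul p, congrArg Additive.ofMul hp⟩
  -- at a marked point `(0, 1)` does not come from the base
  have hne : ¬ IsVertexFace (L.face (etalePoint a)) L.ρ := by
    intro h
    obtain ⟨p, hp⟩ := hsurj (θ.symm (0, 1))
    obtain ⟨n, g, hg, g', hg', e⟩ := h.2 p.toMul
    have h1 := congrArg θ (hp.symm.trans (chartGhost_eq_base a hg hg' e))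
    rw [θ.apply_symm_apply, hθ] at h1
    exact absurd (congrArg Prod.snd h1) one_ne_zero
  obtain ⟨hsep, ⟨g, hg, hwg⟩, hcase⟩ := I.classify hη hne
  have hsep' : ∀ p p' : Additive L.P, V p = V p' → w p = w p' → ghost a p = ghost a p' := fun p p' h h' =>
    (ghost_eq_iff p.toMul p'.toMul).2 (hsep _ _ h h')
  have hVg := (I.V_eq_zero g).2 hg
  have hρ : ∀ n, ghost a (n • Additive.ofMul L.ρ) = baseGhost X.q c n := fun n => ghost_ρ n
  have key : ∀ p : Additive L.P, 0 ≤ w p → (θ (ghost a p)).2 = (w p).toNat * (θ (ghost a (.ofMul g))).2 := by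
    intro p hp
    have h1 : ghost a p = ghost a ((w p).toNat • Additive.ofMul g + V p • Additive.ofMul L.ρ) := by
      apply hsep'
      · simp [hVg, I.V_ρ]
      · simp [hwg, I.w_ρ, hp]
    rw [h1, map_add, map_add, Prod.snd_add, hρ, hθ, map_nsmul, map_nsmul, Prod.smul_snd, smul_eq_mul, add_zero]
  have hpos : ∀ p : Additive L.P, 0 ≤ w p := by
    rcases hcase with hq | ⟨e, he, hn⟩
    · exact fun p => ((hq _ _).1 ⟨p.toMul, rfl, rfl⟩).1
    · exfalso
      -- in `ℕ ⊕_ℕ ℕ²` a multiple of `ρ` is a sum of elements which are not multiples of `ρ`, unlike in `ℕ ⊕ ℕ`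
      obtain ⟨p₂, hp₂, hp₂'⟩ := (hn (-1) e).2 ⟨by simp, by simp⟩
      have h1 : ghost a (.ofMul g + .ofMul p₂) = baseGhost X.q c e := by
        rw [← hρ]
        apply hsep'
        · rw [map_add, hVg, map_nsmul, I.V_ρ, zero_add]
          simpa using hp₂'
        · rw [map_add, hwg, hp₂, map_nsmul, I.w_ρ]
          simp
      have h2 := congrArg Prod.snd (congrArg θ h1)
      rw [map_add, map_add, hθ, Prod.snd_add] at h2
      have h3 : θ (ghost a (.ofMul g)) = θ (ghost a ((θ (ghost a (.ofMul g))).1 • Additive.ofMul L.ρ)) := by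
        rw [hρ, hθ]
        exact Prod.ext rfl (by dsimp only; omega)
      have h4 := (I.eq_of_ghost_eq (θ.injective h3)).2
      rw [hwg, map_nsmul, I.w_ρ, smul_zero] at h4
      exact one_ne_zero h4
  obtain ⟨p₀, hp₀⟩ := hsurj (θ.symm (0, 1))
  have h1 := key p₀ (hpos p₀)
  rw [hp₀, θ.apply_symm_apply] at h1
  rw [key p (hpos p), Nat.eq_one_of_mul_eq_one_left h1.symm, mul_one, Int.toNat_of_nonneg (hpos p)]

/-- At a node the ghost stalk is the monoid `ℕ ⊕_ℕ ℕ²`, whose two faces which do not contain the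
diagonal correspond to the two branches, and the contact order is the difference of the positions
of the vertices divided by `e`. -/
theorem BranchInvariants.node (hη : η ∈ genericPoints X.C) (I : L.BranchInvariants B V w)
    (hc : ¬ IsSmoothAt X.π c) :
    ∃ e : ℕ, 0 < e ∧ (∃ θ : EtaleGhost X.N c ≃+ nodeMonoid e,
        ∀ n, (θ (baseGhost X.q c n) : ℕ × ℕ) = (n, n)) ∧
      ∃ ξ : L.V.left, ξ ⤳ etalePoint a ∧ L.V.hom ξ ∈ genericPoints X.C ∧
        (∀ ζ ∈ genericPoints X.C, ζ ⤳ c → ζ = η ∨ ζ = L.V.hom ξ) ∧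
        ∀ p : Additive L.P, ∃ n : ℕ, (n : ℤ) = e * w p + V p ∧ ∃ g ∈ L.face ξ, ∃ g' ∈ L.face ξ,
          p.toMul * g = L.ρ ^ n * g' := by
  have hv : L.V.hom (etalePoint a) = c := hom_etalePoint a
  have hne : ¬ IsVertexFace (L.face (etalePoint a)) L.ρ := fun h => hc (hv ▸ L.isSmoothAt_of_isVertexFace h)
  obtain ⟨hsep, ⟨g₀, hg₀, hwg₀⟩, hcase⟩ := I.classify hη hne
  obtain ⟨e, he, hn⟩ : ∃ e : ℕ, 0 < e ∧ ∀ x y : ℤ, (∃ p, w (.ofMul p) = x ∧ (V (.ofMul p) : ℤ) = y) ↔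
      0 ≤ e * x + y ∧ 0 ≤ y := by
    refine hcase.resolve_left fun hq => hc (hv ▸ I.isSmoothAt_of_quadrant hsep hg₀ hwg₀ fun p => ?_)
    exact ((hq _ _).1 ⟨p.toMul, rfl, rfl⟩).1
  have hpos : ∀ p : Additive L.P, 0 ≤ e * w p + V p := fun p => ((hn _ _).1 ⟨p.toMul, rfl, rfl⟩).1
  -- `S` is the position of the vertex of the other branch
  let S : Additive L.P →+ ℤ := (e : ℤ) • w + (Nat.castAddMonoidHom ℤ).comp V
  have hS : ∀ p, S p = e * w p + V p := fun p => by simp [S]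
  have hSρ : S (.ofMul L.ρ) = 1 := by rw [hS, I.w_ρ, I.V_ρ]; simp
  let F : Additive L.P →+ nodeMonoid e :=
    { toFun := fun p => ⟨((S p).toNat, V p), by
        change (S p).toNat ≡ V p [MOD e]
        refine ((Nat.modEq_iff_dvd).2 ⟨w p, ?_⟩).symm
        rw [Int.toNat_of_nonneg (hS p ▸ hpos p), hS]
        ring⟩
      map_zero' := by simp
      map_add' := fun p p' => Subtype.ext (Prod.ext
        (by
          have h1 := hS p ▸ hpos p
          have h2 := hS p' ▸ hpos p'
          change (S (p + p')).toNat = (S p).toNat + (S p').toNat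
          rw [map_add]
          omega)
        (map_add V p p')) }
  have hsurj : Function.Surjective (ghost a) := fun x => by
    obtain ⟨p, hp⟩ := chartGhost_surjective L.isChart a x.toMul
    exact ⟨.ofMul p, congrArg Additive.ofMul hp⟩
  have hsep' : ∀ p p' : Additive L.P, V p = V p' → w p = w p' → ghost a p = ghost a p' := fun p p' h h' =>
    (ghost_eq_iff p.toMul p'.toMul).2 (hsep _ _ h h')
  have hFsurj : Function.Surjective F := by
    rintro ⟨⟨x, z⟩, hxz⟩
    obtain ⟨k, hk⟩ := (Nat.modEq_iff_dvd).1 (show z ≡ x [MOD e] from hxz.symm)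
    obtain ⟨p, hp, hp'⟩ := (hn k z).2 ⟨by omega, by omega⟩
    refine ⟨.ofMul p, Subtype.ext (Prod.ext ?_ (Nat.cast_injective hp'))⟩
    change (S (.ofMul p)).toNat = x
    rw [hS, hp, hp', ← hk]
    omega
  obtain ⟨θ, hθ⟩ := exists_addEquiv_of_surjective (ghost a) F hsurj hFsurj fun p p' => by
    constructor
    · intro h
      obtain ⟨h1, h2⟩ := I.eq_of_ghost_eq h
      exact Subtype.ext (Prod.ext (by change (S p).toNat = (S p').toNat; rw [hS, hS, h1, h2]) h1)
    · intro h
      have h1 : V p = V p' := congrArg Prod.snd (congrArg Subtype.val h)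
      have h2 : (S p).toNat = (S p').toNat := congrArg Prod.fst (congrArg Subtype.val h)
      have h3 := hpos p
      have h4 := hpos p'
      rw [hS, hS] at h2
      have h5 : (e : ℤ) * w p = e * w p' := by omega
      exact hsep' p p' h1 (mul_left_cancel₀ (by exact_mod_cast he.ne') h5)
  -- the face of the other branch
  let G : Submonoid L.P :=
    { carrier := {p | S (.ofMul p) = 0}
      one_mem' := map_zero S
      mul_mem' := fun {p q} hp hq => by
        change S (.ofMul (p * q)) = 0
        rw [ofMul_mul, map_add, show S (.ofMul p) = 0 from hp, show S (.ofMul q) = 0 from hq, add_zero] }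
  have hG : IsFace G := fun p q h => by
    have h1 : S (.ofMul p) + S (.ofMul q) = 0 := by rw [← map_add]; exact h
    have h2 := hS (.ofMul p) ▸ hpos (.ofMul p)
    have h3 := hS (.ofMul q) ▸ hpos (.ofMul q)
    change S (.ofMul p) = 0
    omega
  have hρG : L.ρ ∉ G := fun h => one_ne_zero (hSρ.symm.trans h)
  have hVv : ∀ f ∈ L.face (etalePoint a), V (.ofMul f) = 0 := fun f hf =>
    (I.V_eq_zero f).2 (chartFace_le L.β B.specializes hf)
  have hle : L.face (etalePoint a) ≤ G := fun f hf => by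
    change S (.ofMul f) = 0
    rw [hS, I.w_face f hf, hVv f hf]
    simp
  obtain ⟨g₁, hg₁, hg₁'⟩ := (hn (-1) e).2 ⟨by simp, by simp⟩
  have hg₁G : g₁ ∈ G := by
    change S (.ofMul g₁) = 0
    rw [hS, hg₁, hg₁']
    ring
  have hg₁v : g₁ ∉ L.face (etalePoint a) := fun h => by
    rw [I.w_face g₁ h] at hg₁
    omega
  have hg₀v : g₀ ∉ L.face (etalePoint a) := fun h => by
    rw [I.w_face g₀ h] at hwg₀
    omega
  have hVg₀ := (I.V_eq_zero g₀).2 hg₀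
  obtain ⟨ξ, hξ, hξG⟩ := L.exists_face_eq hG hρG hle
  have hgen : L.V.hom ξ ∈ genericPoints X.C := L.mem_genericPoints_of_specializes hξ (by
    rintro rfl
    exact hg₁v (hξG ▸ hg₁G))
  refine ⟨e, he, ⟨θ, fun n => ?_⟩, ξ, hξ, hgen, fun ζ hζ hζc => ?_, fun p => ?_⟩
  · rw [← ghost_ρ (a := a) n, hθ]
    change ((S (n • Additive.ofMul L.ρ)).toNat, V (n • Additive.ofMul L.ρ)) = _
    simp [hSρ, I.V_ρ]
  · rw [← hv] at hζc
    obtain ⟨ξ', hξ', rfl⟩ := Flat.generalizingMap L.V.hom hζc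
    have hvert := L.isVertexFace_face_of_mem_genericPoints hζ
    have hvert₀ := L.isVertexFace_face_ξ hη B
    have hle' := chartFace_le L.β hξ'
    obtain ⟨p, hp, hpv⟩ : ∃ p ∈ L.face ξ', p ∉ L.face (etalePoint a) := by
      by_contra! h
      exact hne ((le_antisymm hle' h : L.face (etalePoint a) = L.face ξ') ▸ hvert)
    have hp0 : ¬ (V (.ofMul p) = 0 ∧ w (.ofMul p) = 0) := fun h => by
      obtain ⟨f, hf, f', hf', e'⟩ := hsep p 1 (by rw [h.1]; exact (map_zero V).symm)
        (by rw [h.2]; exact (map_zero w).symm)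
      rw [one_mul] at e'
      exact hpv (L.isFace_face _ p f (e' ▸ hf'))
    -- an element of the face of `ξ'` generates every face without `ρ` which contains it
    have key : ∀ q : L.P, (∃ k l : ℕ, 0 < l ∧ V (l • Additive.ofMul q) = V (k • Additive.ofMul p) ∧
        w (l • Additive.ofMul q) = w (k • Additive.ofMul p)) → q ∈ L.face ξ' := by
      rintro q ⟨k, l, hl, h1, h2⟩
      obtain ⟨f, hf, f', hf', e'⟩ := hsep (q ^ l) (p ^ k) h1 h2
      obtain ⟨l, rfl⟩ := Nat.exists_eq_succ_of_ne_zero hl.ne'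
      refine L.isFace_face ξ' q (q ^ l * f) ?_
      rw [← mul_assoc, ← pow_succ', e']
      exact mul_mem (pow_mem hp k) (hle' hf')
    have hpp := hpos (.ofMul p)
    -- if `V p = 0`, then the face of `ξ'` contains the face of the branch `B.ξ`, hence is equal to it
    rcases Nat.eq_zero_or_pos (V (.ofMul p)) with hV | hV
    · left
      rw [hV] at hpp
      have hw0 : 0 ≤ w (.ofMul p) := by
        by_contra! h
        have := mul_neg_of_pos_of_neg (show (0 : ℤ) < e by exact_mod_cast he) h
        simp only [Nat.cast_zero, add_zero] at hpp
        omega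
      have hw : 0 < w (.ofMul p) := lt_of_le_of_ne hw0 fun h => hp0 ⟨hV, h.symm⟩
      have hmem : L.face B.ξ ≤ L.face ξ' := fun q hq => by
        have hVq := (I.V_eq_zero q).2 hq
        have hq0 : 0 ≤ w (.ofMul q) := by
          by_contra! h
          have := mul_neg_of_pos_of_neg (show (0 : ℤ) < e by exact_mod_cast he) h
          have := hpos (.ofMul q)
          rw [hVq] at this
          simp only [Nat.cast_zero, add_zero] at this
          omega
        refine key q ⟨(w (.ofMul q)).toNat, (w (.ofMul p)).toNat, by omega, ?_, ?_⟩
        · rw [map_nsmul, map_nsmul, hV, hVq, smul_zero, smul_zero]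
        · rw [map_nsmul, map_nsmul, nsmul_eq_mul, nsmul_eq_mul,
            Int.toNat_of_nonneg hw0, Int.toNat_of_nonneg hq0, mul_comm]
      have hface := hvert₀.eq_of_le (L.isFace_face _) (L.isFace_face _) (L.ρ_notMem_face _) hmem
      have := (L.exists_pow_of_face hne B.specializes hg₀ hg₀v fun q hq => by
        have hVq := (I.V_eq_zero q).2 hq
        have hq0 : 0 ≤ w (.ofMul q) := by
          by_contra! h
          have := mul_neg_of_pos_of_neg (show (0 : ℤ) < e by exact_mod_cast he) h
          have := hpos (.ofMul q)
          rw [hVq] at this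
          simp only [Nat.cast_zero, add_zero] at this
          omega
        refine ⟨(w (.ofMul q)).toNat, hsep _ _ ?_ ?_⟩
        · rw [ofMul_pow, map_nsmul, hVq, hVg₀, smul_zero]
        · rw [ofMul_pow, map_nsmul, hwg₀, nsmul_eq_mul, mul_one, Int.toNat_of_nonneg hq0]).1 hξ' hface.symm
      rw [this, B.map_ξ]
    · right
      -- otherwise `S p = 0`, since else `ρ` would divide `p`, and the face of `ξ'` is the face `G`
      have hSp : S (.ofMul p) = 0 := by
        by_contra h0
        have h1 : 0 < S (.ofMul p) := lt_of_le_of_ne (hS (.ofMul p) ▸ hpp) (Ne.symm h0)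
        rw [hS] at h1
        obtain ⟨p', hp', hp''⟩ := (hn (w (.ofMul p)) (V (.ofMul p) - 1)).2 ⟨by omega, by omega⟩
        obtain ⟨f, hf, f', hf', e'⟩ := hsep p (L.ρ * p') (by
          rw [ofMul_mul, map_add, I.V_ρ]; omega) (by rw [ofMul_mul, map_add, I.w_ρ, hp', zero_add])
        refine L.ρ_notMem_face ξ' (L.isFace_face ξ' L.ρ (p' * f') ?_)
        rw [← mul_assoc, ← e']
        exact mul_mem hp (hle' hf)
      have hwp : ∀ q ∈ G, (V (.ofMul q) : ℤ) = -(e * w (.ofMul q)) := fun q hq => by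
        have : S (.ofMul q) = 0 := hq
        rw [hS] at this
        omega
      have hwneg : ∀ q ∈ G, w (.ofMul q) ≤ 0 := fun q hq => by
        by_contra! h
        have := mul_pos (show (0 : ℤ) < e by exact_mod_cast he) h
        have := hwp q hq
        omega
      have hmem : G ≤ L.face ξ' := fun q hq => by
        have h1 := hwneg q hq
        have h2 := hwneg p hSp
        have h3 : w (.ofMul p) ≠ 0 := fun h => by
          have := hwp p hSp
          rw [h, mul_zero] at this
          omega
        have hw : ((-w (.ofMul p)).toNat : ℤ) * w (.ofMul q) = (-w (.ofMul q)).toNat * w (.ofMul p) := by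
          rw [Int.toNat_of_nonneg (by omega), Int.toNat_of_nonneg (by omega)]
          ring
        refine key q ⟨(-w (.ofMul q)).toNat, (-w (.ofMul p)).toNat, by omega, ?_, ?_⟩
        · apply Nat.cast_injective (R := ℤ)
          rw [map_nsmul, map_nsmul, smul_eq_mul, smul_eq_mul, Nat.cast_mul, Nat.cast_mul, hwp q hq, hwp p hSp,
            mul_neg, mul_neg, mul_left_comm, hw, mul_left_comm]
        · rw [map_nsmul, map_nsmul, nsmul_eq_mul, nsmul_eq_mul]
          exact hw
      rw [← hξG] at hmem
      have hface := (L.isVertexFace_face_of_mem_genericPoints hgen).eq_of_le (L.isFace_face _)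
        (L.isFace_face _) (L.ρ_notMem_face _) hmem
      have := (L.exists_pow_of_face hne hξ (hξG ▸ hg₁G) hg₁v fun q hq => by
        rw [hξG] at hq
        have h1 := hwneg q hq
        refine ⟨(-w (.ofMul q)).toNat, hsep _ _ ?_ ?_⟩
        · apply Nat.cast_injective (R := ℤ)
          rw [ofMul_pow, map_nsmul, smul_eq_mul, Nat.cast_mul, hg₁', Int.toNat_of_nonneg (by omega), hwp q hq]
          ring
        · rw [ofMul_pow, map_nsmul, hg₁, nsmul_eq_mul, Int.toNat_of_nonneg (by omega)]
          ring).1 hξ' hface.symm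
      rw [this]
  · obtain ⟨n, g, hg, g', hg', e'⟩ := (L.isVertexFace_face_of_mem_genericPoints hgen).2 p.toMul
    refine ⟨n, ?_, g, hg, g', hg', e'⟩
    have h1 := congrArg S (congrArg Additive.ofMul e')
    rw [ofMul_mul, ofMul_mul, map_add, map_add, ofMul_pow, map_nsmul, hSρ,
      show S (.ofMul g) = 0 from (hξG ▸ hg : g ∈ G), show S (.ofMul g') = 0 from (hξG ▸ hg' : g' ∈ G)] at h1
    simp only [add_zero, nsmul_eq_mul, mul_one] at h1
    rw [← hS]
    exact h1.symm

end LogChart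

/-! ### Contact orders -/

namespace PrestableLogCurve

variable {κ : Type u} [Field κ] [CharZero κ] {X : PrestableLogCurve κ} {M : ZariskiLogStructure X.C}
  (φ : ZariskiToEtaleHom M X.N) {η : X.C} (hη : η ∈ genericPoints X.C) {y : X.normalizedComponent η}

/-- Every element of the ghost stalk of `M` at a closed point of the normalization is given by an
element of the monoid of a chart, which determines its order of vanishing and its positions at the
generic points. -/
lemma exists_chart (hy : y ≠ genericPoint (X.normalizedComponent η)) (m : Ghost M (X.toCurve η y)) :
    ∃ (L : LogChart X) (a : etaleFiber (X.toCurve η y) L.V) (B : LocalBranch X η L.V.hom (etalePoint a) y)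
      (V : Additive L.P →+ ℕ) (w : Additive L.P →+ ℤ) (_ : L.BranchInvariants B V w) (p : Additive L.P),
      φ.ghostMap _ m = LogChart.ghost a p ∧ vanishingOrder φ hη y m = w p ∧
      ∀ {ξ : L.V.left} {ζ : X.C} (_ : L.V.hom ξ = ζ) (h : ζ ⤳ X.toCurve η y) {g g' : L.P} {n : ℕ},
        g ∈ L.face ξ → g' ∈ L.face ξ → p.toMul * g = L.ρ ^ n * g' →
        φ.ghostMap ζ (generization M h m) = baseGhost X.q ζ n := by
  obtain ⟨U, hU, s, rfl⟩ := exists_ghostGerm_eq m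
  obtain ⟨L, a, f, p, x, hp⟩ := LogChart.exists_presentation (φ := φ) hU s
  obtain ⟨B⟩ := nonempty_localBranch hη L.V.hom (etalePoint a) y hy (hom_etalePoint a)
  obtain ⟨V, w, I⟩ := L.exists_branchInvariants hη B
  refine ⟨L, a, B, V, w, I, .ofMul p, LogChart.ghostMap_ghostGerm hU hp a, vanishingOrder_eq φ hη I hU hp, ?_⟩
  intro ξ ζ hξ h g g' n hg hg' e
  rw [generization_ghostGerm]
  exact LogChart.ghostMap_eq_baseGhost hξ (h.mem_open U.2 hU) hp hg hg' e

lemma exists_eq_baseGhost_of_not_isMarked {c : X.C} (hc : IsSmoothAt X.π c) (hm : ¬ X.IsMarked c)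
    (m : EtaleGhost X.N c) : ∃ n, m = baseGhost X.q c n := by
  obtain ⟨θ, hθ⟩ := X.ghost c hc
  refine ⟨(θ m).1, θ.injective ?_⟩
  rw [hθ]
  ext i
  · rfl
  · exact absurd ⟨i.1, i.2⟩ hm

lemma vanishingOrder_eq_zero (hs : y ∉ X.specialPoints η) (m : Ghost M (X.toCurve η y)) :
    vanishingOrder φ hη y m = 0 := by
  by_cases hy : y = genericPoint (X.normalizedComponent η)
  · subst hy
    exact vanishingOrder_genericPoint φ hη m
  obtain ⟨L, a, B, V, w, I, p, -, h, -⟩ := exists_chart φ hη hy m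
  rw [h]
  refine I.w_eq_zero_of_base (X.exists_eq_baseGhost_of_not_isMarked ?_ fun h => hs (Or.inl h)) p.toMul
  by_contra h
  exact hs (Or.inr h)

include hη in
lemma ne_genericPoint_of_mem_specialPoints (hy : y ∈ X.specialPoints η) :
    y ≠ genericPoint (X.normalizedComponent η) := by
  rintro rfl
  exact X.genericPoint_notMem_specialPoints hη hy

lemma isMarkedContactOrder_iff (hy : y ∈ X.specialPoints η) (hm : X.IsMarked (X.toCurve η y))
    (v : Ghost M (X.toCurve η y) →+ ℤ) :
    IsMarkedContactOrder φ (X.toCurve η y) v ↔ v = vanishingOrder φ hη y := by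
  have key : ∀ θ : EtaleGhost X.N (X.toCurve η y) ≃+ ℕ × ℕ, (∀ n, θ (baseGhost X.q _ n) = (n, 0)) →
      ∀ m, vanishingOrder φ hη y m = (θ (φ.ghostMap _ m)).2 := fun θ hθ m => by
    obtain ⟨L, a, B, V, w, I, p, h1, h2, -⟩ := exists_chart φ hη (ne_genericPoint_of_mem_specialPoints hη hy) m
    rw [h1, h2, I.snd_eq hη θ hθ]
  constructor
  · rintro ⟨θ, hθ, h⟩
    exact AddMonoidHom.ext fun m => (h m).trans (key θ hθ m).symm
  · rintro rfl
    obtain ⟨i, hi⟩ := hm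
    obtain ⟨θ, hθ⟩ := X.ghost (X.toCurve η y) (hi ▸ X.sec_smooth i)
    let U : Unique {i // X.sec i default = X.toCurve η y} :=
      { default := ⟨i, hi⟩
        uniq := fun j => Subtype.ext (X.sec_injective (j.2.trans hi.symm)) }
    refine ⟨θ.trans ((AddEquiv.refl ℕ).prodCongr (AddEquiv.piUnique fun _ => ℕ)), fun n => ?_, key _ fun n => ?_⟩
    all_goals
      rw [AddEquiv.trans_apply, hθ]
      rfl

lemma exists_isVertexPosition {ζ : X.C} (hζ : ζ ∈ genericPoints X.C) : ∃ V, IsVertexPosition φ ζ V := by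
  choose V hV using fun m => X.exists_eq_baseGhost hζ (φ.ghostMap ζ m)
  have hinj := X.baseGhost_injective (X.isSmoothAt_of_mem_genericPoints hζ)
  exact ⟨{ toFun := V
           map_zero' := hinj (by rw [← hV, map_zero, map_zero])
           map_add' := fun m m' => hinj (by rw [← hV, map_add, map_add, ← hV, ← hV]) }, hV⟩

lemma IsVertexPosition.eq {ζ : X.C} (hζ : ζ ∈ genericPoints X.C) {V : Ghost M ζ →+ ℕ}
    (hV : IsVertexPosition φ ζ V) {m : Ghost M ζ} {n : ℕ} (h : φ.ghostMap ζ m = baseGhost X.q ζ n) : V m = n :=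
  X.baseGhost_injective (X.isSmoothAt_of_mem_genericPoints hζ) ((hV m).symm.trans h)

/-- At a node the order of vanishing is the contact order, for every choice of the data in the
definition of the contact order. -/
lemma node_balance (hn : X.IsNode (X.toCurve η y)) (hy : y ∈ X.specialPoints η) :
    ∃ (e : ℕ) (η' : X.C), 0 < e ∧ (∃ θ : EtaleGhost X.N (X.toCurve η y) ≃+ nodeMonoid e,
        ∀ n, (θ (baseGhost X.q _ n) : ℕ × ℕ) = (n, n)) ∧ η' ⤳ X.toCurve η y ∧ η' ∈ genericPoints X.C ∧
      (∀ ζ ∈ genericPoints X.C, ζ ⤳ X.toCurve η y → ζ = η ∨ ζ = η') ∧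
      ∀ (h : η ⤳ X.toCurve η y) (h' : η' ⤳ X.toCurve η y) (V : Ghost M η →+ ℕ) (V' : Ghost M η' →+ ℕ),
        IsVertexPosition φ η V → IsVertexPosition φ η' V' →
        ∀ m, (V' (generization M h' m) : ℤ) - V (generization M h m) = e * vanishingOrder φ hη y m := by
  have hy' := ne_genericPoint_of_mem_specialPoints hη hy
  have key : ∀ m : Ghost M (X.toCurve η y), ∃ (e : ℕ) (η' : X.C), 0 < e ∧
      (∃ θ : EtaleGhost X.N (X.toCurve η y) ≃+ nodeMonoid e,
        ∀ n, (θ (baseGhost X.q _ n) : ℕ × ℕ) = (n, n)) ∧ η' ⤳ X.toCurve η y ∧ η' ∈ genericPoints X.C ∧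
      (∀ ζ ∈ genericPoints X.C, ζ ⤳ X.toCurve η y → ζ = η ∨ ζ = η') ∧
      ∀ (h : η ⤳ X.toCurve η y) (h' : η' ⤳ X.toCurve η y) (V : Ghost M η →+ ℕ) (V' : Ghost M η' →+ ℕ),
        IsVertexPosition φ η V → IsVertexPosition φ η' V' →
        (V' (generization M h' m) : ℤ) - V (generization M h m) = e * vanishingOrder φ hη y m := by
    intro m
    obtain ⟨L, a, B, V₀, w, I, p, -, h2, h3⟩ := exists_chart φ hη hy' m
    obtain ⟨e, he, hθ, ξ, hξ, hgen, honly, hpos⟩ := I.node hη hn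
    refine ⟨e, L.V.hom ξ, he, hθ, ?_, hgen, honly, fun h h' V V' hV hV' => ?_⟩
    · have := hξ.map L.V.hom.continuous
      rwa [hom_etalePoint] at this
    · obtain ⟨n, hn, g, hg, g', hg', e₁⟩ := hpos p
      obtain ⟨k, hk, k', hk', e₂⟩ := I.V_eq p.toMul
      rw [hV'.eq φ hgen (h3 rfl h' hg hg' e₁), hV.eq φ hη (h3 B.map_ξ h hk hk' e₂), h2, hn]
      change (e : ℤ) * w p + V₀ p - V₀ p = _
      ring
  obtain ⟨e, η', he, ⟨θ, hθ⟩, hsp, hgen, honly, -⟩ := key 0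
  refine ⟨e, η', he, ⟨θ, hθ⟩, hsp, hgen, honly, fun h h' V V' hV hV' m => ?_⟩
  obtain ⟨e₁, η₁, he₁, ⟨θ₁, hθ₁⟩, hsp₁, hgen₁, honly₁, hbal⟩ := key m
  obtain rfl : e = e₁ := le_antisymm (le_of_nodeMonoid_equiv θ θ₁ _ hθ hθ₁ he₁) (le_of_nodeMonoid_equiv θ₁ θ _ hθ₁ hθ he)
  obtain rfl : η' = η₁ := by
    rcases honly _ hgen₁ hsp₁ with h1 | h1
    · rcases honly₁ _ hgen hsp with h2 | h2
      · exact h2.trans h1.symm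
      · exact h2
    · exact h1.symm
  exact hbal h h' V V' hV hV'

lemma isNodalContactOrder_iff (hn : X.IsNode (X.toCurve η y)) (hy : y ∈ X.specialPoints η)
    (v : Ghost M (X.toCurve η y) →+ ℤ) :
    IsNodalContactOrder φ η (X.toCurve η y) v ↔ v = vanishingOrder φ hη y := by
  obtain ⟨e, η', he, ⟨θ, hθ⟩, hrest⟩ := node_balance φ hη hn hy
  have hsp := hrest.1
  have hgen := hrest.2.1
  have honly := hrest.2.2.1
  have hbal := hrest.2.2.2
  constructor
  · rintro ⟨e₁, θ₁, η₁, h, h', V, V', he₁, hθ₁, hbr, hV, hV', hu⟩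
    obtain rfl : e = e₁ := le_antisymm (le_of_nodeMonoid_equiv θ θ₁ _ hθ hθ₁ he₁) (le_of_nodeMonoid_equiv θ₁ θ _ hθ₁ hθ he)
    have hgen₁ := hbr.1
    have hbr := hbr.2
    obtain rfl : η' = η₁ := by
      rcases honly _ hgen₁ h' with h1 | h1
      · rcases hbr with h2 | h2
        · exact absurd h1 h2
        · exact (h2 _ hgen hsp).trans h1.symm
      · exact h1.symm
    refine AddMonoidHom.ext fun m => ?_
    exact mul_left_cancel₀ (Nat.cast_ne_zero.2 he.ne') ((hu m).symm.trans (hbal h h' V V' hV hV' m))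
  · rintro rfl
    obtain ⟨V, hV⟩ := exists_isVertexPosition φ hη
    obtain ⟨V', hV'⟩ := exists_isVertexPosition φ hgen
    refine ⟨e, θ, η', X.specializes_toCurve y, hsp, V, V', he, hθ, ⟨hgen, ?_⟩, hV, hV', hbal _ _ V V' hV hV'⟩
    by_cases h : η' = η
    · exact Or.inr fun ζ hζ h1 => (honly ζ hζ h1).elim id fun h2 => h2.trans h
    · exact Or.inl h

/-- The contact orders are the orders of vanishing. -/
theorem isContactData_iff (v : ∀ x : X.specialPoints η, Ghost M (X.toCurve η x.1) →+ ℤ) :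
    IsContactData φ η v ↔ ∀ x : X.specialPoints η, v x = vanishingOrder φ hη (x.1 : X.normalizedComponent η) := by
  constructor
  · intro h x
    have hx : X.IsMarked (X.toCurve η x.1) ∨ X.IsNode (X.toCurve η x.1) := x.2
    rcases hx with hx | hx
    · exact (isMarkedContactOrder_iff φ hη x.2 hx _).1 ((h x).1 hx)
    · exact (isNodalContactOrder_iff φ hη hx x.2 _).1 ((h x).2 hx)
  · intro h x
    exact ⟨fun hx => (isMarkedContactOrder_iff φ hη x.2 hx _).2 (h x),
      fun hx => (isNodalContactOrder_iff φ hη hx x.2 _).2 (h x)⟩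

end PrestableLogCurve

/-! ### The degree of the torsor of a ghost section -/

section Regular

variable {Y : Scheme.{u}} [IsIntegral Y]

lemma genericPoint_mem {U : Y.Opens} {y : Y} (hy : y ∈ U) : genericPoint Y ∈ U :=
  (genericPoint_specializes y).mem_open U.2 hy

lemma stalkSpecializes_genericPoint_injective (y : Y) :
    Function.Injective (Y.presheaf.stalkSpecializes (genericPoint_specializes y)).hom :=
  IsFractionRing.injective (Y.presheaf.stalk y) Y.functionField

/-- A rational function which is regular at all points of an open is regular on it. -/
lemma exists_germ_eq_of_regular {U : Y.Opens} (hU : genericPoint Y ∈ U) (k : Y.functionField)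
    (h : ∀ y ∈ U, ∃ a, Y.presheaf.stalkSpecializes (genericPoint_specializes y) a = k) :
    ∃ f : Γ(Y, U), Y.presheaf.germ U _ hU f = k := by
  have h1 : ∀ y : U, ∃ (V : Y.Opens) (_ : V ≤ U) (_ : y.1 ∈ V) (hε : genericPoint Y ∈ V) (s : Γ(Y, V)),
      Y.presheaf.germ V _ hε s = k := by
    rintro ⟨y, hy⟩
    obtain ⟨a, ha⟩ := h y hy
    obtain ⟨V, hV, s, rfl⟩ := Y.presheaf.exists_germ_eq a
    have hy' : y ∈ V ⊓ U := ⟨hV, hy⟩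
    refine ⟨V ⊓ U, inf_le_right, hy', genericPoint_mem hy', Y.presheaf.map (homOfLE inf_le_left).op s, ?_⟩
    rw [← ha, Y.presheaf.germ_res_apply, TopCat.Presheaf.germ_stalkSpecializes_apply]
  choose V hVU hyV hε s hs using h1
  obtain ⟨f, hf, -⟩ := Y.sheaf.existsUnique_gluing' V U (fun y => homOfLE (hVU y))
    (fun y hy => Opens.mem_iSup.2 ⟨⟨y, hy⟩, hyV ⟨y, hy⟩⟩) s (fun i j => by
      have hij : genericPoint Y ∈ V i ⊓ V j := ⟨hε i, hε j⟩
      refine germ_injective_of_isIntegral Y _ hij ?_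
      refine (Y.presheaf.germ_res_apply _ _ hij _).trans (Eq.trans ?_ (Y.presheaf.germ_res_apply _ _ hij _).symm)
      exact (hs i).trans (hs j).symm)
  refine ⟨f, ?_⟩
  rw [← hs ⟨_, hU⟩, ← hf ⟨_, hU⟩]
  exact (Y.presheaf.germ_res_apply (homOfLE (hVU ⟨_, hU⟩)) _ (hε ⟨_, hU⟩) f).symm

lemma exists_unitGerm_eq_of_regular {U : Y.Opens} (hU : genericPoint Y ∈ U) (k : (Y.functionField)ˣ)
    (h : ∀ y ∈ U, ∃ b : (Y.presheaf.stalk y)ˣ,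
      Y.presheaf.stalkSpecializes (genericPoint_specializes y) (b : Y.presheaf.stalk y) = (k : Y.functionField)) :
    ∃ f : Γ(Y, U)ˣ, unitGerm hU f = k := by
  obtain ⟨f, hf⟩ := exists_germ_eq_of_regular hU k fun y hy => ⟨_, (h y hy).choose_spec⟩
  obtain ⟨f', hf'⟩ := exists_germ_eq_of_regular hU ↑k⁻¹ fun y hy => by
    obtain ⟨b, hb⟩ := h y hy
    refine ⟨↑b⁻¹, ?_⟩
    refine (Units.coe_map_inv (Y.presheaf.stalkSpecializes (genericPoint_specializes y)).hom.toMonoidHom b).symm.trans ?_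
    exact congrArg (fun v : (Y.functionField)ˣ => (↑v⁻¹ : Y.functionField))
      (Units.ext hb : Units.map (Y.presheaf.stalkSpecializes (genericPoint_specializes y)).hom.toMonoidHom b = k)
  have hff : f * f' = 1 := germ_injective_of_isIntegral Y _ hU (by
    rw [map_mul, hf, hf', map_one]
    exact k.mul_inv)
  exact ⟨⟨f, f', hff, by rw [mul_comm, hff]⟩, Units.ext hf⟩

end Regular

lemma PullbackStalk.exists_mk_one_mul {X Y : Scheme.{u}} {g : Y ⟶ X} {M : ZariskiLogStructure X} {y : Y}
    {t t' : PullbackStalk g M y} (h : toGhost g M y t = toGhost g M y t') : ∃ b, t = mk g M y 1 b * t' := by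
  obtain ⟨⟨m, a⟩, rfl⟩ := Con.mk'_surjective t
  obtain ⟨⟨m', a'⟩, rfl⟩ := Con.mk'_surjective t'
  obtain ⟨v, hv⟩ := Associates.mk_eq_mk_iff_associated.1 h
  refine ⟨a * (pullbackUnits g M y v)⁻¹ * a'⁻¹ , (Con.eq _).2 ⟨v, ?_, ?_⟩⟩
  · exact (one_mul _).trans hv.symm
  · change a = a * (pullbackUnits g M y v)⁻¹ * a'⁻¹ * a' * pullbackUnits g M y v
    group

namespace PrestableLogCurve

variable {κ : Type u} [Field κ] [CharZero κ] {X : PrestableLogCurve κ} {M : ZariskiLogStructure X.C}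
  (φ : ZariskiToEtaleHom M X.N) {η : X.C}

/-- The values of germs of the pull-back of `M` at the generic point. -/
def stalkValue (hη : η ∈ genericPoints X.C) (y : X.normalizedComponent η) :
    PullbackStalk (X.toCurve η) M y →* ((X.normalizedComponent η).functionField)ˣ :=
  (pullbackCon (X.toCurve η) M y).lift
    (((rationalValue φ hη).comp (toGeneric M y)).coprod
      (Units.map ((X.normalizedComponent η).presheaf.stalkSpecializes (genericPoint_specializes y)).hom.toMonoidHom))
    (by
      rintro ⟨m, a⟩ ⟨m', a'⟩ ⟨v, h1, h2⟩
      obtain rfl : m' = m * v := h1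
      obtain rfl : a = a' * pullbackUnits (X.toCurve η) M y v := h2
      have h3 : rationalValue φ hη (toGeneric M y v) =
          Units.map ((X.normalizedComponent η).presheaf.stalkSpecializes (genericPoint_specializes y)).hom.toMonoidHom
            (pullbackUnits (X.toCurve η) M y v) :=
        Units.ext (rationalValue_toGeneric_of_isUnit φ hη y v.isUnit)
      rw [Con.ker_rel, MonoidHom.coprod_apply, MonoidHom.coprod_apply, map_mul, map_mul, ← h3]
      exact (mul_assoc _ _ _).symm.trans (mul_right_comm _ _ _))

lemma stalkValue_mk (hη : η ∈ genericPoints X.C) (y : X.normalizedComponent η)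
    (m : zariskiStalk M (X.toCurve η y)) (a : ((X.normalizedComponent η).presheaf.stalk y)ˣ) :
    stalkValue φ hη y (PullbackStalk.mk _ M y m a) = rationalValue φ hη (toGeneric M y m) *
      Units.map ((X.normalizedComponent η).presheaf.stalkSpecializes (genericPoint_specializes y)).hom.toMonoidHom a :=
  rfl

lemma stalkValue_mk_one (hη : η ∈ genericPoints X.C) (y : X.normalizedComponent η)
    (a : ((X.normalizedComponent η).presheaf.stalk y)ˣ) :
    stalkValue φ hη y (PullbackStalk.mk _ M y 1 a) =
      Units.map ((X.normalizedComponent η).presheaf.stalkSpecializes (genericPoint_specializes y)).hom.toMonoidHom a := by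
  rw [stalkValue_mk, map_one, map_one, one_mul]

lemma orderAt_stalkValue (hη : η ∈ genericPoints X.C) (y : X.normalizedComponent η)
    (t : PullbackStalk (X.toCurve η) M y) :
    orderAt (stalkValue φ hη y t : (X.normalizedComponent η).functionField) y =
      vanishingOrder φ hη y (.ofMul (PullbackStalk.toGhost _ M y t)) := by
  have := X.isLocallyNoetherian_normalizedComponent hη
  obtain ⟨⟨m, a⟩, rfl⟩ := Con.mk'_surjective t
  refine (congrArg (fun v : ((X.normalizedComponent η).functionField)ˣ =>
    orderAt (v : (X.normalizedComponent η).functionField) y) (stalkValue_mk φ hη y m a)).trans ?_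
  dsimp only
  rw [Units.val_mul, orderAt_mul (Units.ne_zero _) (Units.ne_zero _)]
  exact (congrArg (_ + ·) (orderAt_germ_of_isUnit a.isUnit)).trans (add_zero _)

variable {s : ghostSections (X.toCurve η) M} {U : (X.normalizedComponent η).Opens}

lemma stalkValue_mk_zGerm (hη : η ∈ genericPoints X.C) {V : X.C.Opens}
    (hU : ∀ z ∈ U, X.toCurve η z ∈ V) (m : M.sections V) (a : Γ(X.normalizedComponent η, U)ˣ)
    {z z' : X.normalizedComponent η} (hz : z ∈ U) (hz' : z' ∈ U) :
    stalkValue φ hη z (PullbackStalk.mk _ M z (zGerm M V _ (hU z hz) m) (unitGerm hz a)) =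
      stalkValue φ hη z' (PullbackStalk.mk _ M z' (zGerm M V _ (hU z' hz') m) (unitGerm hz' a)) := by
  have key : ∀ (w : X.normalizedComponent η) (hw : w ∈ U),
      stalkValue φ hη w (PullbackStalk.mk _ M w (zGerm M V _ (hU w hw) m) (unitGerm hw a)) =
      rationalValue φ hη (zGerm M V _ (hU _ (genericPoint_mem hw)) m) * unitGerm (genericPoint_mem hw) a := by
    intro w hw
    rw [stalkValue_mk, stalkSpecializes_zGerm]
    refine congrArg (_ * ·) (Units.ext ?_)
    exact (X.normalizedComponent η).presheaf.germ_stalkSpecializes_apply hw (genericPoint_specializes w) _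
  rw [key z hz, key z' hz']

/-- The value of a section of the torsor is the same rational function at all points. -/
lemma stalkValue_torsor (hη : η ∈ genericPoints X.C) {t : ∀ y : X.normalizedComponent η, y ∈ U →
    PullbackStalk (X.toCurve η) M y} (ht : IsTorsorSection (X.toCurve η) M s U t)
    {z : X.normalizedComponent η} (hz : z ∈ U) :
    stalkValue φ hη z (t z hz) = stalkValue φ hη _ (t _ (genericPoint_mem hz)) := by
  obtain ⟨-, V, W, hWU, hW, m, a, hzW, h⟩ := ht z hz
  rw [h z hzW, h _ (genericPoint_mem hzW)]
  exact stalkValue_mk_zGerm φ hη hW m a _ _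

lemma exists_torsor_sec (s : ghostSections (X.toCurve η) M) (y : X.normalizedComponent η) :
    ∃ W : (X.normalizedComponent η).Opens, y ∈ W ∧ Nonempty ((torsor (X.toCurve η) M s).sec W) := by
  obtain ⟨V, W, hW, m, hy, h⟩ := s.2 y
  refine ⟨W, hy, ⟨fun z hz => PullbackStalk.mk _ M z (zGerm M V _ (hW z hz) m) 1, fun z hz =>
    ⟨(h z hz).symm, V, W, le_rfl, hW, m, 1, hz, fun z hz => by rw [map_one]⟩⟩⟩

/-- A section of the torsor of `s` has order of vanishing at `y` the order of its value minus the
order of vanishing of `s`. -/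
lemma hasOrderAt_iff (hη : η ∈ genericPoints X.C) (hU : genericPoint (X.normalizedComponent η) ∈ U)
    (σ : (torsor (X.toCurve η) M s).sec U) (y : X.normalizedComponent η) (n : ℤ) :
    (torsor (X.toCurve η) M s).HasOrderAt σ y n ↔
      n = orderAt (stalkValue φ hη _ (σ.1 _ hU) : (X.normalizedComponent η).functionField) y -
        vanishingOrder φ hη y (s.1 y) := by
  have := X.isLocallyNoetherian_normalizedComponent hη
  have key : ∀ (W : (X.normalizedComponent η).Opens) (hy : y ∈ W) (hW : genericPoint (X.normalizedComponent η) ∈ U ⊓ W)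
      (t : (torsor (X.toCurve η) M s).sec W) (f : Γ(X.normalizedComponent η, U ⊓ W)ˣ),
      stalkValue φ hη _ (σ.1 _ hU) = unitGerm hW f * stalkValue φ hη _ (t.1 _ hW.2) →
      orderAt (stalkValue φ hη _ (σ.1 _ hU) : (X.normalizedComponent η).functionField) y -
        vanishingOrder φ hη y (s.1 y) =
        orderAt (unitGerm hW f : (X.normalizedComponent η).functionField) y := by
    intro W hy hW t f h
    rw [h, Units.val_mul, orderAt_mul (Units.ne_zero _) (Units.ne_zero _), ← (t.2 y hy).1,
      ← orderAt_stalkValue, stalkValue_torsor φ hη t.2 hy]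
    exact add_sub_cancel_right _ _
  constructor
  · rintro ⟨W, hne, t, f, hy, h, rfl⟩
    have hW : genericPoint (X.normalizedComponent η) ∈ U ⊓ W := genericPoint_mem hne.some.2
    have h1 := congrFun (congrFun (congrArg Subtype.val h) _) hW
    refine (key W hy hW t f ?_).symm
    refine (congrArg (stalkValue φ hη _) h1).trans ((map_mul _ _ _).trans (congrArg (· * _) ?_))
    rw [stalkValue_mk_one]
    refine Units.ext ?_
    exact ((X.normalizedComponent η).presheaf.germ_stalkSpecializes_apply hW (genericPoint_specializes _) _)
  · rintro rfl
    obtain ⟨W, hy, ⟨t⟩⟩ := exists_torsor_sec s y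
    have hW : genericPoint (X.normalizedComponent η) ∈ U ⊓ W := ⟨hU, genericPoint_mem hy⟩
    have h1 : ∀ z (hz : z ∈ U ⊓ W), ∃ b, σ.1 z hz.1 = PullbackStalk.mk _ M z 1 b * t.1 z hz.2 :=
      fun z hz => PullbackStalk.exists_mk_one_mul ((σ.2 z hz.1).1.trans (t.2 z hz.2).1.symm)
    choose b hb using h1
    have h2 : ∀ z (hz : z ∈ U ⊓ W), Units.map ((X.normalizedComponent η).presheaf.stalkSpecializes
        (genericPoint_specializes z)).hom.toMonoidHom (b z hz) =
        stalkValue φ hη _ (σ.1 _ hU) / stalkValue φ hη _ (t.1 _ hW.2) := by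
      intro z hz
      rw [← stalkValue_torsor φ hη σ.2 hz.1, ← stalkValue_torsor φ hη t.2 hz.2, hb z hz, map_mul, stalkValue_mk_one]
      exact (mul_div_cancel_right _ _).symm
    obtain ⟨f, hf⟩ := exists_unitGerm_eq_of_regular hW _ fun z hz => ⟨b z hz, congrArg Units.val (h2 z hz)⟩
    refine ⟨W, ⟨⟨_, hW⟩⟩, t, f, hy, ?_, key W hy hW t f (by rw [hf]; exact (div_mul_cancel _ _).symm)⟩
    refine Subtype.ext (funext fun z => funext fun hz => (hb z hz).trans ?_)
    refine congrArg (fun b => PullbackStalk.mk _ M z 1 b * t.1 z hz.2) (Units.ext ?_)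
    refine stalkSpecializes_genericPoint_injective z ((congrArg Units.val ((h2 z hz).trans hf.symm)).trans ?_)
    exact ((X.normalizedComponent η).presheaf.germ_stalkSpecializes_apply hz (genericPoint_specializes z) _).symm

lemma finite_vanishingOrder_ne_zero (hη : η ∈ genericPoints X.C) (m : ∀ y, Ghost M (X.toCurve η y)) :
    {y | vanishingOrder φ hη y (m y) ≠ 0}.Finite :=
  (X.finite_specialPoints hη).subset fun y hy => by
    by_contra h
    exact hy (vanishingOrder_eq_zero φ hη h _)

/-- The degree of a torsor, by the vanishing of the degree of a principal divisor. -/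
lemma torsorDegree_eq (hη : η ∈ genericPoints X.C) (s : ghostSections (X.toCurve η) M) :
    torsorDegree η s = -∑ᶠ y, (X.pointDegree η y : ℤ) * vanishingOrder φ hη y (s.1 y) := by
  have h : ∃ (U : (X.normalizedComponent η).Opens) (_ : Nonempty U),
      Nonempty ((torsor (X.toCurve η) M s).sec U) := by
    obtain ⟨W, hy, hW⟩ := exists_torsor_sec s (genericPoint _)
    exact ⟨W, ⟨⟨_, hy⟩⟩, hW⟩
  rw [torsorDegree, UnitsPresheaf.degree, dif_pos h]
  generalize h.choose_spec.choose_spec.some = σ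
  have hU : genericPoint (X.normalizedComponent η) ∈ h.choose := genericPoint_mem h.choose_spec.choose.some.2
  have h1 : ∀ y, (torsor (X.toCurve η) M s).orderAt σ y =
      orderAt (stalkValue φ hη _ (σ.1 _ hU) : (X.normalizedComponent η).functionField) y -
        vanishingOrder φ hη y (s.1 y) := by
    intro y
    have h2 : ∃ n, (torsor (X.toCurve η) M s).HasOrderAt σ y n := ⟨_, (hasOrderAt_iff φ hη hU σ y _).2 rfl⟩
    rw [UnitsPresheaf.orderAt, dif_pos h2]
    exact (hasOrderAt_iff φ hη hU σ y _).1 h2.choose_spec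
  obtain ⟨hfin, hsum⟩ := X.finsum_residueDegree_orderAt hη
    (f := (stalkValue φ hη _ (σ.1 _ hU) : (X.normalizedComponent η).functionField)) (Units.ne_zero _)
  refine (finsum_congr fun y => (congrArg (_ * ·) (h1 y)).trans (mul_sub _ _ _)).trans ?_
  rw [finsum_sub_distrib, hsum, zero_sub]
  · rfl
  · exact hfin.subset fun y hy => right_ne_zero_of_mul hy
  · exact (finite_vanishingOrder_ne_zero φ hη s.1).subset fun y hy => right_ne_zero_of_mul hy

lemma tupleClass_toGp (hη : η ∈ genericPoints X.C)
    (a : ∀ x : X.specialPoints η, Ghost M (X.toCurve η x.1) →+ ℤ) (s : ghostSections (X.toCurve η) M) :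
    tupleClass a (ghostSections.toGp s) = ∑ᶠ x : X.specialPoints η, a x (s.1 x.1) := by
  have := (X.finite_specialPoints hη).to_subtype
  have h : ∀ x : X.specialPoints η,
      dualOfStalk (X.toCurve η) M x.1 (a x) (ghostSections.toGp s) = a x (s.1 x.1) := fun x =>
    DFunLike.congr_fun (Algebra.GrothendieckAddGroup.lift.symm_apply_apply (a x)) (s.1 x.1)
  refine Eq.trans ?_ (finsum_congr h)
  exact (AddMonoidHom.eval (ghostSections.toGp s)).map_finsum (Set.toFinite _)

/-- Minus the weighted sum of the contact orders represents the degree. -/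
lemma isDegreeClass_neg (hη : η ∈ genericPoints X.C) {u : ∀ x : X.specialPoints η, Ghost M (X.toCurve η x.1) →+ ℤ}
    (hu : IsContactData φ η u) : IsDegreeClass (-tupleClass fun x => X.pointDegree η x.1 • u x) := by
  intro s
  rw [torsorDegree_eq φ hη, AddMonoidHom.neg_apply, tupleClass_toGp hη]
  refine congrArg _ ((finsum_congr fun x => ?_).trans (finsum_set_coe_eq_finsum_mem
    (f := fun y => (X.pointDegree η y : ℤ) * vanishingOrder φ hη y (s.1 y)) (X.specialPoints η)) |>.trans ?_)
  · rw [(isContactData_iff φ hη u).1 hu x, AddMonoidHom.nsmul_apply, nsmul_eq_mul]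
  · refine finsum_congr fun y => ?_
    classical
    by_cases hy : y ∈ X.specialPoints η
    · rw [finsum_eq_if, if_pos hy]
    · rw [finsum_eq_if, if_neg hy, vanishingOrder_eq_zero φ hη hy, mul_zero]

end PrestableLogCurve

/-! ### Sections of the ghost sheaf generate its group of sections -/

section ZariskiChart

variable {X : Scheme.{u}} {M : ZariskiLogStructure X}

lemma zariski_res_res {U V W : X.Opens} (f : V ⟶ U) (g : W ⟶ V) (s : M.sections U) :
    M.res g (M.res f s) = M.res (g ≫ f) s :=
  (congrArg (fun k => k.hom s) (M.M.obj.map_comp f.op g.op)).symm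

lemma zGerm_eq {z : X} {U : X.Opens} (hU : z ∈ U) {s t : M.sections U} (h : zGerm M U z hU s = zGerm M U z hU t) :
    ∃ (W : X.Opens) (_ : z ∈ W) (i : W ⟶ U), M.res i s = M.res i t := by
  obtain ⟨W, hW, i, j, e⟩ := TopCat.Presheaf.germ_eq (C := CommMonCat.{u}) (X := X.toTopCat) M.M.obj z hU hU s t h
  obtain rfl : i = j := Subsingleton.elim i j
  exact ⟨W, hW, i, e⟩

lemma ghostGerm_of_isUnit {z : X} {U : X.Opens} (hU : z ∈ U) {s : M.sections U} (hs : IsUnit s) :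
    ghostGerm M hU s = 0 :=
  congrArg Additive.ofMul (Associates.mk_eq_one.2 (hs.map (zGerm M U z hU)))

/-- Sections with the same germ in the ghost sheaf locally differ by a unit. -/
lemma exists_res_eq_mul_unit_of_ghostGerm {z : X} {U : X.Opens} (hU : z ∈ U) {s t : M.sections U}
    (h : ghostGerm M hU s = ghostGerm M hU t) :
    ∃ (W : X.Opens) (_ : z ∈ W) (i : W ⟶ U) (a : (M.sections W)ˣ), M.res i s = M.res i t * a := by
  obtain ⟨v, hv⟩ := Associates.mk_eq_mk_iff_associated.1 (congrArg Additive.toMul h).symm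
  obtain ⟨A, hA, a, ha⟩ := exists_zGerm_eq (v : zariskiStalk M z)
  obtain ⟨B, hB, b, hb⟩ := exists_zGerm_eq (↑v⁻¹ : zariskiStalk M z)
  have hz : z ∈ U ⊓ A ⊓ B := ⟨⟨hU, hA⟩, hB⟩
  let iU : U ⊓ A ⊓ B ⟶ U := homOfLE (inf_le_left.trans inf_le_left)
  let iA : U ⊓ A ⊓ B ⟶ A := homOfLE (inf_le_left.trans inf_le_right)
  let iB : U ⊓ A ⊓ B ⟶ B := homOfLE inf_le_right
  obtain ⟨W₁, hW₁, i₁, e₁⟩ := zGerm_eq (M := M) hz (s := M.res iA a * M.res iB b) (t := 1) (by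
    rw [map_mul, zGerm_res, zGerm_res, ha, hb, Units.mul_inv, map_one])
  obtain ⟨W₂, hW₂, i₂, e₂⟩ := zGerm_eq (M := M) hW₁ (s := M.res (i₁ ≫ iU) s)
    (t := M.res (i₁ ≫ iU) t * M.res (i₁ ≫ iA) a) (by
      rw [map_mul, zGerm_res, zGerm_res, zGerm_res, ha]
      exact hv.symm)
  rw [map_mul, map_one, zariski_res_res, zariski_res_res] at e₁
  refine ⟨W₂, hW₂, i₂ ≫ i₁ ≫ iU, Units.map (M.res i₂) ⟨_, _, e₁, by rw [mul_comm, e₁]⟩, ?_⟩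
  rw [map_mul, zariski_res_res, zariski_res_res] at e₂
  exact e₂

variable {V : X.Opens} {P : Type u} [CommMonoid P] {β : P →* M.sections V} {z : X}

lemma exists_zariskiChart (hM : M.IsFS) (c : X) : ∃ (V : X.Opens) (_ : c ∈ V) (P : Type u) (_ : CommMonoid P)
    (β : P →* M.sections V), IsFineSaturated P ∧ M.IsChart β := by
  obtain ⟨S, hS, h⟩ := hM ⊤
  obtain ⟨V, f, hf, hV⟩ := hS c trivial
  exact ⟨V, hV, h f hf⟩

lemma ghostGerm_chart_surjective (hβ : M.IsChart β) (hz : z ∈ V) (m : Ghost M z) :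
    ∃ p, ghostGerm M hz (β p) = m := by
  obtain ⟨U, hU, s, rfl⟩ := exists_ghostGerm_eq m
  have hUV : z ∈ U ⊓ V := ⟨hU, hz⟩
  obtain ⟨S, hS, h⟩ := hβ.surj (homOfLE inf_le_right : U ⊓ V ⟶ V) (M.res (homOfLE inf_le_left : U ⊓ V ⟶ U) s)
  obtain ⟨W, g, hg, hW⟩ := hS z hUV
  obtain ⟨p, a, e⟩ := h g hg
  refine ⟨p, ?_⟩
  have e' := congrArg (ghostGerm M hW) e
  rw [ghostGerm_mul, ghostGerm_res, ghostGerm_res, ghostGerm_res, ghostGerm_of_isUnit hW a.isUnit, add_zero] at e'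
  exact e'.symm

lemma exists_mul_eq_of_ghostGerm (hβ : M.IsChart β) (hz : z ∈ V) {p p' : P}
    (h : ghostGerm M hz (β p) = ghostGerm M hz (β p')) :
    ∃ b b', ghostGerm M hz (β b) = 0 ∧ ghostGerm M hz (β b') = 0 ∧ p * b = p' * b' := by
  obtain ⟨W, hW, i, a, e⟩ := exists_res_eq_mul_unit_of_ghostGerm hz h
  obtain ⟨S, hS, h⟩ := hβ.inj i p p' a e
  obtain ⟨W', g, hg, hW'⟩ := hS z hW
  obtain ⟨b, b', hb, hb', e, -⟩ := h g hg
  have key : ∀ b, IsUnit (M.res (g ≫ i) (β b)) → ghostGerm M hz (β b) = 0 := fun b hb => by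
    rw [← ghostGerm_of_isUnit hW' hb, ghostGerm_res]
  exact ⟨b, b', key b hb, key b' hb', e⟩

lemma ghostGerm_eq_of_mul_eq (hz : z ∈ V) {p p' b b' : P} (hb : ghostGerm M hz (β b) = 0)
    (hb' : ghostGerm M hz (β b') = 0) (e : p * b = p' * b') : ghostGerm M hz (β p) = ghostGerm M hz (β p') := by
  have h : ghostGerm M hz (β (p * b)) = ghostGerm M hz (β (p' * b')) := by rw [e]
  rwa [map_mul, map_mul, ghostGerm_mul, ghostGerm_mul, hb, hb', add_zero, add_zero] at h

lemma isCancelAdd_ghost (hM : M.IsFS) (z : X) : IsCancelAdd (Ghost M z) := by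
  obtain ⟨V, hz, P, _, β, hP, hβ⟩ := exists_zariskiChart hM z
  have key : ∀ m m' n : Ghost M z, m + n = m' + n → m = m' := by
    intro m m' n h
    obtain ⟨p, rfl⟩ := ghostGerm_chart_surjective hβ hz m
    obtain ⟨p', rfl⟩ := ghostGerm_chart_surjective hβ hz m'
    obtain ⟨r, rfl⟩ := ghostGerm_chart_surjective hβ hz n
    rw [← ghostGerm_mul, ← ghostGerm_mul, ← map_mul, ← map_mul] at h
    obtain ⟨b, b', hb, hb', e⟩ := exists_mul_eq_of_ghostGerm hβ hz h
    exact ghostGerm_eq_of_mul_eq hz hb hb' (hP.integral _ _ r (by rw [mul_right_comm, e, mul_right_comm]))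
  exact { add_left_cancel := fun n m m' h => key m m' n (by rw [add_comm m, add_comm m']; exact h)
          add_right_cancel := fun n m m' h => key m m' n h }

lemma generization_surjective (hM : M.IsFS) {ζ z : X} (h : ζ ⤳ z) : Function.Surjective (generization M h) := by
  obtain ⟨V, hz, P, _, β, -, hβ⟩ := exists_zariskiChart hM z
  intro m
  obtain ⟨p, rfl⟩ := ghostGerm_chart_surjective hβ (h.mem_open V.2 hz) m
  exact ⟨_, generization_ghostGerm h hz (β p)⟩

/-- Generization is injective on ghost stalks in a neighbourhood: finitely many generators of a chart
which become units at `ζ` are units near `ζ`. -/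
lemma exists_generization_injective (hM : M.IsFS) (ζ : X) :
    ∃ U : X.Opens, ζ ∈ U ∧ ∀ z ∈ U, ∀ h : ζ ⤳ z, Function.Injective (generization M h) := by
  obtain ⟨V, hζ, P, _, β, hP, hβ⟩ := exists_zariskiChart hM ζ
  obtain ⟨G, hG⟩ := hP.fg.fg_top
  have h1 : ∀ p : P, ∃ U : X.Opens, ζ ∈ U ∧ ∀ z ∈ U, ∃ hz : z ∈ V,
      ghostGerm M hζ (β p) = 0 → ghostGerm M hz (β p) = 0 := by
    intro p
    by_cases h : ghostGerm M hζ (β p) = 0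
    · obtain ⟨W, hW, i, a, e⟩ := exists_res_eq_mul_unit_of_ghostGerm hζ (h.trans (ghostGerm_one M hζ).symm)
      refine ⟨W, hW, fun z hz => ⟨i.le hz, fun _ => ?_⟩⟩
      rw [← ghostGerm_of_isUnit hz a.isUnit, ← one_mul (a : M.sections W), ← map_one (M.res i), ← e, ghostGerm_res]
    · exact ⟨V, hζ, fun z hz => ⟨hz, fun h' => absurd h' h⟩⟩
  choose U hU h using h1
  refine ⟨V ⊓ G.inf U, ⟨hζ, ?_⟩, ?_⟩
  · exact Finset.inf_induction (p := fun W : X.Opens => ζ ∈ W) trivial (fun _ h _ h' => ⟨h, h'⟩) fun p _ => hU p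
  rintro z ⟨hz, hzG⟩ hs m m' e
  have key : ∀ p : P, ghostGerm M hζ (β p) = 0 → ghostGerm M hz (β p) = 0 := by
    intro p
    have hp : p ∈ Submonoid.closure (G : Set P) := hG ▸ Submonoid.mem_top p
    induction hp using Submonoid.closure_induction with
    | mem p hp => exact (h p z (Finset.inf_le (f := U) hp hzG)).choose_spec
    | one => exact fun _ => by rw [map_one, ghostGerm_one]
    | mul p p' _ _ hp hp' =>
      intro h
      rw [map_mul, ghostGerm_mul] at h
      have h' := mul_eq_one.1 (show Associates.mk (zGerm M V ζ hζ (β p)) *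
        Associates.mk (zGerm M V ζ hζ (β p')) = 1 from congrArg Additive.toMul h)
      rw [map_mul, ghostGerm_mul, hp (congrArg Additive.ofMul h'.1), hp' (congrArg Additive.ofMul h'.2), add_zero]
  obtain ⟨p, rfl⟩ := ghostGerm_chart_surjective hβ hz m
  obtain ⟨p', rfl⟩ := ghostGerm_chart_surjective hβ hz m'
  rw [generization_ghostGerm, generization_ghostGerm] at e
  obtain ⟨b, b', hb, hb', e⟩ := exists_mul_eq_of_ghostGerm hβ hζ e
  exact ghostGerm_eq_of_mul_eq hz (key b hb) (key b' hb') e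

end ZariskiChart

namespace PrestableLogCurve

variable {κ : Type u} [Field κ] [CharZero κ] {X : PrestableLogCurve κ} {M : ZariskiLogStructure X.C} {η : X.C}

variable (M) in
/-- The generization map from a ghost stalk at a point of the normalization to the generic one. -/
abbrev ghostToGeneric (y : X.normalizedComponent η) : Ghost M (X.toCurve η y) →+
    Ghost M (X.toCurve η (genericPoint (X.normalizedComponent η))) :=
  generization M (toCurve_genericPoint_specializes y)

lemma ghostToGeneric_genericPoint_injective :
    Function.Injective (ghostToGeneric M (genericPoint (X.normalizedComponent η))) := by
  have h1 : ∀ m : Ghost M _, ghostToGeneric M (genericPoint (X.normalizedComponent η)) m = m := by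
    intro m
    obtain ⟨V, hV, s, rfl⟩ := exists_ghostGerm_eq m
    exact generization_ghostGerm _ hV s
  intro m m' h
  rwa [h1, h1] at h

lemma finite_not_injective (hM : M.IsFS) (hη : η ∈ genericPoints X.C) :
    {y : X.normalizedComponent η | ¬ Function.Injective (ghostToGeneric M y)}.Finite := by
  obtain ⟨U, hU, h⟩ := exists_generization_injective hM (X.toCurve η (genericPoint (X.normalizedComponent η)))
  refine (X.finite_of_isClosed hη (Z := (X.toCurve η ⁻¹ᵁ U : Set (X.normalizedComponent η))ᶜ)
    (X.toCurve η ⁻¹ᵁ U).2.isClosed_compl fun h' => h' hU).subset fun y hy hyU => hy (h _ hyU _)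

/-- Near a point `y`, generization is injective away from `y`. -/
lemma exists_injective_of_ne (hM : M.IsFS) (hη : η ∈ genericPoints X.C) (y : X.normalizedComponent η) :
    ∃ W : (X.normalizedComponent η).Opens, y ∈ W ∧ ∀ z ∈ W, z ≠ y → Function.Injective (ghostToGeneric M z) := by
  have hZ : IsClosed ({z : X.normalizedComponent η | ¬ Function.Injective (ghostToGeneric M z)} \ {y}) := by
    rw [← Set.biUnion_of_singleton ({z : X.normalizedComponent η | _} \ {y})]
    refine ((finite_not_injective hM hη).subset Set.sdiff_subset).isClosed_biUnion fun z hz => ?_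
    refine isClosed_of_closure_subset fun x hx => ?_
    refine (X.eq_of_specializes_normalizedComponent hη (specializes_iff_mem_closure.2 hx) ?_).symm
    rintro rfl
    exact hz.1 ghostToGeneric_genericPoint_injective
  refine ⟨⟨_, hZ.isOpen_compl⟩, fun h => h.2 rfl, fun z hz hzy => ?_⟩
  by_contra h
  exact hz ⟨h, hzy⟩

/-- A family of elements of the ghost stalks with the same generization is a section. -/
lemma mem_ghostSections (hM : M.IsFS) (hη : η ∈ genericPoints X.C) {t : ∀ y, Ghost M (X.toCurve η y)}
    {A : Ghost M (X.toCurve η (genericPoint (X.normalizedComponent η)))}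
    (ht : ∀ y, ghostToGeneric M y (t y) = A) : t ∈ ghostSections (X.toCurve η) M := by
  intro y
  obtain ⟨V, hV, s, hs⟩ := exists_ghostGerm_eq (t y)
  obtain ⟨W, hy, hW⟩ := exists_injective_of_ne hM hη y
  have key : ∀ z (hzV : X.toCurve η z ∈ V), z ∈ W → t z = ghostGerm M hzV s := by
    intro z hzV hz
    by_cases hzy : z = y
    · subst hzy
      exact hs.symm
    · have h1 := ht y
      rw [← hs] at h1
      have h2 := generization_ghostGerm (toCurve_genericPoint_specializes y) hV s
      have h3 := generization_ghostGerm (toCurve_genericPoint_specializes z) hzV s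
      exact hW z hz hzy ((ht z).trans (h1.symm.trans (h2.trans h3.symm)))
  exact ⟨V, X.toCurve η ⁻¹ᵁ V ⊓ W, fun z hz => hz.1, s, ⟨hV, hy⟩, fun z hz => key z hz.1 hz.2⟩

open Classical in
/-- A section of the group is a difference of two sections of the monoid: at the finitely many points
where generization is not injective, denominators are made to have the same generization. -/
lemma exists_toGp_sub_toGp (hM : M.IsFS) (hη : η ∈ genericPoints X.C) (s : ghostGpSections (X.toCurve η) M) :
    ∃ t t' : ghostSections (X.toCurve η) M, s = ghostSections.toGp t - ghostSections.toGp t' := by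
  have hc := isCancelAdd_ghost hM (X.toCurve η (genericPoint (X.normalizedComponent η)))
  have h1 : ∀ y, ∃ a b : Ghost M (X.toCurve η y), s.1 y = .of a - .of b ∧
      s.1 (genericPoint _) = .of (ghostToGeneric M y a) - .of (ghostToGeneric M y b) := by
    intro y
    obtain ⟨V, W, hW, m, m', hy, h⟩ := s.2 y
    refine ⟨_, _, h y hy, (h _ (genericPoint_mem hy)).trans ?_⟩
    rw [generization_ghostGerm, generization_ghostGerm]
  choose a b hs hε using h1
  have hab : ∀ y z, ghostToGeneric M y (a y) + ghostToGeneric M z (b z) =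
      ghostToGeneric M z (a z) + ghostToGeneric M y (b y) := by
    intro y z
    refine Algebra.GrothendieckAddGroup.of_injective ?_
    rw [map_add, map_add]
    exact sub_eq_sub_iff_add_eq_add.1 ((hε y).symm.trans (hε z))
  let Z : Finset (X.normalizedComponent η) := (finite_not_injective hM hη).toFinset
  let e := genericPoint (X.normalizedComponent η)
  let A := ghostToGeneric M e (a e) + ∑ y ∈ Z, ghostToGeneric M y (b y)
  let B := ghostToGeneric M e (b e) + ∑ y ∈ Z, ghostToGeneric M y (b y)
  have h2 : ∀ y, ∃ t t' : Ghost M (X.toCurve η y), ghostToGeneric M y t = A ∧ ghostToGeneric M y t' = B ∧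
      t + b y = a y + t' := by
    intro y
    by_cases hy : y ∈ Z
    · obtain ⟨l, hl⟩ := generization_surjective hM (toCurve_genericPoint_specializes y)
        (ghostToGeneric M e (b e) + ∑ z ∈ Z.erase y, ghostToGeneric M z (b z))
      refine ⟨a y + l, b y + l, ?_, ?_, by rw [add_assoc, add_comm l]⟩
      · rw [map_add, hl, ← add_assoc, hab y e, add_assoc, Finset.add_sum_erase Z (fun y => ghostToGeneric M y (b y)) hy]
      · rw [map_add, hl, add_left_comm, Finset.add_sum_erase Z (fun y => ghostToGeneric M y (b y)) hy]
    · have hinj : Function.Injective (ghostToGeneric M y) := by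
        by_contra h
        exact hy ((finite_not_injective hM hη).mem_toFinset.2 h)
      obtain ⟨t, ht⟩ := generization_surjective hM (toCurve_genericPoint_specializes y) A
      obtain ⟨t', ht'⟩ := generization_surjective hM (toCurve_genericPoint_specializes y) B
      refine ⟨t, t', ht, ht', hinj ?_⟩
      rw [map_add, map_add, ht, ht', add_right_comm, hab e y, add_assoc]
  choose t t' ht ht' h using h2
  refine ⟨⟨t, mem_ghostSections hM hη ht⟩, ⟨t', mem_ghostSections hM hη ht'⟩, Subtype.ext (funext fun y => ?_)⟩
  refine (hs y).trans (sub_eq_sub_iff_add_eq_add.2 ?_)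
  exact (map_add _ _ _).symm.trans ((congrArg _ (h y).symm).trans (map_add _ _ _))

/-- An element of the dual is determined by its values on sections of the monoid. -/
lemma IsDegreeClass.unique (hM : M.IsFS) (hη : η ∈ genericPoints X.C) {T T' : DualGhostGp (X.toCurve η) M}
    (h : IsDegreeClass T) (h' : IsDegreeClass T') : T = T' := by
  refine AddMonoidHom.ext fun s => ?_
  obtain ⟨t, t', rfl⟩ := exists_toGp_sub_toGp hM hη s
  rw [map_sub, map_sub, h, h, h', h']

end PrestableLogCurve

end LogGeom

end

open LogGeom PrestableLogCurve
theorem mainTheorem11 {κ : Type u} [Field κ] [CharZero κ] (X : PrestableLogCurve κ)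
    (M : ZariskiLogStructure X.C) (hM : M.IsFS) (φ : ZariskiToEtaleHom M X.N)
    (η : X.C) (hη : η ∈ genericPoints X.C) :
    (X.specialPoints η).Finite ∧
    (∃! u : ∀ x : X.specialPoints η, Ghost M (X.toCurve η x.1) →+ ℤ, IsContactData φ η u) ∧
    ∀ u : ∀ x : X.specialPoints η, Ghost M (X.toCurve η x.1) →+ ℤ, IsContactData φ η u →
      (∃ T : DualGhostGp (X.toCurve η) M, IsDegreeClass T ∧
        tupleClass (fun x => X.pointDegree η x.1 • u x) + T = 0) ∧
      (∀ τ : ∀ x : X.specialPoints η, Ghost M (X.toCurve η x.1) →+ ℤ,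
        IsDegreeClass (tupleClass τ) →
        tupleClass (fun x => X.pointDegree η x.1 • u x) + tupleClass τ = 0) := by
  refine ⟨X.finite_specialPoints hη, ⟨fun x => vanishingOrder φ hη x.1,
    (isContactData_iff φ hη _).2 fun _ => rfl, fun v hv => funext ((isContactData_iff φ hη v).1 hv)⟩,
    fun u hu => ⟨⟨_, isDegreeClass_neg φ hη hu, add_neg_cancel _⟩, fun τ hτ => ?_⟩⟩
  rw [hτ.unique hM hη (isDegreeClass_neg φ hη hu), add_neg_cancel]
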